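/- Let $a>0$, $v_1=a(\tfrac{\sqrt3}{2},\tfrac12)$, $v_2=a(\tfrac{\sqrt3}{2},-\tfrac12)$, $\Lambda=\mathbb Zv_1\oplus\mathbb Zv_2$, $x_0=\tfrac23(v_1+v_2)$, $Y=\{y_1,y_2\}=\{0,x_0\}$, and let $H=\Lambda\cup(\Lambda+x_0)$ be the honeycomb lattice. Let $\Lambda^*=\{\xi_m=m_1k_1+m_2k_2: m\in\mathbb Z^2\}$ with $k_i\cdot v_j=2\pi\delta_{ij}$ be the dual lattice and $\mathcal B$ the closed hexagonal Brillouin zone (the points at least as close to $0$ as to any other point of $\Lambda^*$). Write $|\Gamma|=\tfrac{\sqrt3}{2}a^2$ and fix $\alpha\in\mathbb R$. Let $-\Delta_{\beta,H}$, $\beta=(\alpha,\alpha,\dots)$, be the self-adjoint operator on $L^2(\mathbb R^2)$ of point scatterers of strength $\alpha$ at all points of $H$: with $\lambda=-\kappa^2$, $\kappa>0$, and $G_\lambda(x)=\tfrac i4H_0^{(1)}(i\kappa|x|)$ the kernel of $(-\Delta-\lambda)^{-1}$, one has $(-\Delta_{\beta,H}-\lambda)\psi=w$ if and only if $$\psi=(-\Delta-\lambda)^{-1}w+\sum_{y\in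 H}q_y\,G_\lambda(\cdot-y)$$ for some $q\in\ell^2(H)$ with $\sum_{y'\in H}[\Gamma(\lambda)]_{yy'}q_{y'}=\int G_\lambda(x-y)\,w(x)\,dx$ for all $y\in H$, where $[\Gamma(\lambda)]_{yy}=\alpha+\tfrac1{2\pi}\ln\tfrac{\kappa}{2}$ and $[\Gamma(\lambda)]_{yy'}=-G_\lambda(y-y')$ for $y\ne y'$. (The operator does not depend on $\kappa>0$; when $\Gamma(\lambda)$ is invertible this is Krein's resolvent formula.) For $k\in\mathcal B$ let $-\Delta_{\alpha,Y}(k)$ be the fiber operator on $\ell^2(\mathbb Z^2)$ (Fourier coefficients of $k$-quasi-periodic functions), obtained by removing the momentum cutoff $r$ in $u_m\mapsto|\xi_m+k|^2u_m-\tfrac1{|\Gamma|}\sum_j c(r)(\phi_j^r,u)\phi_j^r(m)$, where $\phi^r_j(m)=\mathbf 1_{|\xi_m+k|\le r}e^{-i(\xi_m+k)\cdot y_j}$ and $c(r)^{-1}=\alpha+\tfrac{\ln r-\ln2}{2\pi}$. That is, $-\Delta_{\alpha,Y}(k)u=f$ if and only if there is $q\in\mathbb C^2$ with $f_m=|\xi_m+k|^2u_m-\tfrac1{|\Gamma|}\sum_jq_je^{-i(\xi_m+k)\cdot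 y_j}$ for all $m$ and $\lim_{r\to\infty}\big[(\phi_j^r,u)-c(r)^{-1}q_j\big]=0$ for $j=1,2$. Theorem. For each $k\in\mathcal B$ the eigenvalues of $-\Delta_{\alpha,Y}(k)$ can be listed, with multiplicity, as $\lambda_1(k,\alpha)\le\lambda_2(k,\alpha)\le\cdots$; the extrema below are attained, and $$\sigma(-\Delta_{\beta,H})=I_1\cup I_2\cup I_3,$$ $$I_1=\Big[\lambda_1(0,\alpha),\max_{k\in\mathcal B}\lambda_2(k,\alpha)\Big],\quad I_2=\Big[\min_{k\in\mathcal B}\lambda_3(k,\alpha),\max_{k\in\mathcal B}\lambda_3(k,\alpha)\Big],\quad I_3=\Big[\min_{k\in\mathcal B}\lambda_4(k,\alpha),\infty\Big).$$ In particular $\sigma(-\Delta_{\beta,H})$ consists of at most three disjoint intervals (it has at most three connected components). -/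

import Mathlib

open MeasureTheory Filter Topology

namespace HoneycombScatterer

noncomputable section

/-! ### Lattices -/

/-- The Euclidean plane `ℝ²`. -/
abbrev Plane : Type := EuclideanSpace ℝ (Fin 2)

/-- The lattice vector `v₁ = a (√3/2, 1/2)`. -/
def v₁ (a : ℝ) : Plane := !₂[a * (√3 / 2), a * (1 / 2)]

/-- The lattice vector `v₂ = a (√3/2, -1/2)`. -/
def v₂ (a : ℝ) : Plane := !₂[a * (√3 / 2), -(a * (1 / 2))]

/-- The point `x₀ = (2/3)(v₁ + v₂)`, the second scatterer of the fundamental cell. -/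
def x₀ (a : ℝ) : Plane := (2 / 3 : ℝ) • (v₁ a + v₂ a)

/-- The two scatterers `0`, `x₀` of a fundamental cell. -/
def cellPoint (a : ℝ) : Fin 2 → Plane := ![0, x₀ a]

/-- The lattice vector `m₁ v₁ + m₂ v₂`. -/
def latticeVec (a : ℝ) (m : ℤ × ℤ) : Plane := (m.1 : ℝ) • v₁ a + (m.2 : ℝ) • v₂ a

/-- The triangular lattice `Λ = ℤ v₁ ⊕ ℤ v₂`. -/
def triangularLattice (a : ℝ) : Set Plane := Set.range (latticeVec a)

/-- The honeycomb lattice `H = Λ ∪ (Λ + x₀)`. -/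
def honeycomb (a : ℝ) : Set Plane :=
  triangularLattice a ∪ (fun v => v + x₀ a) '' triangularLattice a

/-- The area of the fundamental cell `Γ = ℝ²/Λ`, i.e. `|det (v₁, v₂)| = (√3/2) a²`. -/
def cellArea (a : ℝ) : ℝ := |v₁ a 0 * v₂ a 1 - v₁ a 1 * v₂ a 0|

/-- The dual vector `k₁ = 4π/(a√3) (1/2, √3/2)`. -/
def k₁ (a : ℝ) : Plane :=
  (4 * Real.pi / (a * √3)) • (!₂[1 / 2, √3 / 2] : Plane)

/-- The dual vector `k₂ = 4π/(a√3) (1/2, -√3/2)`. -/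
def k₂ (a : ℝ) : Plane :=
  (4 * Real.pi / (a * √3)) • (!₂[1 / 2, -(√3 / 2)] : Plane)

/-- The dual lattice vector `ξ_m = m₁ k₁ + m₂ k₂`. -/
def dualVec (a : ℝ) (m : ℤ × ℤ) : Plane := (m.1 : ℝ) • k₁ a + (m.2 : ℝ) • k₂ a

/-- The (closed, hexagonal) Brillouin zone: the points of the dual space at least as close to `0`
as to every other point of the dual lattice. -/
def brillouinZone (a : ℝ) : Set Plane := {k | ∀ m : ℤ × ℤ, ‖k‖ ≤ ‖k - dualVec a m‖}

/-! ### Unbounded operators, spectrum and eigenvalues -/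

section Operators

variable {E : Type*} [NormedAddCommGroup E] [NormedSpace ℂ E]

/-- The resolvent set of an unbounded operator `A`: the `z` for which `A - z` has an everywhere
defined bounded inverse `R`, that is, `u ∈ D(A)` and `(A - z) u = f` exactly when `u = R f`. -/
def opResolventSet (A : E →ₗ.[ℂ] E) : Set ℂ :=
  {z | ∃ R : E →L[ℂ] E, ∀ f u : E, (u, f + z • u) ∈ A.graph ↔ u = R f}

/-- The spectrum of an unbounded operator. -/
def opSpectrum (A : E →ₗ.[ℂ] E) : Set ℂ := (opResolventSet A)ᶜ

/-- The eigenspace `ker (A - z)` of an unbounded operator (`0` if `z` is not an eigenvalue). -/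
def eigenspace (A : E →ₗ.[ℂ] E) (z : ℂ) : Submodule ℂ E where
  carrier := {u | (u, z • u) ∈ A.graph}
  add_mem' := by
    intro u v hu hv
    have h := A.graph.add_mem hu hv
    simpa [smul_add] using h
  zero_mem' := by
    change ((0 : E), z • (0 : E)) ∈ A.graph
    rw [smul_zero]
    exact A.graph.zero_mem
  smul_mem' := by
    intro c u hu
    have h := A.graph.smul_mem c hu
    simpa [smul_comm c z u] using h

/-- `μ 1 ≤ μ 2 ≤ μ 3 ≤ …` is the list of all eigenvalues of `A`, in increasing order and each
repeated according to its (necessarily finite) multiplicity. -/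
def IsEigenvalueEnumeration (A : E →ₗ.[ℂ] E) (μ : ℕ+ → ℝ) : Prop :=
  Monotone μ ∧
  ∀ z : ℂ, FiniteDimensional ℂ (eigenspace A z) ∧
    {n : ℕ+ | (μ n : ℂ) = z}.encard = (Module.finrank ℂ (eigenspace A z) : ℕ∞)

end Operators

/-! ### The full Hamiltonian -/

/-- The Hilbert space `L²(ℝ²)`. -/
abbrev PlaneL2 : Type := Lp ℂ 2 (volume : Measure Plane)

/-- The free Green function `G_λ(x) = (i/4) H₀⁽¹⁾(√λ |x|)` of `-Δ - λ` on `ℝ²` at the energy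
`λ = -κ² < 0` (`√λ = i κ`), i.e. `(1/2π) K₀(κ |x|)`, as the time integral of the heat kernel. -/
def green (κ : ℝ) (x : Plane) : ℝ :=
  ∫ t in Set.Ioi (0 : ℝ), Real.exp (-(κ ^ 2 * t) - ‖x‖ ^ 2 / (4 * t)) / (4 * Real.pi * t)

/-- `φ = (-Δ + κ²)⁻¹ w`, as the pointwise defined potential `φ(x) = ∫ G(x - x') w(x') dx'`. -/
def IsGreenPotential (κ : ℝ) (w : PlaneL2) (φ : Plane → ℂ) : Prop :=
  ∀ x, Integrable (fun x' => (green κ (x - x') : ℂ) * w x') ∧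
    φ x = ∫ x', (green κ (x - x') : ℂ) * w x'

theorem IsGreenPotential.add {κ : ℝ} {w w' : PlaneL2} {φ φ' : Plane → ℂ}
    (h : IsGreenPotential κ w φ) (h' : IsGreenPotential κ w' φ') :
    IsGreenPotential κ (w + w') (φ + φ') := by
  intro x
  have e : (fun x' => (green κ (x - x') : ℂ) * (w + w' : PlaneL2) x')
      =ᵐ[volume] fun x' => (green κ (x - x') : ℂ) * w x' + (green κ (x - x') : ℂ) * w' x' := by
    filter_upwards [Lp.coeFn_add w w'] with x' hx'
    rw [hx', Pi.add_apply, mul_add]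
  refine ⟨((h x).1.add (h' x).1).congr e.symm, ?_⟩
  rw [integral_congr_ae e, integral_add (h x).1 (h' x).1, Pi.add_apply, (h x).2, (h' x).2]

theorem IsGreenPotential.zero (κ : ℝ) : IsGreenPotential κ 0 0 := by
  intro x
  have e : (fun x' => (green κ (x - x') : ℂ) * (0 : PlaneL2) x')
      =ᵐ[volume] fun _ => (0 : ℂ) := by
    filter_upwards [Lp.coeFn_zero ℂ 2 (volume : Measure Plane)] with x' hx'
    rw [hx', Pi.zero_apply, mul_zero]
  refine ⟨(integrable_zero _ _ _).congr e.symm, ?_⟩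
  rw [integral_congr_ae e, integral_zero, Pi.zero_apply]

theorem IsGreenPotential.smul {κ : ℝ} {w : PlaneL2} {φ : Plane → ℂ}
    (h : IsGreenPotential κ w φ) (c : ℂ) : IsGreenPotential κ (c • w) (c • φ) := by
  intro x
  have e : (fun x' => (green κ (x - x') : ℂ) * (c • w : PlaneL2) x')
      =ᵐ[volume] fun x' => c * ((green κ (x - x') : ℂ) * w x') := by
    filter_upwards [Lp.coeFn_smul c w] with x' hx'
    rw [hx', Pi.smul_apply, smul_eq_mul, mul_left_comm]
  refine ⟨((h x).1.const_mul c).congr e.symm, ?_⟩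
  rw [integral_congr_ae e, integral_const_mul, Pi.smul_apply, (h x).2, smul_eq_mul]

open Classical in
/-- The infinite matrix `Γ_{β,X}(λ)`, at `λ = -κ²`, of point scatterers of strength `β` on `X`:
`β_y + (1/2π) ln (√λ/(2i))` on the diagonal (`√λ/(2i) = κ/2`), and `-G_λ(y - y')` off it. -/
def scatteringMatrix (κ : ℝ) (X : Set Plane) (β : X → ℝ) (y y' : X) : ℝ :=
  if y = y' then β y + 1 / (2 * Real.pi) * Real.log (κ / 2) else -green κ (y - y' : Plane)

/-- The graph of `-Δ_{β,X}`, in the form of the resolvent formula at `λ = -κ²`: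
`-Δ_{β,X} ψ = η` if and only if, with `w = η + κ² ψ`,
`ψ = (-Δ + κ²)⁻¹ w + ∑_y q_y G_λ(· - y)` for some `q ∈ ℓ²(X)` with
`∑_{y'} Γ_{β,X}(λ)_{y y'} q_{y'} = (G_λ(· - y), w)` for all `y ∈ X`. -/
def scattererGraph (κ : ℝ) (X : Set Plane) (β : X → ℝ) : Submodule ℂ (PlaneL2 × PlaneL2) where
  carrier := {p | ∃ (φ : Plane → ℂ) (q : lp (fun _ : X => ℂ) 2),
    IsGreenPotential κ (p.2 + ((κ ^ 2 : ℝ) : ℂ) • p.1) φ ∧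
    (∀ y : X, HasSum (fun y' : X => (scatteringMatrix κ X β y y' : ℂ) * q y') (φ y)) ∧
    ∀ᵐ x : Plane, HasSum (fun y : X => q y * (green κ (x - y) : ℂ)) (p.1 x - φ x)}
  add_mem' := by
    rintro p p' ⟨φ, q, hφ, hq, hψ⟩ ⟨φ', q', hφ', hq', hψ'⟩
    refine ⟨φ + φ', q + q', ?_, ?_, ?_⟩
    · have h := hφ.add hφ'
      rwa [show p.2 + ((κ ^ 2 : ℝ) : ℂ) • p.1 + (p'.2 + ((κ ^ 2 : ℝ) : ℂ) • p'.1)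
        = (p + p').2 + ((κ ^ 2 : ℝ) : ℂ) • (p + p').1 by
          simp only [Prod.fst_add, Prod.snd_add, smul_add]; abel] at h
    · intro y
      simpa [mul_add] using (hq y).add (hq' y)
    · filter_upwards [hψ, hψ', Lp.coeFn_add p.1 p'.1] with x h h' hx
      have h2 := h.add h'
      rw [Prod.fst_add, hx]
      simp only [Pi.add_apply, lp.coeFn_add, add_mul]
      convert h2 using 1
      ring
  zero_mem' := by
    refine ⟨0, 0, ?_, ?_, ?_⟩
    · have h : (0 : PlaneL2 × PlaneL2).2 + ((κ ^ 2 : ℝ) : ℂ) • (0 : PlaneL2 × PlaneL2).1 = 0 := by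
        simp
      rw [h]
      exact IsGreenPotential.zero κ
    · intro y
      simp
    · filter_upwards [Lp.coeFn_zero ℂ 2 (volume : Measure Plane)] with x hx
      rw [Prod.fst_zero, hx]
      simp
  smul_mem' := by
    rintro c p ⟨φ, q, hφ, hq, hψ⟩
    refine ⟨c • φ, c • q, ?_, ?_, ?_⟩
    · have h := hφ.smul c
      rwa [show c • (p.2 + ((κ ^ 2 : ℝ) : ℂ) • p.1)
        = (c • p).2 + ((κ ^ 2 : ℝ) : ℂ) • (c • p).1 by
          simp only [Prod.smul_fst, Prod.smul_snd, smul_add, smul_comm c]] at h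
    · intro y
      simpa [mul_left_comm] using (hq y).mul_left c
    · filter_upwards [hψ, Lp.coeFn_smul c p.1] with x h hx
      have h2 := h.mul_left c
      rw [Prod.smul_fst, hx]
      rw [mul_sub] at h2
      simpa only [Pi.smul_apply, lp.coeFn_smul, smul_eq_mul, mul_assoc] using h2

/-- The Hamiltonian `-Δ_{β,X}` on `L²(ℝ²)` of point scatterers on `X` with parameters `β`, built
at the reference energy `-κ²` (the operator does not depend on the choice of `κ > 0`). -/
def pointScatterer (κ : ℝ) (X : Set Plane) (β : X → ℝ) : PlaneL2 →ₗ.[ℂ] PlaneL2 :=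
  (scattererGraph κ X β).toLinearPMap

/-! ### The Floquet fibers -/

/-- The Hilbert space `ℓ²(Λ*)` of Fourier coefficients `(u_m)` of the quasi-periodic functions
`u(x) = ∑_m u_m e^{i (ξ_m + k)·x}` of `L²_k(Γ)`. -/
abbrev DualL2 : Type := lp (fun _ : ℤ × ℤ => ℂ) 2

/-- The plane wave `e^{i (ξ_m + k)·y}`. -/
def planeWave (a : ℝ) (k y : Plane) (m : ℤ × ℤ) : ℂ :=
  Complex.exp (Complex.I * ((inner ℝ (dualVec a m + k) y : ℝ) : ℂ))

/-- `s` is the value at `y` of the quasi-periodic function with Fourier coefficients `u`, with the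
momentum cut off at `r`: `s = ∑_{|ξ_m + k| ≤ r} u_m e^{i (ξ_m + k)·y}` (a finite sum). -/
def IsCutoffValue (a : ℝ) (k y : Plane) (u : DualL2) (r : ℝ) (s : ℂ) : Prop :=
  HasSum (fun m : {m : ℤ × ℤ // ‖dualVec a m + k‖ ≤ r} => planeWave a k y m * u m) s

/-- The graph of the fiber `-Δ_{α,Y}(k)`, `Y = {y₁, y₂} = {0, x₀}`, in the Fourier representation:
the limit, as the momentum cutoff `r` is removed, of
`|ξ_m + k|² u_m - |Γ|⁻¹ ∑_j c_j(r) (φ_j^r, u) φ_j^r`, where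
`φ_j^r(m) = 1_{|ξ_m + k| ≤ r} e^{-i (ξ_m + k)·y_j}` and
`c_j(r)⁻¹ = α_j + (ln r - ln 2)/(2π)`. In the limit `q_j` stands for `c_j(r) (φ_j^r, u)`:
the relation `(φ_j^r, u) = c_j(r)⁻¹ q_j` holds up to `o(1)` as `r → ∞`. -/
def fiberGraph (a : ℝ) (α : Fin 2 → ℝ) (k : Plane) : Submodule ℂ (DualL2 × DualL2) where
  carrier := {p | ∃ q : Fin 2 → ℂ,
    (∀ m : ℤ × ℤ, p.2 m = ((‖dualVec a m + k‖ ^ 2 : ℝ) : ℂ) * p.1 m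
      - ((1 / cellArea a : ℝ) : ℂ) *
        ∑ j, q j * (starRingEnd ℂ) (planeWave a k (cellPoint a j) m)) ∧
    ∀ j, ∃ S : ℝ → ℂ, (∀ r, IsCutoffValue a k (cellPoint a j) p.1 r (S r)) ∧
      Tendsto
        (fun r : ℝ => S r
          - ((α j + (Real.log r - Real.log 2) / (2 * Real.pi) : ℝ) : ℂ) * q j)
        atTop (𝓝 0)}
  add_mem' := by
    rintro p p' ⟨q, hf, hS⟩ ⟨q', hf', hS'⟩
    refine ⟨q + q', ?_, ?_⟩
    · intro m
      simp only [Prod.snd_add, Prod.fst_add, lp.coeFn_add, Pi.add_apply, hf m, hf' m, add_mul,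
        Finset.sum_add_distrib]
      ring
    · intro j
      obtain ⟨S, hS1, hS2⟩ := hS j
      obtain ⟨S', hS1', hS2'⟩ := hS' j
      refine ⟨S + S', ?_, ?_⟩
      · intro r
        have h := (hS1 r).add (hS1' r)
        simp only [IsCutoffValue, Prod.fst_add, lp.coeFn_add, Pi.add_apply, mul_add]
        exact h
      · have h := hS2.add hS2'
        rw [add_zero] at h
        refine h.congr fun r => ?_
        simp only [Pi.add_apply]
        ring
  zero_mem' := by
    refine ⟨0, ?_, ?_⟩
    · intro m
      simp
    · intro j
      refine ⟨0, ?_, ?_⟩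
      · intro r
        simp [IsCutoffValue]
      · simp
  smul_mem' := by
    rintro c p ⟨q, hf, hS⟩
    refine ⟨c • q, ?_, ?_⟩
    · intro m
      simp only [Prod.smul_snd, Prod.smul_fst, lp.coeFn_smul, Pi.smul_apply, smul_eq_mul, hf m,
        mul_assoc, ← Finset.mul_sum]
      ring
    · intro j
      obtain ⟨S, hS1, hS2⟩ := hS j
      refine ⟨c • S, ?_, ?_⟩
      · intro r
        have h := (hS1 r).mul_left c
        simp only [IsCutoffValue, Prod.smul_fst, lp.coeFn_smul, Pi.smul_apply, smul_eq_mul,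
          mul_left_comm _ c]
        exact h
      · have h := hS2.const_mul c
        rw [mul_zero] at h
        refine h.congr fun r => ?_
        simp only [Pi.smul_apply, smul_eq_mul]
        ring

/-- The fiber Hamiltonian `-Δ_{α,Y}(k)` with quasi-momentum `k`, in the Fourier representation. -/
def fiberHamiltonian (a : ℝ) (α : Fin 2 → ℝ) (k : Plane) : DualL2 →ₗ.[ℂ] DualL2 :=
  (fiberGraph a α k).toLinearPMap

end

end HoneycombScatterer

namespace HoneycombScatterer

noncomputable section

/-! ### Geometry of the lattices -/

/-! The proof has three layers: a resolvent formula for the fibers, a direct integral for the full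
operator, and a study of four band functions.

Fibers. At energy `-κ²` a fiber differs from the free one by a term of rank at most two, governed by
a 2×2 Hermitian matrix `kreinMatrix`. Its entries are regularised lattice sums, convergent because
the coupling `c(r)⁻¹` carries exactly the logarithm by which the diagonal sums diverge. For a
suitable large reference value of `κ` this matrix is positive definite for every `k` at once
(`exists_forall_posDef`). Then `kreinOp`, the fiber resolvent at `-κ²`, is compact, symmetric,
strictly positive and norm continuous in `k`. Its min–max values `μ_n` are continuous in `k`, and
`band`, which is `1/μ_n - κ²`, enumerates the eigenvalues of the fiber
(`isEigenvalueEnumeration_band`).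

Direct integral. The Fourier coefficients of `kreinMatrix` over the dual cell are the entries of the
infinite scattering matrix (`integral_kreinMatrix`). Hence the Floquet transform carries the graph
of the full operator to the pairs that lie in the fiber graph for almost every quasi-momentum
(`mem_scattererGraph_iff`). Continuity in `k` and compactness of the fiber resolvents then give that
the spectrum is the set of all fiber eigenvalues (`mem_opSpectrum_iff`).

Bands. The Brillouin zone is compact and connected, so each band function has a compact interval as
range. It remains to see how these intervals fit together, and four facts decide it. (1) The first
band is lowest at `k = 0` (`band_one_zero_le`): the Fourier coefficients of the Krein matrix off the
constant term all have one sign, so the triangle inequality compares every `k` with `k = 0`. (2) At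
the corner of the zone the threefold rotation makes the Krein matrix scalar, so the lowest
eigenvalue there is at least double (`band_two_diracPoint_le`), and the ranges of the first two
bands overlap. (3) At `k = 0` the fourth band is at least `|k₁|²` (`dualLength_sq_le_band_four`),
since three linear conditions remove the zero mode and both rank-one corrections. (4) Every energy
`E ≥ |k₁|²` is an eigenvalue of some fiber (`exists_eigenvector_of_ge`): two plane waves of equal
energy which agree on all scatterers have a difference that the scatterers do not see. By (1) and
(2) the first two bands fill one interval, and by (3) and (4) nothing is missing above the minimum
of the fourth band. -/

theorem inner_plane (x y : Plane) : inner ℝ x y = x 0 * y 0 + x 1 * y 1 := by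
  simp [PiLp.inner_apply, Fin.sum_univ_two, mul_comm]

theorem norm_sq_plane (x : Plane) : ‖x‖ ^ 2 = x 0 ^ 2 + x 1 ^ 2 := by
  simp [EuclideanSpace.norm_sq_eq, Fin.sum_univ_two]

theorem sqrt_three_sq : (√3 : ℝ) ^ 2 = 3 := Real.sq_sqrt (by norm_num)

theorem cellArea_eq {a : ℝ} : cellArea a = √3 / 2 * a ^ 2 := by
  have h : v₁ a 0 * v₂ a 1 - v₁ a 1 * v₂ a 0 = -(√3 / 2 * a ^ 2) := by
    simp [v₁, v₂]; ring
  rw [cellArea, h, abs_neg, abs_of_nonneg (by positivity)]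

theorem cellArea_pos {a : ℝ} (ha : 0 < a) : 0 < cellArea a := by
  rw [cellArea_eq]; positivity

/-- The momentum `s k₁ + t k₂`. -/
def momentum (a : ℝ) (t : Fin 2 → ℝ) : Plane := t 0 • k₁ a + t 1 • k₂ a

/-- The length of the dual lattice vectors `k₁`, `k₂`. -/
def dualLength (a : ℝ) : ℝ := 4 * Real.pi / (a * √3)

theorem dualLength_pos {a : ℝ} (ha : 0 < a) : 0 < dualLength a := by
  unfold dualLength; positivity

theorem dualVec_eq_momentum (a : ℝ) (m : ℤ × ℤ) : dualVec a m = momentum a ![m.1, m.2] := by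
  simp [dualVec, momentum]

theorem momentum_apply_zero (a : ℝ) (t : Fin 2 → ℝ) :
    momentum a t 0 = dualLength a * ((t 0 + t 1) / 2) := by
  simp [momentum, k₁, k₂, dualLength]; ring

theorem momentum_apply_one (a : ℝ) (t : Fin 2 → ℝ) :
    momentum a t 1 = dualLength a * (√3 / 2 * (t 0 - t 1)) := by
  simp [momentum, k₁, k₂, dualLength]; ring

theorem norm_sq_momentum (a : ℝ) (t : Fin 2 → ℝ) :
    ‖momentum a t‖ ^ 2 = dualLength a ^ 2 * (t 0 ^ 2 + t 1 ^ 2 - t 0 * t 1) := by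
  rw [norm_sq_plane, momentum_apply_zero, momentum_apply_one]
  linear_combination (dualLength a ^ 2 * (t 0 - t 1) ^ 2 / 4) * sqrt_three_sq

theorem momentum_add (a : ℝ) (s t : Fin 2 → ℝ) :
    momentum a (s + t) = momentum a s + momentum a t := by
  simp [momentum, add_smul]; abel

theorem momentum_sub (a : ℝ) (s t : Fin 2 → ℝ) :
    momentum a (s - t) = momentum a s - momentum a t := by
  simp [momentum, sub_smul]; abel

theorem continuous_momentum (a : ℝ) : Continuous (momentum a) := by
  unfold momentum; fun_prop

theorem dualVec_add (a : ℝ) (m n : ℤ × ℤ) : dualVec a (m + n) = dualVec a m + dualVec a n := by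
  simp [dualVec, add_smul]; abel

theorem dualVec_sub (a : ℝ) (m n : ℤ × ℤ) : dualVec a (m - n) = dualVec a m - dualVec a n := by
  simp [dualVec, sub_smul]; abel

theorem dualVec_zero (a : ℝ) : dualVec a 0 = 0 := by
  simp [dualVec]

theorem norm_sq_dualVec (a : ℝ) (m : ℤ × ℤ) :
    ‖dualVec a m‖ ^ 2 = dualLength a ^ 2 * ((m.1 : ℝ) ^ 2 + (m.2 : ℝ) ^ 2 - m.1 * m.2) := by
  rw [dualVec_eq_momentum, norm_sq_momentum]; simp

theorem inner_momentum_latticeVec {a : ℝ} (ha : 0 < a) (t : Fin 2 → ℝ) (n : ℤ × ℤ) :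
    inner ℝ (momentum a t) (latticeVec a n) = 2 * Real.pi * (t 0 * n.1 + t 1 * n.2) := by
  have h : dualLength a * a * √3 = 4 * Real.pi := by
    unfold dualLength; field_simp
  rw [inner_plane, momentum_apply_zero, momentum_apply_one]
  simp only [latticeVec, v₁, v₂, PiLp.add_apply, PiLp.smul_apply, smul_eq_mul, Fin.isValue,
    Matrix.cons_val_zero, Matrix.cons_val_one, Matrix.cons_val_fin_one]
  linear_combination ((t 0 * n.1 + t 1 * n.2) / 2) * h

theorem inner_momentum_x₀ {a : ℝ} (ha : 0 < a) (t : Fin 2 → ℝ) :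
    inner ℝ (momentum a t) (x₀ a) = 4 * Real.pi / 3 * (t 0 + t 1) := by
  have h := inner_momentum_latticeVec ha t (1, 1)
  have e : x₀ a = (2 / 3 : ℝ) • latticeVec a (1, 1) := by simp [x₀, latticeVec]
  rw [e, inner_smul_right, h]; simp; ring

theorem inner_dualVec_latticeVec {a : ℝ} (ha : 0 < a) (m n : ℤ × ℤ) :
    inner ℝ (dualVec a m) (latticeVec a n) = 2 * Real.pi * ((m.1 * n.1 + m.2 * n.2 : ℤ) : ℝ) := by
  rw [dualVec_eq_momentum, inner_momentum_latticeVec ha]; simp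

theorem inner_dualVec_x₀ {a : ℝ} (ha : 0 < a) (m : ℤ × ℤ) :
    inner ℝ (dualVec a m) (x₀ a) = 4 * Real.pi / 3 * ((m.1 + m.2 : ℤ) : ℝ) := by
  rw [dualVec_eq_momentum, inner_momentum_x₀ ha]; simp

theorem norm_sq_latticeVec {a : ℝ} (m : ℤ × ℤ) :
    ‖latticeVec a m‖ ^ 2 = a ^ 2 * ((m.1 : ℝ) ^ 2 + (m.2 : ℝ) ^ 2 + m.1 * m.2) := by
  rw [norm_sq_plane]
  simp only [latticeVec, v₁, v₂, PiLp.add_apply, PiLp.smul_apply, smul_eq_mul, Fin.isValue,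
    Matrix.cons_val_zero, Matrix.cons_val_one, Matrix.cons_val_fin_one]
  linear_combination (a ^ 2 * (m.1 + m.2) ^ 2 / 4) * sqrt_three_sq

theorem latticeVec_sub (a : ℝ) (m n : ℤ × ℤ) :
    latticeVec a (m - n) = latticeVec a m - latticeVec a n := by
  simp [latticeVec, sub_smul]; abel

theorem latticeVec_zero (a : ℝ) : latticeVec a 0 = 0 := by
  simp [latticeVec]

/-- Every point of the plane is a momentum. -/
theorem exists_momentum_eq {a : ℝ} (ha : 0 < a) (k : Plane) : ∃ t, momentum a t = k := by
  have hL := (dualLength_pos ha).ne'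
  have h3 : (√3 : ℝ) ≠ 0 := by positivity
  refine ⟨![(k 0 + k 1 / √3) / dualLength a, (k 0 - k 1 / √3) / dualLength a], ?_⟩
  ext i
  fin_cases i
  · change momentum a _ 0 = k 0
    rw [momentum_apply_zero]
    simp only [Matrix.cons_val_zero, Matrix.cons_val_one]
    field_simp; ring
  · change momentum a _ 1 = k 1
    rw [momentum_apply_one]
    simp only [Matrix.cons_val_zero, Matrix.cons_val_one]
    field_simp; ring

/-! ### Lattice sums -/

/-- From `|xy| ≤ (x² + y²)/2` half of the diagonal form survives. One inequality serves both
lattices: the dual one has `s = -1`, the direct one `s = 1`. -/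
theorem sq_max_le_of_form {x y s : ℝ} (hs : |s| ≤ 1) :
    (max |x| |y|) ^ 2 / 2 ≤ x ^ 2 + y ^ 2 + s * (x * y) := by
  have h1 : |x * y| ≤ (x ^ 2 + y ^ 2) / 2 := by
    rw [abs_le]; constructor <;> nlinarith [sq_nonneg (x + y), sq_nonneg (x - y)]
  have h2 : -|x * y| ≤ s * (x * y) := by
    have := neg_abs_le (s * (x * y))
    rw [abs_mul] at this
    nlinarith [abs_nonneg (x * y)]
  rcases max_cases |x| |y| with ⟨h, -⟩ | ⟨h, -⟩ <;> rw [h, sq_abs] <;>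
    nlinarith [sq_nonneg x, sq_nonneg y]

/-- Comparison with the Eisenstein sum of `‖m‖⁻³` in the sup norm, convergent because the exponent
exceeds the dimension two. The third power is the one that differences of free resolvents produce.
-/
theorem summable_int_prod_rpow {f : ℤ × ℤ → ℝ} {c : ℝ} (hc : 0 < c)
    (hf0 : ∀ m, 0 ≤ f m)
    (hf : ∀ m : ℤ × ℤ, c * (max |(m.1 : ℝ)| |(m.2 : ℝ)|) ≤ f m) :
    Summable fun m => 1 / (1 + f m) ^ 3 := by
  have h := EisensteinSeries.summable_one_div_norm_rpow (k := 3) (by norm_num)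
  have h2 := (finTwoArrowEquiv ℤ).symm.summable_iff.mpr h
  refine Summable.of_norm_bounded_eventually (h2.mul_left (c ^ 3)⁻¹) ?_
  have : ∀ᶠ m : ℤ × ℤ in cofinite, m ≠ 0 := by
    simp [Filter.eventually_cofinite]
  filter_upwards [this] with m hm
  have e : ‖(finTwoArrowEquiv ℤ).symm m‖ = max |(m.1 : ℝ)| |(m.2 : ℝ)| := by
    rw [EisensteinSeries.norm_eq_max_natAbs]
    simp [Nat.cast_max, Nat.cast_natAbs]
  have hpos : 0 < max |(m.1 : ℝ)| |(m.2 : ℝ)| := by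
    by_contra hcon
    push Not at hcon
    have h1 : |(m.1 : ℝ)| ≤ 0 := (le_max_left _ _).trans hcon
    have h2 : |(m.2 : ℝ)| ≤ 0 := (le_max_right _ _).trans hcon
    apply hm
    ext
    · simpa using abs_nonpos_iff.mp h1
    · simpa using abs_nonpos_iff.mp h2
  simp only [Function.comp_apply, e]
  have e3 : (max |(m.1 : ℝ)| |(m.2 : ℝ)|) ^ (-3 : ℝ) = ((max |(m.1 : ℝ)| |(m.2 : ℝ)|) ^ 3)⁻¹ := by
    rw [Real.rpow_neg hpos.le]; norm_cast
  rw [e3, Real.norm_of_nonneg (by have := hf0 m; positivity), ← mul_inv, ← mul_pow, one_div]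
  have h4 := hf m
  gcongr
  linarith

theorem summable_dualVec {a : ℝ} (ha : 0 < a) :
    Summable fun m : ℤ × ℤ => 1 / (1 + ‖dualVec a m‖) ^ 3 := by
  have hL := dualLength_pos ha
  refine summable_int_prod_rpow (c := dualLength a / 2) (by positivity) (fun m => norm_nonneg _)
    fun m => ?_
  apply le_of_sq_le_sq _ (norm_nonneg _)
  rw [norm_sq_dualVec]
  have := sq_max_le_of_form (x := (m.1 : ℝ)) (y := m.2) (s := -1) (by simp)
  have h2 : 0 ≤ (max |(m.1 : ℝ)| |(m.2 : ℝ)|) ^ 2 := by positivity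
  have h3 : (dualLength a) ^ 2 * ((max |(m.1 : ℝ)| |(m.2 : ℝ)|) ^ 2 / 4) ≤
      dualLength a ^ 2 * ((m.1 : ℝ) ^ 2 + (m.2 : ℝ) ^ 2 - m.1 * m.2) := by
    gcongr; linarith
  linarith

theorem summable_latticeVec {a : ℝ} (ha : 0 < a) :
    Summable fun m : ℤ × ℤ => 1 / (1 + ‖latticeVec a m‖) ^ 3 := by
  refine summable_int_prod_rpow (c := a / 2) (by positivity) (fun m => norm_nonneg _)
    fun m => ?_
  apply le_of_sq_le_sq _ (norm_nonneg _)
  rw [norm_sq_latticeVec]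
  have := sq_max_le_of_form (x := (m.1 : ℝ)) (y := m.2) (s := 1) (by simp)
  have h2 : 0 ≤ (max |(m.1 : ℝ)| |(m.2 : ℝ)|) ^ 2 := by positivity
  have h3 : a ^ 2 * ((max |(m.1 : ℝ)| |(m.2 : ℝ)|) ^ 2 / 4) ≤
      a ^ 2 * ((m.1 : ℝ) ^ 2 + (m.2 : ℝ) ^ 2 + m.1 * m.2) := by
    gcongr; linarith
  linarith

/-- The norm form `p² + q² - pq` is integral and positive definite, so it is at least `1` off the
origin. -/
theorem dualLength_le_norm_sub {a : ℝ} {m n : ℤ × ℤ} (h : m ≠ n) :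
    dualLength a ≤ ‖dualVec a m - dualVec a n‖ := by
  rw [← dualVec_sub]
  apply le_of_sq_le_sq _ (norm_nonneg _)
  rw [norm_sq_dualVec]
  have h1 : (1 : ℤ) ≤ (m - n).1 ^ 2 + (m - n).2 ^ 2 - (m - n).1 * (m - n).2 := by
    by_contra hcon
    have hx : (m - n).1 ^ 2 + (m - n).2 ^ 2 - (m - n).1 * (m - n).2 ≤ 0 := by omega
    have h1 : (m - n).1 = 0 := by
      have : (m - n).1 ^ 2 ≤ 0 := by nlinarith [sq_nonneg ((m-n).1 - 2 * (m-n).2)]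
      exact pow_eq_zero_iff (two_ne_zero) |>.mp (le_antisymm this (sq_nonneg _))
    have h2 : (m - n).2 = 0 := by
      rw [h1] at hx
      have : (m - n).2 ^ 2 ≤ 0 := by nlinarith
      exact pow_eq_zero_iff (two_ne_zero) |>.mp (le_antisymm this (sq_nonneg _))
    exact h (sub_eq_zero.mp (Prod.ext h1 h2))
  have h2 : (1 : ℝ) ≤ ((m - n).1 : ℝ) ^ 2 + ((m - n).2 : ℝ) ^ 2 - (m - n).1 * (m - n).2 := by
    exact_mod_cast h1
  nlinarith [sq_nonneg (dualLength a)]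

theorem finite_norm_dualVec_le {a : ℝ} (ha : 0 < a) (r : ℝ) :
    {m : ℤ × ℤ | ‖dualVec a m‖ ≤ r}.Finite := by
  have h := (summable_dualVec ha).tendsto_cofinite_zero
  have hr : 0 < 1 / (1 + |r|) ^ 3 := by positivity
  have h2 := h.eventually (gt_mem_nhds hr)
  rw [Filter.eventually_cofinite] at h2
  refine h2.subset fun m hm => ?_
  simp only [Set.mem_ofPred_eq, not_lt] at hm ⊢
  have := hm.trans (le_abs_self r)
  gcongr

theorem finite_norm_dualVec_add_le {a : ℝ} (ha : 0 < a) (k : Plane) (r : ℝ) :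
    {m : ℤ × ℤ | ‖dualVec a m + k‖ ≤ r}.Finite := by
  refine (finite_norm_dualVec_le ha (r + ‖k‖)).subset fun m hm => ?_
  simp only [Set.mem_ofPred_eq] at hm ⊢
  calc ‖dualVec a m‖ = ‖(dualVec a m + k) - k‖ := by simp
    _ ≤ _ := (norm_sub_le _ _).trans (by linarith)

end

end HoneycombScatterer

/-! ### Truncated lattice sums of the free resolvent and their differences. -/

namespace HoneycombScatterer

noncomputable section

/-- The number of dual lattice points in an annulus grows at most linearly with its radius. -/
theorem card_annulus_le {a : ℝ} (ha : 0 < a) {ρ r : ℝ} (hρ : 0 ≤ ρ)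
    (hr : ρ + dualLength a / 2 ≤ r) (S : Finset (ℤ × ℤ))
    (hS : ∀ m ∈ S, |‖dualVec a m‖ - r| ≤ ρ) :
    (S.card : ℝ) * (dualLength a / 2) ^ 2 ≤ 4 * r * (ρ + dualLength a / 2) := by
  set δ := dualLength a / 2 with hδ
  have hδ0 : 0 < δ := by have := dualLength_pos ha; positivity
  have hvol : ∀ (x : Plane) {s : ℝ}, 0 ≤ s →
      (volume : Measure Plane).real (Metric.ball x s) = s ^ 2 * Real.pi := by
    intro x s hs
    rw [Measure.real, EuclideanSpace.volume_ball_fin_two]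
    simp [ENNReal.toReal_mul, ENNReal.toReal_pow, ENNReal.toReal_ofReal hs]
    left; exact Real.pi_pos.le
  -- Packing by area: balls of radius `δ`, half the minimal distance, around the points of the
  -- annulus are disjoint. Together with the ball of radius `r - ρ - δ` they lie in the ball of
  -- radius `r + ρ + δ`, and the difference of squared radii is `4 r (ρ + δ)`.
  have hdisj : Set.PairwiseDisjoint (↑S) fun m => Metric.ball (dualVec a m) δ := by
    intro m _ n _ hmn
    apply Metric.ball_disjoint_ball
    rw [dist_eq_norm, hδ]
    have := dualLength_le_norm_sub (a := a) hmn
    linarith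
  have h1 : (volume : Measure Plane).real (⋃ m ∈ S, Metric.ball (dualVec a m) δ)
      = S.card * (δ ^ 2 * Real.pi) := by
    rw [measureReal_biUnion_finset hdisj (fun _ _ => measurableSet_ball)
      (fun _ _ => measure_ball_lt_top.ne)]
    simp [hvol _ hδ0.le]
  have hd2 : Disjoint (⋃ m ∈ S, Metric.ball (dualVec a m) δ) (Metric.ball 0 (r - ρ - δ)) := by
    rw [Set.disjoint_iUnion₂_left]
    intro m hm
    apply Metric.ball_disjoint_ball
    have := (abs_le.mp (hS m hm)).1
    rw [dist_zero_right]; linarith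
  have hsub : (⋃ m ∈ S, Metric.ball (dualVec a m) δ) ∪ Metric.ball 0 (r - ρ - δ)
      ⊆ Metric.ball 0 (r + ρ + δ) := by
    apply Set.union_subset
    · refine Set.iUnion₂_subset fun m hm => Metric.ball_subset_ball' ?_
      have := (abs_le.mp (hS m hm)).2
      rw [dist_zero_right]; linarith
    · exact Metric.ball_subset_ball (by linarith)
  have h2 := measureReal_mono (μ := (volume : Measure Plane)) hsub measure_ball_lt_top.ne
  rw [measureReal_union hd2 measurableSet_ball
    ((measure_biUnion_lt_top S.finite_toSet fun _ _ => measure_ball_lt_top).ne)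
    measure_ball_lt_top.ne, h1,
    hvol _ (by linarith), hvol _ (by linarith)] at h2
  have hp := Real.pi_pos
  have h3 : ((S.card : ℝ) * δ ^ 2) * Real.pi ≤ (4 * r * (ρ + δ)) * Real.pi := by nlinarith
  exact le_of_mul_le_mul_right h3 hp

/-- The Fourier multiplier `1 / (|ξ_m + k|² + κ²)` of `(-Δ + κ²)⁻¹`. -/
def freeResolvent (a κ : ℝ) (k : Plane) (m : ℤ × ℤ) : ℝ := 1 / (‖dualVec a m + k‖ ^ 2 + κ ^ 2)

theorem freeResolvent_pos {a κ : ℝ} (hκ : 0 < κ) (k : Plane) (m : ℤ × ℤ) :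
    0 < freeResolvent a κ k m := by unfold freeResolvent; positivity

theorem freeResolvent_le {a κ : ℝ} (hκ : 0 < κ) (k : Plane) (m : ℤ × ℤ) :
    freeResolvent a κ k m ≤ 1 / κ ^ 2 := by
  unfold freeResolvent
  gcongr
  nlinarith [sq_nonneg ‖dualVec a m + k‖]

/-- Replaces the weight in `ξ_m + k` by one in `ξ_m` alone, at a cost uniform in `‖k‖ ≤ ρ`; all
later majorants depend on `k` only through `ρ`. -/
theorem one_add_norm_dualVec_le {a κ ρ : ℝ} (hκ : 0 < κ) {k : Plane} (hk : ‖k‖ ≤ ρ)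
    (m : ℤ × ℤ) :
    1 + ‖dualVec a m‖ ≤ ((1 + ρ) / κ + 1) * √(‖dualVec a m + k‖ ^ 2 + κ ^ 2) := by
  have hρ : 0 ≤ ρ := (norm_nonneg _).trans hk
  set s := √(‖dualVec a m + k‖ ^ 2 + κ ^ 2)
  have h1 : ‖dualVec a m‖ ≤ ‖dualVec a m + k‖ + ρ := by
    calc ‖dualVec a m‖ = ‖(dualVec a m + k) - k‖ := by simp
      _ ≤ _ := (norm_sub_le _ _).trans (by linarith)
  have h2 : ‖dualVec a m + k‖ ≤ s := by
    apply Real.le_sqrt_of_sq_le; nlinarith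
  have h3 : κ ≤ s := by
    apply Real.le_sqrt_of_sq_le; nlinarith [sq_nonneg ‖dualVec a m + k‖]
  have h4 : 1 + ρ ≤ (1 + ρ) / κ * s := by
    rw [div_mul_eq_mul_div, le_div_iff₀ hκ]; gcongr
  linarith

theorem freeResolvent_eq_sqrt {a κ : ℝ} (k : Plane) (m : ℤ × ℤ) :
    freeResolvent a κ k m = 1 / √(‖dualVec a m + k‖ ^ 2 + κ ^ 2) ^ 2 := by
  rw [Real.sq_sqrt (by positivity), freeResolvent]

theorem freeResolvent_le_of_norm_le {a κ ρ : ℝ} (hκ : 0 < κ) {k : Plane} (hk : ‖k‖ ≤ ρ)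
    (m : ℤ × ℤ) :
    freeResolvent a κ k m ≤ ((1 + ρ) / κ + 1) ^ 2 / (1 + ‖dualVec a m‖) ^ 2 := by
  have h := one_add_norm_dualVec_le (a := a) hκ hk m
  have hs : 0 < √(‖dualVec a m + k‖ ^ 2 + κ ^ 2) := by positivity
  rw [freeResolvent_eq_sqrt, div_le_div_iff₀ (by positivity) (by positivity), one_mul, ← mul_pow]
  gcongr

/-- Differencing in `k` gains one power of decay. The resolvent itself decays like `|ξ|⁻²`, which is
not summable in the plane; the difference decays like `|ξ|⁻³`, which is. -/
theorem abs_freeResolvent_sub_le {a κ ρ : ℝ} (hκ : 0 < κ) {k k' : Plane} (hk : ‖k‖ ≤ ρ)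
    (hk' : ‖k'‖ ≤ ρ) (m : ℤ × ℤ) :
    |freeResolvent a κ k m - freeResolvent a κ k' m|
      ≤ 2 * ((1 + ρ) / κ + 1) ^ 3 * ‖k - k'‖ * (1 / (1 + ‖dualVec a m‖) ^ 3) := by
  have h := one_add_norm_dualVec_le (a := a) hκ hk m
  have h' := one_add_norm_dualVec_le (a := a) hκ hk' m
  have hρ : 0 ≤ ρ := (norm_nonneg _).trans hk
  rw [freeResolvent_eq_sqrt, freeResolvent_eq_sqrt]
  set B := (1 + ρ) / κ + 1 with hB
  have hB0 : 0 < B := by positivity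
  set p := ‖dualVec a m + k‖ with hp
  set p' := ‖dualVec a m + k'‖ with hp'
  set s := √(p ^ 2 + κ ^ 2) with hs
  set s' := √(p' ^ 2 + κ ^ 2) with hs'
  have hs0 : 0 < s := by positivity
  have hs0' : 0 < s' := by positivity
  set X := 1 + ‖dualVec a m‖ with hX
  have hX0 : 0 < X := by positivity
  have hps : p ≤ s := Real.le_sqrt_of_sq_le (by nlinarith)
  have hps' : p' ≤ s' := Real.le_sqrt_of_sq_le (by nlinarith)
  have hd : |p' - p| ≤ ‖k - k'‖ := by
    refine (abs_norm_sub_norm_le _ _).trans (le_of_eq ?_)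
    rw [add_sub_add_left_eq_sub, norm_sub_rev]
  have e : 1 / s ^ 2 - 1 / s' ^ 2 = (p' - p) * (p + p') / (s ^ 2 * s' ^ 2) := by
    have e1 : s ^ 2 = p ^ 2 + κ ^ 2 := Real.sq_sqrt (by positivity)
    have e2 : s' ^ 2 = p' ^ 2 + κ ^ 2 := Real.sq_sqrt (by positivity)
    rw [div_sub_div _ _ (by positivity) (by positivity)]
    congr 1
    rw [e1, e2]; ring
  rw [e, abs_div, abs_mul, abs_of_nonneg (a := p + p') (by positivity),
    abs_of_pos (a := s ^ 2 * s' ^ 2) (by positivity)]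
  have hXs : X / B ≤ s := by rw [div_le_iff₀ hB0]; linarith
  have hXs' : X / B ≤ s' := by rw [div_le_iff₀ hB0]; linarith
  have hXB : 0 < X / B := by positivity
  calc |p' - p| * (p + p') / (s ^ 2 * s' ^ 2)
      ≤ ‖k - k'‖ * (s + s') / (s ^ 2 * s' ^ 2) := by gcongr
    _ = ‖k - k'‖ * (1 / (s * s' ^ 2) + 1 / (s ^ 2 * s')) := by field_simp
    _ ≤ ‖k - k'‖ * (1 / ((X / B) * (X / B) ^ 2) + 1 / ((X / B) ^ 2 * (X / B))) := by gcongr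
    _ = _ := by field_simp; ring

/-- The free resolvent with the momentum cut off at `r`. -/
def cutResolvent (a κ r : ℝ) (k : Plane) (m : ℤ × ℤ) : ℝ :=
  if ‖dualVec a m + k‖ ≤ r then freeResolvent a κ k m else 0

theorem finite_support_cutResolvent {a : ℝ} (ha : 0 < a) (κ r : ℝ) (k : Plane) :
    (Function.support (cutResolvent a κ r k)).Finite := by
  refine (finite_norm_dualVec_add_le ha k r).subset fun m hm => ?_
  by_contra h
  exact hm (if_neg h)

theorem summable_mul_cutResolvent {a : ℝ} (ha : 0 < a) (κ r : ℝ) (k : Plane) (χ : ℤ × ℤ → ℂ) :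
    Summable fun m => χ m * (cutResolvent a κ r k m : ℂ) := by
  apply summable_of_hasFiniteSupport
  refine (finite_support_cutResolvent ha κ r k).subset fun m hm => ?_
  simp only [Function.mem_support, ne_eq, mul_eq_zero, not_or] at hm
  exact_mod_cast hm.2

/-- The lattice sum `∑ χ(m) / (|ξ_m + k|² + κ²)` over `|ξ_m + k| ≤ r`. -/
def cutSum (a κ : ℝ) (χ : ℤ × ℤ → ℂ) (k : Plane) (r : ℝ) : ℂ :=
  ∑' m, χ m * (cutResolvent a κ r k m : ℂ)

theorem norm_mul_ofReal_le {z : ℂ} (hz : ‖z‖ ≤ 1) {x C : ℝ} (hx : |x| ≤ C) :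
    ‖z * (x : ℂ)‖ ≤ C := by
  rw [norm_mul, Complex.norm_real, Real.norm_eq_abs]
  calc ‖z‖ * |x| ≤ 1 * |x| := mul_le_mul_of_nonneg_right hz (abs_nonneg _)
    _ ≤ C := by rw [one_mul]; exact hx

theorem summable_mul_freeResolvent_sub {a κ : ℝ} (ha : 0 < a) (hκ : 0 < κ) (k k' : Plane)
    {χ : ℤ × ℤ → ℂ} (hχ : ∀ m, ‖χ m‖ ≤ 1) :
    Summable fun m => χ m * ((freeResolvent a κ k m - freeResolvent a κ k' m : ℝ) : ℂ) := by
  refine Summable.of_norm_bounded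
    ((summable_dualVec ha).mul_left (2 * ((1 + max ‖k‖ ‖k'‖) / κ + 1) ^ 3 * ‖k - k'‖)) fun m => ?_
  exact norm_mul_ofReal_le (hχ m) <|
    abs_freeResolvent_sub_le hκ (le_max_left _ _) (le_max_right _ _) m

/-- The cut-off disks for `k` and `k'` differ only in an annulus of bounded width. It holds `O(r)`
lattice points, each with a term `O(r⁻²)`, so using the disk of `k` for both sums costs `O(1/r)`. -/
theorem boundary_sum_le {a κ ρ r : ℝ} (ha : 0 < a) (hκ : 0 < κ) {k k' : Plane} (hk : ‖k‖ ≤ ρ)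
    (hk' : ‖k'‖ ≤ ρ) {χ : ℤ × ℤ → ℂ} (hχ : ∀ m, ‖χ m‖ ≤ 1)
    (hr : 2 * ρ + dualLength a / 2 ≤ r) :
    ‖cutSum a κ χ k r - cutSum a κ χ k' r - ∑' m, (if ‖dualVec a m + k‖ ≤ r then
        χ m * ((freeResolvent a κ k m - freeResolvent a κ k' m : ℝ) : ℂ) else 0)‖
      ≤ 16 * (ρ + dualLength a / 2) * ((1 + ρ) / κ + 1) ^ 2 / (dualLength a / 2) ^ 2 / r := by
  have hρ : 0 ≤ ρ := (norm_nonneg _).trans hk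
  have hL := dualLength_pos ha
  have hfin : {m : ℤ × ℤ | |‖dualVec a m‖ - r| ≤ ρ}.Finite :=
    (finite_norm_dualVec_le ha (r + ρ)).subset fun m hm => by
      have := (abs_le.mp (show |‖dualVec a m‖ - r| ≤ ρ from hm)).2
      simp only [Set.mem_ofPred_eq]; linarith
  set S := hfin.toFinset with hSdef
  have hS : ∀ m ∈ S, |‖dualVec a m‖ - r| ≤ ρ := fun m hm => by simpa [hSdef] using hm
  have hcard := card_annulus_le ha hρ (by linarith) S hS
  have hr0 : 0 < r := by linarith
  have hsum : Summable fun m => (if ‖dualVec a m + k‖ ≤ r then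
      χ m * ((freeResolvent a κ k m - freeResolvent a κ k' m : ℝ) : ℂ) else 0) := by
    apply summable_of_hasFiniteSupport
    refine (finite_norm_dualVec_add_le ha k r).subset fun m hm => ?_
    by_contra h
    exact hm (if_neg h)
  rw [cutSum, cutSum, ← (summable_mul_cutResolvent ha κ r k χ).tsum_sub
    (summable_mul_cutResolvent ha κ r k' χ), ← Summable.tsum_sub
    ((summable_mul_cutResolvent ha κ r k χ).sub (summable_mul_cutResolvent ha κ r k' χ)) hsum]
  rw [tsum_eq_sum (s := S)]
  · refine (norm_sum_le_of_le (n := fun _ => ((1 + ρ) / κ + 1) ^ 2 / (r / 2) ^ 2) S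
      fun m hm => ?_).trans ?_
    · have hb := freeResolvent_le_of_norm_le (a := a) hκ hk' m
      have hm1 := (abs_le.mp (hS m hm)).1
      have hb2 : freeResolvent a κ k' m ≤ ((1 + ρ) / κ + 1) ^ 2 / (r / 2) ^ 2 := by
        refine hb.trans ?_
        gcongr
        linarith
      have h0 := (freeResolvent_pos (a := a) hκ k' m).le
      -- In each of the four cut-off cases what is left is `0` or `±χ m` times the resolvent at
      -- `k'`; the resolvent at `k` always cancels.
      have key : ∀ z : ℂ, ‖z‖ ≤ 1 → ‖z * (freeResolvent a κ k' m : ℂ)‖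
          ≤ ((1 + ρ) / κ + 1) ^ 2 / (r / 2) ^ 2 := by
        intro z hz
        exact norm_mul_ofReal_le hz (by rwa [abs_of_nonneg h0])
      unfold cutResolvent
      split_ifs
      · refine le_trans (le_of_eq ?_) (key 0 (by simp))
        congr 1; push_cast; ring
      · refine le_trans (le_of_eq ?_) (key (χ m) (hχ m))
        congr 1; push_cast; ring
      · refine le_trans (le_of_eq ?_) (key (-χ m) (by rw [norm_neg]; exact hχ m))
        congr 1; push_cast; ring
      · simp; positivity
    · rw [Finset.sum_const, nsmul_eq_mul]
      have hδ : 0 < (dualLength a / 2) ^ 2 := by positivity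
      have hc2 : (S.card : ℝ) ≤ 4 * r * (ρ + dualLength a / 2) / (dualLength a / 2) ^ 2 := by
        rw [le_div_iff₀ hδ]; exact hcard
      calc _ ≤ 4 * r * (ρ + dualLength a / 2) / (dualLength a / 2) ^ 2
            * (((1 + ρ) / κ + 1) ^ 2 / (r / 2) ^ 2) := by gcongr
        _ = _ := by field_simp; ring
  · intro m hm
    have hm' : ¬ |‖dualVec a m‖ - r| ≤ ρ := by simpa [hSdef] using hm
    have h1 : |‖dualVec a m + k‖ - ‖dualVec a m‖| ≤ ρ :=
      (abs_norm_sub_norm_le _ _).trans (by simpa using hk)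
    have h2 : |‖dualVec a m + k'‖ - ‖dualVec a m‖| ≤ ρ :=
      (abs_norm_sub_norm_le _ _).trans (by simpa using hk')
    rw [abs_le] at h1 h2
    rw [abs_le, not_and_or, not_le, not_le] at hm'
    unfold cutResolvent
    rcases hm' with h | h
    · rw [if_pos (by linarith), if_pos (by linarith), if_pos (by linarith)]
      push_cast; ring
    · rw [if_neg (by linarith), if_neg (by linarith), if_neg (by linarith)]
      simp

/-- The bound is uniform in `k`, `k'` and the phases, which is what dominated convergence over the
dual cell requires. -/
theorem exists_cutSum_sub_bound {a κ : ℝ} (ha : 0 < a) (hκ : 0 < κ) (ρ : ℝ) :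
    ∃ C, ∀ᶠ r in atTop, ∀ k k' : Plane, ‖k‖ ≤ ρ → ‖k'‖ ≤ ρ →
      ∀ χ : ℤ × ℤ → ℂ, (∀ m, ‖χ m‖ ≤ 1) → ‖cutSum a κ χ k r - cutSum a κ χ k' r‖ ≤ C := by
  have hL := dualLength_pos ha
  refine ⟨16 * (ρ + dualLength a / 2) * ((1 + ρ) / κ + 1) ^ 2 / (dualLength a / 2) ^ 2 +
    2 * ((1 + ρ) / κ + 1) ^ 3 * (2 * ρ) * ∑' m, 1 / (1 + ‖dualVec a m‖) ^ 3, ?_⟩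
  filter_upwards [eventually_ge_atTop (2 * ρ + dualLength a / 2), eventually_ge_atTop 1]
    with r hr hr1 k k' hk hk' χ hχ
  have hρ : 0 ≤ ρ := (norm_nonneg _).trans hk
  have hb := boundary_sum_le ha hκ hk hk' hχ hr
  have h2 : ‖∑' m, (if ‖dualVec a m + k‖ ≤ r then
        χ m * ((freeResolvent a κ k m - freeResolvent a κ k' m : ℝ) : ℂ) else 0)‖
      ≤ 2 * ((1 + ρ) / κ + 1) ^ 3 * (2 * ρ) * ∑' m, 1 / (1 + ‖dualVec a m‖) ^ 3 := by
    rw [← tsum_mul_left]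
    refine tsum_of_norm_bounded ((summable_dualVec ha).mul_left _).hasSum fun m => ?_
    have h0 : 0 ≤ 2 * ((1 + ρ) / κ + 1) ^ 3 * (2 * ρ) * (1 / (1 + ‖dualVec a m‖) ^ 3) := by
      positivity
    split_ifs
    · refine norm_mul_ofReal_le (hχ m) ((abs_freeResolvent_sub_le hκ hk hk' m).trans ?_)
      gcongr
      exact (norm_sub_le _ _).trans (by linarith)
    · simpa using h0
  calc _ ≤ _ := norm_le_norm_sub_add _ (∑' m, (if ‖dualVec a m + k‖ ≤ r then
        χ m * ((freeResolvent a κ k m - freeResolvent a κ k' m : ℝ) : ℂ) else 0))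
    _ ≤ _ := by
      refine add_le_add (hb.trans ?_) h2
      exact div_le_self (by positivity) hr1

/-- A single truncated sum may diverge logarithmically. In the difference the summands are
absolutely summable and the mismatch of the cut-offs tends to zero by `boundary_sum_le`. -/
theorem tendsto_cutSum_sub {a κ : ℝ} (ha : 0 < a) (hκ : 0 < κ) (k k' : Plane)
    {χ : ℤ × ℤ → ℂ} (hχ : ∀ m, ‖χ m‖ ≤ 1) :
    Tendsto (fun r => cutSum a κ χ k r - cutSum a κ χ k' r) atTop
      (𝓝 (∑' m, χ m * ((freeResolvent a κ k m - freeResolvent a κ k' m : ℝ) : ℂ))) := by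
  set ρ := max ‖k‖ ‖k'‖
  have h1 : Tendsto (fun r => ∑' m, (if ‖dualVec a m + k‖ ≤ r then
        χ m * ((freeResolvent a κ k m - freeResolvent a κ k' m : ℝ) : ℂ) else 0)) atTop
      (𝓝 (∑' m, χ m * ((freeResolvent a κ k m - freeResolvent a κ k' m : ℝ) : ℂ))) := by
    refine tendsto_tsum_of_dominated_convergence
      (summable_mul_freeResolvent_sub ha hκ k k' hχ).norm ?_ ?_
    · intro m
      refine tendsto_const_nhds.congr' ?_
      filter_upwards [eventually_ge_atTop ‖dualVec a m + k‖] with r hr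
      rw [if_pos hr]
    · refine Eventually.of_forall fun r m => ?_
      split_ifs
      · exact le_rfl
      · rw [norm_zero]; exact norm_nonneg _
  have h2 : Tendsto (fun r => cutSum a κ χ k r - cutSum a κ χ k' r -
      ∑' m, (if ‖dualVec a m + k‖ ≤ r then
        χ m * ((freeResolvent a κ k m - freeResolvent a κ k' m : ℝ) : ℂ) else 0))
      atTop (𝓝 0) := by
    refine squeeze_zero_norm' ?_ (tendsto_const_nhds.div_atTop tendsto_id :
      Tendsto (fun r => 16 * (ρ + dualLength a / 2) * ((1 + ρ) / κ + 1) ^ 2 /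
        (dualLength a / 2) ^ 2 / id r) atTop (𝓝 0))
    filter_upwards [eventually_ge_atTop (2 * ρ + dualLength a / 2)] with r hr
    exact boundary_sum_le ha hκ (le_max_left _ _) (le_max_right _ _) hχ hr
  simpa using h2.add h1

theorem norm_tsum_freeResolvent_sub_le {a κ ρ : ℝ} (ha : 0 < a) (hκ : 0 < κ) {k k' : Plane}
    (hk : ‖k‖ ≤ ρ) (hk' : ‖k'‖ ≤ ρ) {χ : ℤ × ℤ → ℂ} (hχ : ∀ m, ‖χ m‖ ≤ 1) :
    ‖∑' m, χ m * ((freeResolvent a κ k m - freeResolvent a κ k' m : ℝ) : ℂ)‖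
      ≤ (2 * ((1 + ρ) / κ + 1) ^ 3 * ∑' m, 1 / (1 + ‖dualVec a m‖) ^ 3) * ‖k - k'‖ := by
  rw [mul_assoc, mul_comm (∑' m, _) ‖k - k'‖, ← mul_assoc, ← tsum_mul_left]
  refine tsum_of_norm_bounded ((summable_dualVec ha).mul_left _).hasSum fun m => ?_
  exact norm_mul_ofReal_le (hχ m) <|
    abs_freeResolvent_sub_le hκ hk hk' m

theorem cutSum_comp_equiv {a κ r : ℝ} {χ : ℤ × ℤ → ℂ} {k k' : Plane} (σ : ℤ × ℤ ≃ ℤ × ℤ)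
    (h : ∀ m, ‖dualVec a (σ m) + k‖ = ‖dualVec a m + k'‖) :
    cutSum a κ χ k r = cutSum a κ (χ ∘ σ) k' r := by
  unfold cutSum
  rw [← σ.tsum_eq]
  simp only [cutResolvent, freeResolvent, h, Function.comp_apply]

end

end HoneycombScatterer

namespace HoneycombScatterer

noncomputable section

/-! ### The fundamental cell of the dual lattice -/

/-- The half-open unit square, the fundamental cell in the coordinates of `momentum`. -/
def unitCell : Set (Fin 2 → ℝ) := {t | ∀ i, t i ∈ Set.Ioc (0 : ℝ) 1}

theorem measurableSet_unitCell : MeasurableSet unitCell :=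
  MeasurableSet.univ_pi' fun _ => measurableSet_Ioc

/-- Lebesgue measure on the unit square. -/
def cellMeasure : Measure (Fin 2 → ℝ) := volume.restrict unitCell

theorem volume_unitCell : volume unitCell = 1 := by
  have : unitCell = Set.pi Set.univ fun _ => Set.Ioc (0 : ℝ) 1 := by
    ext t; simp [unitCell, Set.mem_pi]
  rw [this, Real.volume_pi_Ioc]; simp

instance : IsProbabilityMeasure cellMeasure :=
  ⟨by rw [cellMeasure, Measure.restrict_apply_univ, volume_unitCell]⟩

theorem ae_mem_unitCell : ∀ᵐ t ∂cellMeasure, t ∈ unitCell :=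
  ae_restrict_mem measurableSet_unitCell

/-- An integer pair as a vector. -/
def intVec (m : ℤ × ℤ) : Fin 2 → ℝ := ![(m.1 : ℝ), (m.2 : ℝ)]

theorem momentum_intVec (a : ℝ) (m : ℤ × ℤ) : momentum a (intVec m) = dualVec a m :=
  (dualVec_eq_momentum a m).symm

/-- The integer part with respect to `unitCell`. -/
def cellIndex (t : Fin 2 → ℝ) : ℤ × ℤ := (⌈t 0⌉ - 1, ⌈t 1⌉ - 1)

theorem measurable_cellIndex : Measurable cellIndex := by
  unfold cellIndex; fun_prop

/-- The cell is open below and closed above, hence `⌈t⌉ - 1` in place of the floor. -/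
theorem sub_cellIndex_mem (t : Fin 2 → ℝ) : t - intVec (cellIndex t) ∈ unitCell := by
  intro i
  fin_cases i
  · have h1 := Int.le_ceil (t 0)
    have h2 := Int.ceil_lt_add_one (t 0)
    simp [intVec, cellIndex]; constructor <;> linarith
  · have h1 := Int.le_ceil (t 1)
    have h2 := Int.ceil_lt_add_one (t 1)
    simp [intVec, cellIndex]; constructor <;> linarith

theorem cellIndex_add_intVec {t : Fin 2 → ℝ} (ht : t ∈ unitCell) (m : ℤ × ℤ) :
    cellIndex (t + intVec m) = m := by
  have h0 := ht 0
  have h1 := ht 1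
  ext
  · simp only [cellIndex, intVec, Pi.add_apply, Matrix.cons_val_zero]
    rw [Int.ceil_add_intCast, (Int.ceil_eq_iff (z := 1)).mpr]
    · ring
    · simpa using h0
  · change ⌈t 1 + (m.2 : ℝ)⌉ - 1 = m.2
    rw [Int.ceil_add_intCast, (Int.ceil_eq_iff (z := 1)).mpr]
    · ring
    · simpa using h1

/-- The integer translates of the half-open square tile the plane, so Lebesgue measure is the sum
over `m` of translated copies of the measure on the cell. -/
theorem measurePreserving_add_intVec :
    MeasurePreserving (fun p : (Fin 2 → ℝ) × (ℤ × ℤ) => p.1 + intVec p.2)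
      (cellMeasure.prod Measure.count) volume := by
  have hm : Measurable fun p : (Fin 2 → ℝ) × (ℤ × ℤ) => p.1 + intVec p.2 := by
    apply measurable_from_prod_countable_left
    intro m; fun_prop
  refine ⟨hm, ?_⟩
  ext S hS
  rw [Measure.map_apply hm hS, Measure.prod_apply_symm (hm hS), lintegral_count]
  have h1 : ∀ m : ℤ × ℤ, cellMeasure ((fun t => (t, m)) ⁻¹'
      ((fun p : (Fin 2 → ℝ) × (ℤ × ℤ) => p.1 + intVec p.2) ⁻¹' S))
      = volume (S ∩ cellIndex ⁻¹' {m}) := by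
    intro m
    have hS' : MeasurableSet ((fun t => (t, m)) ⁻¹'
        ((fun p : (Fin 2 → ℝ) × (ℤ × ℤ) => p.1 + intVec p.2) ⁻¹' S)) :=
      measurable_prodMk_right (hm hS)
    rw [cellMeasure, Measure.restrict_apply hS']
    rw [← measure_preimage_add_right volume (intVec m) (S ∩ cellIndex ⁻¹' {m})]
    congr 1
    ext t
    simp only [Set.mem_inter_iff, Set.mem_preimage, Set.mem_singleton_iff]
    refine and_congr_right fun _ => ⟨fun ht => cellIndex_add_intVec ht m, fun h => ?_⟩
    have := sub_cellIndex_mem (t + intVec m)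
    rwa [h, add_sub_cancel_right] at this
  simp_rw [h1]
  rw [← measure_iUnion]
  · congr 1
    ext t; simp
  · intro m n hmn
    refine Set.disjoint_left.mpr fun t ht hn => hmn ?_
    exact (ht.2 : cellIndex t = m).symm.trans hn.2
  · exact fun m => hS.inter (measurable_cellIndex (measurableSet_singleton m))

/-- The point `(2π)⁻¹ (t₀ k₁ + t₁ k₂)`, for the Fourier transform with kernel `e^{-2πi x·ν}`. -/
def dualPoint (a : ℝ) (t : Fin 2 → ℝ) : Plane := (2 * Real.pi)⁻¹ • momentum a t

theorem continuous_dualPoint (a : ℝ) : Continuous (dualPoint a) :=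
  Continuous.const_smul (c := (2 * Real.pi)⁻¹) (continuous_momentum a)

theorem two_pi_smul_dualPoint (a : ℝ) (t : Fin 2 → ℝ) (m : ℤ × ℤ) :
    (2 * Real.pi) • dualPoint a (t + intVec m) = dualVec a m + momentum a t := by
  rw [dualPoint, smul_smul, mul_inv_cancel₀ (by positivity), one_smul, momentum_add,
    momentum_intVec, add_comm]

/-- The matrix with columns `k₁/(2π)` and `k₂/(2π)` has determinant `-1/|Γ|`. This Jacobian is the
source of every factor `1/|Γ|` that follows. -/
theorem measurePreserving_dualPoint {a : ℝ} (ha : 0 < a) :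
    MeasurePreserving (dualPoint a) (ENNReal.ofReal (1 / cellArea a) • volume) volume := by
  refine ⟨(continuous_dualPoint a).measurable, ?_⟩
  set M : Matrix (Fin 2) (Fin 2) ℝ := (dualLength a / (2 * Real.pi)) •
    !![1 / 2, 1 / 2; √3 / 2, -(√3 / 2)] with hM
  have hdet : M.det = -(1 / cellArea a) := by
    rw [hM, Matrix.det_smul, Matrix.det_fin_two_of, cellArea_eq, dualLength]
    simp only [Fintype.card_fin]
    have : (√3 : ℝ) ≠ 0 := by positivity
    field_simp
    ring
  have hc := cellArea_pos ha
  have hdet0 : M.det ≠ 0 := by rw [hdet]; exact neg_ne_zero.mpr (by positivity)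
  have e : dualPoint a = (WithLp.toLp 2) ∘ (Matrix.toLin' M) := by
    funext t
    ext i
    fin_cases i
    · change (2 * Real.pi)⁻¹ * momentum a t 0 = _
      rw [momentum_apply_zero]
      simp [hM, Matrix.vecHead, Matrix.vecTail]
      ring
    · change (2 * Real.pi)⁻¹ * momentum a t 1 = _
      rw [momentum_apply_one]
      simp [hM, Matrix.vecHead, Matrix.vecTail]
      ring
  rw [Measure.map_smul, e, ← Measure.map_map (by fun_prop) (by fun_prop),
    Real.map_matrix_volume_pi_eq_smul_volume_pi hdet0, Measure.map_smul,
    (PiLp.volume_preserving_toLp (Fin 2)).map_eq, smul_smul, hdet, ← ENNReal.ofReal_mul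
    (by positivity)]
  rw [inv_neg, abs_neg, abs_of_pos (by positivity)]
  have : 1 / cellArea a * (1 / cellArea a)⁻¹ = 1 := by field_simp
  rw [this]; simp

/-- The unfolding map of momentum space into cells. -/
def unfoldMap (a : ℝ) (p : (Fin 2 → ℝ) × (ℤ × ℤ)) : Plane := dualPoint a (p.1 + intVec p.2)

theorem measurePreserving_unfoldMap {a : ℝ} (ha : 0 < a) :
    MeasurePreserving (unfoldMap a)
      (ENNReal.ofReal (1 / cellArea a) • cellMeasure.prod Measure.count) volume :=
  (measurePreserving_dualPoint ha).comp (measurePreserving_add_intVec.smul_measure _)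

theorem two_pi_smul_unfoldMap (a : ℝ) (t : Fin 2 → ℝ) (m : ℤ × ℤ) :
    (2 * Real.pi) • unfoldMap a (t, m) = dualVec a m + momentum a t :=
  two_pi_smul_dualPoint a t m

theorem measurable_unfoldMap {a : ℝ} (ha : 0 < a) (m : ℤ × ℤ) :
    Measurable fun t => unfoldMap a (t, m) :=
  (measurePreserving_unfoldMap ha).measurable.comp (by fun_prop)

theorem ofReal_one_div_cellArea_ne_zero {a : ℝ} (ha : 0 < a) :
    ENNReal.ofReal (1 / cellArea a) ≠ 0 := by
  have := cellArea_pos ha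
  simp; positivity

theorem lintegral_eq_cell {a : ℝ} (ha : 0 < a) {f : Plane → ENNReal} (hf : Measurable f) :
    ∫⁻ ν, f ν = ENNReal.ofReal (1 / cellArea a) *
      ∫⁻ t, ∑' m, f (unfoldMap a (t, m)) ∂cellMeasure := by
  have hU := measurePreserving_unfoldMap ha
  rw [← hU.lintegral_comp hf, lintegral_smul_measure, smul_eq_mul,
    lintegral_prod (fun p => f (unfoldMap a p)) (hf.comp hU.measurable).aemeasurable]
  simp_rw [lintegral_count]

theorem ae_cell_of_ae {a : ℝ} (ha : 0 < a) {p : Plane → Prop} (h : ∀ᵐ ν, p ν) :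
    ∀ᵐ t ∂cellMeasure, ∀ m, p (unfoldMap a (t, m)) := by
  have h2 := (measurePreserving_unfoldMap ha).quasiMeasurePreserving.ae h
  rw [Measure.ae_ennreal_smul_measure_eq (ofReal_one_div_cellArea_ne_zero ha)] at h2
  have h3 := Measure.ae_ae_of_ae_prod h2
  filter_upwards [h3] with t ht m
  exact Measure.ae_count_iff.mp ht m

theorem integrable_cell {a : ℝ} (ha : 0 < a) {f : Plane → ℂ} (hf : Integrable f) :
    Integrable (fun p => f (unfoldMap a p)) (cellMeasure.prod Measure.count) := by
  have hU := measurePreserving_unfoldMap ha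
  have h1 := (hU.integrable_comp hf.aestronglyMeasurable).mpr hf
  exact (integrable_smul_measure (ofReal_one_div_cellArea_ne_zero ha) ENNReal.ofReal_ne_top).mp h1

theorem integral_eq_cell {a : ℝ} (ha : 0 < a) {f : Plane → ℂ} (hf : Integrable f) :
    ∫ ν, f ν = ((1 / cellArea a : ℝ) : ℂ) *
      ∫ t, ∑' m, f (unfoldMap a (t, m)) ∂cellMeasure := by
  have hU := measurePreserving_unfoldMap ha
  have hi := integrable_cell ha hf
  have hc := cellArea_pos ha
  rw [← hU.map_eq, integral_map hU.measurable.aemeasurable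
    (by rw [hU.map_eq]; exact hf.aestronglyMeasurable), integral_smul_measure,
    integral_prod _ hi, ENNReal.toReal_ofReal (by positivity), Complex.real_smul]
  congr 1
  apply integral_congr_ae
  filter_upwards [hi.prod_right_ae] with t ht
  rw [integral_countable ht]
  simp [Measure.real]

theorem integrable_tsum_cell {a : ℝ} (ha : 0 < a) {f : Plane → ℂ} (hf : Integrable f) :
    Integrable (fun t => ∑' m, f (unfoldMap a (t, m))) cellMeasure := by
  have hi := integrable_cell ha hf
  refine hi.integral_prod_left.congr ?_
  filter_upwards [hi.prod_right_ae] with t ht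
  rw [integral_countable ht]
  simp [Measure.real]

/-! ### Fourier series on the cell -/

/-- The character `e^{2πi (t₀ n₁ + t₁ n₂)}`. -/
def cellChar (n : ℤ × ℤ) (t : Fin 2 → ℝ) : ℂ :=
  Complex.exp (2 * Real.pi * Complex.I * (t 0 * n.1 + t 1 * n.2))

theorem continuous_cellChar (n : ℤ × ℤ) : Continuous (cellChar n) := by
  unfold cellChar; fun_prop

theorem norm_cellChar (n : ℤ × ℤ) (t : Fin 2 → ℝ) : ‖cellChar n t‖ = 1 := by
  have : 2 * Real.pi * Complex.I * (t 0 * n.1 + t 1 * n.2)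
      = ((2 * Real.pi * (t 0 * n.1 + t 1 * n.2) : ℝ) : ℂ) * Complex.I := by push_cast; ring
  rw [cellChar, this, Complex.norm_exp_ofReal_mul_I]

theorem cellChar_add (m n : ℤ × ℤ) (t : Fin 2 → ℝ) :
    cellChar (m + n) t = cellChar m t * cellChar n t := by
  simp only [cellChar, ← Complex.exp_add]
  congr 1; simp; ring

theorem cellChar_neg (n : ℤ × ℤ) (t : Fin 2 → ℝ) :
    cellChar (-n) t = (starRingEnd ℂ) (cellChar n t) := by
  simp only [cellChar, ← Complex.exp_conj]
  congr 1; simp [Complex.conj_ofNat]; ring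

theorem cellChar_zero (t : Fin 2 → ℝ) : cellChar 0 t = 1 := by simp [cellChar]

attribute [local instance] instMeasureSpaceUnitAddCircle

/-- The projection of the square onto the torus. -/
def toTorus (t : Fin 2 → ℝ) : UnitAddTorus (Fin 2) := fun i => (t i : UnitAddCircle)

/-- The section of the torus over the square. -/
def ofTorus (x : UnitAddTorus (Fin 2)) : Fin 2 → ℝ :=
  (UnitAddTorus.measurableEquivPiIoc (fun _ : Fin 2 => (0 : ℝ)) x).1

theorem toTorus_ofTorus (x : UnitAddTorus (Fin 2)) : toTorus (ofTorus x) = x :=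
  (UnitAddTorus.measurableEquivPiIoc (fun _ : Fin 2 => (0 : ℝ))).symm_apply_apply x

theorem measurePreserving_ofTorus : MeasurePreserving ofTorus volume cellMeasure := by
  have h := UnitAddTorus.measurePreserving_equivPiIoc (fun _ : Fin 2 => (0 : ℝ))
  have e : {x : Fin 2 → ℝ | ∀ i, x i ∈ Set.Ioc (0 : ℝ) (0 + 1)} = unitCell := by
    simp [unitCell]
  have hms : MeasurableSet {x : Fin 2 → ℝ | ∀ i, x i ∈ Set.Ioc (0 : ℝ) (0 + 1)} := by
    rw [e]; exact measurableSet_unitCell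
  have h2 : MeasurePreserving
      (Subtype.val : {x : Fin 2 → ℝ // ∀ i, x i ∈ Set.Ioc (0 : ℝ) (0 + 1)} → (Fin 2 → ℝ))
      (Measure.comap Subtype.val volume) cellMeasure := by
    refine ⟨measurable_subtype_coe, ?_⟩
    rw [cellMeasure, ← e]
    exact map_comap_subtype_coe hms volume
  exact h2.comp h

theorem measurable_toTorus : Measurable toTorus :=
  measurable_pi_lambda _ fun i => AddCircle.measurable_mk'.comp (measurable_pi_apply i)

theorem measurePreserving_toTorus : MeasurePreserving toTorus cellMeasure volume := by
  refine ⟨measurable_toTorus, ?_⟩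
  rw [← measurePreserving_ofTorus.map_eq,
    Measure.map_map measurable_toTorus measurePreserving_ofTorus.measurable]
  have : toTorus ∘ ofTorus = id := funext toTorus_ofTorus
  rw [this, Measure.map_id]

theorem mFourier_toTorus (n : ℤ × ℤ) (t : Fin 2 → ℝ) :
    UnitAddTorus.mFourier ![n.1, n.2] (toTorus t) = cellChar n t := by
  simp only [UnitAddTorus.mFourier, ContinuousMap.coe_mk, Fin.prod_univ_two, toTorus,
    Matrix.cons_val_zero, Matrix.cons_val_one, fourier_coe_apply, cellChar, ← Complex.exp_add]
  congr 1; push_cast; ring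

/-- The space `L²` of the cell. -/
abbrev CellL2 : Type := Lp ℂ 2 cellMeasure

theorem orthonormal_cellFourier : Orthonormal ℂ fun n : ℤ × ℤ =>
    Lp.compMeasurePreservingₗᵢ ℂ toTorus measurePreserving_toTorus
      (UnitAddTorus.mFourierLp 2 ![n.1, n.2]) := by
  have h := (UnitAddTorus.orthonormal_mFourier (d := Fin 2)).comp
    (fun n : ℤ × ℤ => ![n.1, n.2]) (fun m n h => Prod.ext (congrFun h 0) (congrFun h 1))
  exact h.comp_linearIsometry (Lp.compMeasurePreservingₗᵢ ℂ toTorus measurePreserving_toTorus)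

/-- Pulling back along `ofTorus` undoes the pull-back along `toTorus`, so a function orthogonal to
all the characters of the cell becomes one on the torus with vanishing Fourier coefficients, where
completeness is known. -/
theorem cellFourier_complete : (Submodule.span ℂ (Set.range fun n : ℤ × ℤ =>
    Lp.compMeasurePreservingₗᵢ ℂ toTorus measurePreserving_toTorus
      (UnitAddTorus.mFourierLp 2 ![n.1, n.2])))ᗮ = ⊥ := by
  rw [Submodule.eq_bot_iff]
  intro f hf
  rw [Submodule.mem_orthogonal] at hf
  set S := Lp.compMeasurePreservingₗᵢ (E := ℂ) (p := 2) ℂ ofTorus measurePreserving_ofTorus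
  have hcomp : ∀ g : Lp ℂ 2 (volume : Measure (UnitAddTorus (Fin 2))),
      S (Lp.compMeasurePreservingₗᵢ ℂ toTorus measurePreserving_toTorus g) = g := by
    intro g
    apply Lp.ext
    have h1 := Lp.coeFn_compMeasurePreserving
      (Lp.compMeasurePreservingₗᵢ ℂ toTorus measurePreserving_toTorus g) measurePreserving_ofTorus
    have h2 := measurePreserving_ofTorus.quasiMeasurePreserving.ae_eq_comp
      (Lp.coeFn_compMeasurePreserving g measurePreserving_toTorus)
    refine h1.trans (h2.trans ?_)
    rw [Function.comp_assoc]
    have : toTorus ∘ ofTorus = id := funext toTorus_ofTorus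
    rw [this, Function.comp_id]
  have h0 : S f = 0 := by
    have hz : ∀ n, UnitAddTorus.mFourierBasis.repr (S f) n = 0 := by
      intro n
      rw [HilbertBasis.repr_apply_apply, UnitAddTorus.coe_mFourierBasis]
      have hn : n = ![((n 0, n 1) : ℤ × ℤ).1, ((n 0, n 1) : ℤ × ℤ).2] := by
        ext i; fin_cases i <;> rfl
      rw [hn, ← hcomp (UnitAddTorus.mFourierLp 2 _), S.inner_map_map]
      exact hf _ (Submodule.subset_span ⟨(n 0, n 1), rfl⟩)
    apply UnitAddTorus.mFourierBasis.repr.injective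
    ext n
    rw [hz n]; simp
  exact S.injective (by rw [h0, map_zero])

/-- The Fourier basis of `L²` of the cell. -/
def cellBasis : HilbertBasis (ℤ × ℤ) ℂ CellL2 :=
  HilbertBasis.mkOfOrthogonalEqBot orthonormal_cellFourier cellFourier_complete

theorem coeFn_cellBasis (n : ℤ × ℤ) : cellBasis n =ᵐ[cellMeasure] cellChar n := by
  rw [cellBasis, HilbertBasis.coe_mkOfOrthogonalEqBot]
  refine (Lp.coeFn_compMeasurePreserving _ measurePreserving_toTorus).trans ?_
  have h2 := measurePreserving_toTorus.quasiMeasurePreserving.ae_eq_comp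
    (UnitAddTorus.coeFn_mFourierLp 2 ![n.1, n.2])
  refine h2.trans (Eventually.of_forall fun t => ?_)
  exact mFourier_toTorus n t

theorem cellBasis_repr (f : CellL2) (n : ℤ × ℤ) :
    cellBasis.repr f n = ∫ t, cellChar (-n) t * f t ∂cellMeasure := by
  rw [HilbertBasis.repr_apply_apply, L2.inner_def]
  apply integral_congr_ae
  filter_upwards [coeFn_cellBasis n] with t ht
  rw [ht, RCLike.inner_apply, cellChar_neg, mul_comm]

/-- Converts identities indexed by the lattice into almost everywhere identities in the
quasi-momentum. -/
theorem ae_eq_of_fourier_eq {f g : (Fin 2 → ℝ) → ℂ} (hf : MemLp f 2 cellMeasure)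
    (hg : MemLp g 2 cellMeasure)
    (h : ∀ n, ∫ t, cellChar n t * f t ∂cellMeasure = ∫ t, cellChar n t * g t ∂cellMeasure) :
    f =ᵐ[cellMeasure] g := by
  have e : hf.toLp f = hg.toLp g := by
    apply cellBasis.repr.injective
    ext n
    rw [cellBasis_repr, cellBasis_repr]
    have h1 : ∫ t, cellChar (-n) t * hf.toLp f t ∂cellMeasure
        = ∫ t, cellChar (-n) t * f t ∂cellMeasure := by
      apply integral_congr_ae
      filter_upwards [hf.coeFn_toLp] with t ht
      rw [ht]
    have h2 : ∫ t, cellChar (-n) t * hg.toLp g t ∂cellMeasure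
        = ∫ t, cellChar (-n) t * g t ∂cellMeasure := by
      apply integral_congr_ae
      filter_upwards [hg.coeFn_toLp] with t ht
      rw [ht]
    rw [h1, h2, h]
  exact (MemLp.toLp_eq_toLp_iff hf hg).mp e

end

end HoneycombScatterer

namespace HoneycombScatterer

noncomputable section

/-! ### Plane waves -/

theorem norm_planeWave (a : ℝ) (k y : Plane) (m : ℤ × ℤ) : ‖planeWave a k y m‖ = 1 := by
  rw [planeWave, mul_comm, Complex.norm_exp_ofReal_mul_I]

theorem planeWave_zero (a : ℝ) (k : Plane) (m : ℤ × ℤ) : planeWave a k 0 m = 1 := by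
  simp [planeWave]

theorem planeWave_mul_conj (a : ℝ) (k x y : Plane) (m : ℤ × ℤ) :
    planeWave a k x m * (starRingEnd ℂ) (planeWave a k y m) = planeWave a k (x - y) m := by
  simp only [planeWave, ← Complex.exp_conj, ← Complex.exp_add, inner_sub_right]
  congr 1; simp; ring

theorem conj_planeWave (a : ℝ) (k y : Plane) (m : ℤ × ℤ) :
    (starRingEnd ℂ) (planeWave a k y m) = planeWave a k (-y) m := by
  simp only [planeWave, ← Complex.exp_conj, inner_neg_right]
  congr 1; simp

/-- The factor `e^{i k·y}`. -/
def bloch (k y : Plane) : ℂ := Complex.exp (Complex.I * ((inner ℝ k y : ℝ) : ℂ))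

theorem bloch_zero (k : Plane) : bloch k 0 = 1 := by simp [bloch]

theorem norm_bloch (k y : Plane) : ‖bloch k y‖ = 1 := by
  rw [bloch, mul_comm, Complex.norm_exp_ofReal_mul_I]

theorem continuous_bloch (y : Plane) : Continuous fun k => bloch k y := by
  unfold bloch; fun_prop

theorem bloch_add (k k' y : Plane) : bloch (k + k') y = bloch k y * bloch k' y := by
  simp only [bloch, ← Complex.exp_add, inner_add_left]
  congr 1; push_cast; ring

theorem bloch_add_right (k y y' : Plane) : bloch k (y + y') = bloch k y * bloch k y' := by
  simp only [bloch, ← Complex.exp_add, inner_add_right]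
  congr 1; push_cast; ring

theorem planeWave_eq_bloch (a : ℝ) (k y : Plane) (m : ℤ × ℤ) :
    planeWave a k y m = bloch (dualVec a m + k) y := rfl

theorem planeWave_eq_mul (a : ℝ) (k y : Plane) (m : ℤ × ℤ) :
    planeWave a k y m = bloch k y * bloch (dualVec a m) y := by
  rw [planeWave_eq_bloch, bloch_add, mul_comm]

theorem bloch_momentum_latticeVec {a : ℝ} (ha : 0 < a) (t : Fin 2 → ℝ) (n : ℤ × ℤ) :
    bloch (momentum a t) (latticeVec a n) = cellChar n t := by
  rw [bloch, inner_momentum_latticeVec ha, cellChar]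
  congr 1; push_cast; ring

theorem bloch_dualVec_latticeVec {a : ℝ} (ha : 0 < a) (m n : ℤ × ℤ) :
    bloch (dualVec a m) (latticeVec a n) = 1 := by
  rw [bloch, inner_dualVec_latticeVec ha]
  rw [Complex.exp_eq_one_iff]
  exact ⟨m.1 * n.1 + m.2 * n.2, by push_cast; ring⟩

/-- Since `ξ_m · v ∈ 2πℤ` for `v ∈ Λ`, a lattice translation contributes a factor that does not
depend on `m`. -/
theorem planeWave_add_latticeVec {a : ℝ} (ha : 0 < a) (t : Fin 2 → ℝ) (y : Plane) (m n : ℤ × ℤ) :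
    planeWave a (momentum a t) (latticeVec a n + y) m
      = cellChar n t * planeWave a (momentum a t) y m := by
  rw [planeWave_eq_bloch, bloch_add_right, bloch_add, bloch_dualVec_latticeVec ha,
    bloch_momentum_latticeVec ha, one_mul, planeWave_eq_bloch]

/-! ### Momentum integrals -/

/-- The kernel of `(-Δ + κ²)⁻¹` with the momentum cut off at `r`. -/
def greenCut (κ r : ℝ) (x : Plane) : ℂ :=
  ∫ ν : Plane, if ‖(2 * Real.pi) • ν‖ ≤ r then
    bloch ((2 * Real.pi) • ν) x * ((1 / (‖(2 * Real.pi) • ν‖ ^ 2 + κ ^ 2) : ℝ) : ℂ) else 0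

theorem integrable_greenCut {κ : ℝ} (hκ : 0 < κ) (r : ℝ) (x : Plane) :
    Integrable fun ν : Plane => if ‖(2 * Real.pi) • ν‖ ≤ r then
    bloch ((2 * Real.pi) • ν) x * ((1 / (‖(2 * Real.pi) • ν‖ ^ 2 + κ ^ 2) : ℝ) : ℂ) else 0 := by
  have hcl : IsClosed {ν : Plane | ‖(2 * Real.pi) • ν‖ ≤ r} :=
    isClosed_le (by fun_prop) continuous_const
  have hbd : {ν : Plane | ‖(2 * Real.pi) • ν‖ ≤ r} ⊆ Metric.closedBall 0 (r / (2 * Real.pi)) := by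
    intro ν hν
    rw [mem_closedBall_zero_iff, le_div_iff₀ (by positivity)]
    have h : ‖(2 * Real.pi) • ν‖ ≤ r := hν
    rwa [norm_smul, Real.norm_of_nonneg (by positivity), mul_comm] at h
  have hcpt : IsCompact {ν : Plane | ‖(2 * Real.pi) • ν‖ ≤ r} :=
    (isCompact_closedBall _ _).of_isClosed_subset hcl hbd
  have hcont : Continuous fun ν : Plane => bloch ((2 * Real.pi) • ν) x *
      ((1 / (‖(2 * Real.pi) • ν‖ ^ 2 + κ ^ 2) : ℝ) : ℂ) := by
    refine ((continuous_bloch x).comp (continuous_const_smul _)).mul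
      (Complex.continuous_ofReal.comp ?_)
    refine continuous_const.div (by fun_prop) fun ν => by positivity
  have h := (hcont.continuousOn.integrableOn_compact hcpt (μ := volume)).integrable_indicator
    hcl.measurableSet
  refine h.congr (Eventually.of_forall fun ν => ?_)
  simp only [Set.indicator, Set.mem_ofPred_eq]

/-- The lattice sum defining an entry of the Krein matrix. -/
def waveSum (a κ : ℝ) (x k : Plane) (r : ℝ) : ℂ := cutSum a κ (planeWave a k x) k r

theorem waveSum_eq_tsum (a κ : ℝ) (x : Plane) (t : Fin 2 → ℝ) (r : ℝ) :
    waveSum a κ x (momentum a t) r = ∑' m, (fun ν : Plane => if ‖(2 * Real.pi) • ν‖ ≤ r then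
      bloch ((2 * Real.pi) • ν) x * ((1 / (‖(2 * Real.pi) • ν‖ ^ 2 + κ ^ 2) : ℝ) : ℂ) else 0)
      (unfoldMap a (t, m)) := by
  unfold waveSum cutSum
  congr 1
  funext m
  simp only [two_pi_smul_unfoldMap, cutResolvent, freeResolvent, planeWave_eq_bloch]
  split_ifs <;> simp

theorem integrable_waveSum {a κ : ℝ} (ha : 0 < a) (hκ : 0 < κ) (x : Plane) (r : ℝ) :
    Integrable (fun t => waveSum a κ x (momentum a t) r) cellMeasure := by
  simp_rw [waveSum_eq_tsum]
  exact integrable_tsum_cell ha (integrable_greenCut hκ r x)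

/-- Unfolding: summing over the dual lattice and integrating over its cell is integrating over all
of momentum space. -/
theorem integral_waveSum {a κ : ℝ} (ha : 0 < a) (hκ : 0 < κ) (x : Plane) (r : ℝ) :
    ((1 / cellArea a : ℝ) : ℂ) * ∫ t, waveSum a κ x (momentum a t) r ∂cellMeasure
      = greenCut κ r x := by
  simp_rw [waveSum_eq_tsum]
  exact (integral_eq_cell ha (integrable_greenCut hκ r x)).symm

/-- Polar coordinates reduce the integral to that of `s / ((2πs)² + κ²)`, with a logarithm as
primitive. -/
theorem greenCut_zero {κ r : ℝ} (hκ : 0 < κ) (hr : 0 < r) :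
    greenCut κ r 0 = ((1 / (4 * Real.pi) * Real.log ((r ^ 2 + κ ^ 2) / κ ^ 2) : ℝ) : ℂ) := by
  have e : greenCut κ r 0 = ∫ ν : Plane, (fun s : ℝ => (((if 2 * Real.pi * s ≤ r then
      1 / ((2 * Real.pi * s) ^ 2 + κ ^ 2) else 0 : ℝ)) : ℂ)) ‖ν‖ := by
    unfold greenCut
    congr 1
    funext ν
    rw [norm_smul, Real.norm_of_nonneg (by positivity), bloch_zero]
    by_cases h : 2 * Real.pi * ‖ν‖ ≤ r
    · rw [if_pos h, one_mul]; beta_reduce; rw [if_pos h]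
    · rw [if_neg h]; beta_reduce; rw [if_neg h, Complex.ofReal_zero]
  have hpi := Real.pi_pos
  have hvol : (volume : Measure Plane).real (Metric.ball 0 1) = Real.pi := by
    rw [Measure.real, EuclideanSpace.volume_ball_fin_two]
    simpa using Real.pi_pos.le
  have e1 := e.trans (integral_fun_norm_addHaar (volume : Measure Plane)
    (fun s : ℝ => (((if 2 * Real.pi * s ≤ r then
      1 / ((2 * Real.pi * s) ^ 2 + κ ^ 2) else 0 : ℝ)) : ℂ)))
  rw [e1, hvol, finrank_euclideanSpace_fin]
  have e2 : ∫ y in Set.Ioi (0 : ℝ), y ^ (2 - 1) • (((if 2 * Real.pi * y ≤ r then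
      1 / ((2 * Real.pi * y) ^ 2 + κ ^ 2) else 0 : ℝ)) : ℂ)
      = ((∫ y in (0 : ℝ)..(r / (2 * Real.pi)), y / ((2 * Real.pi * y) ^ 2 + κ ^ 2) : ℝ) : ℂ) := by
    rw [intervalIntegral.integral_of_le (by positivity), ← integral_complex_ofReal,
      ← Set.Ioi_inter_Iic, ← setIntegral_indicator measurableSet_Iic]
    congr 1
    funext y
    rw [Set.indicator_apply]
    have hiff : y ∈ Set.Iic (r / (2 * Real.pi)) ↔ 2 * Real.pi * y ≤ r := by
      rw [Set.mem_Iic, le_div_iff₀ (by positivity), mul_comm]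
    by_cases h : 2 * Real.pi * y ≤ r
    · rw [if_pos h, if_pos (hiff.mpr h), Complex.real_smul]
      push_cast; ring
    · rw [if_neg h, if_neg (fun h' => h (hiff.mp h'))]
      simp
  rw [e2]
  have e3 : ∫ y in (0 : ℝ)..(r / (2 * Real.pi)), y / ((2 * Real.pi * y) ^ 2 + κ ^ 2)
      = 1 / (8 * Real.pi ^ 2) * Real.log ((2 * Real.pi * (r / (2 * Real.pi))) ^ 2 + κ ^ 2)
        - 1 / (8 * Real.pi ^ 2) * Real.log ((2 * Real.pi * 0) ^ 2 + κ ^ 2) := by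
    refine intervalIntegral.integral_eq_sub_of_hasDerivAt
      (f := fun y => 1 / (8 * Real.pi ^ 2) * Real.log ((2 * Real.pi * y) ^ 2 + κ ^ 2)) ?_ ?_
    · intro y _
      have h0 : (2 * Real.pi * y) ^ 2 + κ ^ 2 ≠ 0 := by positivity
      have h1 : HasDerivAt (fun y => (2 * Real.pi * y) ^ 2 + κ ^ 2)
          (2 * (2 * Real.pi * y) * (2 * Real.pi)) y := by
        exact ((((hasDerivAt_id y).const_mul (2 * Real.pi)).pow 2).add_const (κ ^ 2)).congr_deriv
          (by simp)
      exact ((h1.log h0).const_mul (1 / (8 * Real.pi ^ 2))).congr_deriv (by field_simp; norm_num)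
    · apply Continuous.intervalIntegrable
      refine continuous_id.div (by fun_prop) fun y => by positivity
  rw [e3]
  have e4 : 2 * Real.pi * (r / (2 * Real.pi)) = r := by field_simp
  rw [e4, Real.log_div (by positivity) (by positivity)]
  simp only [nsmul_eq_mul, mul_zero, Complex.real_smul]
  push_cast
  have : (Real.pi : ℂ) ≠ 0 := by exact_mod_cast hpi.ne'
  field_simp
  simp
  ring

/-- The subtracted `ln r / (2π)` is the counterterm in `c(r)⁻¹`. The finite part `-ln κ / (2π)` is
where the `ln κ` on the diagonal of the scattering matrix comes from. -/
theorem tendsto_greenCut_zero {κ : ℝ} (hκ : 0 < κ) :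
    Tendsto (fun r : ℝ => greenCut κ r 0 - ((Real.log r / (2 * Real.pi) : ℝ) : ℂ)) atTop
      (𝓝 ((-(Real.log κ / (2 * Real.pi)) : ℝ) : ℂ)) := by
  have h1 : Tendsto (fun r : ℝ => 1 / (4 * Real.pi) * Real.log (1 / κ ^ 2 + 1 / r ^ 2)) atTop
      (𝓝 (1 / (4 * Real.pi) * Real.log (1 / κ ^ 2 + 0))) := by
    refine ((Tendsto.log (tendsto_const_nhds.add ?_) (by positivity)).const_mul _)
    exact tendsto_const_nhds.div_atTop (tendsto_pow_atTop two_ne_zero)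
  have h2 : 1 / (4 * Real.pi) * Real.log (1 / κ ^ 2 + 0) = -(Real.log κ / (2 * Real.pi)) := by
    rw [add_zero, one_div (κ ^ 2), Real.log_inv, Real.log_pow]
    field_simp; push_cast; ring
  rw [h2] at h1
  refine ((Complex.continuous_ofReal.tendsto _).comp h1).congr' ?_
  filter_upwards [eventually_gt_atTop 0] with r hr
  rw [greenCut_zero hκ hr, ← Complex.ofReal_sub]
  simp only [Function.comp_apply]
  congr 1
  have e : (r ^ 2 + κ ^ 2) / κ ^ 2 = r ^ 2 * (1 / κ ^ 2 + 1 / r ^ 2) := by field_simp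
  rw [e, Real.log_mul (by positivity) (by positivity), Real.log_pow]
  field_simp; push_cast; ring

/-! ### Convergence of the lattice sums -/

theorem norm_momentum_le {a : ℝ} {t : Fin 2 → ℝ} (ht : t ∈ unitCell) :
    ‖momentum a t‖ ≤ ‖k₁ a‖ + ‖k₂ a‖ := by
  have h0 := ht 0
  have h1 := ht 1
  refine (norm_add_le _ _).trans (add_le_add ?_ ?_)
  · rw [norm_smul, Real.norm_of_nonneg h0.1.le]
    exact mul_le_of_le_one_left (norm_nonneg _) h0.2
  · rw [norm_smul, Real.norm_of_nonneg h1.1.le]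
    exact mul_le_of_le_one_left (norm_nonneg _) h1.2

theorem waveSum_shift {a κ : ℝ} (x k : Plane) (r : ℝ) :
    waveSum a κ x k r = bloch (k₁ a) x * cutSum a κ (planeWave a k x) (k + k₁ a) r := by
  have hk : dualVec a (1, 0) = k₁ a := by simp [dualVec]
  have h := cutSum_comp_equiv (κ := κ) (r := r) (χ := planeWave a k x) (k := k) (k' := k + k₁ a)
    (Equiv.addRight ((1, 0) : ℤ × ℤ)) (a := a) (fun m => by
      rw [Equiv.coe_addRight, dualVec_add, hk]; congr 1; abel)
  rw [waveSum, h]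
  unfold cutSum
  rw [← tsum_mul_left]
  congr 1
  funext m
  simp only [Function.comp_apply, Equiv.coe_addRight, planeWave_eq_bloch, dualVec_add, hk,
    bloch_add]
  ring

/-- Summation by parts. Shifting the index by `(1, 0)` multiplies the terms by the phase `b = e^{i
k₁·x}` and moves the resolvent from `k` to `k + k₁`; for `b ≠ 1` the relation can be solved for the
sum, which becomes a difference of the kind controlled above. -/
theorem waveSum_eq_sub {a κ : ℝ} {x : Plane} (hx : bloch (k₁ a) x ≠ 1) (k : Plane) (r : ℝ) :
    waveSum a κ x k r = -bloch (k₁ a) x / (1 - bloch (k₁ a) x) *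
      (cutSum a κ (planeWave a k x) k r - cutSum a κ (planeWave a k x) (k + k₁ a) r) := by
  have h := waveSum_shift (a := a) (κ := κ) x k r
  have h0 : 1 - bloch (k₁ a) x ≠ 0 := sub_ne_zero.mpr (Ne.symm hx)
  change _ = _ * (waveSum a κ x k r - _)
  field_simp
  linear_combination h

theorem tendsto_waveSum_of_ne {a κ : ℝ} (ha : 0 < a) (hκ : 0 < κ) {x : Plane}
    (hx : bloch (k₁ a) x ≠ 1) (k : Plane) :
    ∃ s, Tendsto (waveSum a κ x k) atTop (𝓝 s) := by
  have h := (tendsto_cutSum_sub (χ := planeWave a k x) ha hκ k (k + k₁ a)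
    (fun m => (norm_planeWave _ _ _ _).le)).const_mul (-bloch (k₁ a) x / (1 - bloch (k₁ a) x))
  exact ⟨_, h.congr fun r => (waveSum_eq_sub hx k r).symm⟩

theorem waveSum_bound_of_ne {a κ : ℝ} (ha : 0 < a) (hκ : 0 < κ) {x : Plane}
    (hx : bloch (k₁ a) x ≠ 1) (ρ : ℝ) :
    ∃ C, ∀ᶠ r in atTop, ∀ k, ‖k‖ ≤ ρ → ‖waveSum a κ x k r‖ ≤ C := by
  obtain ⟨C, hC⟩ := exists_cutSum_sub_bound ha hκ (ρ + ‖k₁ a‖)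
  refine ⟨‖-bloch (k₁ a) x / (1 - bloch (k₁ a) x)‖ * C, ?_⟩
  filter_upwards [hC] with r hr k hk
  rw [waveSum_eq_sub hx, norm_mul]
  gcongr
  exact hr k (k + k₁ a) (hk.trans (by simp))
    ((norm_add_le _ _).trans (by linarith)) _ fun m => (norm_planeWave _ _ _ _).le

/-- At `x = 0` the phase is trivial and summation by parts is unavailable. Instead the sum at `k` is
compared with its average over the dual cell; the average is a truncated Green function at the
origin, known in closed form. -/
theorem waveSum_zero_eq {a κ : ℝ} (ha : 0 < a) (hκ : 0 < κ) (k : Plane) (r : ℝ) :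
    ((1 / cellArea a : ℝ) : ℂ) * waveSum a κ 0 k r =
      ((1 / cellArea a : ℝ) : ℂ) * ∫ t, (cutSum a κ (fun _ => 1) k r -
        cutSum a κ (fun _ => 1) (momentum a t) r) ∂cellMeasure + greenCut κ r 0 := by
  have h1 : ∀ k, waveSum a κ 0 k r = cutSum a κ (fun _ => 1) k r := by
    intro k; unfold waveSum; congr 1; funext m; exact planeWave_zero a k m
  have hi := integrable_waveSum ha hκ 0 r
  have hs := integral_waveSum ha hκ 0 r
  simp_rw [h1] at hi hs ⊢
  rw [← hs, integral_sub (integrable_const _) hi]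
  simp; ring

theorem tendsto_waveSum_zero {a κ : ℝ} (ha : 0 < a) (hκ : 0 < κ) (k : Plane) :
    ∃ s, Tendsto (fun r => ((1 / cellArea a : ℝ) : ℂ) * waveSum a κ 0 k r -
      ((Real.log r / (2 * Real.pi) : ℝ) : ℂ)) atTop (𝓝 s) := by
  obtain ⟨C, hC⟩ := exists_cutSum_sub_bound ha hκ (max ‖k‖ (‖k₁ a‖ + ‖k₂ a‖))
  have h1 : Tendsto (fun r => ∫ t, (cutSum a κ (fun _ => 1) k r -
        cutSum a κ (fun _ => 1) (momentum a t) r) ∂cellMeasure) atTop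
      (𝓝 (∫ t, (∑' m, (1 : ℂ) * ((freeResolvent a κ k m -
        freeResolvent a κ (momentum a t) m : ℝ) : ℂ)) ∂cellMeasure)) := by
    refine tendsto_integral_filter_of_dominated_convergence (fun _ => C) ?_ ?_
      (integrable_const _) ?_
    · refine Eventually.of_forall fun r => ?_
      have h1 : ∀ k, waveSum a κ 0 k r = cutSum a κ (fun _ => 1) k r := by
        intro k; unfold waveSum; congr 1; funext m; exact planeWave_zero a k m
      have hi := integrable_waveSum ha hκ 0 r
      simp_rw [h1] at hi
      exact aestronglyMeasurable_const.sub hi.aestronglyMeasurable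
    · filter_upwards [hC] with r hr
      filter_upwards [ae_mem_unitCell] with t ht
      exact hr _ _ (le_max_left _ _) ((norm_momentum_le ht).trans (le_max_right _ _)) _
        fun m => by simp
    · refine Eventually.of_forall fun t => ?_
      exact tendsto_cutSum_sub ha hκ _ _ fun m => by simp
  refine ⟨_, ((h1.const_mul ((1 / cellArea a : ℝ) : ℂ)).add (tendsto_greenCut_zero hκ)).congr ?_⟩
  intro r
  rw [waveSum_zero_eq ha hκ]; ring

theorem waveSum_zero_bound {a κ : ℝ} (ha : 0 < a) (hκ : 0 < κ) (ρ : ℝ) :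
    ∃ C, ∀ᶠ r in atTop, ∀ k, ‖k‖ ≤ ρ → ‖((1 / cellArea a : ℝ) : ℂ) * waveSum a κ 0 k r -
      ((Real.log r / (2 * Real.pi) : ℝ) : ℂ)‖ ≤ C := by
  obtain ⟨C, hC⟩ := exists_cutSum_sub_bound ha hκ (max ρ 0)
  obtain ⟨s, hs⟩ := tendsto_waveSum_zero ha hκ 0
  refine ⟨‖((1 / cellArea a : ℝ) : ℂ)‖ * C + (‖s‖ + 1), ?_⟩
  have h2 := hs.norm.eventually (gt_mem_nhds (lt_add_one ‖s‖))
  filter_upwards [hC, h2] with r hr hr2 k hk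
  have h1 : ∀ k, waveSum a κ 0 k r = cutSum a κ (fun _ => 1) k r := by
    intro k; unfold waveSum; congr 1; funext m; exact planeWave_zero a k m
  have h3 := hr k 0 (hk.trans (le_max_left _ _)) (by simp) (fun _ => 1) fun m => by simp
  rw [← h1, ← h1] at h3
  calc _ = ‖((1 / cellArea a : ℝ) : ℂ) * (waveSum a κ 0 k r - waveSum a κ 0 0 r) +
        (((1 / cellArea a : ℝ) : ℂ) * waveSum a κ 0 0 r -
        ((Real.log r / (2 * Real.pi) : ℝ) : ℂ))‖ := by congr 1; ring
    _ ≤ _ := by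
      refine (norm_add_le _ _).trans (add_le_add ?_ hr2.le)
      rw [norm_mul]; gcongr

end

end HoneycombScatterer

namespace HoneycombScatterer

noncomputable section

/-! ### The Krein matrix of a fiber -/

theorem bloch_k₁_x₀ {a : ℝ} (ha : 0 < a) :
    bloch (k₁ a) (x₀ a) = Complex.exp (((4 * Real.pi / 3 : ℝ) : ℂ) * Complex.I) := by
  have h := inner_momentum_x₀ ha ![1, 0]
  have e : momentum a ![1, 0] = k₁ a := by simp [momentum]
  rw [e] at h
  rw [bloch, h, mul_comm]
  simp

/-- The phase is a primitive cube root of unity, as its real part is `-1/2`. Being trivial on `Λ`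
and not at `x₀`, this character separates the two sublattices. -/
theorem bloch_k₁_x₀_ne {a : ℝ} (ha : 0 < a) : bloch (k₁ a) (x₀ a) ≠ 1 := by
  rw [bloch_k₁_x₀ ha]
  intro h
  have h2 := congrArg Complex.re h
  rw [Complex.exp_ofReal_mul_I_re, Complex.one_re,
    show 4 * Real.pi / 3 = Real.pi / 3 + Real.pi by ring, Real.cos_add_pi, Real.cos_pi_div_three]
    at h2
  norm_num at h2

theorem bloch_neg (k y : Plane) : bloch k (-y) = (bloch k y)⁻¹ := by
  have h := bloch_add_right k y (-y)
  rw [add_neg_cancel, bloch_zero] at h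
  exact eq_inv_of_mul_eq_one_right h.symm

theorem bloch_ne_zero (k y : Plane) : bloch k y ≠ 0 := Complex.exp_ne_zero _

theorem bloch_k₁_ne {a : ℝ} (ha : 0 < a) {j l : Fin 2} (h : j ≠ l) :
    bloch (k₁ a) (cellPoint a j - cellPoint a l) ≠ 1 := by
  fin_cases j <;> fin_cases l <;> simp_all [cellPoint]
  · rw [bloch_neg]
    intro h
    exact bloch_k₁_x₀_ne ha (inv_eq_one.mp h)
  · exact bloch_k₁_x₀_ne ha

/-- The matrix `δ_{jl} c(r)⁻¹ - |Γ|⁻¹ ∑_{|ξ_m + k| ≤ r} e^{i (ξ_m + k)·(y_j - y_l)} / (|ξ_m + k|² + κ²)`. -/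
def kreinCut (a α κ : ℝ) (k : Plane) (j l : Fin 2) (r : ℝ) : ℂ :=
  (if j = l then ((α + (Real.log r - Real.log 2) / (2 * Real.pi) : ℝ) : ℂ) else 0) -
    ((1 / cellArea a : ℝ) : ℂ) * waveSum a κ (cellPoint a j - cellPoint a l) k r

/-- The Krein matrix of the fiber at energy `-κ²`. -/
def kreinMatrix (a α κ : ℝ) (k : Plane) : Matrix (Fin 2) (Fin 2) ℂ :=
  Matrix.of fun j l => limUnder atTop (kreinCut a α κ k j l)

theorem kreinCut_self (a α κ : ℝ) (k : Plane) (j : Fin 2) (r : ℝ) :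
    kreinCut a α κ k j j r = ((α - Real.log 2 / (2 * Real.pi) : ℝ) : ℂ) -
      (((1 / cellArea a : ℝ) : ℂ) * waveSum a κ 0 k r - ((Real.log r / (2 * Real.pi) : ℝ) : ℂ)) := by
  rw [kreinCut, if_pos rfl, sub_self]
  push_cast; ring

/-- Shows that the `limUnder` in `kreinMatrix` is a true limit. On the diagonal the counterterm
absorbs the logarithm; off the diagonal the phase gives convergence without any counterterm. -/
theorem tendsto_kreinCut {a κ : ℝ} (ha : 0 < a) (hκ : 0 < κ) (α : ℝ) (k : Plane) (j l : Fin 2) :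
    Tendsto (kreinCut a α κ k j l) atTop (𝓝 (kreinMatrix a α κ k j l)) := by
  have h : ∃ s, Tendsto (kreinCut a α κ k j l) atTop (𝓝 s) := by
    by_cases h : j = l
    · subst h
      obtain ⟨s, hs⟩ := tendsto_waveSum_zero ha hκ k
      exact ⟨_, (hs.const_sub _).congr fun r => (kreinCut_self a α κ k j r).symm⟩
    · obtain ⟨s, hs⟩ := tendsto_waveSum_of_ne ha hκ (bloch_k₁_ne ha h) k
      refine ⟨_, ((hs.const_mul ((1 / cellArea a : ℝ) : ℂ)).const_sub 0).congr fun r => ?_⟩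
      rw [kreinCut, if_neg h]
  exact tendsto_nhds_limUnder h

theorem kreinCut_bound {a κ : ℝ} (ha : 0 < a) (hκ : 0 < κ) (α : ℝ) (ρ : ℝ) (j l : Fin 2) :
    ∃ C, ∀ᶠ r in atTop, ∀ k, ‖k‖ ≤ ρ → ‖kreinCut a α κ k j l r‖ ≤ C := by
  by_cases h : j = l
  · subst h
    obtain ⟨C, hC⟩ := waveSum_zero_bound ha hκ ρ
    refine ⟨‖((α - Real.log 2 / (2 * Real.pi) : ℝ) : ℂ)‖ + C, ?_⟩
    filter_upwards [hC] with r hr k hk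
    rw [kreinCut_self]
    exact (norm_sub_le _ _).trans (add_le_add le_rfl (hr k hk))
  · obtain ⟨C, hC⟩ := waveSum_bound_of_ne ha hκ (bloch_k₁_ne ha h) ρ
    refine ⟨‖((1 / cellArea a : ℝ) : ℂ)‖ * C, ?_⟩
    filter_upwards [hC] with r hr k hk
    rw [kreinCut, if_neg h, zero_sub, norm_neg, norm_mul]
    gcongr
    exact hr k hk

theorem waveSum_eq_bloch_mul (a κ : ℝ) (x k : Plane) (r : ℝ) :
    waveSum a κ x k r = bloch k x * cutSum a κ (fun m => bloch (dualVec a m) x) k r := by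
  unfold waveSum cutSum
  rw [← tsum_mul_left]
  congr 1; funext m
  rw [planeWave_eq_mul, mul_assoc]

/-- Once the Bloch phase is removed, the dependence on `k` sits in the free resolvent alone, and the
difference is an absolutely convergent sum. Local Lipschitz continuity of the entries follows, up to
the phase. -/
theorem kreinMatrix_sub {a κ : ℝ} (ha : 0 < a) (hκ : 0 < κ) (α : ℝ) (k k' : Plane) (j l : Fin 2) :
    bloch k (-(cellPoint a j - cellPoint a l)) * kreinMatrix a α κ k j l -
      bloch k' (-(cellPoint a j - cellPoint a l)) * kreinMatrix a α κ k' j l =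
    -((1 / cellArea a : ℝ) : ℂ) * ∑' m, bloch (dualVec a m) (cellPoint a j - cellPoint a l) *
      ((freeResolvent a κ k m - freeResolvent a κ k' m : ℝ) : ℂ) := by
  have h1 := ((tendsto_kreinCut ha hκ α k j l).const_mul
    (bloch k (-(cellPoint a j - cellPoint a l)))).sub ((tendsto_kreinCut ha hκ α k' j l).const_mul
    (bloch k' (-(cellPoint a j - cellPoint a l))))
  have h2 := (tendsto_cutSum_sub ha hκ k k'
    (χ := fun m => bloch (dualVec a m) (cellPoint a j - cellPoint a l))
    fun m => (norm_bloch _ _).le).const_mul (-((1 / cellArea a : ℝ) : ℂ))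
  refine tendsto_nhds_unique h1 (h2.congr fun r => ?_)
  simp only [kreinCut, waveSum_eq_bloch_mul, bloch_neg]
  have e1 := bloch_ne_zero k (cellPoint a j - cellPoint a l)
  have e2 := bloch_ne_zero k' (cellPoint a j - cellPoint a l)
  by_cases h : j = l
  · subst h
    simp [bloch_zero]; ring
  · simp only [if_neg h]
    field_simp
    ring

theorem continuous_kreinMatrix {a κ : ℝ} (ha : 0 < a) (hκ : 0 < κ) (α : ℝ) (j l : Fin 2) :
    Continuous fun k => kreinMatrix a α κ k j l := by
  set x := cellPoint a j - cellPoint a l with hx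
  have h1 : Continuous fun k => bloch k (-x) * kreinMatrix a α κ k j l := by
    rw [continuous_iff_continuousAt]
    intro k
    rw [ContinuousAt, tendsto_iff_norm_sub_tendsto_zero]
    set C := 2 * ((1 + (‖k‖ + 1)) / κ + 1) ^ 3 * ∑' m, 1 / (1 + ‖dualVec a m‖) ^ 3
    have h0 : Tendsto (fun k' => ‖-((1 / cellArea a : ℝ) : ℂ)‖ * (C * ‖k' - k‖)) (𝓝 k) (𝓝 0) := by
      have : Continuous fun k' => ‖-((1 / cellArea a : ℝ) : ℂ)‖ * (C * ‖k' - k‖) := by fun_prop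
      simpa using this.tendsto k
    refine squeeze_zero' (Eventually.of_forall fun _ => norm_nonneg _) ?_ h0
    filter_upwards [Metric.ball_mem_nhds k one_pos] with k' hk'
    rw [hx, kreinMatrix_sub ha hκ, norm_mul]
    gcongr
    refine norm_tsum_freeResolvent_sub_le ha hκ (ρ := ‖k‖ + 1) ?_ (by linarith)
      fun m => (norm_bloch _ _).le
    rw [mem_ball_iff_norm] at hk'
    have := norm_le_norm_add_norm_sub' k' k
    linarith
  have h2 := (continuous_bloch x).mul h1
  refine h2.congr fun k => ?_
  change bloch k x * (bloch k (-x) * _) = _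
  rw [bloch_neg, mul_inv_cancel_left₀ (bloch_ne_zero _ _)]

/-! ### Periodicity, symmetry and energy dependence of the Krein matrix. -/

theorem planeWave_add_dualVec (a : ℝ) (k y : Plane) (m n : ℤ × ℤ) :
    planeWave a (k + dualVec a n) y m = planeWave a k y (m + n) := by
  rw [planeWave_eq_bloch, planeWave_eq_bloch, dualVec_add]
  congr 1; abel

theorem waveSum_add_dualVec (a κ : ℝ) (x k : Plane) (n : ℤ × ℤ) (r : ℝ) :
    waveSum a κ x (k + dualVec a n) r = waveSum a κ x k r := by
  have h := cutSum_comp_equiv (κ := κ) (r := r) (χ := planeWave a k x) (k := k)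
    (k' := k + dualVec a n) (Equiv.addRight n) (a := a) (fun m => by
      rw [Equiv.coe_addRight, dualVec_add]; congr 1; abel)
  rw [waveSum, waveSum, h]
  congr 1
  funext m
  exact planeWave_add_dualVec a k x m n

theorem kreinMatrix_add_dualVec (a α κ : ℝ) (k : Plane) (n : ℤ × ℤ) :
    kreinMatrix a α κ (k + dualVec a n) = kreinMatrix a α κ k := by
  ext j l
  simp only [kreinMatrix, Matrix.of_apply]
  congr 1
  funext r
  rw [kreinCut, waveSum_add_dualVec]; rfl

theorem conj_waveSum (a κ : ℝ) (x k : Plane) (r : ℝ) :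
    (starRingEnd ℂ) (waveSum a κ x k r) = waveSum a κ (-x) k r := by
  unfold waveSum cutSum
  rw [Complex.conj_tsum]
  congr 1; funext m
  rw [map_mul, conj_planeWave, Complex.conj_ofReal]

theorem isHermitian_kreinMatrix {a κ : ℝ} (ha : 0 < a) (hκ : 0 < κ) (α : ℝ) (k : Plane) :
    (kreinMatrix a α κ k).IsHermitian := by
  ext j l
  rw [Matrix.conjTranspose_apply]
  refine tendsto_nhds_unique ((Complex.continuous_conj.tendsto _).comp
    (tendsto_kreinCut ha hκ α k l j)) ((tendsto_kreinCut ha hκ α k j l).congr fun r => ?_)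
  simp only [Function.comp_apply, kreinCut, map_sub, map_mul, conj_waveSum, Complex.conj_ofReal,
    neg_sub]
  by_cases h : j = l
  · subst h
    rw [if_pos rfl, Complex.conj_ofReal]
  · simp [h, Ne.symm h]

theorem freeResolvent_sub_eq {a κ κ' : ℝ} (hκ : 0 < κ) (hκ' : 0 < κ') (k : Plane) (m : ℤ × ℤ) :
    freeResolvent a κ k m - freeResolvent a κ' k m =
      (κ' ^ 2 - κ ^ 2) * (freeResolvent a κ k m * freeResolvent a κ' k m) := by
  have h1 : ‖dualVec a m + k‖ ^ 2 + κ ^ 2 ≠ 0 := by positivity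
  have h2 : ‖dualVec a m + k‖ ^ 2 + κ' ^ 2 ≠ 0 := by positivity
  unfold freeResolvent
  field_simp
  ring

theorem summable_freeResolvent_mul {a κ κ' : ℝ} (ha : 0 < a) (hκ : 0 < κ) (hκ' : 0 < κ')
    (k : Plane) : Summable fun m => freeResolvent a κ k m * freeResolvent a κ' k m := by
  refine Summable.of_nonneg_of_le
    (fun m => mul_nonneg (freeResolvent_pos hκ k m).le (freeResolvent_pos hκ' k m).le) (fun m => ?_)
    ((summable_dualVec ha).mul_left
      (((1 + ‖k‖) / κ + 1) ^ 2 * ((1 + ‖k‖) / κ' + 1) ^ 2))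
  have h1 := freeResolvent_le_of_norm_le hκ (le_refl ‖k‖) (a := a) m
  have h2 := freeResolvent_le_of_norm_le hκ' (le_refl ‖k‖) (a := a) m
  have hp : 0 < 1 + ‖dualVec a m‖ := by positivity
  calc _ ≤ (((1 + ‖k‖) / κ + 1) ^ 2 / (1 + ‖dualVec a m‖) ^ 2) *
        (((1 + ‖k‖) / κ' + 1) ^ 2 / (1 + ‖dualVec a m‖) ^ 2) :=
        mul_le_mul h1 h2 (freeResolvent_pos hκ' k m).le (by positivity)
    _ = ((1 + ‖k‖) / κ + 1) ^ 2 * ((1 + ‖k‖) / κ' + 1) ^ 2 * (1 / (1 + ‖dualVec a m‖) ^ 4) := by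
        field_simp
    _ ≤ _ := by
        gcongr
        · linarith [norm_nonneg (dualVec a m)]
        · norm_num

theorem summable_mul_freeResolvent_mul {a κ κ' : ℝ} (ha : 0 < a) (hκ : 0 < κ) (hκ' : 0 < κ')
    (k : Plane) {χ : ℤ × ℤ → ℂ} (hχ : ∀ m, ‖χ m‖ ≤ 1) :
    Summable fun m => χ m * ((freeResolvent a κ k m * freeResolvent a κ' k m : ℝ) : ℂ) := by
  refine Summable.of_norm_bounded (summable_freeResolvent_mul ha hκ hκ' k) fun m => ?_
  exact norm_mul_ofReal_le (hχ m) (abs_of_nonneg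
    (mul_nonneg (freeResolvent_pos hκ k m).le (freeResolvent_pos hκ' k m).le)).le

/-- Partial sums over `|ξ_m + k| ≤ r` converge to the sum. -/
theorem tendsto_tsum_norm_le (a : ℝ) (k : Plane) {f : ℤ × ℤ → ℂ} (hf : Summable f) :
    Tendsto (fun r : ℝ => ∑' m, if ‖dualVec a m + k‖ ≤ r then f m else 0) atTop
      (𝓝 (∑' m, f m)) := by
  refine tendsto_tsum_of_dominated_convergence hf.norm (fun m => ?_)
    (Eventually.of_forall fun r m => ?_)
  · refine tendsto_const_nhds.congr' ?_
    filter_upwards [eventually_ge_atTop ‖dualVec a m + k‖] with r hr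
    rw [if_pos hr]
  · split_ifs
    · exact le_rfl
    · simp

/-- Between two energies the counterterms cancel, and the resolvent identity turns the rest into a
sum of products of two resolvents, which decays like `|ξ|⁻⁴`. -/
theorem kreinMatrix_sub_kappa {a κ κ' : ℝ} (ha : 0 < a) (hκ : 0 < κ) (hκ' : 0 < κ') (α : ℝ)
    (k : Plane) (j l : Fin 2) :
    kreinMatrix a α κ k j l - kreinMatrix a α κ' k j l =
      ((1 / cellArea a * (κ ^ 2 - κ' ^ 2) : ℝ) : ℂ) *
        ∑' m, planeWave a k (cellPoint a j - cellPoint a l) m *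
          ((freeResolvent a κ k m * freeResolvent a κ' k m : ℝ) : ℂ) := by
  have h1 := (tendsto_kreinCut ha hκ α k j l).sub (tendsto_kreinCut ha hκ' α k j l)
  have h2 := (tendsto_tsum_norm_le a k (summable_mul_freeResolvent_mul ha hκ hκ' k
    (χ := planeWave a k (cellPoint a j - cellPoint a l))
    fun m => (norm_planeWave _ _ _ _).le)).const_mul ((1 / cellArea a * (κ ^ 2 - κ' ^ 2) : ℝ) : ℂ)
  refine tendsto_nhds_unique h1 (h2.congr fun r => ?_)
  have h3 : waveSum a κ (cellPoint a j - cellPoint a l) k r -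
      waveSum a κ' (cellPoint a j - cellPoint a l) k r = ((κ' ^ 2 - κ ^ 2 : ℝ) : ℂ) *
      ∑' m, if ‖dualVec a m + k‖ ≤ r then planeWave a k (cellPoint a j - cellPoint a l) m *
          ((freeResolvent a κ k m * freeResolvent a κ' k m : ℝ) : ℂ) else 0 := by
    unfold waveSum cutSum
    rw [← Summable.tsum_sub (summable_mul_cutResolvent ha κ r k _)
      (summable_mul_cutResolvent ha κ' r k _), ← tsum_mul_left]
    congr 1; funext m
    rw [← mul_sub, ← Complex.ofReal_sub]
    unfold cutResolvent
    split_ifs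
    · rw [freeResolvent_sub_eq hκ hκ']; push_cast; ring
    · simp
  have h4 : kreinCut a α κ k j l r - kreinCut a α κ' k j l r = -((1 / cellArea a : ℝ) : ℂ) *
      (waveSum a κ (cellPoint a j - cellPoint a l) k r -
      waveSum a κ' (cellPoint a j - cellPoint a l) k r) := by
    simp only [kreinCut]; ring
  rw [h4, h3]
  push_cast; ring

/-! ### Fourier coefficients of the Krein matrix -/

theorem continuous_kreinMatrix_momentum {a κ : ℝ} (ha : 0 < a) (hκ : 0 < κ) (α : ℝ) (j l : Fin 2) :
    Continuous fun t => kreinMatrix a α κ (momentum a t) j l :=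
  (continuous_kreinMatrix ha hκ α j l).comp (continuous_momentum a)

theorem integral_cellChar (n : ℤ × ℤ) : ∫ t, cellChar n t ∂cellMeasure = if n = 0 then 1 else 0 := by
  have h := cellBasis_repr (cellBasis 0) (-n)
  rw [neg_neg, HilbertBasis.repr_self] at h
  have e : ∫ t, cellChar n t * (cellBasis 0 : CellL2) t ∂cellMeasure
      = ∫ t, cellChar n t ∂cellMeasure := by
    refine integral_congr_ae ?_
    filter_upwards [coeFn_cellBasis 0] with t ht
    rw [ht, cellChar_zero, mul_one]
  rw [e] at h
  rw [← h, lp.single_apply]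
  by_cases hn : n = 0
  · subst hn; simp
  · rw [if_neg hn, Pi.single_apply, if_neg (by simpa using hn)]

/-- The character is absorbed by translating the displacement by a lattice vector, after which the
cell integral unfolds. The constant counterterm survives only in the zeroth coefficient. -/
theorem integral_kreinCut {a κ : ℝ} (ha : 0 < a) (hκ : 0 < κ) (α : ℝ) (j l : Fin 2) (n : ℤ × ℤ)
    (r : ℝ) :
    ∫ t, cellChar n t * kreinCut a α κ (momentum a t) j l r ∂cellMeasure =
      (if n = 0 ∧ j = l then ((α + (Real.log r - Real.log 2) / (2 * Real.pi) : ℝ) : ℂ) else 0) -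
      greenCut κ r (latticeVec a n + (cellPoint a j - cellPoint a l)) := by
  have e : ∀ t, cellChar n t * kreinCut a α κ (momentum a t) j l r =
      cellChar n t * (if j = l then ((α + (Real.log r - Real.log 2) / (2 * Real.pi) : ℝ) : ℂ) else 0)
      - ((1 / cellArea a : ℝ) : ℂ) *
        waveSum a κ (latticeVec a n + (cellPoint a j - cellPoint a l)) (momentum a t) r := by
    intro t
    have h : waveSum a κ (latticeVec a n + (cellPoint a j - cellPoint a l)) (momentum a t) r =
        cellChar n t * waveSum a κ (cellPoint a j - cellPoint a l) (momentum a t) r := by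
      unfold waveSum cutSum
      rw [← tsum_mul_left]
      congr 1; funext m
      rw [planeWave_add_latticeVec ha]; ring
    rw [h, kreinCut]; ring
  simp_rw [e]
  have hc : Integrable (cellChar n) cellMeasure :=
    Integrable.of_bound (C := 1) (continuous_cellChar n).aestronglyMeasurable
      (Eventually.of_forall fun t => (norm_cellChar n t).le)
  rw [integral_sub (hc.mul_const _) ((integrable_waveSum ha hκ _ r).const_mul _),
    integral_mul_const, integral_const_mul, integral_waveSum ha hκ, integral_cellChar]
  by_cases hn : n = 0 <;> by_cases hj : j = l <;> simp [hn, hj]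

theorem measurable_kreinCut {a κ : ℝ} (ha : 0 < a) (hκ : 0 < κ) (α : ℝ) (j l : Fin 2) (r : ℝ) :
    AEStronglyMeasurable (fun t => kreinCut a α κ (momentum a t) j l r) cellMeasure := by
  unfold kreinCut
  exact aestronglyMeasurable_const.sub
    ((integrable_waveSum ha hκ _ r).aestronglyMeasurable.const_mul _)

theorem tendsto_integral_kreinCut {a κ : ℝ} (ha : 0 < a) (hκ : 0 < κ) (α : ℝ) (j l : Fin 2)
    (n : ℤ × ℤ) :
    Tendsto (fun r => ∫ t, cellChar n t * kreinCut a α κ (momentum a t) j l r ∂cellMeasure) atTop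
      (𝓝 (∫ t, cellChar n t * kreinMatrix a α κ (momentum a t) j l ∂cellMeasure)) := by
  obtain ⟨C, hC⟩ := kreinCut_bound ha hκ α (‖k₁ a‖ + ‖k₂ a‖) j l
  refine tendsto_integral_filter_of_dominated_convergence (fun _ => C) ?_ ?_
    (integrable_const _) ?_
  · exact Eventually.of_forall fun r =>
      (continuous_cellChar n).aestronglyMeasurable.mul (measurable_kreinCut ha hκ α j l r)
  · filter_upwards [hC] with r hr
    filter_upwards [ae_mem_unitCell] with t ht
    rw [norm_mul, norm_cellChar, one_mul]
    exact hr _ (norm_momentum_le ht)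
  · exact Eventually.of_forall fun t => (tendsto_kreinCut ha hκ α _ j l).const_mul _

/-- The diagonal Fourier coefficient is the diagonal entry of the scattering matrix. -/
theorem integral_kreinMatrix_self {a κ : ℝ} (ha : 0 < a) (hκ : 0 < κ) (α : ℝ) (j : Fin 2) :
    ∫ t, kreinMatrix a α κ (momentum a t) j j ∂cellMeasure =
      ((α + 1 / (2 * Real.pi) * Real.log (κ / 2) : ℝ) : ℂ) := by
  have h := tendsto_integral_kreinCut ha hκ α j j 0
  simp_rw [integral_kreinCut ha hκ, cellChar_zero, one_mul] at h
  refine tendsto_nhds_unique h (((tendsto_greenCut_zero hκ).const_sub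
    ((α - Real.log 2 / (2 * Real.pi) : ℝ) : ℂ)).congr' ?_ |>.trans_eq ?_)
  · refine Eventually.of_forall fun r => ?_
    simp only [and_self, if_true, latticeVec_zero, sub_self, add_zero]
    push_cast; ring
  · congr 1
    rw [Real.log_div hκ.ne' two_ne_zero]
    push_cast; ring

/-- Off the diagonal the momentum integral of the Green function converges. -/
theorem tendsto_greenCut_neg_integral {a κ : ℝ} (ha : 0 < a) (hκ : 0 < κ) (α : ℝ) {j l : Fin 2}
    {n : ℤ × ℤ} (h : ¬(n = 0 ∧ j = l)) :
    Tendsto (fun r => greenCut κ r (latticeVec a n + (cellPoint a j - cellPoint a l))) atTop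
      (𝓝 (-∫ t, cellChar n t * kreinMatrix a α κ (momentum a t) j l ∂cellMeasure)) := by
  have h1 := tendsto_integral_kreinCut ha hκ α j l n
  simp_rw [integral_kreinCut ha hκ, if_neg h, zero_sub] at h1
  simpa using h1.neg

end

end HoneycombScatterer

namespace HoneycombScatterer

noncomputable section

/-! ### The Fourier transform on `L²` and on `L¹` -/

section FourierPairing

open FourierTransform SchwartzMap ContDiff

/-- The transform on `L²` has no integral formula; it is reached through its pairing with Schwartz
functions, against which the integral transform of an `L¹` function can be compared. -/
theorem integral_schwartz_mul_fourierInv (u : PlaneL2) (φ : 𝓢(Plane, ℂ)) :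
    ∫ x, φ x * (𝓕⁻ u : PlaneL2) x = ∫ x, (𝓕⁻ φ) x * u x := by
  have h := congrArg (fun T : 𝓢'(Plane, ℂ) => T φ) (Lp.fourierInv_toTemperedDistribution_eq u)
  simpa using h.symm

theorem integral_fourier_mul_integrable {g f : Plane → ℂ} (hg : Integrable g) (hf : Integrable f) :
    ∫ x, 𝓕 f x * g x = ∫ x, f x * 𝓕 g x := by
  simpa using! VectorFourier.integral_bilin_fourierIntegral_eq_flip (ContinuousLinearMap.mul ℂ ℂ)
    (L := innerₗ Plane) Real.continuous_fourierChar continuous_inner hf hg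

theorem integral_fourierInv_mul_integrable {g f : Plane → ℂ} (hg : Integrable g)
    (hf : Integrable f) : ∫ x, 𝓕⁻ f x * g x = ∫ x, f x * 𝓕⁻ g x := by
  rw [Real.fourierInv_eq_fourier_comp_neg g, ← integral_fourier_mul_integrable hg.comp_neg hf,
    ← integral_neg_eq_self]
  simp_rw [Real.fourierInv_eq_fourier_neg, neg_neg]

theorem ae_eq_of_integral_schwartz {f g : Plane → ℂ} (hf : LocallyIntegrable f)
    (hg : LocallyIntegrable g) (h : ∀ φ : 𝓢(Plane, ℂ), ∫ x, φ x * f x = ∫ x, φ x * g x) :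
    f =ᵐ[volume] g := by
  refine ae_eq_of_integral_contDiff_smul_eq hf hg fun ψ hψ hψc => ?_
  have hg₁ : HasCompactSupport (Complex.ofRealCLM ∘ ψ) := hψc.comp_left rfl
  have hg₂ : ContDiff ℝ ∞ (Complex.ofRealCLM ∘ ψ) := by fun_prop
  simpa using h (hg₁.toSchwartzMap hg₂)

/-- An integrable function whose Fourier integral is in `L²` is the inverse transform of it. -/
theorem ae_eq_fourierInv_of_fourier_ae_eq {g : Plane → ℂ} (hg : Integrable g) {h : PlaneL2}
    (hgh : 𝓕 g =ᵐ[volume] h) : g =ᵐ[volume] (𝓕⁻ h : PlaneL2) := by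
  refine ae_eq_of_integral_schwartz hg.locallyIntegrable
    ((Lp.memLp _).locallyIntegrable (by norm_num)) fun φ => ?_
  rw [integral_schwartz_mul_fourierInv]
  have e : ∫ x, (𝓕⁻ φ : 𝓢(Plane, ℂ)) x * h x = ∫ x, (𝓕⁻ φ : 𝓢(Plane, ℂ)) x * 𝓕 g x := by
    refine integral_congr_ae ?_
    filter_upwards [hgh] with x hx
    rw [hx]
  rw [e, ← integral_fourier_mul_integrable hg (𝓕⁻ φ : 𝓢(Plane, ℂ)).integrable]
  congr 1
  have : 𝓕 ((𝓕⁻ φ : 𝓢(Plane, ℂ)) : Plane → ℂ) = φ := by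
    rw [← SchwartzMap.fourier_coe, fourier_fourierInv_eq]
  rw [this]

theorem fourierInv_ae_eq {g : Plane → ℂ} (hg : Integrable g) {u : PlaneL2}
    (hgu : g =ᵐ[volume] u) : 𝓕⁻ g =ᵐ[volume] (𝓕⁻ u : PlaneL2) := by
  have hc : Continuous (𝓕⁻ g) := VectorFourier.fourierIntegral_continuous
    Real.continuous_fourierChar (continuous_inner (𝕜 := ℝ) (E := Plane)).neg hg
  refine ae_eq_of_integral_schwartz hc.locallyIntegrable
    ((Lp.memLp _).locallyIntegrable (by norm_num)) fun φ => ?_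
  rw [integral_schwartz_mul_fourierInv, ← integral_fourierInv_mul_integrable hg φ.integrable]
  refine integral_congr_ae ?_
  filter_upwards [hgu] with x hx
  rw [hx, SchwartzMap.fourierInv_coe]

theorem fourier_apply_eq (f : Plane → ℂ) (ν : Plane) :
    𝓕 f ν = ∫ x, bloch ((2 * Real.pi) • ν) (-x) * f x := by
  rw [Real.fourier_eq']
  congr 1; funext x
  rw [smul_eq_mul, bloch, inner_neg_right, inner_smul_left, real_inner_comm]
  congr 2
  simp; ring

theorem fourierInv_apply_eq (f : Plane → ℂ) (x : Plane) :
    𝓕⁻ f x = ∫ ν, bloch ((2 * Real.pi) • ν) x * f ν := by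
  rw [Real.fourierInv_eq']
  congr 1; funext ν
  rw [smul_eq_mul, bloch, inner_smul_left]
  congr 2
  simp; ring

end FourierPairing

/-! ### The free Green function -/

/-- The integrand of the Green function. -/
def heat (κ t : ℝ) (x : Plane) : ℝ :=
  Real.exp (-(κ ^ 2 * t) - ‖x‖ ^ 2 / (4 * t)) / (4 * Real.pi * t)

theorem green_eq (κ : ℝ) (x : Plane) : green κ x = ∫ t in Set.Ioi (0 : ℝ), heat κ t x := rfl

theorem heat_nonneg {t : ℝ} (ht : 0 < t) (κ : ℝ) (x : Plane) : 0 ≤ heat κ t x := by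
  have := Real.pi_pos
  unfold heat; positivity

theorem measurable_heat (κ : ℝ) : Measurable fun p : ℝ × Plane => heat κ p.1 p.2 := by
  unfold heat; fun_prop

theorem green_neg (κ : ℝ) (x : Plane) : green κ (-x) = green κ x := by simp [green]

theorem heat_eq_gaussian (t κ : ℝ) (x : Plane) :
    heat κ t x = Real.exp (-(κ ^ 2 * t)) / (4 * Real.pi * t) *
      Real.exp (-(1 / (4 * t)) * ‖x‖ ^ 2) := by
  rw [heat, sub_eq_add_neg, Real.exp_add]
  have : -(‖x‖ ^ 2 / (4 * t)) = -(1 / (4 * t)) * ‖x‖ ^ 2 := by ring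
  rw [this]; ring

theorem integral_heat {t : ℝ} (ht : 0 < t) (κ : ℝ) :
    ∫ x, heat κ t x = Real.exp (-(κ ^ 2 * t)) := by
  have hpi := Real.pi_pos
  simp_rw [heat_eq_gaussian]
  rw [integral_const_mul, GaussianFourier.integral_rexp_neg_mul_sq_norm (by positivity),
    finrank_euclideanSpace_fin]
  norm_num
  field_simp

theorem integrable_heat {t : ℝ} (ht : 0 < t) (κ : ℝ) : Integrable (heat κ t) := by
  by_contra h
  have h1 := integral_undef h
  rw [integral_heat ht] at h1
  exact (Real.exp_pos _).ne' h1

theorem integrable_exp_neg_sq {κ : ℝ} (hκ : 0 < κ) :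
    IntegrableOn (fun t => Real.exp (-(κ ^ 2 * t))) (Set.Ioi 0) := by
  simpa using exp_neg_integrableOn_Ioi 0 (pow_pos hκ 2)

theorem integrable_heat_prod {κ : ℝ} (hκ : 0 < κ) :
    Integrable (fun p : ℝ × Plane => heat κ p.1 p.2)
      ((volume.restrict (Set.Ioi 0)).prod volume) := by
  rw [integrable_prod_iff (measurable_heat κ).aestronglyMeasurable]
  constructor
  · filter_upwards [ae_restrict_mem measurableSet_Ioi] with t ht
    exact integrable_heat ht κ
  · refine (integrable_exp_neg_sq hκ).congr ?_
    filter_upwards [ae_restrict_mem measurableSet_Ioi] with t ht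
    rw [← integral_heat ht κ]
    congr 1; funext x
    rw [Real.norm_of_nonneg (heat_nonneg ht κ x)]

theorem integrable_green {κ : ℝ} (hκ : 0 < κ) : Integrable (green κ) :=
  (integrable_heat_prod hκ).integral_prod_right

theorem fourier_heat {t : ℝ} (ht : 0 < t) (κ : ℝ) (ν : Plane) :
    ∫ x, bloch ((2 * Real.pi) • ν) (-x) * (heat κ t x : ℂ) =
      ((Real.exp (-(κ ^ 2 + ‖(2 * Real.pi) • ν‖ ^ 2) * t) : ℝ) : ℂ) := by
  have hpi := Real.pi_pos
  have h := fourier_gaussian_innerProductSpace (V := Plane) (b := ((1 / (4 * t) : ℝ) : ℂ))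
    (by rw [Complex.ofReal_re]; positivity) ν
  rw [fourier_apply_eq] at h
  have e : ∀ x : Plane, bloch ((2 * Real.pi) • ν) (-x) * (heat κ t x : ℂ) =
      ((Real.exp (-(κ ^ 2 * t)) / (4 * Real.pi * t) : ℝ) : ℂ) * (bloch ((2 * Real.pi) • ν) (-x) *
      Complex.exp (-((1 / (4 * t) : ℝ) : ℂ) * (‖x‖ : ℂ) ^ 2)) := by
    intro x
    rw [heat_eq_gaussian]
    push_cast; ring
  simp_rw [e]
  rw [integral_const_mul, h, finrank_euclideanSpace_fin]
  have h2 : ((2 : ℕ) : ℂ) / 2 = 1 := by norm_num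
  rw [h2, Complex.cpow_one]
  have ht0 : (t : ℂ) ≠ 0 := by exact_mod_cast ht.ne'
  have hpi0 : (Real.pi : ℂ) ≠ 0 := by exact_mod_cast hpi.ne'
  have e1 : -(Real.pi : ℂ) ^ 2 * (‖ν‖ : ℂ) ^ 2 / ((1 / (4 * t) : ℝ) : ℂ) =
      ((-(‖(2 * Real.pi) • ν‖ ^ 2 * t) : ℝ) : ℂ) := by
    rw [norm_smul, Real.norm_of_nonneg (by positivity)]
    push_cast; field_simp; ring
  rw [e1, ← Complex.ofReal_exp, show -(κ ^ 2 + ‖(2 * Real.pi) • ν‖ ^ 2) * t =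
    -(κ ^ 2 * t) + -(‖(2 * Real.pi) • ν‖ ^ 2 * t) by ring, Real.exp_add]
  push_cast
  field_simp

theorem integral_exp_neg_Ioi {c : ℝ} (hc : 0 < c) (ε : ℝ) :
    ∫ t in Set.Ioi ε, Real.exp (-c * t) = Real.exp (-c * ε) / c := by
  rw [integral_exp_mul_Ioi (by linarith)]
  field_simp

open FourierTransform in
-- Fubini applied to the heat-kernel representation: the Gaussians transform into exponentials in
-- time, and integrating over time gives the resolvent symbol.
theorem fourier_green {κ : ℝ} (hκ : 0 < κ) (ν : Plane) :
    𝓕 (fun x => (green κ x : ℂ)) ν =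
      ((1 / (‖(2 * Real.pi) • ν‖ ^ 2 + κ ^ 2) : ℝ) : ℂ) := by
  rw [fourier_apply_eq]
  have e : ∀ x, bloch ((2 * Real.pi) • ν) (-x) * (green κ x : ℂ) =
      ∫ t in Set.Ioi (0 : ℝ), bloch ((2 * Real.pi) • ν) (-x) * (heat κ t x : ℂ) := by
    intro x
    rw [integral_const_mul, green_eq, integral_complex_ofReal]
  simp_rw [e]
  rw [integral_integral_swap]
  · have e2 : ∫ t in Set.Ioi (0 : ℝ), ∫ x, bloch ((2 * Real.pi) • ν) (-x) * (heat κ t x : ℂ) =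
        ∫ t in Set.Ioi (0 : ℝ),
          ((Real.exp (-(κ ^ 2 + ‖(2 * Real.pi) • ν‖ ^ 2) * t) : ℝ) : ℂ) :=
      setIntegral_congr_fun measurableSet_Ioi fun t ht => fourier_heat ht κ ν
    rw [e2, integral_complex_ofReal, integral_exp_neg_Ioi (by positivity)]
    simp [add_comm]
  · have h := (integrable_heat_prod hκ).swap.ofReal (𝕜 := ℂ)
    refine h.bdd_mul (c := 1) ?_ (Eventually.of_forall fun p => (norm_bloch _ _).le)
    have : Continuous fun p : Plane × ℝ => bloch ((2 * Real.pi) • ν) (-p.1) := by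
      unfold bloch; fun_prop
    exact this.aestronglyMeasurable

/-- With `s = |x|²/(4t)` the bound `e^{-s} ≤ 2/s²` trades the Gaussian for `t²/|x|⁴`. This removes
the `1/t` singularity and gives the Green function a decay that is summable over a planar lattice.
-/
theorem heat_le {κ t : ℝ} (ht : 0 < t) {x : Plane} (hx : x ≠ 0) :
    heat κ t x ≤ 8 / (Real.pi * ‖x‖ ^ 4) * (t * Real.exp (-(κ ^ 2 * t))) := by
  have hpi := Real.pi_pos
  have hx' : 0 < ‖x‖ := norm_pos_iff.mpr hx
  rw [heat, sub_eq_add_neg, Real.exp_add]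
  set s := ‖x‖ ^ 2 / (4 * t) with hs
  have hs0 : 0 < s := by positivity
  have h1 : s ^ 2 / 2 ≤ Real.exp s := by
    have := Real.quadratic_le_exp_of_nonneg hs0.le
    linarith
  have h2 : Real.exp (-s) ≤ 2 / s ^ 2 := by
    rw [Real.exp_neg, inv_le_comm₀ (Real.exp_pos _) (by positivity), inv_div]
    exact h1
  calc _ ≤ Real.exp (-(κ ^ 2 * t)) * (2 / s ^ 2) / (4 * Real.pi * t) := by gcongr
    _ = _ := by rw [hs]; field_simp; ring

theorem integrable_mul_exp {κ : ℝ} (hκ : 0 < κ) :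
    IntegrableOn (fun t => t * Real.exp (-(κ ^ 2 * t))) (Set.Ioi 0) := by
  have h := integrableOn_rpow_mul_exp_neg_mul_rpow (p := 1) (s := 1) (b := κ ^ 2) (by norm_num)
    one_pos (by positivity)
  simpa using h

theorem integrableOn_heat {κ : ℝ} (hκ : 0 < κ) {x : Plane} (hx : x ≠ 0) :
    IntegrableOn (fun t => heat κ t x) (Set.Ioi 0) := by
  refine ((integrable_mul_exp hκ).const_mul (8 / (Real.pi * ‖x‖ ^ 4))).mono'
    ((measurable_heat κ).comp (measurable_id.prodMk measurable_const)).aestronglyMeasurable ?_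
  filter_upwards [ae_restrict_mem measurableSet_Ioi] with t ht
  rw [Real.norm_of_nonneg (heat_nonneg ht κ x)]
  exact heat_le ht hx

theorem green_nonneg (κ : ℝ) (x : Plane) : 0 ≤ green κ x :=
  setIntegral_nonneg measurableSet_Ioi fun _ ht => heat_nonneg ht κ x

theorem exists_green_le {κ : ℝ} (hκ : 0 < κ) : ∃ C, ∀ x ≠ 0, green κ x ≤ C / ‖x‖ ^ 4 := by
  refine ⟨8 / Real.pi * ∫ t in Set.Ioi (0 : ℝ), t * Real.exp (-(κ ^ 2 * t)), fun x hx => ?_⟩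
  rw [green_eq]
  calc _ ≤ ∫ t in Set.Ioi (0 : ℝ), 8 / (Real.pi * ‖x‖ ^ 4) * (t * Real.exp (-(κ ^ 2 * t))) :=
        setIntegral_mono_on (integrableOn_heat hκ hx) ((integrable_mul_exp hκ).const_mul _)
          measurableSet_Ioi fun t ht => heat_le ht hx
    _ = _ := by
        rw [integral_const_mul]
        have := norm_pos_iff.mpr hx
        rw [← div_div]; ring

end

end HoneycombScatterer

namespace HoneycombScatterer

noncomputable section

/-! ### The Green function as a momentum integral -/

/-- The integrand of the momentum integral of the Green function. -/
def greenSymbol (κ : ℝ) (x ν : Plane) : ℂ :=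
  bloch ((2 * Real.pi) • ν) x * ((1 / (‖(2 * Real.pi) • ν‖ ^ 2 + κ ^ 2) : ℝ) : ℂ)

theorem continuous_bloch_smul (x : Plane) : Continuous fun ν => bloch ((2 * Real.pi) • ν) x :=
  (continuous_bloch x).comp (continuous_const_smul _)

theorem continuous_resolventSymbol {κ : ℝ} (hκ : 0 < κ) :
    Continuous fun ν : Plane => 1 / (‖(2 * Real.pi) • ν‖ ^ 2 + κ ^ 2) :=
  continuous_const.div (by fun_prop) fun ν => by positivity

theorem continuous_greenSymbol {κ : ℝ} (hκ : 0 < κ) (x : Plane) :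
    Continuous (greenSymbol κ x) :=
  (continuous_bloch_smul x).mul
    (Complex.continuous_ofReal.comp (continuous_resolventSymbol hκ))

theorem greenCut_eq (κ r : ℝ) (x : Plane) :
    greenCut κ r x = ∫ ν, if ‖(2 * Real.pi) • ν‖ ≤ r then greenSymbol κ x ν else 0 := rfl

theorem norm_greenSymbol (κ : ℝ) (x ν : Plane) :
    ‖greenSymbol κ x ν‖ = 1 / (‖(2 * Real.pi) • ν‖ ^ 2 + κ ^ 2) := by
  rw [greenSymbol, norm_mul, norm_bloch, one_mul, Complex.norm_real,
    Real.norm_of_nonneg (by positivity)]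

theorem norm_greenCut_le {κ : ℝ} (hκ : 0 < κ) (x : Plane) {r r' : ℝ} (h : r ≤ r') :
    ‖greenCut κ r x‖ ≤ ∫ ν : Plane, ‖if ‖(2 * Real.pi) • ν‖ ≤ r' then greenSymbol κ x ν else 0‖ := by
  rw [greenCut_eq]
  refine (norm_integral_le_integral_norm _).trans
    (integral_mono (integrable_greenCut hκ r x).norm (integrable_greenCut hκ r' x).norm
      fun ν => ?_)
  dsimp only
  by_cases h1 : ‖(2 * Real.pi) • ν‖ ≤ r
  · rw [if_pos h1, if_pos (h1.trans h)]
  · rw [if_neg h1, norm_zero]; exact norm_nonneg _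

/-- Convergence bounds the large truncations; the smaller ones are dominated by the absolute
integral over a fixed disk. -/
theorem exists_norm_greenCut_le {κ : ℝ} (hκ : 0 < κ) {x : Plane} {L : ℂ}
    (hL : Tendsto (fun r => greenCut κ r x) atTop (𝓝 L)) : ∃ M, ∀ r, ‖greenCut κ r x‖ ≤ M := by
  obtain ⟨r₀, h⟩ := (hL.norm.eventually (gt_mem_nhds (lt_add_one ‖L‖))).exists_forall_of_atTop
  refine ⟨max (‖L‖ + 1)
    (∫ ν : Plane, ‖if ‖(2 * Real.pi) • ν‖ ≤ r₀ then greenSymbol κ x ν else 0‖), fun r => ?_⟩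
  rcases le_total r₀ r with hr | hr
  · exact (h r hr).le.trans (le_max_left _ _)
  · exact (norm_greenCut_le hκ x hr).trans (le_max_right _ _)

theorem measurable_greenCut_integrand {κ : ℝ} (hκ : 0 < κ) (x : Plane) (R : ℝ) :
    Measurable fun p : ℝ × Plane =>
      if ‖(2 * Real.pi) • p.2‖ ≤ R * p.1 then greenSymbol κ x p.2 else 0 :=
  Measurable.ite (measurableSet_le (by fun_prop) (by fun_prop))
    ((continuous_greenSymbol hκ x).measurable.comp measurable_snd) measurable_const

theorem aestronglyMeasurable_greenCut {κ : ℝ} (hκ : 0 < κ) (x : Plane) (R : ℝ) (μ : Measure ℝ) :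
    AEStronglyMeasurable (fun s => greenCut κ (R * s) x) μ :=
  ((measurable_greenCut_integrand hκ x R).stronglyMeasurable.integral_prod_right
    (ν := (volume : Measure Plane))).aestronglyMeasurable

/-- The Abel weight `2 s e^{-s²}`. -/
theorem integrable_abelWeight : IntegrableOn (fun s : ℝ => 2 * s * Real.exp (-s ^ 2))
    (Set.Ioi 0) := by
  have h := (integrable_mul_exp_neg_mul_sq (b := 1) one_pos).const_mul 2
  refine (h.congr (Eventually.of_forall fun s => ?_)).integrableOn
  simp [mul_assoc]

theorem integral_abelWeight {c : ℝ} (hc : 0 ≤ c) :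
    ∫ s in Set.Ioi c, 2 * s * Real.exp (-s ^ 2) = Real.exp (-c ^ 2) := by
  have h := integral_Ioi_of_hasDerivAt_of_tendsto (f := fun s => -Real.exp (-s ^ 2))
    (f' := fun s => 2 * s * Real.exp (-s ^ 2)) (a := c) (m := 0) ?_ ?_ ?_ ?_
  · rw [h]; ring
  · exact Continuous.continuousWithinAt (by fun_prop)
  · intro s _
    have h1 : HasDerivAt (fun s : ℝ => -s ^ 2) (-(2 * s)) s :=
      (hasDerivAt_pow 2 s).neg.congr_deriv (by simp)
    exact h1.exp.neg.congr_deriv (by ring)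
  · exact integrable_abelWeight.mono_set (Set.Ioi_subset_Ioi hc)
  · rw [← neg_zero]
    refine (Real.tendsto_exp_atBot.comp ?_).neg
    exact tendsto_neg_atTop_atBot.comp (tendsto_pow_atTop two_ne_zero)

/-- An Abelian theorem: averaging truncations at scale `R` with a probability density on `(0, ∞)`
does not change the limit. The density is chosen so that the average can be computed. -/
theorem tendsto_abel {κ : ℝ} (hκ : 0 < κ) {x : Plane} {L : ℂ}
    (hL : Tendsto (fun r => greenCut κ r x) atTop (𝓝 L)) :
    Tendsto (fun R => ∫ s in Set.Ioi (0 : ℝ), ((2 * s * Real.exp (-s ^ 2) : ℝ) : ℂ) *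
      greenCut κ (R * s) x) atTop (𝓝 L) := by
  obtain ⟨M, hM⟩ := exists_norm_greenCut_le hκ hL
  have h1 : ∫ s in Set.Ioi (0 : ℝ), ((2 * s * Real.exp (-s ^ 2) : ℝ) : ℂ) * L = L := by
    rw [integral_mul_const, integral_complex_ofReal, integral_abelWeight le_rfl]; simp
  rw [← h1]
  refine tendsto_integral_filter_of_dominated_convergence
    (fun s => 2 * s * Real.exp (-s ^ 2) * M) ?_ ?_ (integrable_abelWeight.mul_const M) ?_
  · refine Eventually.of_forall fun R => AEStronglyMeasurable.mul ?_
      (aestronglyMeasurable_greenCut hκ x R _)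
    exact Continuous.aestronglyMeasurable (by fun_prop)
  · refine Eventually.of_forall fun R => ?_
    filter_upwards [ae_restrict_mem measurableSet_Ioi] with s hs
    have hs' : 0 < s := hs
    rw [norm_mul, Complex.norm_real, Real.norm_of_nonneg (by positivity)]
    gcongr
    exact hM _
  · filter_upwards [ae_restrict_mem measurableSet_Ioi] with s hs
    exact (hL.comp (tendsto_id.atTop_mul_const hs)).const_mul _

theorem integral_bloch_gaussian {b : ℝ} (hb : 0 < b) (x : Plane) :
    ∫ ν, bloch ((2 * Real.pi) • ν) x * ((Real.exp (-b * ‖(2 * Real.pi) • ν‖ ^ 2) : ℝ) : ℂ) =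
      ((Real.exp (-(‖x‖ ^ 2 / (4 * b))) / (4 * Real.pi * b) : ℝ) : ℂ) := by
  have hpi := Real.pi_pos
  have h := fourier_gaussian_innerProductSpace (V := Plane)
    (b := ((4 * Real.pi ^ 2 * b : ℝ) : ℂ)) (by rw [Complex.ofReal_re]; positivity) (-x)
  rw [← Real.fourierInv_eq_fourier_neg, fourierInv_apply_eq] at h
  have e : ∀ ν : Plane, ((Real.exp (-b * ‖(2 * Real.pi) • ν‖ ^ 2) : ℝ) : ℂ) =
      Complex.exp (-((4 * Real.pi ^ 2 * b : ℝ) : ℂ) * (‖ν‖ : ℂ) ^ 2) := by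
    intro ν
    rw [norm_smul, Real.norm_of_nonneg (by positivity)]
    push_cast; congr 1; ring
  simp_rw [e]
  rw [h, finrank_euclideanSpace_fin]
  have h2 : ((2 : ℕ) : ℂ) / 2 = 1 := by norm_num
  rw [h2, Complex.cpow_one, norm_neg]
  have hb0 : (b : ℂ) ≠ 0 := by exact_mod_cast hb.ne'
  have hpi0 : (Real.pi : ℂ) ≠ 0 := by exact_mod_cast hpi.ne'
  have e1 : -(Real.pi : ℂ) ^ 2 * (‖x‖ : ℂ) ^ 2 / ((4 * Real.pi ^ 2 * b : ℝ) : ℂ) =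
      ((-(‖x‖ ^ 2 / (4 * b)) : ℝ) : ℂ) := by
    push_cast; field_simp
  rw [e1, ← Complex.ofReal_exp]
  push_cast
  field_simp

theorem integrable_gaussian_momentum {b : ℝ} (hb : 0 < b) :
    Integrable fun ν : Plane => Real.exp (-b * ‖(2 * Real.pi) • ν‖ ^ 2) := by
  have h0 := GaussianFourier.integral_rexp_neg_mul_sq_norm (V := Plane)
    (b := 4 * Real.pi ^ 2 * b) (by positivity)
  have h1 : Integrable fun ν : Plane => Real.exp (-(4 * Real.pi ^ 2 * b) * ‖ν‖ ^ 2) := by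
    by_contra h
    rw [integral_undef h, finrank_euclideanSpace_fin] at h0
    have : 0 < Real.pi / (4 * Real.pi ^ 2 * b) := by positivity
    exact (Real.rpow_pos_of_pos this _).ne h0
  refine h1.congr (Eventually.of_forall fun ν => ?_)
  dsimp only
  rw [norm_smul, Real.norm_of_nonneg (by positivity)]
  congr 1; ring

/-- Averaging the sharp cut-offs with weight `2s e^{-s²}` produces a Gaussian cut-off, because the
tail integral of the weight from `c` is `e^{-c²}`. Unlike the sharp disk, a Gaussian has an explicit
Fourier transform. -/
theorem integral_abel_eq {κ : ℝ} (hκ : 0 < κ) (x : Plane) {R : ℝ} (hR : 0 < R) :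
    ∫ s in Set.Ioi (0 : ℝ), ((2 * s * Real.exp (-s ^ 2) : ℝ) : ℂ) * greenCut κ (R * s) x =
      ∫ ν, greenSymbol κ x ν * ((Real.exp (-(1 / R ^ 2) * ‖(2 * Real.pi) • ν‖ ^ 2) : ℝ) : ℂ) := by
  have e1 : ∀ s : ℝ, ((2 * s * Real.exp (-s ^ 2) : ℝ) : ℂ) * greenCut κ (R * s) x =
      ∫ ν, ((2 * s * Real.exp (-s ^ 2) : ℝ) : ℂ) *
        (if ‖(2 * Real.pi) • ν‖ ≤ R * s then greenSymbol κ x ν else 0) := by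
    intro s
    rw [integral_const_mul, greenCut_eq]
  simp_rw [e1]
  have key : ∀ (f : ℝ → ℝ) (z : Plane → ℂ) (ν : Plane), (fun s : ℝ => ((f s : ℝ) : ℂ) *
      (if ‖(2 * Real.pi) • ν‖ ≤ R * s then z ν else 0)) =
      (Set.Ici (‖(2 * Real.pi) • ν‖ / R)).indicator fun s => ((f s : ℝ) : ℂ) * z ν := by
    intro f z ν
    funext s
    have : (‖(2 * Real.pi) • ν‖ ≤ R * s) ↔ s ∈ Set.Ici (‖(2 * Real.pi) • ν‖ / R) := by
      rw [Set.mem_Ici, div_le_iff₀ hR, mul_comm s R]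
    by_cases h : ‖(2 * Real.pi) • ν‖ ≤ R * s
    · rw [if_pos h, Set.indicator_of_mem (this.mp h)]
    · rw [if_neg h, Set.indicator_of_notMem (fun h' => h (this.mpr h')), mul_zero]
  have inner : ∀ ν : Plane, ∫ s in Set.Ioi (0 : ℝ), ((2 * s * Real.exp (-s ^ 2) : ℝ) : ℂ) *
        (if ‖(2 * Real.pi) • ν‖ ≤ R * s then greenSymbol κ x ν else 0) =
      greenSymbol κ x ν * ((Real.exp (-(1 / R ^ 2) * ‖(2 * Real.pi) • ν‖ ^ 2) : ℝ) : ℂ) := by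
    intro ν
    have hc : 0 ≤ ‖(2 * Real.pi) • ν‖ / R := by positivity
    rw [key (fun s => 2 * s * Real.exp (-s ^ 2)) (greenSymbol κ x) ν,
      ← integral_Ici_eq_integral_Ioi, setIntegral_indicator measurableSet_Ici,
      Set.Ici_inter_Ici, sup_eq_right.mpr hc, integral_Ici_eq_integral_Ioi, integral_mul_const,
      integral_complex_ofReal, integral_abelWeight hc, mul_comm]
    congr 4
    rw [div_pow]; ring
  rw [integral_integral_swap]
  · congr 1; funext ν
    exact inner ν
  · have hm : AEStronglyMeasurable (Function.uncurry fun (s : ℝ) (ν : Plane) =>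
        ((2 * s * Real.exp (-s ^ 2) : ℝ) : ℂ) *
        (if ‖(2 * Real.pi) • ν‖ ≤ R * s then greenSymbol κ x ν else 0))
        ((volume.restrict (Set.Ioi 0)).prod volume) := by
      refine AEStronglyMeasurable.mul ?_
        (measurable_greenCut_integrand hκ x R).aestronglyMeasurable
      have : Continuous fun p : ℝ × Plane => ((2 * p.1 * Real.exp (-p.1 ^ 2) : ℝ) : ℂ) := by
        fun_prop
      exact this.aestronglyMeasurable
    rw [integrable_prod_iff' hm]
    constructor
    · refine Eventually.of_forall fun ν => ?_
      simp only [Function.uncurry]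
      rw [key (fun s => 2 * s * Real.exp (-s ^ 2)) (greenSymbol κ x) ν]
      exact (integrable_abelWeight.ofReal.mul_const _).indicator measurableSet_Ici
    · have hb : Integrable fun ν : Plane => 1 / κ ^ 2 *
          Real.exp (-(1 / R ^ 2) * ‖(2 * Real.pi) • ν‖ ^ 2) :=
        (integrable_gaussian_momentum (by positivity)).const_mul _
      refine hb.mono' hm.norm.prod_swap.integral_prod_right' (Eventually.of_forall fun ν => ?_)
      rw [Real.norm_of_nonneg (integral_nonneg fun _ => norm_nonneg _)]
      have e3 : ∫ s in Set.Ioi (0 : ℝ), ‖Function.uncurry (fun (s : ℝ) (ν : Plane) =>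
          ((2 * s * Real.exp (-s ^ 2) : ℝ) : ℂ) *
          (if ‖(2 * Real.pi) • ν‖ ≤ R * s then greenSymbol κ x ν else 0)) (s, ν)‖ =
          ‖greenSymbol κ x ν‖ * Real.exp (-(1 / R ^ 2) * ‖(2 * Real.pi) • ν‖ ^ 2) := by
        have h2 := inner ν
        have hc : 0 ≤ ‖(2 * Real.pi) • ν‖ / R := by positivity
        have e4 : ∀ s ∈ Set.Ioi (0 : ℝ), ‖Function.uncurry (fun (s : ℝ) (ν : Plane) =>
          ((2 * s * Real.exp (-s ^ 2) : ℝ) : ℂ) *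
          (if ‖(2 * Real.pi) • ν‖ ≤ R * s then greenSymbol κ x ν else 0)) (s, ν)‖ =
          (Set.Ici (‖(2 * Real.pi) • ν‖ / R)).indicator
            (fun s => 2 * s * Real.exp (-s ^ 2) * ‖greenSymbol κ x ν‖) s := by
          intro s hs
          have hs' : 0 < s := hs
          have h3 := congrFun (key (fun s => 2 * s * Real.exp (-s ^ 2)) (greenSymbol κ x) ν) s
          simp only [Function.uncurry] at h3 ⊢
          rw [h3]
          by_cases hs2 : s ∈ Set.Ici (‖(2 * Real.pi) • ν‖ / R)
          · rw [Set.indicator_of_mem hs2, Set.indicator_of_mem hs2, norm_mul, Complex.norm_real,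
              Real.norm_of_nonneg (by positivity)]
          · rw [Set.indicator_of_notMem hs2, Set.indicator_of_notMem hs2, norm_zero]
        rw [setIntegral_congr_fun measurableSet_Ioi e4, ← integral_Ici_eq_integral_Ioi,
          setIntegral_indicator measurableSet_Ici,
          Set.Ici_inter_Ici, sup_eq_right.mpr hc, integral_Ici_eq_integral_Ioi, integral_mul_const,
          integral_abelWeight hc, mul_comm]
        congr 2
        rw [div_pow]; ring
      rw [e3, norm_greenSymbol]
      gcongr
      exact le_add_of_nonneg_left (by positivity)

/-- Writing the resolvent symbol as a Laplace integral turns the Gaussian regulator `ε` into a shift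
of the heat time. Off the origin the limit `ε → 0` is then harmless. -/
theorem integral_greenSymbol_gaussian {κ : ℝ} (hκ : 0 < κ) (x : Plane) {ε : ℝ} (hε : 0 < ε) :
    ∫ ν, greenSymbol κ x ν * ((Real.exp (-ε * ‖(2 * Real.pi) • ν‖ ^ 2) : ℝ) : ℂ) =
      ((Real.exp (κ ^ 2 * ε) * ∫ t in Set.Ioi (0 : ℝ), heat κ (t + ε) x : ℝ) : ℂ) := by
  have e1 : ∀ ν, greenSymbol κ x ν * ((Real.exp (-ε * ‖(2 * Real.pi) • ν‖ ^ 2) : ℝ) : ℂ) =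
      ∫ t in Set.Ioi (0 : ℝ), ((Real.exp (-(κ ^ 2 * t)) : ℝ) : ℂ) * (bloch ((2 * Real.pi) • ν) x *
        ((Real.exp (-(t + ε) * ‖(2 * Real.pi) • ν‖ ^ 2) : ℝ) : ℂ)) := by
    intro ν
    have h := integral_exp_neg_Ioi (c := ‖(2 * Real.pi) • ν‖ ^ 2 + κ ^ 2) (by positivity) 0
    rw [mul_zero, Real.exp_zero] at h
    rw [greenSymbol, ← h, ← integral_complex_ofReal, mul_assoc, ← integral_mul_const,
      ← integral_const_mul]
    congr 1; funext t
    have h2 : ((Real.exp (-(‖(2 * Real.pi) • ν‖ ^ 2 + κ ^ 2) * t) : ℝ) : ℂ) *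
        ((Real.exp (-ε * ‖(2 * Real.pi) • ν‖ ^ 2) : ℝ) : ℂ) =
        ((Real.exp (-(κ ^ 2 * t)) : ℝ) : ℂ) *
        ((Real.exp (-(t + ε) * ‖(2 * Real.pi) • ν‖ ^ 2) : ℝ) : ℂ) := by
      rw [← Complex.ofReal_mul, ← Complex.ofReal_mul, ← Real.exp_add, ← Real.exp_add]
      congr 2; ring
    linear_combination bloch ((2 * Real.pi) • ν) x * h2
  simp_rw [e1]
  rw [integral_integral_swap]
  · have e2 : ∫ t in Set.Ioi (0 : ℝ), ∫ ν, ((Real.exp (-(κ ^ 2 * t)) : ℝ) : ℂ) *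
        (bloch ((2 * Real.pi) • ν) x *
        ((Real.exp (-(t + ε) * ‖(2 * Real.pi) • ν‖ ^ 2) : ℝ) : ℂ)) =
        ∫ t in Set.Ioi (0 : ℝ), ((Real.exp (κ ^ 2 * ε) * heat κ (t + ε) x : ℝ) : ℂ) := by
      refine setIntegral_congr_fun measurableSet_Ioi fun t ht => ?_
      have ht' : 0 < t := ht
      rw [integral_const_mul, integral_bloch_gaussian (by positivity), ← Complex.ofReal_mul, heat,
        sub_eq_add_neg (-(κ ^ 2 * (t + ε))), Real.exp_add]
      congr 1
      rw [show -(κ ^ 2 * t) = κ ^ 2 * ε + -(κ ^ 2 * (t + ε)) by ring, Real.exp_add]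
      ring
    rw [e2, integral_complex_ofReal, integral_const_mul]
  · have h1 : Integrable (fun p : Plane × ℝ => Real.exp (-ε * ‖(2 * Real.pi) • p.1‖ ^ 2) *
        Real.exp (-(κ ^ 2 * p.2))) (volume.prod (volume.restrict (Set.Ioi 0))) :=
      (integrable_gaussian_momentum hε).mul_prod (integrable_exp_neg_sq hκ)
    refine h1.mono' ?_ ?_
    · have : Continuous (Function.uncurry fun (ν : Plane) (t : ℝ) =>
          ((Real.exp (-(κ ^ 2 * t)) : ℝ) : ℂ) * (bloch ((2 * Real.pi) • ν) x *
          ((Real.exp (-(t + ε) * ‖(2 * Real.pi) • ν‖ ^ 2) : ℝ) : ℂ))) := by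
        unfold bloch Function.uncurry; fun_prop
      exact this.aestronglyMeasurable
    · have h2 : ∀ᵐ p : Plane × ℝ ∂(volume.prod (volume.restrict (Set.Ioi 0))), p.2 ∈ Set.Ioi 0 :=
        Measure.quasiMeasurePreserving_snd.ae (ae_restrict_mem measurableSet_Ioi)
      filter_upwards [h2] with p hp
      have hp' : 0 < p.2 := hp
      simp only [Function.uncurry]
      rw [norm_mul, norm_mul, norm_bloch, one_mul, Complex.norm_real, Complex.norm_real,
        Real.norm_of_nonneg (Real.exp_pos _).le, Real.norm_of_nonneg (Real.exp_pos _).le, mul_comm]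
      gcongr
      linarith

theorem tendsto_integral_heat_shift {κ : ℝ} (hκ : 0 < κ) {x : Plane} (hx : x ≠ 0) :
    Tendsto (fun ε => ∫ t in Set.Ioi (0 : ℝ), heat κ (t + ε) x) (𝓝[>] 0) (𝓝 (green κ x)) := by
  rw [green_eq]
  have hpi := Real.pi_pos
  have hx' := norm_pos_iff.mpr hx
  refine tendsto_integral_filter_of_dominated_convergence
    (fun t => 8 / (Real.pi * ‖x‖ ^ 4) * (t * Real.exp (-(κ ^ 2 * t)) + Real.exp (-(κ ^ 2 * t))))
    ?_ ?_ (((integrable_mul_exp hκ).add (integrable_exp_neg_sq hκ)).const_mul _) ?_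
  · refine Eventually.of_forall fun ε => ?_
    exact ((measurable_heat κ).comp
      ((measurable_id.add_const ε).prodMk measurable_const)).aestronglyMeasurable
  · have h01 : Set.Ioc (0 : ℝ) 1 ∈ 𝓝[>] (0 : ℝ) := Ioc_mem_nhdsGT one_pos
    filter_upwards [h01] with ε hε
    filter_upwards [ae_restrict_mem measurableSet_Ioi] with t ht
    have ht' : 0 < t := ht
    have hε0 := hε.1
    rw [Real.norm_of_nonneg (heat_nonneg (by linarith) κ x)]
    refine (heat_le (by linarith) hx).trans ?_
    gcongr
    rw [← add_one_mul]
    gcongr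
    · exact hε.2
    · linarith
  · filter_upwards [ae_restrict_mem measurableSet_Ioi] with t ht
    have ht' : 0 < t := ht
    have hc : ContinuousAt (fun ε => heat κ (t + ε) x) 0 := by
      unfold heat
      have h1 : (fun ε : ℝ => 4 * (t + ε)) 0 ≠ 0 := by simp; positivity
      have h2 : (fun ε : ℝ => 4 * Real.pi * (t + ε)) 0 ≠ 0 := by simp; positivity
      refine ContinuousAt.div ?_ (by fun_prop) h2
      refine Real.continuous_exp.continuousAt.comp ?_
      refine ContinuousAt.sub (by fun_prop) ?_
      exact ContinuousAt.div (by fun_prop) (by fun_prop) h1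
    have h := hc.tendsto
    rw [add_zero] at h
    exact h.mono_left nhdsWithin_le_nhds

/-- If the momentum integral converges away from the origin, its value is the Green function. -/
theorem eq_green_of_tendsto_greenCut {κ : ℝ} (hκ : 0 < κ) {x : Plane} (hx : x ≠ 0) {L : ℂ}
    (hL : Tendsto (fun r => greenCut κ r x) atTop (𝓝 L)) : L = (green κ x : ℂ) := by
  have h1 := tendsto_abel hκ hL
  have h2 : Tendsto (fun R : ℝ => 1 / R ^ 2) atTop (𝓝[>] 0) := by
    rw [tendsto_nhdsWithin_iff]
    refine ⟨tendsto_const_nhds.div_atTop (tendsto_pow_atTop two_ne_zero), ?_⟩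
    filter_upwards [eventually_gt_atTop 0] with R hR
    exact Set.mem_Ioi.mpr (by positivity)
  have h3 : Tendsto (fun ε => Real.exp (κ ^ 2 * ε)) (𝓝[>] 0) (𝓝 1) := by
    have : Continuous fun ε => Real.exp (κ ^ 2 * ε) := by fun_prop
    simpa using (this.tendsto 0).mono_left nhdsWithin_le_nhds
  have h4 := (Complex.continuous_ofReal.tendsto _).comp
    ((h3.mul (tendsto_integral_heat_shift hκ hx)).comp h2)
  rw [one_mul] at h4
  refine tendsto_nhds_unique h1 (h4.congr' ?_)
  filter_upwards [eventually_gt_atTop 0] with R hR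
  rw [integral_abel_eq hκ x hR, integral_greenSymbol_gaussian hκ x (by positivity)]
  rfl

/-- The off-diagonal Fourier coefficients are the entries `-G(y - y')` of the scattering matrix. -/
theorem integral_kreinMatrix_of_ne {a κ : ℝ} (ha : 0 < a) (hκ : 0 < κ) (α : ℝ) {j l : Fin 2}
    {n : ℤ × ℤ} (h : ¬(n = 0 ∧ j = l))
    (hx : latticeVec a n + (cellPoint a j - cellPoint a l) ≠ 0) :
    ∫ t, cellChar n t * kreinMatrix a α κ (momentum a t) j l ∂cellMeasure =
      -(green κ (latticeVec a n + (cellPoint a j - cellPoint a l)) : ℂ) := by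
  have h1 := eq_green_of_tendsto_greenCut hκ hx (tendsto_greenCut_neg_integral ha hκ α h)
  rw [← h1, neg_neg]

end

end HoneycombScatterer

namespace HoneycombScatterer

noncomputable section

/-! ### The sites of the honeycomb -/

/-- The site of the honeycomb with cell index `n` and type `j`. -/
def sitePoint (a : ℝ) (p : (ℤ × ℤ) × Fin 2) : Plane := latticeVec a p.1 + cellPoint a p.2

theorem bloch_k₁_latticeVec {a : ℝ} (ha : 0 < a) (n : ℤ × ℤ) : bloch (k₁ a) (latticeVec a n) = 1 := by
  have h := bloch_dualVec_latticeVec ha (1, 0) n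
  simpa [dualVec] using h

theorem latticeVec_eq_zero_iff {a : ℝ} (ha : 0 < a) {n : ℤ × ℤ} : latticeVec a n = 0 ↔ n = 0 := by
  refine ⟨fun h => ?_, fun h => by rw [h, latticeVec_zero]⟩
  have h1 := norm_sq_latticeVec (a := a) n
  rw [h, norm_zero] at h1
  have h2 : (n.1 : ℝ) ^ 2 + (n.2 : ℝ) ^ 2 + n.1 * n.2 = 0 := by
    have : 0 < a ^ 2 := by positivity
    have h3 : a ^ 2 * ((n.1 : ℝ) ^ 2 + (n.2 : ℝ) ^ 2 + n.1 * n.2) = 0 := by rw [← h1]; norm_num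
    exact (mul_eq_zero.mp h3).resolve_left this.ne'
  have h4 : (n.1 : ℝ) = 0 := by nlinarith [sq_nonneg ((n.1 : ℝ) + 2 * n.2)]
  have h5 : (n.2 : ℝ) = 0 := by nlinarith [sq_nonneg ((n.1 : ℝ) * 2 + n.2)]
  exact Prod.ext (by exact_mod_cast h4) (by exact_mod_cast h5)

/-- The character `e^{i k₁·x}` is `1` on `Λ` and differs from `1` on displacements between the
sublattices, so the two sublattices are disjoint. -/
theorem siteDiff_ne_zero {a : ℝ} (ha : 0 < a) {n : ℤ × ℤ} {j l : Fin 2} (h : ¬(n = 0 ∧ j = l)) :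
    latticeVec a n + (cellPoint a j - cellPoint a l) ≠ 0 := by
  intro h0
  by_cases hj : j = l
  · subst hj
    rw [sub_self, add_zero, latticeVec_eq_zero_iff ha] at h0
    exact h ⟨h0, rfl⟩
  · apply bloch_k₁_ne ha hj
    have h1 := congrArg (bloch (k₁ a)) h0
    rwa [bloch_add_right, bloch_k₁_latticeVec ha, one_mul, bloch_zero] at h1

theorem sitePoint_injective {a : ℝ} (ha : 0 < a) : Function.Injective (sitePoint a) := by
  intro p q h
  by_contra hne
  refine siteDiff_ne_zero ha (n := p.1 - q.1) (j := p.2) (l := q.2) ?_ ?_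
  · rintro ⟨h1, h2⟩
    exact hne (Prod.ext (sub_eq_zero.mp h1) h2)
  · rw [latticeVec_sub]
    simp only [sitePoint] at h
    have : latticeVec a p.1 - latticeVec a q.1 + (cellPoint a p.2 - cellPoint a q.2) =
      (latticeVec a p.1 + cellPoint a p.2) - (latticeVec a q.1 + cellPoint a q.2) := by abel
    rw [this, h, sub_self]

theorem range_sitePoint (a : ℝ) : Set.range (sitePoint a) = honeycomb a := by
  ext x
  simp only [honeycomb, triangularLattice, Set.mem_range, Set.mem_union, Set.mem_image]
  constructor
  · rintro ⟨⟨n, j⟩, rfl⟩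
    fin_cases j
    · left; exact ⟨n, by simp [sitePoint, cellPoint]⟩
    · right; exact ⟨_, ⟨n, rfl⟩, by simp [sitePoint, cellPoint]⟩
  · rintro (⟨n, rfl⟩ | ⟨_, ⟨n, rfl⟩, rfl⟩)
    · exact ⟨(n, 0), by simp [sitePoint, cellPoint]⟩
    · exact ⟨(n, 1), by simp [sitePoint, cellPoint]⟩

/-- The sites, indexed by cell and type. -/
def siteEquiv {a : ℝ} (ha : 0 < a) : (ℤ × ℤ) × Fin 2 ≃ honeycomb a :=
  (Equiv.ofInjective _ (sitePoint_injective ha)).trans (Equiv.setCongr (range_sitePoint a))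

theorem coe_siteEquiv {a : ℝ} (ha : 0 < a) (p : (ℤ × ℤ) × Fin 2) :
    (siteEquiv ha p : Plane) = sitePoint a p := rfl

/-- The entries of the scattering matrix by cell difference. -/
def kreinCoef (a α κ : ℝ) (j l : Fin 2) (n : ℤ × ℤ) : ℝ :=
  if n = 0 ∧ j = l then α + 1 / (2 * Real.pi) * Real.log (κ / 2)
  else -green κ (latticeVec a n + (cellPoint a j - cellPoint a l))

theorem scatteringMatrix_site {a : ℝ} (ha : 0 < a) (α κ : ℝ) (p q : (ℤ × ℤ) × Fin 2) :
    scatteringMatrix κ (honeycomb a) (fun _ => α) (siteEquiv ha p) (siteEquiv ha q) =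
      kreinCoef a α κ p.2 q.2 (p.1 - q.1) := by
  rw [scatteringMatrix, kreinCoef]
  by_cases h : p = q
  · subst h; simp
  · rw [if_neg (by simpa using h), if_neg, coe_siteEquiv, coe_siteEquiv]
    · congr 2
      rw [latticeVec_sub, sitePoint, sitePoint]; abel
    · rintro ⟨h1, h2⟩
      exact h (Prod.ext (sub_eq_zero.mp h1) h2)

/-- The link between the infinite system and its fibers: the scattering matrix is invariant under
lattice translations, and the fiber Krein matrix is its symbol. The logarithms and cut-offs of the
two definitions agree exactly, diagonal included. -/
theorem integral_kreinMatrix {a κ : ℝ} (ha : 0 < a) (hκ : 0 < κ) (α : ℝ) (j l : Fin 2)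
    (n : ℤ × ℤ) :
    ∫ t, cellChar n t * kreinMatrix a α κ (momentum a t) j l ∂cellMeasure =
      (kreinCoef a α κ j l n : ℂ) := by
  by_cases h : n = 0 ∧ j = l
  · obtain ⟨rfl, rfl⟩ := h
    simp_rw [cellChar_zero, one_mul]
    rw [integral_kreinMatrix_self ha hκ, kreinCoef, if_pos ⟨rfl, rfl⟩]
  · rw [integral_kreinMatrix_of_ne ha hκ α h (siteDiff_ne_zero ha h), kreinCoef, if_neg h]
    push_cast; rfl

/-! ### Summability of the Green function over the lattice -/

theorem eventually_lt_norm_latticeVec {a : ℝ} (ha : 0 < a) (r : ℝ) :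
    ∀ᶠ n in cofinite, r < ‖latticeVec a n‖ := by
  have h := (summable_latticeVec ha).tendsto_cofinite_zero.eventually
    (gt_mem_nhds (show (0 : ℝ) < 1 / (1 + |r|) ^ 3 by positivity))
  filter_upwards [h] with n hn
  by_contra! hle
  have h1 : 1 + ‖latticeVec a n‖ ≤ 1 + |r| := by linarith [le_abs_self r]
  have h2 : 1 / (1 + |r|) ^ 3 ≤ 1 / (1 + ‖latticeVec a n‖) ^ 3 := by gcongr
  linarith

theorem summable_green {a κ : ℝ} (ha : 0 < a) (hκ : 0 < κ) (x : Plane) :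
    Summable fun n => green κ (x - latticeVec a n) := by
  obtain ⟨C, hC⟩ := exists_green_le hκ
  refine Summable.of_norm_bounded_eventually ((summable_latticeVec ha).mul_left (16 * |C|)) ?_
  filter_upwards [eventually_lt_norm_latticeVec ha (2 * ‖x‖ + 1)] with n hn
  -- Far from `x` the distance to the lattice point is at least half of `1 + ‖v‖`; the fourth power
  -- of that half is the factor `16` in the majorant.
  have h1 : (1 + ‖latticeVec a n‖) / 2 ≤ ‖x - latticeVec a n‖ := by
    have := norm_sub_norm_le (latticeVec a n) x
    rw [norm_sub_rev] at this
    linarith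
  have hp : 0 < 1 + ‖latticeVec a n‖ := by positivity
  have hx : x - latticeVec a n ≠ 0 := by
    rw [← norm_pos_iff]; linarith
  rw [Real.norm_of_nonneg (green_nonneg κ _)]
  calc _ ≤ C / ‖x - latticeVec a n‖ ^ 4 := hC _ hx
    _ ≤ |C| / ((1 + ‖latticeVec a n‖) / 2) ^ 4 := by gcongr; exact le_abs_self C
    _ = 16 * |C| * (1 / (1 + ‖latticeVec a n‖) ^ 4) := by field_simp; norm_num
    _ ≤ _ := by
      gcongr
      · linarith [norm_nonneg (latticeVec a n)]
      · norm_num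

theorem summable_green_site {a κ : ℝ} (ha : 0 < a) (hκ : 0 < κ) (x : Plane) :
    Summable fun p => green κ (x - sitePoint a p) := by
  refine (Summable.prod_symm (f := fun p : Fin 2 × (ℤ × ℤ) => green κ (x - sitePoint a p.swap)) ?_)
  refine (summable_prod_of_nonneg fun _ => green_nonneg _ _).mpr ⟨fun j => ?_, Summable.of_finite⟩
  refine (summable_green ha hκ (x - cellPoint a j)).congr fun n => ?_
  simp only [Prod.swap_prod_mk, sitePoint]
  congr 1; abel

theorem summable_green_siteDiff {a κ : ℝ} (ha : 0 < a) (hκ : 0 < κ) (j l : Fin 2) :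
    Summable fun n => green κ (latticeVec a n + (cellPoint a j - cellPoint a l)) := by
  refine (summable_green ha hκ (cellPoint a l - cellPoint a j)).congr fun n => ?_
  rw [← green_neg]
  congr 1; abel

theorem green_anti {κ κ' : ℝ} (hκ : 0 < κ) (h : κ ≤ κ') {x : Plane} (hx : x ≠ 0) :
    green κ' x ≤ green κ x := by
  rw [green_eq, green_eq]
  refine setIntegral_mono_on (integrableOn_heat (hκ.trans_le h) hx) (integrableOn_heat hκ hx)
    measurableSet_Ioi fun t ht => ?_
  have ht' : 0 < t := ht
  have := Real.pi_pos
  unfold heat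
  gcongr

theorem summable_kreinCoef {a κ : ℝ} (ha : 0 < a) (hκ : 0 < κ) (α : ℝ) (j l : Fin 2) :
    Summable fun n => |kreinCoef a α κ j l n| := by
  refine Summable.of_norm_bounded_eventually (summable_green_siteDiff ha hκ j l) ?_
  filter_upwards [(Set.finite_singleton (0 : ℤ × ℤ)).compl_mem_cofinite] with n hn
  rw [kreinCoef, if_neg (fun h => hn h.1), abs_neg, abs_of_nonneg (green_nonneg _ _),
    Real.norm_of_nonneg (green_nonneg _ _)]

/-! ### The Fourier series of the Krein matrix -/

theorem cellChar_add_intVec (n m : ℤ × ℤ) (t : Fin 2 → ℝ) :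
    cellChar n (t + intVec m) = cellChar n t := by
  unfold cellChar
  rw [Complex.exp_eq_exp_iff_exists_int]
  refine ⟨m.1 * n.1 + m.2 * n.2, ?_⟩
  simp [intVec]; ring

/-- Periodicity spreads the almost everywhere identity from the cell to the plane, and continuity
makes it hold everywhere. -/
theorem eq_of_ae_eq_cell {f g : (Fin 2 → ℝ) → ℂ} (hf : Continuous f) (hg : Continuous g)
    (hfp : ∀ t m, f (t + intVec m) = f t) (hgp : ∀ t m, g (t + intVec m) = g t)
    (h : f =ᵐ[cellMeasure] g) : f = g := by
  rw [← Continuous.ae_eq_iff_eq volume hf hg, ← measurePreserving_add_intVec.map_eq]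
  rw [Filter.EventuallyEq, ae_map_iff measurePreserving_add_intVec.aemeasurable
    (measurableSet_eq_fun hf.measurable hg.measurable)]
  have h2 := (Measure.quasiMeasurePreserving_fst (μ := cellMeasure)
    (ν := (Measure.count : Measure (ℤ × ℤ)))).ae h
  filter_upwards [h2] with p hp
  rw [hfp, hgp, hp]

/-- The coefficients are absolutely summable, so the Fourier series is continuous. It has the same
coefficients as the Krein matrix, and the identity holds at every point, which the bounds at an
individual `k` need. -/
theorem kreinMatrix_eq_tsum {a κ : ℝ} (ha : 0 < a) (hκ : 0 < κ) (α : ℝ) (t : Fin 2 → ℝ)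
    (j l : Fin 2) :
    kreinMatrix a α κ (momentum a t) j l =
      ∑' n, cellChar (-n) t * (kreinCoef a α κ j l n : ℂ) := by
  have hs := summable_kreinCoef ha hκ α j l
  have hb : ∀ n t, ‖cellChar (-n) t * (kreinCoef a α κ j l n : ℂ)‖ ≤ |kreinCoef a α κ j l n| := by
    intro n t
    rw [norm_mul, norm_cellChar, one_mul, Complex.norm_real, Real.norm_eq_abs]
  have hg : Continuous fun t => ∑' n, cellChar (-n) t * (kreinCoef a α κ j l n : ℂ) :=
    continuous_tsum (fun n => (continuous_cellChar _).mul continuous_const) hs hb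
  have hf := continuous_kreinMatrix_momentum ha hκ α j l
  refine congrFun (eq_of_ae_eq_cell hf hg ?_ ?_ ?_) t
  · intro t m
    rw [momentum_add, momentum_intVec, kreinMatrix_add_dualVec]
  · intro t m
    simp_rw [cellChar_add_intVec]
  · have hgb : ∀ t, ‖∑' n, cellChar (-n) t * (kreinCoef a α κ j l n : ℂ)‖ ≤
        ∑' n, |kreinCoef a α κ j l n| := fun t => tsum_of_norm_bounded hs.hasSum fun n => hb n t
    obtain ⟨C, hC⟩ : ∃ C, ∀ᵐ t ∂cellMeasure, ‖kreinMatrix a α κ (momentum a t) j l‖ ≤ C := by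
      have hcpt : IsCompact (Set.pi Set.univ fun _ : Fin 2 => Set.Icc (0 : ℝ) 1) :=
        isCompact_univ_pi fun _ => isCompact_Icc
      obtain ⟨C, hC⟩ := hcpt.exists_bound_of_continuousOn hf.continuousOn
      refine ⟨C, ?_⟩
      filter_upwards [ae_mem_unitCell] with t ht
      exact hC t fun i _ => Set.Ioc_subset_Icc_self (ht i)
    refine ae_eq_of_fourier_eq
      (MemLp.of_bound hf.aestronglyMeasurable C hC)
      (MemLp.of_bound hg.aestronglyMeasurable _ (Eventually.of_forall hgb)) fun m => ?_
    rw [integral_kreinMatrix ha hκ]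
    have e1 : ∀ t, cellChar m t * ∑' n, cellChar (-n) t * (kreinCoef a α κ j l n : ℂ) =
        ∑' n, (kreinCoef a α κ j l n : ℂ) * cellChar (m - n) t := by
      intro t
      rw [← tsum_mul_left]
      congr 1; funext n
      rw [sub_eq_add_neg, cellChar_add]; ring
    simp_rw [e1]
    rw [← integral_tsum_of_summable_integral_norm]
    · simp_rw [integral_const_mul, integral_cellChar]
      rw [tsum_eq_single m]
      · simp
      · intro n hn
        rw [if_neg (by rw [sub_eq_zero]; exact hn.symm), mul_zero]
    · intro n
      exact (Integrable.of_bound (continuous_cellChar _).aestronglyMeasurable 1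
        (Eventually.of_forall fun t => (norm_cellChar _ t).le)).const_mul _
    · simp_rw [norm_mul, norm_cellChar, mul_one, Complex.norm_real, Real.norm_eq_abs]
      simpa using hs

/-- The sum of the Green function over the sites of type `j` seen from the type `l`, the site itself
excluded. -/
def greenSum (a κ : ℝ) (j l : Fin 2) : ℝ :=
  ∑' n, if n = 0 ∧ j = l then 0 else green κ (latticeVec a n + (cellPoint a j - cellPoint a l))

theorem summable_greenSum {a κ : ℝ} (ha : 0 < a) (hκ : 0 < κ) (j l : Fin 2) :
    Summable fun n => if n = 0 ∧ j = l then 0 else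
      green κ (latticeVec a n + (cellPoint a j - cellPoint a l)) := by
  refine Summable.of_nonneg_of_le (fun n => ?_) (fun n => ?_) (summable_green_siteDiff ha hκ j l)
  · split_ifs
    · exact le_rfl
    · exact green_nonneg _ _
  · split_ifs
    · exact green_nonneg _ _
    · exact le_rfl

theorem greenSum_nonneg (a κ : ℝ) (j l : Fin 2) : 0 ≤ greenSum a κ j l := by
  refine tsum_nonneg fun n => ?_
  split_ifs
  · exact le_rfl
  · exact green_nonneg _ _

theorem greenSum_anti {a κ κ' : ℝ} (ha : 0 < a) (hκ : 0 < κ) (h : κ ≤ κ') (j l : Fin 2) :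
    greenSum a κ' j l ≤ greenSum a κ j l := by
  refine (summable_greenSum ha (hκ.trans_le h) j l).tsum_le_tsum (fun n => ?_)
    (summable_greenSum ha hκ j l)
  split_ifs with h1
  · exact le_rfl
  · exact green_anti hκ h (siteDiff_ne_zero ha h1)

/-- The Fourier series of the entries of the Krein matrix, with the constant term separated. -/
theorem kreinMatrix_eq_sub {a κ : ℝ} (ha : 0 < a) (hκ : 0 < κ) (α : ℝ) (t : Fin 2 → ℝ)
    (j l : Fin 2) :
    kreinMatrix a α κ (momentum a t) j l =
      (if j = l then ((α + 1 / (2 * Real.pi) * Real.log (κ / 2) : ℝ) : ℂ) else 0) -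
      ∑' n, cellChar (-n) t * ((if n = 0 ∧ j = l then 0 else
        green κ (latticeVec a n + (cellPoint a j - cellPoint a l)) : ℝ) : ℂ) := by
  rw [kreinMatrix_eq_tsum ha hκ]
  have h2 : Summable fun n => cellChar (-n) t * ((if n = 0 ∧ j = l then 0 else
        green κ (latticeVec a n + (cellPoint a j - cellPoint a l)) : ℝ) : ℂ) := by
    refine Summable.of_norm_bounded (summable_greenSum ha hκ j l) fun n => ?_
    rw [norm_mul, norm_cellChar, one_mul, Complex.norm_real, Real.norm_of_nonneg]
    split_ifs
    · exact le_rfl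
    · exact green_nonneg _ _
  have h1 : HasSum (fun n : ℤ × ℤ => if n = 0 then
      (if j = l then ((α + 1 / (2 * Real.pi) * Real.log (κ / 2) : ℝ) : ℂ) else 0) else 0)
      (if j = l then ((α + 1 / (2 * Real.pi) * Real.log (κ / 2) : ℝ) : ℂ) else 0) :=
    hasSum_ite_eq 0 _
  rw [← (h1.sub h2.hasSum).tsum_eq]
  congr 1; funext n
  rw [kreinCoef]
  by_cases hn : n = 0 <;> by_cases hj : j = l <;> simp [hn, hj, cellChar_zero]

/-- Triangle inequality in the Fourier series. As the Green function is nonnegative and all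
characters equal `1` at `k = 0`, the bound is attained there (`kreinMatrix_zero`); this is why zero
quasi-momentum is extremal for the lowest band. -/
theorem norm_kreinMatrix_sub_le {a κ : ℝ} (ha : 0 < a) (hκ : 0 < κ) (α : ℝ) (k : Plane)
    (j l : Fin 2) :
    ‖kreinMatrix a α κ k j l -
      (if j = l then ((α + 1 / (2 * Real.pi) * Real.log (κ / 2) : ℝ) : ℂ) else 0)‖
      ≤ greenSum a κ j l := by
  obtain ⟨t, rfl⟩ := exists_momentum_eq ha k
  rw [kreinMatrix_eq_sub ha hκ, sub_sub_cancel_left, norm_neg]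
  refine tsum_of_norm_bounded (summable_greenSum ha hκ j l).hasSum fun n => ?_
  rw [norm_mul, norm_cellChar, one_mul, Complex.norm_real, Real.norm_of_nonneg]
  split_ifs
  · exact le_rfl
  · exact green_nonneg _ _

theorem kreinMatrix_zero {a κ : ℝ} (ha : 0 < a) (hκ : 0 < κ) (α : ℝ) (j l : Fin 2) :
    kreinMatrix a α κ 0 j l =
      (((if j = l then α + 1 / (2 * Real.pi) * Real.log (κ / 2) else 0) - greenSum a κ j l : ℝ)
        : ℂ) := by
  have h := kreinMatrix_eq_sub ha hκ α 0 j l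
  have e : momentum a 0 = 0 := by simp [momentum]
  have e2 : ∀ n, cellChar n 0 = 1 := by simp [cellChar]
  rw [e] at h
  simp_rw [e2, one_mul] at h
  rw [h, ← Complex.ofReal_tsum, greenSum]
  split_ifs <;> push_cast <;> rfl

end

end HoneycombScatterer

namespace HoneycombScatterer

noncomputable section

/-! ### Square summable sequences -/

theorem memℓp_two_iff {u : ℤ × ℤ → ℂ} : Memℓp u 2 ↔ Summable fun m => ‖u m‖ ^ 2 := by
  rw [memℓp_gen_iff (by norm_num)]
  simp

theorem summable_norm_sq (u : DualL2) : Summable fun m => ‖u m‖ ^ 2 :=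
  memℓp_two_iff.mp (lp.memℓp u)

theorem hasSum_norm_sq (u : DualL2) : HasSum (fun m => ‖u m‖ ^ 2) (‖u‖ ^ 2) := by
  have h := lp.hasSum_norm (p := 2) (by norm_num) u
  simpa using h

/-- The diagonal operator with bounded entries `b`. -/
def diagOp (b : ℤ × ℤ → ℝ) {C : ℝ} (hb : ∀ m, |b m| ≤ C) : DualL2 →L[ℂ] DualL2 :=
  LinearMap.mkContinuous
    { toFun := fun u => ⟨fun m => (b m : ℂ) * u m, memℓp_two_iff.mpr (by
        refine Summable.of_nonneg_of_le (fun m => by positivity) (fun m => ?_)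
          ((summable_norm_sq u).mul_left (C ^ 2))
        rw [norm_mul, mul_pow, Complex.norm_real, Real.norm_eq_abs]
        have := hb m
        gcongr)⟩
      map_add' := fun u v => by ext m; exact mul_add _ _ _
      map_smul' := fun c u => by ext m; exact mul_left_comm _ _ _ } C (by
    intro u
    have hC : 0 ≤ C := (abs_nonneg _).trans (hb 0)
    refine abs_le_of_sq_le_sq' ?_ (by positivity) |>.2
    rw [mul_pow]
    refine hasSum_le (fun m => ?_) (hasSum_norm_sq _) ((hasSum_norm_sq u).mul_left (C ^ 2))
    change ‖(b m : ℂ) * u m‖ ^ 2 ≤ _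
    rw [norm_mul, mul_pow, Complex.norm_real, Real.norm_eq_abs]
    have := hb m
    gcongr)

theorem diagOp_apply {b : ℤ × ℤ → ℝ} {C : ℝ} (hb : ∀ m, |b m| ≤ C) (u : DualL2) (m : ℤ × ℤ) :
    diagOp b hb u m = b m * u m := rfl

theorem norm_diagOp_le {b : ℤ × ℤ → ℝ} {C : ℝ} (hb : ∀ m, |b m| ≤ C) : ‖diagOp b hb‖ ≤ C :=
  LinearMap.mkContinuous_norm_le _ ((abs_nonneg _).trans (hb 0)) _

theorem inner_dual_eq_tsum (u v : DualL2) :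
    inner ℂ u v = ∑' m, (starRingEnd ℂ) (u m) * v m := by
  rw [lp.inner_eq_tsum]
  congr 1; funext m
  rw [RCLike.inner_apply, mul_comm]

theorem hasSum_inner_dual (u v : DualL2) :
    HasSum (fun m => (starRingEnd ℂ) (u m) * v m) (inner ℂ u v) := by
  refine (lp.hasSum_inner u v).congr_fun ?_
  intro m
  rw [RCLike.inner_apply, mul_comm]

theorem inner_diagOp {b : ℤ × ℤ → ℝ} {C : ℝ} (hb : ∀ m, |b m| ≤ C) (u v : DualL2) :
    inner ℂ (diagOp b hb u) v = inner ℂ u (diagOp b hb v) := by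
  rw [inner_dual_eq_tsum, inner_dual_eq_tsum]
  congr 1; funext m
  rw [diagOp_apply, diagOp_apply, map_mul, Complex.conj_ofReal]; ring

/-! ### The free resolvent and the Krein vectors -/

theorem abs_freeResolvent_le {κ : ℝ} (hκ : 0 < κ) (a : ℝ) (k : Plane) (m : ℤ × ℤ) :
    |freeResolvent a κ k m| ≤ 1 / κ ^ 2 := by
  rw [abs_of_pos (freeResolvent_pos hκ k m)]
  exact freeResolvent_le hκ k m

/-- The resolvent of the free fiber at energy `-κ²`. -/
def freeOp {κ : ℝ} (hκ : 0 < κ) (a : ℝ) (k : Plane) : DualL2 →L[ℂ] DualL2 :=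
  diagOp (freeResolvent a κ k) (abs_freeResolvent_le hκ a k)

theorem freeOp_apply {κ : ℝ} (hκ : 0 < κ) (a : ℝ) (k : Plane) (u : DualL2) (m : ℤ × ℤ) :
    freeOp hκ a k u m = freeResolvent a κ k m * u m := rfl

/-- The Green function of the fiber with source at `y_j`. -/
def kreinVec {a κ : ℝ} (ha : 0 < a) (hκ : 0 < κ) (k : Plane) (j : Fin 2) : DualL2 :=
  ⟨fun m => (starRingEnd ℂ) (planeWave a k (cellPoint a j) m) * freeResolvent a κ k m,
    memℓp_two_iff.mpr (by
      refine (summable_freeResolvent_mul ha hκ hκ k).congr fun m => ?_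
      rw [norm_mul, RCLike.norm_conj, norm_planeWave, one_mul, Complex.norm_real, Real.norm_eq_abs,
        sq_abs, sq])⟩

theorem kreinVec_apply {a κ : ℝ} (ha : 0 < a) (hκ : 0 < κ) (k : Plane) (j : Fin 2) (m : ℤ × ℤ) :
    kreinVec ha hκ k j m =
      (starRingEnd ℂ) (planeWave a k (cellPoint a j) m) * freeResolvent a κ k m := rfl

theorem inner_kreinVec {a κ : ℝ} (ha : 0 < a) (hκ : 0 < κ) (k : Plane) (j : Fin 2) (w : DualL2) :
    HasSum (fun m => planeWave a k (cellPoint a j) m * freeResolvent a κ k m * w m)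
      (inner ℂ (kreinVec ha hκ k j) w) := by
  refine (hasSum_inner_dual _ _).congr_fun fun m => ?_
  rw [kreinVec_apply, map_mul, Complex.conj_conj, Complex.conj_ofReal]

/-! ### The fiber graph through the Krein matrix -/

/-- The defining relation of the fiber graph with a given charge `q`. -/
def FiberRel (a α : ℝ) (k : Plane) (q : Fin 2 → ℂ) (u f : DualL2) : Prop :=
  (∀ m : ℤ × ℤ, f m = ((‖dualVec a m + k‖ ^ 2 : ℝ) : ℂ) * u m
      - ((1 / cellArea a : ℝ) : ℂ) *
        ∑ j, q j * (starRingEnd ℂ) (planeWave a k (cellPoint a j) m)) ∧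
    ∀ j, ∃ S : ℝ → ℂ, (∀ r, IsCutoffValue a k (cellPoint a j) u r (S r)) ∧
      Tendsto
        (fun r : ℝ => S r
          - ((α + (Real.log r - Real.log 2) / (2 * Real.pi) : ℝ) : ℂ) * q j)
        atTop (𝓝 0)

theorem mem_fiberGraph_iff {a α : ℝ} {k : Plane} {u f : DualL2} :
    (u, f) ∈ fiberGraph a (fun _ => α) k ↔ ∃ q, FiberRel a α k q u f := Iff.rfl

theorem isCutoffValue_iff {a : ℝ} (ha : 0 < a) (k y : Plane) (u : DualL2) (r : ℝ) (s : ℂ) :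
    IsCutoffValue a k y u r s ↔
      s = ∑' m, if ‖dualVec a m + k‖ ≤ r then planeWave a k y m * u m else 0 := by
  have hfin := finite_norm_dualVec_add_le ha k r
  have : Finite {m : ℤ × ℤ // ‖dualVec a m + k‖ ≤ r} := hfin
  have e : ∑' m : {m : ℤ × ℤ // ‖dualVec a m + k‖ ≤ r}, planeWave a k y m * u m =
      ∑' m, if ‖dualVec a m + k‖ ≤ r then planeWave a k y m * u m else 0 := by
    have h := tsum_subtype {m : ℤ × ℤ | ‖dualVec a m + k‖ ≤ r} fun m => planeWave a k y m * u m
    refine h.trans ?_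
    congr 1
  rw [IsCutoffValue, ← e]
  exact ⟨fun h => h.tsum_eq.symm, fun h => h ▸ Summable.of_finite.hasSum⟩

theorem mul_freeResolvent (a : ℝ) {κ : ℝ} (hκ : 0 < κ) (k : Plane) (m : ℤ × ℤ) :
    ((‖dualVec a m + k‖ ^ 2 + κ ^ 2 : ℝ) : ℂ) * (freeResolvent a κ k m : ℂ) = 1 := by
  rw [← Complex.ofReal_mul, freeResolvent, mul_one_div_cancel (by positivity), Complex.ofReal_one]

theorem fiber_eq_iff {a κ : ℝ} (ha : 0 < a) (hκ : 0 < κ) (k : Plane) (q : Fin 2 → ℂ)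
    (u f : DualL2) :
    (∀ m : ℤ × ℤ, f m = ((‖dualVec a m + k‖ ^ 2 : ℝ) : ℂ) * u m
      - ((1 / cellArea a : ℝ) : ℂ) *
        ∑ j, q j * (starRingEnd ℂ) (planeWave a k (cellPoint a j) m)) ↔
    u = freeOp hκ a k (f + ((κ ^ 2 : ℝ) : ℂ) • u) +
      ((1 / cellArea a : ℝ) : ℂ) • ∑ j, q j • kreinVec ha hκ k j := by
  have hr : ∀ m, (freeOp hκ a k (f + ((κ ^ 2 : ℝ) : ℂ) • u) +
      ((1 / cellArea a : ℝ) : ℂ) • ∑ j, q j • kreinVec ha hκ k j : DualL2) m =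
      freeResolvent a κ k m * (f m + ((κ ^ 2 : ℝ) : ℂ) * u m + ((1 / cellArea a : ℝ) : ℂ) *
        ∑ j, q j * (starRingEnd ℂ) (planeWave a k (cellPoint a j) m)) := by
    intro m
    simp only [lp.coeFn_add, Pi.add_apply, freeOp_apply, lp.coeFn_smul, Pi.smul_apply,
      Fin.sum_univ_two, smul_eq_mul, kreinVec_apply]
    ring
  constructor
  · intro h
    ext m
    rw [hr, h m]
    have h1 := mul_freeResolvent a hκ k m
    push_cast at h1 ⊢
    linear_combination (-(u m)) * h1
  · intro h m
    have h2 := hr m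
    rw [← h] at h2
    have h1 := mul_freeResolvent a hκ k m
    rw [Complex.ofReal_add] at h1
    linear_combination (-((‖dualVec a m + k‖ ^ 2 : ℝ) : ℂ) - ((κ ^ 2 : ℝ) : ℂ)) * h2 -
      (f m + ((κ ^ 2 : ℝ) : ℂ) * u m + ((1 / cellArea a : ℝ) : ℂ) *
        ∑ j, q j * (starRingEnd ℂ) (planeWave a k (cellPoint a j) m)) * h1

/-- Inserting the Krein form of `u`, the truncated value at `y_j` splits into a convergent inner
product and wave sums with coefficients `q`. The counterterm joins the latter to form the truncated
Krein matrix, so the boundary condition becomes a linear equation for the charges. -/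
theorem tendsto_cutoff {a κ : ℝ} (ha : 0 < a) (hκ : 0 < κ) (α : ℝ) (k : Plane) (q : Fin 2 → ℂ)
    {u w : DualL2} (hu : u = freeOp hκ a k w +
      ((1 / cellArea a : ℝ) : ℂ) • ∑ j, q j • kreinVec ha hκ k j) (j : Fin 2) :
    Tendsto (fun r : ℝ =>
        (∑' m, if ‖dualVec a m + k‖ ≤ r then planeWave a k (cellPoint a j) m * u m else 0)
          - ((α + (Real.log r - Real.log 2) / (2 * Real.pi) : ℝ) : ℂ) * q j) atTop
      (𝓝 (inner ℂ (kreinVec ha hκ k j) w - ∑ l, kreinMatrix a α κ k j l * q l)) := by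
  have hi := inner_kreinVec ha hκ k j w
  have h1 := tendsto_tsum_norm_le a k hi.summable
  rw [hi.tsum_eq] at h1
  have h2 : Tendsto (fun r => ∑ l, kreinCut a α κ k j l r * q l) atTop
      (𝓝 (∑ l, kreinMatrix a α κ k j l * q l)) :=
    tendsto_finsetSum _ fun l _ => (tendsto_kreinCut ha hκ α k j l).mul_const _
  refine (h1.sub h2).congr fun r => ?_
  have hs : ∀ χ : ℤ × ℤ → ℂ, Summable fun m => χ m * (cutResolvent a κ r k m : ℂ) :=
    summable_mul_cutResolvent ha κ r k
  have e1 : ∀ m, (if ‖dualVec a m + k‖ ≤ r then planeWave a k (cellPoint a j) m * u m else 0) =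
      (if ‖dualVec a m + k‖ ≤ r then
        planeWave a k (cellPoint a j) m * freeResolvent a κ k m * w m else 0) +
      ∑ l, ((1 / cellArea a : ℝ) : ℂ) * q l *
        (planeWave a k (cellPoint a j - cellPoint a l) m * (cutResolvent a κ r k m : ℂ)) := by
    intro m
    rw [cutResolvent]
    split_ifs with h
    · rw [hu]
      simp only [lp.coeFn_add, Pi.add_apply, freeOp_apply, lp.coeFn_smul, Pi.smul_apply,
        Fin.sum_univ_two, smul_eq_mul, kreinVec_apply, ← planeWave_mul_conj]
      ring
    · simp
  have hs1 : Summable fun m => (if ‖dualVec a m + k‖ ≤ r then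
        planeWave a k (cellPoint a j) m * freeResolvent a κ k m * w m else 0) := by
    refine (hs fun m => planeWave a k (cellPoint a j) m * w m).congr fun m => ?_
    rw [cutResolvent]
    split_ifs
    · ring
    · simp
  simp_rw [e1]
  rw [Summable.tsum_add hs1 (summable_sum fun l _ => (hs _).mul_left _),
    Summable.tsum_finsetSum fun l _ => (hs _).mul_left _]
  simp_rw [tsum_mul_left]
  have e2 : ∀ l, ∑' m, planeWave a k (cellPoint a j - cellPoint a l) m *
      (cutResolvent a κ r k m : ℂ) = waveSum a κ (cellPoint a j - cellPoint a l) k r := fun l => rfl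
  simp_rw [e2, kreinCut]
  fin_cases j <;> simp [Fin.sum_univ_two] <;> ring

/-- The fiber relation through the Krein matrix at energy `-κ²`. -/
theorem fiberRel_iff {a κ : ℝ} (ha : 0 < a) (hκ : 0 < κ) (α : ℝ) (k : Plane) (q : Fin 2 → ℂ)
    (u f : DualL2) :
    FiberRel a α k q u f ↔
      u = freeOp hκ a k (f + ((κ ^ 2 : ℝ) : ℂ) • u) +
        ((1 / cellArea a : ℝ) : ℂ) • ∑ j, q j • kreinVec ha hκ k j ∧
      ∀ j, inner ℂ (kreinVec ha hκ k j) (f + ((κ ^ 2 : ℝ) : ℂ) • u) =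
        ∑ l, kreinMatrix a α κ k j l * q l := by
  -- The relation on the left knows nothing of `κ`: the charges are the same at every reference
  -- energy. This is what later permits the passage from the given `κ` to a reference value with
  -- good Krein matrices.
  rw [FiberRel, fiber_eq_iff ha hκ]
  refine and_congr_right fun hu => forall_congr' fun j => ?_
  have ht := tendsto_cutoff ha hκ α k q hu j
  constructor
  · rintro ⟨S, hS, hS0⟩
    have e : S = fun r => ∑' m, if ‖dualVec a m + k‖ ≤ r then
        planeWave a k (cellPoint a j) m * u m else 0 :=
      funext fun r => (isCutoffValue_iff ha k _ u r _).mp (hS r)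
    rw [e] at hS0
    exact sub_eq_zero.mp (tendsto_nhds_unique ht hS0)
  · intro h
    rw [h, sub_self] at ht
    exact ⟨_, fun r => (isCutoffValue_iff ha k _ u r _).mpr rfl, ht⟩

end

end HoneycombScatterer

namespace HoneycombScatterer

noncomputable section

/-! ### The resolvent of a fiber -/

theorem norm_diagOp_sub_le {b b' : ℤ × ℤ → ℝ} {C C' D : ℝ} (hb : ∀ m, |b m| ≤ C)
    (hb' : ∀ m, |b' m| ≤ C') (h : ∀ m, |b m - b' m| ≤ D) :
    ‖diagOp b hb - diagOp b' hb'‖ ≤ D := by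
  have e : diagOp b hb - diagOp b' hb' = diagOp (fun m => b m - b' m) h := by
    ext u m
    simp only [_root_.sub_apply, lp.coeFn_sub, Pi.sub_apply, diagOp_apply]
    push_cast; ring
  rw [e]
  exact norm_diagOp_le h

theorem isCompactOperator_rankOne (x y : DualL2) :
    IsCompactOperator (InnerProductSpace.rankOne ℂ x y) := by
  have h := (isCompactOperator_of_locallyCompactSpace_rng
    (ContinuousLinearMap.toSpanSingleton ℂ x : ℂ →L[ℂ] DualL2)).comp_clm (innerSL ℂ y)
  exact h

theorem isCompactOperator_diagOp_of_finite {b : ℤ × ℤ → ℝ} {C : ℝ} (hb : ∀ m, |b m| ≤ C)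
    (hf : (Function.support b).Finite) : IsCompactOperator (diagOp b hb) := by
  have e : diagOp b hb = ∑ m ∈ hf.toFinset, (b m : ℂ) •
      InnerProductSpace.rankOne ℂ (lp.single 2 m (1 : ℂ)) (lp.single 2 m (1 : ℂ)) := by
    ext u n
    rw [diagOp_apply, _root_.sum_apply]
    simp only [_root_.smul_apply, InnerProductSpace.rankOne_apply, lp.coeFn_sum,
      Finset.sum_apply, lp.coeFn_smul, Pi.smul_apply, lp.inner_single_left]
    by_cases hn : b n = 0
    · rw [hn, Finset.sum_eq_zero]
      · simp
      · intro m hm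
        have hmn : m ≠ n := by
          rintro rfl
          rw [Set.Finite.mem_toFinset] at hm
          exact hm hn
        rw [lp.single_apply, Pi.single_eq_of_ne hmn.symm]; simp
    · rw [Finset.sum_eq_single n]
      · rw [lp.single_apply_self]; simp
      · intro m _ hmn
        rw [lp.single_apply, Pi.single_eq_of_ne hmn.symm]; simp
      · intro h
        exact absurd (by simpa using h) hn
  rw [e]
  exact (compactOperator (RingHom.id ℂ) DualL2 DualL2).sum_mem fun m _ =>
    (compactOperator (RingHom.id ℂ) DualL2 DualL2).smul_mem _ (isCompactOperator_rankOne _ _)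

/-- The diagonal entries tend to zero: cutting off at momentum `r` leaves a finite-rank operator at
distance at most `1/r²`. -/
theorem isCompactOperator_freeOp {a κ : ℝ} (ha : 0 < a) (hκ : 0 < κ) (k : Plane) :
    IsCompactOperator (freeOp hκ a k) := by
  have hb : ∀ r m, |cutResolvent a κ r k m| ≤ 1 / κ ^ 2 := by
    intro r m
    rw [cutResolvent]
    split_ifs
    · exact abs_freeResolvent_le hκ a k m
    · rw [abs_zero]; positivity
  have h0 : Tendsto (fun r : ℝ => 1 / r ^ 2) atTop (𝓝 0) :=
    tendsto_const_nhds.div_atTop (tendsto_pow_atTop two_ne_zero)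
  have ht : Tendsto (fun r : ℝ => diagOp (cutResolvent a κ r k) (hb r)) atTop
      (𝓝 (freeOp hκ a k)) := by
    rw [tendsto_iff_norm_sub_tendsto_zero]
    refine squeeze_zero' (Eventually.of_forall fun _ => norm_nonneg _) ?_ h0
    filter_upwards [eventually_gt_atTop 0] with r hr
    refine norm_diagOp_sub_le _ _ fun m => ?_
    rw [cutResolvent]
    split_ifs with h
    · rw [sub_self, abs_zero]; positivity
    · rw [zero_sub, abs_neg, abs_of_pos (freeResolvent_pos hκ k m), freeResolvent]
      push Not at h
      have : r ^ 2 ≤ ‖dualVec a m + k‖ ^ 2 + κ ^ 2 := by nlinarith [sq_nonneg κ]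
      gcongr
  exact isCompactOperator_of_tendsto ht (Eventually.of_forall fun r =>
    isCompactOperator_diagOp_of_finite _ (finite_support_cutResolvent ha κ r k))

/-- Krein's formula for the resolvent of the fiber at energy `-κ²`. -/
def kreinOp {a κ : ℝ} (ha : 0 < a) (hκ : 0 < κ) (α : ℝ) (k : Plane) : DualL2 →L[ℂ] DualL2 :=
  freeOp hκ a k + ((1 / cellArea a : ℝ) : ℂ) • ∑ j, ∑ l, (kreinMatrix a α κ k)⁻¹ j l •
    InnerProductSpace.rankOne ℂ (kreinVec ha hκ k j) (kreinVec ha hκ k l)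

theorem kreinOp_apply {a κ : ℝ} (ha : 0 < a) (hκ : 0 < κ) (α : ℝ) (k : Plane) (w : DualL2) :
    kreinOp ha hκ α k w = freeOp hκ a k w + ((1 / cellArea a : ℝ) : ℂ) •
      ∑ j, ((kreinMatrix a α κ k)⁻¹.mulVec fun l => inner ℂ (kreinVec ha hκ k l) w) j •
        kreinVec ha hκ k j := by
  simp only [kreinOp, _root_.add_apply, _root_.smul_apply,
    _root_.sum_apply, InnerProductSpace.rankOne_apply, Matrix.mulVec, dotProduct,
    Finset.sum_smul, smul_smul]

theorem isCompactOperator_kreinOp {a κ : ℝ} (ha : 0 < a) (hκ : 0 < κ) (α : ℝ) (k : Plane) :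
    IsCompactOperator (kreinOp ha hκ α k) := by
  have h1 : freeOp hκ a k ∈ compactOperator (RingHom.id ℂ) DualL2 DualL2 :=
    isCompactOperator_freeOp ha hκ k
  exact Submodule.add_mem _ h1 (Submodule.smul_mem _ _ (Submodule.sum_mem _ fun j _ =>
    Submodule.sum_mem _ fun l _ => Submodule.smul_mem _ _ (isCompactOperator_rankOne _ _)))

/-- An invertible Krein matrix lets the charges be solved for and eliminated. -/
theorem mem_fiberGraph_iff_kreinOp {a κ : ℝ} (ha : 0 < a) (hκ : 0 < κ) {α : ℝ} {k : Plane}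
    (hM : IsUnit (kreinMatrix a α κ k)) (u f : DualL2) :
    (u, f) ∈ fiberGraph a (fun _ => α) k ↔
      u = kreinOp ha hκ α k (f + ((κ ^ 2 : ℝ) : ℂ) • u) := by
  have hdet := (Matrix.isUnit_iff_isUnit_det _).mp hM
  rw [mem_fiberGraph_iff]
  simp_rw [fiberRel_iff ha hκ, kreinOp_apply]
  constructor
  · rintro ⟨q, hu, hq⟩
    have e : (fun l => inner ℂ (kreinVec ha hκ k l) (f + ((κ ^ 2 : ℝ) : ℂ) • u)) =
        (kreinMatrix a α κ k).mulVec q := funext hq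
    rw [e, Matrix.mulVec_mulVec, Matrix.nonsing_inv_mul _ hdet, Matrix.one_mulVec]
    exact hu
  · intro hu
    refine ⟨_, hu, fun j => ?_⟩
    change _ = (kreinMatrix a α κ k).mulVec _ j
    rw [Matrix.mulVec_mulVec, Matrix.mul_nonsing_inv _ hdet, Matrix.one_mulVec]

/-- The charge is determined by the Krein matrix. -/
theorem fiberRel_charge {a κ : ℝ} (ha : 0 < a) (hκ : 0 < κ) {α : ℝ} {k : Plane}
    (hM : IsUnit (kreinMatrix a α κ k)) {q : Fin 2 → ℂ} {u f : DualL2}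
    (h : FiberRel a α k q u f) :
    q = (kreinMatrix a α κ k)⁻¹.mulVec fun l =>
      inner ℂ (kreinVec ha hκ k l) (f + ((κ ^ 2 : ℝ) : ℂ) • u) := by
  have hdet := (Matrix.isUnit_iff_isUnit_det _).mp hM
  have e : (fun l => inner ℂ (kreinVec ha hκ k l) (f + ((κ ^ 2 : ℝ) : ℂ) • u)) =
      (kreinMatrix a α κ k).mulVec q := funext ((fiberRel_iff ha hκ α k q u f).mp h).2
  rw [e, Matrix.mulVec_mulVec, Matrix.nonsing_inv_mul _ hdet, Matrix.one_mulVec]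

theorem hasSum_inner_freeOp {κ : ℝ} (hκ : 0 < κ) (a : ℝ) (k : Plane) (v : DualL2) :
    HasSum (fun m => freeResolvent a κ k m * ‖v m‖ ^ 2)
      (RCLike.re (inner ℂ v (freeOp hκ a k v))) := by
  refine ((hasSum_inner_dual v (freeOp hκ a k v)).mapL Complex.reCLM).congr_fun fun m => ?_
  rw [freeOp_apply, Complex.reCLM_apply, mul_left_comm, Complex.re_ofReal_mul, mul_comm _ (v m),
    Complex.mul_conj, Complex.normSq_eq_norm_sq, Complex.ofReal_re]

open ComplexOrder in
theorem inner_kreinOp {a κ : ℝ} (ha : 0 < a) (hκ : 0 < κ) (α : ℝ) (k : Plane) (v : DualL2) :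
    inner ℂ v (kreinOp ha hκ α k v) = inner ℂ v (freeOp hκ a k v) +
      ((1 / cellArea a : ℝ) : ℂ) * (dotProduct (star fun l => inner ℂ (kreinVec ha hκ k l) v)
        ((kreinMatrix a α κ k)⁻¹.mulVec fun l => inner ℂ (kreinVec ha hκ k l) v)) := by
  rw [kreinOp_apply, inner_add_right, inner_smul_right, inner_sum]
  congr 2
  refine Finset.sum_congr rfl fun j _ => ?_
  rw [inner_smul_right, Pi.star_apply, RCLike.star_def, inner_conj_symm, mul_comm]

open ComplexOrder in
-- The correction to the free resolvent is, up to `1/|Γ|`, the quadratic form of the inverse Krein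
-- matrix at the vector of inner products with the Krein vectors. It is nonnegative when the matrix
-- is positive definite.
theorem re_inner_freeOp_le {a κ : ℝ} (ha : 0 < a) (hκ : 0 < κ) {α : ℝ} {k : Plane}
    (hM : (kreinMatrix a α κ k).PosDef) (v : DualL2) :
    RCLike.re (inner ℂ v (freeOp hκ a k v)) ≤ RCLike.re (inner ℂ v (kreinOp ha hκ α k v)) := by
  rw [inner_kreinOp, map_add]
  have h := hM.inv.posSemidef.dotProduct_mulVec_nonneg
    (fun l => inner ℂ (kreinVec ha hκ k l) v)
  have h2 := (Complex.le_def.mp h).1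
  have hc : 0 ≤ 1 / cellArea a := one_div_nonneg.mpr (cellArea_pos ha).le
  have h3 : RCLike.re (((1 / cellArea a : ℝ) : ℂ) *
      (dotProduct (star fun l => inner ℂ (kreinVec ha hκ k l) v)
        ((kreinMatrix a α κ k)⁻¹.mulVec fun l => inner ℂ (kreinVec ha hκ k l) v))) =
      (1 / cellArea a) * (dotProduct (star fun l => inner ℂ (kreinVec ha hκ k l) v)
        ((kreinMatrix a α κ k)⁻¹.mulVec fun l => inner ℂ (kreinVec ha hκ k l) v)).re :=
    Complex.re_ofReal_mul _ _
  rw [h3]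
  exact le_add_of_nonneg_right (mul_nonneg hc h2)

open ComplexOrder in
theorem re_inner_freeOp_lt {a κ : ℝ} (ha : 0 < a) (hκ : 0 < κ) {α : ℝ} {k : Plane}
    (hM : (kreinMatrix a α κ k).PosDef) {v : DualL2} {l : Fin 2}
    (hl : inner ℂ (kreinVec ha hκ k l) v ≠ 0) :
    RCLike.re (inner ℂ v (freeOp hκ a k v)) < RCLike.re (inner ℂ v (kreinOp ha hκ α k v)) := by
  rw [inner_kreinOp, map_add]
  have hne : (fun l => inner ℂ (kreinVec ha hκ k l) v) ≠ 0 := fun h => hl (congrFun h l)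
  have h := (Matrix.posDef_iff_dotProduct_mulVec.mp hM.inv).2 hne
  have h2 := (Complex.lt_def.mp h).1
  have hc : 0 < 1 / cellArea a := one_div_pos.mpr (cellArea_pos ha)
  have h3 : RCLike.re (((1 / cellArea a : ℝ) : ℂ) *
      (dotProduct (star fun l => inner ℂ (kreinVec ha hκ k l) v)
        ((kreinMatrix a α κ k)⁻¹.mulVec fun l => inner ℂ (kreinVec ha hκ k l) v))) =
      (1 / cellArea a) * (dotProduct (star fun l => inner ℂ (kreinVec ha hκ k l) v)
        ((kreinMatrix a α κ k)⁻¹.mulVec fun l => inner ℂ (kreinVec ha hκ k l) v)).re :=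
    Complex.re_ofReal_mul _ _
  rw [h3]
  exact lt_add_of_pos_right _ (mul_pos hc h2)

theorem re_inner_freeOp_pos {κ : ℝ} (hκ : 0 < κ) (a : ℝ) (k : Plane) {v : DualL2} (hv : v ≠ 0) :
    0 < RCLike.re (inner ℂ v (freeOp hκ a k v)) := by
  have h := hasSum_inner_freeOp hκ a k v
  obtain ⟨m, hm⟩ : ∃ m, v m ≠ 0 := by
    by_contra! h0
    exact hv (by ext m; exact h0 m)
  have hp : 0 < freeResolvent a κ k m * ‖v m‖ ^ 2 :=
    mul_pos (freeResolvent_pos hκ k m) (by positivity)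
  refine hp.trans_le (le_hasSum h m fun n _ => ?_)
  exact mul_nonneg (freeResolvent_pos hκ k n).le (by positivity)

theorem isSymmetric_kreinOp {a κ : ℝ} (ha : 0 < a) (hκ : 0 < κ) (α : ℝ) (k : Plane) :
    (kreinOp ha hκ α k : DualL2 →ₗ[ℂ] DualL2).IsSymmetric := by
  intro u v
  have hH : (kreinMatrix a α κ k)⁻¹.IsHermitian := (isHermitian_kreinMatrix ha hκ α k).inv
  have e : ∀ j l, (starRingEnd ℂ) ((kreinMatrix a α κ k)⁻¹ j l) = (kreinMatrix a α κ k)⁻¹ l j :=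
    fun j l => hH.apply l j
  have e2 : ∀ x l, (starRingEnd ℂ) (inner ℂ (kreinVec ha hκ k l) x) =
      inner ℂ x (kreinVec ha hκ k l) := fun x l => inner_conj_symm _ _
  simp only [ContinuousLinearMap.coe_coe, kreinOp_apply, inner_add_left, inner_add_right,
    inner_smul_left, inner_smul_right, Fin.sum_univ_two, Matrix.mulVec, dotProduct, map_add, map_mul,
    Complex.conj_ofReal, e, e2]
  rw [freeOp, inner_diagOp]
  ring

/-! ### Continuity in the quasi-momentum -/

theorem norm_sq_le_of_le {u : DualL2} {b : ℤ × ℤ → ℝ} {B : ℝ} (hb : HasSum b B)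
    (h : ∀ m, ‖u m‖ ^ 2 ≤ b m) : ‖u‖ ^ 2 ≤ B :=
  hasSum_le h (hasSum_norm_sq u) hb

theorem continuous_of_local_lipschitz {X : Type*} [PseudoMetricSpace X] {F : Plane → X}
    (h : ∀ ρ : ℝ, ∃ C, ∀ k k' : Plane, ‖k‖ ≤ ρ → ‖k'‖ ≤ ρ → dist (F k) (F k') ≤ C * ‖k - k'‖) :
    Continuous F := by
  rw [continuous_iff_continuousAt]
  intro k
  obtain ⟨C, hC⟩ := h (‖k‖ + 1)
  rw [ContinuousAt, tendsto_iff_dist_tendsto_zero]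
  have h0 : Tendsto (fun k' => C * ‖k' - k‖) (𝓝 k) (𝓝 0) := by
    have : Continuous fun k' => C * ‖k' - k‖ := by fun_prop
    simpa using this.tendsto k
  refine squeeze_zero' (Eventually.of_forall fun _ => dist_nonneg) ?_ h0
  filter_upwards [Metric.ball_mem_nhds k one_pos] with k' hk'
  refine hC k' k ?_ (by linarith)
  rw [mem_ball_iff_norm] at hk'
  have := norm_le_norm_add_norm_sub' k' k
  linarith

theorem continuous_freeOp {κ : ℝ} (hκ : 0 < κ) (a : ℝ) : Continuous (freeOp hκ a) := by
  refine continuous_of_local_lipschitz fun ρ => ⟨2 * ((1 + ρ) / κ + 1) ^ 3, fun k k' hk hk' => ?_⟩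
  rw [dist_eq_norm]
  refine norm_diagOp_sub_le _ _ fun m => (abs_freeResolvent_sub_le hκ hk hk' m).trans ?_
  have hρ : 0 ≤ ρ := (norm_nonneg _).trans hk
  refine mul_le_of_le_one_right (by positivity) ?_
  rw [div_le_one (by positivity)]
  exact one_le_pow₀ (by linarith [norm_nonneg (dualVec a m)])

theorem continuous_kreinVec {a κ : ℝ} (ha : 0 < a) (hκ : 0 < κ) (j : Fin 2) :
    Continuous fun k => kreinVec ha hκ k j := by
  -- The phase `e^{ik·y}` would cost a separate estimate; after multiplying by it only the resolvent
  -- depends on `k`, and the phase is divided out at the end.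
  have h1 : Continuous fun k => bloch k (cellPoint a j) • kreinVec ha hκ k j := by
    refine continuous_of_local_lipschitz fun ρ =>
      ⟨2 * ((1 + ρ) / κ + 1) ^ 3 * √(∑' m, 1 / (1 + ‖dualVec a m‖) ^ 3), fun k k' hk hk' => ?_⟩
    have hρ : 0 ≤ ρ := (norm_nonneg _).trans hk
    have hS : 0 ≤ ∑' m, 1 / (1 + ‖dualVec a m‖) ^ 3 := tsum_nonneg fun m => by positivity
    rw [dist_eq_norm]
    refine abs_le_of_sq_le_sq' ?_ (by positivity) |>.2
    have e : (2 * ((1 + ρ) / κ + 1) ^ 3 * √(∑' m, 1 / (1 + ‖dualVec a m‖) ^ 3) * ‖k - k'‖) ^ 2 =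
        (2 * ((1 + ρ) / κ + 1) ^ 3 * ‖k - k'‖) ^ 2 * ∑' m, 1 / (1 + ‖dualVec a m‖) ^ 3 := by
      rw [mul_pow, mul_pow, Real.sq_sqrt hS]; ring
    rw [e]
    refine norm_sq_le_of_le ((summable_dualVec ha).hasSum.mul_left _) fun m => ?_
    have e2 : (bloch k (cellPoint a j) • kreinVec ha hκ k j -
        bloch k' (cellPoint a j) • kreinVec ha hκ k' j : DualL2) m =
        (starRingEnd ℂ) (bloch (dualVec a m) (cellPoint a j)) *
          ((freeResolvent a κ k m - freeResolvent a κ k' m : ℝ) : ℂ) := by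
      have hb : ∀ k, bloch k (cellPoint a j) * (starRingEnd ℂ) (bloch k (cellPoint a j)) = 1 := by
        intro k
        rw [Complex.mul_conj, Complex.normSq_eq_norm_sq, norm_bloch]; simp
      simp only [lp.coeFn_sub, Pi.sub_apply, lp.coeFn_smul, Pi.smul_apply, smul_eq_mul,
        kreinVec_apply, planeWave_eq_mul, map_mul]
      push_cast
      linear_combination (starRingEnd ℂ) (bloch (dualVec a m) (cellPoint a j)) *
        (freeResolvent a κ k m) * hb k - (starRingEnd ℂ) (bloch (dualVec a m) (cellPoint a j)) *
        (freeResolvent a κ k' m) * hb k'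
    rw [e2, norm_mul, RCLike.norm_conj, norm_bloch, one_mul, Complex.norm_real, Real.norm_eq_abs]
    have h3 := abs_freeResolvent_sub_le hκ hk hk' (a := a) m
    have h4 : (1 / (1 + ‖dualVec a m‖) ^ 3) ^ 2 ≤ 1 / (1 + ‖dualVec a m‖) ^ 3 := by
      refine pow_le_of_le_one (by positivity) ?_ two_ne_zero
      rw [div_le_one (by positivity)]
      exact one_le_pow₀ (by linarith [norm_nonneg (dualVec a m)])
    calc _ ≤ (2 * ((1 + ρ) / κ + 1) ^ 3 * ‖k - k'‖ * (1 / (1 + ‖dualVec a m‖) ^ 3)) ^ 2 := by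
          gcongr
      _ = (2 * ((1 + ρ) / κ + 1) ^ 3 * ‖k - k'‖) ^ 2 * (1 / (1 + ‖dualVec a m‖) ^ 3) ^ 2 := by ring
      _ ≤ _ := by gcongr
  have h2 : Continuous fun k => (bloch k (cellPoint a j))⁻¹ •
      (bloch k (cellPoint a j) • kreinVec ha hκ k j) :=
    ((continuous_bloch _).inv₀ fun k => bloch_ne_zero k _).smul h1
  refine h2.congr fun k => ?_
  rw [smul_smul, inv_mul_cancel₀ (bloch_ne_zero _ _), one_smul]

theorem continuous_kreinMatrix_inv {a κ : ℝ} (ha : 0 < a) (hκ : 0 < κ) {α : ℝ}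
    (hM : ∀ k, IsUnit (kreinMatrix a α κ k)) (j l : Fin 2) :
    Continuous fun k => (kreinMatrix a α κ k)⁻¹ j l := by
  have hc : Continuous (kreinMatrix a α κ) :=
    continuous_matrix fun j l => continuous_kreinMatrix ha hκ α j l
  have e : ∀ k, (kreinMatrix a α κ k)⁻¹ j l =
      ((kreinMatrix a α κ k).det)⁻¹ * (kreinMatrix a α κ k).adjugate j l := by
    intro k
    rw [Matrix.inv_def, Ring.inverse_eq_inv', Matrix.smul_apply, smul_eq_mul]
  simp_rw [e]
  refine (hc.matrix_det.inv₀ fun k => ?_).mul (hc.matrix_adjugate.matrix_elem j l)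
  exact ((Matrix.isUnit_iff_isUnit_det _).mp (hM k)).ne_zero

theorem continuous_kreinOp {a κ : ℝ} (ha : 0 < a) (hκ : 0 < κ) {α : ℝ}
    (hM : ∀ k, IsUnit (kreinMatrix a α κ k)) : Continuous (kreinOp ha hκ α) := by
  unfold kreinOp
  refine (continuous_freeOp hκ a).add (Continuous.fun_const_smul ?_ _)
  refine continuous_finsetSum _ fun j _ => continuous_finsetSum _ fun l _ => ?_
  refine (continuous_kreinMatrix_inv ha hκ hM j l).smul ?_
  exact (((ContinuousLinearMap.toSpanSingletonCLE (𝕜 := ℂ) (E := DualL2)).continuous.comp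
    (continuous_kreinVec ha hκ j)).clm_comp
    ((innerSL ℂ (E := DualL2)).continuous.comp (continuous_kreinVec ha hκ l)) :)

/-! ### Positivity at large negative energy -/

open ComplexOrder in
-- Diagonal dominance, uniform in `k`: the constant term `α + ln(κ/2)/(2π)` grows without bound,
-- while the Green sums decrease in `κ` and so stay below their values at `κ = 1`.
theorem exists_forall_posDef {a : ℝ} (ha : 0 < a) (α : ℝ) :
    ∃ κ > 0, ∀ k, (kreinMatrix a α κ k).PosDef := by
  set S := greenSum a 1 0 0 + greenSum a 1 1 1 + greenSum a 1 0 1 with hS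
  have h00 := greenSum_nonneg a 1 0 0
  have h11 := greenSum_nonneg a 1 1 1
  have h01 := greenSum_nonneg a 1 0 1
  have hlim : Tendsto (fun κ : ℝ => α + 1 / (2 * Real.pi) * Real.log (κ / 2)) atTop atTop := by
    refine tendsto_atTop_add_const_left _ _ (Tendsto.const_mul_atTop (by positivity) ?_)
    exact Real.tendsto_log_atTop.comp (tendsto_id.atTop_div_const two_pos)
  -- Of the threshold `2S`, one `S` pays for the deviation of the diagonal and for the off-diagonal
  -- entries; the other remains as a margin.
  obtain ⟨κ, hκS, hκ1⟩ := ((hlim.eventually_gt_atTop (2 * S)).and (eventually_ge_atTop 1)).exists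
  have hκ : 0 < κ := one_pos.trans_le hκ1
  refine ⟨κ, hκ, fun k => ?_⟩
  set L := α + 1 / (2 * Real.pi) * Real.log (κ / 2) with hL
  set M := kreinMatrix a α κ k with hMdef
  have hH : M.IsHermitian := isHermitian_kreinMatrix ha hκ α k
  have b : ∀ j l, ‖M j l - (if j = l then (L : ℂ) else 0)‖ ≤ greenSum a 1 j l := fun j l =>
    (norm_kreinMatrix_sub_le ha hκ α k j l).trans (greenSum_anti ha one_pos hκ1 j l)
  have b00 := (Complex.abs_re_le_norm _).trans (b 0 0)
  have b11 := (Complex.abs_re_le_norm _).trans (b 1 1)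
  have b01 := b 0 1
  simp only [if_true, Complex.sub_re, Complex.ofReal_re, Fin.zero_eq_one_iff, OfNat.ofNat_ne_one,
    if_false, sub_zero] at b00 b11 b01
  rw [Matrix.posDef_iff_dotProduct_mulVec]
  refine ⟨hH, fun x hx => ?_⟩
  have him : (dotProduct (star x) (M.mulVec x)).im = 0 := by
    have h := Matrix.IsHermitian.im_star_dotProduct_mulVec_self hH x
    simpa using h
  rw [Complex.lt_def]
  refine ⟨?_, by rw [him]; rfl⟩
  have h10 : M 1 0 = (starRingEnd ℂ) (M 0 1) := (hH.apply 1 0).symm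
  have hd : ∀ j, (M j j).im = 0 := by
    intro j
    have := hH.apply j j
    exact Complex.conj_eq_iff_im.mp this
  have key : (dotProduct (star x) (M.mulVec x)).re = (M 0 0).re * ‖x 0‖ ^ 2 +
      (M 1 1).re * ‖x 1‖ ^ 2 + 2 * ((starRingEnd ℂ) (x 0) * M 0 1 * x 1).re := by
    simp only [dotProduct, Matrix.mulVec, Fin.sum_univ_two, Pi.star_apply, RCLike.star_def, h10,
      ← Complex.normSq_eq_norm_sq, Complex.normSq_apply, Complex.add_re, Complex.mul_re,
      Complex.mul_im, Complex.conj_re, Complex.conj_im, Complex.add_im, hd]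
    ring
  rw [key, Complex.zero_re]
  have hcross : -(greenSum a 1 0 1 * (‖x 0‖ ^ 2 + ‖x 1‖ ^ 2)) ≤
      2 * ((starRingEnd ℂ) (x 0) * M 0 1 * x 1).re := by
    have h1 := Complex.abs_re_le_norm ((starRingEnd ℂ) (x 0) * M 0 1 * x 1)
    rw [norm_mul, norm_mul, RCLike.norm_conj] at h1
    have h2 := neg_le_of_abs_le h1
    have h3 : ‖x 0‖ * ‖M 0 1‖ * ‖x 1‖ ≤ greenSum a 1 0 1 * (‖x 0‖ * ‖x 1‖) := by
      have := mul_le_mul_of_nonneg_right b01 (mul_nonneg (norm_nonneg (x 0)) (norm_nonneg (x 1)))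
      linarith
    nlinarith [sq_nonneg (‖x 0‖ - ‖x 1‖)]
  have hxpos : 0 < ‖x 0‖ ^ 2 + ‖x 1‖ ^ 2 := by
    by_contra! h
    apply hx
    have h0 : ‖x 0‖ = 0 := by nlinarith [sq_nonneg ‖x 0‖, sq_nonneg ‖x 1‖]
    have h1 : ‖x 1‖ = 0 := by nlinarith [sq_nonneg ‖x 0‖, sq_nonneg ‖x 1‖]
    ext j
    fin_cases j
    · exact norm_eq_zero.mp h0
    · exact norm_eq_zero.mp h1
  have c00 : S ≤ (M 0 0).re - greenSum a 1 0 1 := by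
    have := (abs_le.mp b00).1
    linarith
  have c11 : S ≤ (M 1 1).re - greenSum a 1 0 1 := by
    have := (abs_le.mp b11).1
    linarith
  -- Only nonnegativity of the Green sums is at hand, so `S = 0` has to be treated; then the
  -- off-diagonal bound is zero and the diagonal is positive by itself.
  by_cases hS0 : 0 < S
  · nlinarith [sq_nonneg ‖x 0‖, sq_nonneg ‖x 1‖]
  · have hS00 : S = 0 := by linarith
    have : 0 < L := by linarith
    have d00 : 0 < (M 0 0).re := by have := (abs_le.mp b00).1; linarith
    have d11 : 0 < (M 1 1).re := by have := (abs_le.mp b11).1; linarith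
    have z : greenSum a 1 0 1 = 0 := by linarith
    rw [z] at hcross
    rcases (sq_nonneg ‖x 0‖).lt_or_eq with h | h
    · nlinarith [sq_nonneg ‖x 1‖]
    · nlinarith [sq_nonneg ‖x 1‖]

end

end HoneycombScatterer

namespace HoneycombScatterer

noncomputable section

/-! ### The min–max principle for compact positive operators -/

section MinMax

variable {H : Type*} [NormedAddCommGroup H] [InnerProductSpace ℂ H]

/-- The `n`-th min–max value of the quadratic form `⟪v, T v⟫`, counted from above. -/
def minMax (T : H →L[ℂ] H) (n : ℕ) : ℝ :=
  sSup {t : ℝ | ∃ V : Submodule ℂ H, Module.finrank ℂ V = n ∧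
    ∀ v ∈ V, t * ‖v‖ ^ 2 ≤ RCLike.re (inner ℂ v (T v))}

theorem abs_re_inner_le (T : H →L[ℂ] H) (v : H) :
    |RCLike.re (inner ℂ v (T v))| ≤ ‖T‖ * ‖v‖ ^ 2 := by
  refine (RCLike.abs_re_le_norm _).trans ((norm_inner_le_norm _ _).trans ?_)
  have h := T.le_opNorm v
  nlinarith [norm_nonneg v]

theorem bddAbove_minMax (T : H →L[ℂ] H) {n : ℕ} (hn : 0 < n) :
    BddAbove {t : ℝ | ∃ V : Submodule ℂ H, Module.finrank ℂ V = n ∧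
      ∀ v ∈ V, t * ‖v‖ ^ 2 ≤ RCLike.re (inner ℂ v (T v))} := by
  refine ⟨‖T‖, ?_⟩
  rintro t ⟨V, hV, h⟩
  have : Nontrivial V := Module.nontrivial_of_finrank_pos (R := ℂ) (by rw [hV]; exact hn)
  obtain ⟨v, hv⟩ := exists_ne (0 : V)
  have hv0 : (v : H) ≠ 0 := fun e => hv (Subtype.ext e)
  have h1 := h v v.2
  have h2 := (le_abs_self _).trans (abs_re_inner_le T (v : H))
  have h3 : 0 < ‖(v : H)‖ ^ 2 := by positivity
  exact le_of_mul_le_mul_right (h1.trans h2) h3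

theorem le_minMax {T : H →L[ℂ] H} {n : ℕ} (hn : 0 < n) {t : ℝ} (V : Submodule ℂ H)
    (hV : Module.finrank ℂ V = n) (h : ∀ v ∈ V, t * ‖v‖ ^ 2 ≤ RCLike.re (inner ℂ v (T v))) :
    t ≤ minMax T n :=
  le_csSup (bddAbove_minMax T hn) ⟨V, hV, h⟩

/-- Guarantees that the set in `minMax` is nonempty, without which upper bounds on its `sSup` would
say nothing. -/
theorem exists_submodule_finrank_eq (hinf : ¬ FiniteDimensional ℂ H) (n : ℕ) :
    ∃ V : Submodule ℂ H, Module.finrank ℂ V = n := by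
  have hr : (n : Cardinal) ≤ Module.rank ℂ H := by
    have h := Module.rank_lt_aleph0_iff.not.mpr hinf
    exact (Cardinal.natCast_lt_aleph0.le).trans (not_lt.mp h)
  obtain ⟨s, hs, hli⟩ := le_rank_iff_exists_linearIndependent_finset.mp hr
  refine ⟨Submodule.span ℂ (s : Set H), ?_⟩
  rw [finrank_span_set_eq_card hli]
  simp [hs]

/-- A space of dimension `n` meets the orthogonal complement of a space of smaller dimension, since
the projection of the first onto the second has a kernel. -/
theorem minMax_le (hinf : ¬ FiniteDimensional ℂ H) {T : H →L[ℂ] H} {n : ℕ} {t : ℝ}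
    (W : Submodule ℂ H) [FiniteDimensional ℂ W] (hW : Module.finrank ℂ W < n)
    (h : ∀ v ∈ Wᗮ, RCLike.re (inner ℂ v (T v)) ≤ t * ‖v‖ ^ 2) : minMax T n ≤ t := by
  obtain ⟨V₀, hV₀⟩ := exists_submodule_finrank_eq hinf n
  refine csSup_le ⟨-‖T‖, V₀, hV₀, fun v _ => ?_⟩ ?_
  · have := neg_le_of_abs_le (abs_re_inner_le T v)
    linarith
  rintro s ⟨V, hV, hs⟩
  have : FiniteDimensional ℂ V := Module.finite_of_finrank_pos (by omega)
  have hker := LinearMap.ker_ne_bot_of_finrank_lt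
    (f := (W.orthogonalProjectionOnto : H →ₗ[ℂ] W).comp V.subtype) (by rw [hV]; exact hW)
  obtain ⟨v, hv, hv0⟩ := Submodule.exists_mem_ne_zero_of_ne_bot hker
  have hv0' : (v : H) ≠ 0 := fun e => hv0 (Subtype.ext e)
  have hvW : (v : H) ∈ Wᗮ := by
    rw [← Submodule.orthogonalProjectionOnto_eq_zero_iff]
    exact hv
  have h3 : 0 < ‖(v : H)‖ ^ 2 := by positivity
  exact le_of_mul_le_mul_right ((hs v v.2).trans (h v hvW)) h3

/-- Weyl's perturbation bound: an optimal trial space for one operator loses at most `‖T - T'‖` for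
the other. Applied both ways it makes the min–max values 1-Lipschitz in the operator. -/
theorem minMax_le_add (hinf : ¬ FiniteDimensional ℂ H) (T T' : H →L[ℂ] H) {n : ℕ} (hn : 0 < n) :
    minMax T n ≤ minMax T' n + ‖T - T'‖ := by
  obtain ⟨V₀, hV₀⟩ := exists_submodule_finrank_eq hinf n
  refine csSup_le ⟨-‖T‖, V₀, hV₀, fun v _ => ?_⟩ ?_
  · have := neg_le_of_abs_le (abs_re_inner_le T v)
    linarith
  rintro s ⟨V, hV, hs⟩
  have : s - ‖T - T'‖ ≤ minMax T' n := by
    refine le_minMax hn V hV fun v hv => ?_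
    have h1 := hs v hv
    have h2 := (le_abs_self _).trans (abs_re_inner_le (T - T') v)
    rw [_root_.sub_apply, inner_sub_right, map_sub] at h2
    linarith
  linarith

theorem abs_minMax_sub_le (hinf : ¬ FiniteDimensional ℂ H) (T T' : H →L[ℂ] H) {n : ℕ}
    (hn : 0 < n) : |minMax T n - minMax T' n| ≤ ‖T - T'‖ := by
  rw [abs_le]
  have h1 := minMax_le_add hinf T T' hn
  have h2 := minMax_le_add hinf T' T hn
  rw [norm_sub_rev] at h2
  constructor <;> linarith

theorem minMax_anti (hinf : ¬ FiniteDimensional ℂ H) (T : H →L[ℂ] H) {m n : ℕ} (hm : 0 < m)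
    (hmn : m ≤ n) : minMax T n ≤ minMax T m := by
  obtain ⟨V₀, hV₀⟩ := exists_submodule_finrank_eq hinf n
  refine csSup_le ⟨-‖T‖, V₀, hV₀, fun v _ => ?_⟩ ?_
  · have := neg_le_of_abs_le (abs_re_inner_le T v)
    linarith
  rintro s ⟨V, hV, hs⟩
  obtain ⟨V', hV', hle⟩ : ∃ V' : Submodule ℂ H, Module.finrank ℂ V' = m ∧ V' ≤ V := by
    have hr : m ≤ Module.finrank ℂ V := by omega
    obtain ⟨s, hs, hli⟩ := exists_finset_linearIndependent_of_le_finrank hr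
    refine ⟨(Submodule.span ℂ (s : Set V)).map V.subtype, ?_, Submodule.map_subtype_le _ _⟩
    rw [(Submodule.equivMapOfInjective V.subtype V.injective_subtype _).finrank_eq.symm,
      finrank_span_set_eq_card hli]
    simp [hs]
  exact le_minMax hm V' hV' fun v hv => hs v (hle hv)

/-- A compact symmetric operator with trivial kernel has a Hilbert basis of eigenvectors. -/
theorem exists_eigenbasis [CompleteSpace H] {T : H →L[ℂ] H} (hc : IsCompactOperator T)
    (hs : (T : H →ₗ[ℂ] H).IsSymmetric)
    (hpos : ∀ v ≠ 0, 0 < RCLike.re (inner ℂ v (T v))) :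
    ∃ (ι : Type) (b : HilbertBasis ι ℂ H) (μ : ι → ℝ), (∀ i, 0 < μ i) ∧
      ∀ i, T (b i) = (μ i : ℂ) • b i := by
  -- Compactness covers the nonzero eigenvalues; for zero, strict positivity leaves no kernel.
  have hf : ∀ μ : ℂ, FiniteDimensional ℂ (Module.End.eigenspace (T : Module.End ℂ H) μ) := by
    intro μ
    rcases eq_or_ne μ 0 with rfl | hμ
    · have : Module.End.eigenspace (T : Module.End ℂ H) 0 = ⊥ := by
        rw [eq_bot_iff]
        intro v hv
        by_contra hv0
        have h := hpos v hv0
        have h2 : T v = 0 := by simpa using Module.End.mem_eigenspace_iff.mp hv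
        rw [h2, inner_zero_right, map_zero] at h
        exact lt_irrefl _ h
      rw [this]; infer_instance
    · exact ContinuousLinearMap.finite_dimensional_eigenspace hc μ hμ
  -- Orthonormal bases of all eigenspaces are put together. The index type ranges over all complex
  -- numbers, but those which are not eigenvalues contribute an empty fiber.
  let v : (Σ μ : ℂ, Fin (Module.finrank ℂ (Module.End.eigenspace (T : Module.End ℂ H) μ))) → H :=
    fun a => (stdOrthonormalBasis ℂ (Module.End.eigenspace (T : Module.End ℂ H) a.1) a.2 : H)
  have hv : Orthonormal ℂ v :=
    hs.orthogonalFamily_eigenspaces.orthonormal_sigma_orthonormal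
      (v_family := fun μ => stdOrthonormalBasis ℂ (Module.End.eigenspace (T : Module.End ℂ H) μ))
      fun μ => (stdOrthonormalBasis ℂ _).orthonormal
  have hTv : ∀ i, T (v i) = i.1 • v i := fun i =>
    Module.End.mem_eigenspace_iff.mp
      (stdOrthonormalBasis ℂ (Module.End.eigenspace (T : Module.End ℂ H) i.1) i.2).2
  have hsp : (Submodule.span ℂ (Set.range v))ᗮ = ⊥ := by
    rw [eq_bot_iff, ← ContinuousLinearMap.orthogonalComplement_iSup_eigenspaces_eq_bot hc hs]
    refine Submodule.orthogonal_le (iSup_le fun μ => ?_)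
    intro x hx
    have h1 : (⟨x, hx⟩ : Module.End.eigenspace (T : Module.End ℂ H) μ) ∈
        Submodule.span ℂ (Set.range (stdOrthonormalBasis ℂ
          (Module.End.eigenspace (T : Module.End ℂ H) μ))) := by
      rw [← OrthonormalBasis.coe_toBasis, Module.Basis.span_eq]; trivial
    have h2 := Submodule.mem_map_of_mem
      (f := (Module.End.eigenspace (T : Module.End ℂ H) μ).subtype) h1
    rw [Submodule.map_span] at h2
    refine Submodule.span_mono ?_ h2
    rintro _ ⟨_, ⟨i, rfl⟩, rfl⟩
    exact ⟨⟨μ, i⟩, rfl⟩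
  have hreal : ∀ i : (Σ μ : ℂ, Fin (Module.finrank ℂ
      (Module.End.eigenspace (T : Module.End ℂ H) μ))), 0 < i.1.re ∧ i.1 = (i.1.re : ℂ) := by
    intro i
    have hn := hv.1 i
    have h1 : inner ℂ (v i) (T (v i)) = i.1 := by
      rw [hTv, inner_smul_right, inner_self_eq_norm_sq_to_K, hn]; simp
    have h2 : inner ℂ (T (v i)) (v i) = (starRingEnd ℂ) i.1 := by
      rw [hTv, inner_smul_left, inner_self_eq_norm_sq_to_K, hn]; simp
    have h3 : inner ℂ (T (v i)) (v i) = inner ℂ (v i) (T (v i)) := hs (v i) (v i)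
    refine ⟨?_, ?_⟩
    · have h := hpos (v i) (hv.ne_zero i)
      rw [h1] at h
      exact h
    · rw [h1, h2] at h3
      exact (Complex.conj_eq_iff_re.mp h3).symm
  refine ⟨_, HilbertBasis.mkOfOrthogonalEqBot hv hsp, fun i => Complex.re (Sigma.fst i),
    fun i => (hreal i).1, fun i => ?_⟩
  rw [HilbertBasis.coe_mkOfOrthogonalEqBot, hTv, ← (hreal i).2]

variable {ι : Type*} {T : H →L[ℂ] H} {b : HilbertBasis ι ℂ H} {μ : ι → ℝ}

theorem inner_eigenbasis (hs : (T : H →ₗ[ℂ] H).IsSymmetric)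
    (hb : ∀ i, T (b i) = (μ i : ℂ) • b i) (i : ι) (v : H) :
    inner ℂ (b i) (T v) = μ i * inner ℂ (b i) v := by
  rw [← (show inner ℂ (T (b i)) v = inner ℂ (b i) (T v) from hs (b i) v), hb, inner_smul_left,
    Complex.conj_ofReal]

theorem hasSum_eigenbasis (hs : (T : H →ₗ[ℂ] H).IsSymmetric)
    (hb : ∀ i, T (b i) = (μ i : ℂ) • b i) (v : H) :
    HasSum (fun i => μ i * ‖inner ℂ (b i) v‖ ^ 2) (RCLike.re (inner ℂ v (T v))) := by
  have h := (b.hasSum_inner_mul_inner v (T v)).mapL Complex.reCLM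
  refine (congrArg (HasSum · _) (funext fun i => ?_)).mp h
  rw [inner_eigenbasis hs hb, ← inner_conj_symm v (b i), mul_left_comm,
    ← Complex.normSq_eq_conj_mul_self, Complex.normSq_eq_norm_sq, ← Complex.ofReal_mul]
  exact Complex.ofReal_re _

theorem hasSum_norm_sq_eigenbasis (b : HilbertBasis ι ℂ H) (v : H) :
    HasSum (fun i => ‖inner ℂ (b i) v‖ ^ 2) (‖v‖ ^ 2) := by
  have h := (b.hasSum_inner_mul_inner v v).mapL Complex.reCLM
  rw [show Complex.reCLM (inner ℂ v v) = ‖v‖ ^ 2 from inner_self_eq_norm_sq (𝕜 := ℂ) v] at h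
  refine (congrArg (HasSum · _) (funext fun i => ?_)).mp h
  rw [← inner_conj_symm v (b i), ← Complex.normSq_eq_conj_mul_self, Complex.normSq_eq_norm_sq]
  exact Complex.ofReal_re _

/-- Infinitely many orthonormal eigenvectors with eigenvalues at least `t` would have images at
mutual distance at least `t`, hence without a convergent subsequence. -/
theorem finite_setOf_le_eigenvalue (hc : IsCompactOperator T)
    (hb : ∀ i, T (b i) = (μ i : ℂ) • b i) {t : ℝ} (ht : 0 < t) : {i | t ≤ μ i}.Finite := by
  by_contra hinf
  have e := Set.Infinite.natEmbedding _ (show Set.Infinite _ from hinf)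
  have hK := hc.isCompact_closure_image_closedBall (𝕜₁ := ℂ) (𝕜₂ := ℂ) (f := (T : H →ₗ[ℂ] H)) 1
  have hmem : ∀ n, T (b (e n)) ∈ closure (T '' Metric.closedBall 0 1) := fun n =>
    subset_closure ⟨_, by simp [b.orthonormal.1], rfl⟩
  obtain ⟨x, -, φ, hφ, hlim⟩ := hK.tendsto_subseq hmem
  have hca := Metric.cauchySeq_iff.mp hlim.cauchySeq t ht
  obtain ⟨N, hN⟩ := hca
  have h := hN (N + 1) (by omega) N le_rfl
  have hne : (e (φ (N + 1)) : ι) ≠ e (φ N) := by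
    intro h
    have := hφ.injective (e.injective (Subtype.ext h))
    omega
  have h0 : inner ℂ (T (b (e (φ (N + 1))))) (T (b (e (φ N)))) = (0 : ℂ) := by
    rw [hb, hb, inner_smul_left, inner_smul_right, b.orthonormal.2 hne]; simp
  have hsq : ‖T (b (e (φ (N + 1)))) - T (b (e (φ N)))‖ ^ 2
      = ‖T (b (e (φ (N + 1))))‖ ^ 2 + ‖T (b (e (φ N)))‖ ^ 2 := by
    rw [@norm_sub_sq ℂ, h0]; simp
  have hn : t ≤ ‖T (b (e (φ N)))‖ := by
    rw [hb, norm_smul, b.orthonormal.1, mul_one, Complex.norm_real]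
    exact (e (φ N)).2.trans (le_abs_self _)
  rw [dist_eq_norm] at h
  simp only [Function.comp_apply] at h
  nlinarith [norm_nonneg (T (b (e (φ (N + 1)))) - T (b (e (φ N)))), sq_nonneg ‖T (b (e (φ (N + 1))))‖]

theorem finrank_span_hilbertBasis (b : HilbertBasis ι ℂ H) (s : Finset ι) :
    Module.finrank ℂ (Submodule.span ℂ (b '' s)) = s.card := by
  classical
  have hli := b.orthonormal.linearIndependent
  rw [← Finset.coe_image, finrank_span_finset_eq_card, Finset.card_image_of_injective _
    hli.injective]
  rw [Finset.coe_image]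
  exact LinearIndepOn.id_image (hli.linearIndepOn _)

theorem mem_span_hilbertBasis_iff (b : HilbertBasis ι ℂ H) (s : Finset ι) (v : H) :
    v ∈ Submodule.span ℂ (b '' s) ↔ ∀ i ∉ s, inner ℂ (b i) v = 0 := by
  constructor
  · intro hv i hi
    have hle : Submodule.span ℂ (b '' s) ≤ (Submodule.span ℂ {b i})ᗮ := by
      rw [Submodule.span_le]
      rintro _ ⟨j, hj, rfl⟩
      rw [SetLike.mem_coe, Submodule.mem_orthogonal_singleton_iff_inner_right]
      exact b.orthonormal.2 fun h => hi (h ▸ hj)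
    exact Submodule.mem_orthogonal_singleton_iff_inner_right.mp (hle hv)
  · intro h
    have h1 := b.hasSum_repr v
    have h2 : HasSum (fun i => b.repr v i • b i) (∑ i ∈ s, b.repr v i • b i) :=
      hasSum_sum_of_ne_finset_zero fun i hi => by rw [b.repr_apply_apply, h i hi, zero_smul]
    rw [h1.unique h2]
    exact Submodule.sum_mem _ fun i hi =>
      Submodule.smul_mem _ _ (Submodule.subset_span ⟨i, hi, rfl⟩)

theorem le_minMax_of_card_le (hs : (T : H →ₗ[ℂ] H).IsSymmetric)
    (hb : ∀ i, T (b i) = (μ i : ℂ) • b i) {n : ℕ} (hn : 0 < n) {t : ℝ} (s : Finset ι)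
    (hsμ : ∀ i ∈ s, t ≤ μ i) (hcard : s.card = n) : t ≤ minMax T n := by
  refine le_minMax hn (Submodule.span ℂ (b '' s)) (by rw [finrank_span_hilbertBasis, hcard]) ?_
  intro v hv
  refine hasSum_le (fun i => ?_) ((hasSum_norm_sq_eigenbasis b v).mul_left t)
    (hasSum_eigenbasis hs hb v)
  by_cases hi : i ∈ s
  · exact mul_le_mul_of_nonneg_right (hsμ i hi) (by positivity)
  · rw [(mem_span_hilbertBasis_iff b s v).mp hv i hi]; simp

theorem minMax_le_of_card_lt (hinf : ¬ FiniteDimensional ℂ H) (hs : (T : H →ₗ[ℂ] H).IsSymmetric)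
    (hb : ∀ i, T (b i) = (μ i : ℂ) • b i) {n : ℕ} {t : ℝ} (s : Finset ι)
    (hsμ : ∀ i ∉ s, μ i ≤ t) (hcard : s.card < n) : minMax T n ≤ t := by
  have : FiniteDimensional ℂ (Submodule.span ℂ (b '' (s : Set ι))) :=
    FiniteDimensional.span_of_finite ℂ (s.finite_toSet.image b)
  refine minMax_le hinf (Submodule.span ℂ (b '' s)) (by rwa [finrank_span_hilbertBasis]) ?_
  intro v hv
  refine hasSum_le (fun i => ?_) (hasSum_eigenbasis hs hb v)
    ((hasSum_norm_sq_eigenbasis b v).mul_left t)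
  by_cases hi : i ∈ s
  · have : inner ℂ (b i) v = (0 : ℂ) :=
      Submodule.inner_right_of_mem_orthogonal
        (Submodule.subset_span (Set.mem_image_of_mem b (Finset.mem_coe.mpr hi))) hv
    rw [this]; simp
  · exact mul_le_mul_of_nonneg_right (hsμ i hi) (by positivity)

/-- The span of the eigenvectors with eigenvalue at least `t` serves as trial space in one direction
and as constraint space in the other. -/
theorem le_minMax_iff (hinf : ¬ FiniteDimensional ℂ H) (hc : IsCompactOperator T)
    (hs : (T : H →ₗ[ℂ] H).IsSymmetric) (hb : ∀ i, T (b i) = (μ i : ℂ) • b i) {n : ℕ} (hn : 0 < n)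
    {t : ℝ} (ht : 0 < t) : t ≤ minMax T n ↔ n ≤ {i | t ≤ μ i}.ncard := by
  have hfin := finite_setOf_le_eigenvalue hc hb ht
  rw [Set.ncard_eq_toFinset_card _ hfin]
  constructor
  · intro h
    by_contra! hlt
    have hfin2 := finite_setOf_le_eigenvalue hc hb (half_pos ht)
    -- A gap below `t`: only finitely many eigenvalues exceed `t/2`, so those below `t` stay below
    -- some `r < t`. This makes the constraint bound strict.
    obtain ⟨r, hrt, hr⟩ : ∃ r < t, ∀ i, ¬ t ≤ μ i → μ i ≤ r := by
      by_cases hne : (hfin2.toFinset.filter fun i => μ i < t).Nonempty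
      · obtain ⟨i₀, hi₀, hmax⟩ := Finset.exists_max_image _ μ hne
        refine ⟨max (t / 2) (μ i₀), max_lt (by linarith) (Finset.mem_filter.mp hi₀).2, ?_⟩
        intro i hi
        by_cases hi2 : t / 2 ≤ μ i
        · exact le_max_of_le_right (hmax i (Finset.mem_filter.mpr ⟨by simpa using hi2, not_le.mp hi⟩))
        · exact le_max_of_le_left (not_le.mp hi2).le
      · refine ⟨t / 2, by linarith, fun i hi => ?_⟩
        by_contra hi2
        have : i ∈ hfin2.toFinset := by simpa using (not_le.mp hi2).le
        exact hne ⟨i, Finset.mem_filter.mpr ⟨this, not_le.mp hi⟩⟩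
    have := minMax_le_of_card_lt hinf hs hb hfin.toFinset (t := r)
      (fun i hi => hr i (by simpa using hi)) hlt
    linarith
  · intro h
    obtain ⟨s, hss, hcard⟩ := Finset.exists_subset_card_eq h
    exact le_minMax_of_card_le hs hb hn s (fun i hi => by simpa using hss hi) hcard

theorem lt_minMax_iff (hinf : ¬ FiniteDimensional ℂ H) (hc : IsCompactOperator T)
    (hs : (T : H →ₗ[ℂ] H).IsSymmetric) (hb : ∀ i, T (b i) = (μ i : ℂ) • b i) {n : ℕ} (hn : 0 < n)
    {t : ℝ} (ht : 0 < t) : t < minMax T n ↔ n ≤ {i | t < μ i}.ncard := by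
  have hfin : {i | t < μ i}.Finite :=
    (finite_setOf_le_eigenvalue hc hb ht).subset fun i (hi : t < μ i) => hi.le
  constructor
  · intro h
    obtain ⟨r, htr, hr⟩ := exists_between h
    refine ((le_minMax_iff hinf hc hs hb hn (ht.trans htr)).mp hr.le).trans ?_
    exact Set.ncard_le_ncard (fun i hi => htr.trans_le hi) hfin
  · intro h
    have hne : hfin.toFinset.Nonempty := by
      rw [← Finset.card_pos, ← Set.ncard_eq_toFinset_card _ hfin]; omega
    obtain ⟨i₀, hi₀, hmin⟩ := Finset.exists_min_image _ μ hne
    have h0 : t < μ i₀ := by simpa using hi₀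
    refine h0.trans_le ((le_minMax_iff hinf hc hs hb hn (ht.trans h0)).mpr (h.trans ?_))
    exact Set.ncard_le_ncard (fun i hi => hmin i (by simpa using hi))
      (finite_setOf_le_eigenvalue hc hb (ht.trans h0))

theorem minMax_pos [CompleteSpace H] (hinf : ¬ FiniteDimensional ℂ H) (hc : IsCompactOperator T)
    (hs : (T : H →ₗ[ℂ] H).IsSymmetric) (hpos : ∀ v ≠ 0, 0 < RCLike.re (inner ℂ v (T v)))
    {n : ℕ} (hn : 0 < n) : 0 < minMax T n := by
  obtain ⟨ι, b, μ, hμ, hb⟩ := exists_eigenbasis hc hs hpos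
  have hι : Infinite ι := by
    by_contra h
    rw [not_infinite_iff_finite] at h
    have := Fintype.ofFinite ι
    exact hinf (Module.Finite.of_basis (b.toOrthonormalBasis).toBasis)
  obtain ⟨s, hcard⟩ := Infinite.exists_subset_card_eq ι n
  have hne : s.Nonempty := by rw [← Finset.card_pos]; omega
  obtain ⟨i₀, hi₀, hmin⟩ := Finset.exists_min_image s μ hne
  exact (hμ i₀).trans_le (le_minMax_of_card_le hs hb hn s hmin hcard)

theorem finrank_eigenspace_eq (hc : IsCompactOperator T) (hs : (T : H →ₗ[ℂ] H).IsSymmetric)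
    (hb : ∀ i, T (b i) = (μ i : ℂ) • b i) {t : ℝ} (ht : 0 < t) :
    Module.finrank ℂ (Module.End.eigenspace (T : Module.End ℂ H) (t : ℂ)) =
      {i | μ i = t}.ncard := by
  have hfin : {i | μ i = t}.Finite :=
    (finite_setOf_le_eigenvalue hc hb ht).subset fun i hi => le_of_eq (Eq.symm hi)
  rw [Set.ncard_eq_toFinset_card _ hfin, ← finrank_span_hilbertBasis b]
  have e : Module.End.eigenspace (T : Module.End ℂ H) (t : ℂ) =
      Submodule.span ℂ (b '' (hfin.toFinset : Set ι)) := by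
    refine le_antisymm (fun v hv => ?_) ?_
    · rw [mem_span_hilbertBasis_iff]
      intro i hi
      have h1 : T v = (t : ℂ) • v := Module.End.mem_eigenspace_iff.mp hv
      have h2 := inner_eigenbasis hs hb i v
      rw [h1, inner_smul_right] at h2
      have h3 : (t : ℂ) ≠ μ i := by
        intro h; exact hi (by simpa using (Complex.ofReal_injective h).symm)
      by_contra h0
      exact h3 (mul_right_cancel₀ h0 h2)
    · rw [Submodule.span_le]
      rintro _ ⟨i, hi, rfl⟩
      have hi' : μ i = t := by simpa using hi
      refine Module.End.mem_eigenspace_iff.mpr ?_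
      have := hb i
      rw [hi'] at this
      exact this
  rw [e]

/-- The min–max values of a compact positive operator enumerate its eigenvalues. -/
theorem encard_minMax_eq [CompleteSpace H] (hinf : ¬ FiniteDimensional ℂ H) (hc : IsCompactOperator T)
    (hs : (T : H →ₗ[ℂ] H).IsSymmetric) (hpos : ∀ v ≠ 0, 0 < RCLike.re (inner ℂ v (T v)))
    {t : ℝ} (ht : 0 < t) :
    {n : ℕ+ | minMax T n = t}.encard =
      (Module.finrank ℂ (Module.End.eigenspace (T : Module.End ℂ H) (t : ℂ)) : ℕ∞) := by
  obtain ⟨ι, b, μ, hμ, hb⟩ := exists_eigenbasis hc hs hpos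
  have hfin := finite_setOf_le_eigenvalue hc hb ht
  rw [finrank_eigenspace_eq hc hs hb ht]
  have hunion : {i | t ≤ μ i} = {i | t < μ i} ∪ {i | μ i = t} := by
    ext i
    simp only [Set.mem_ofPred_eq, Set.mem_union]
    rw [le_iff_lt_or_eq, eq_comm (a := t)]
  have hcard : {i | t ≤ μ i}.ncard = {i | t < μ i}.ncard + {i | μ i = t}.ncard := by
    have hf1 : {i | t < μ i}.Finite := hfin.subset fun i (hi : t < μ i) => hi.le
    have hf2 : {i | μ i = t}.Finite := hfin.subset fun i hi => le_of_eq (Eq.symm hi)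
    rw [hunion, Set.ncard_union_eq _ hf1 hf2]
    rw [Set.disjoint_left]
    intro i h1 h2
    exact (ne_of_gt h1) h2
  -- The `n`-th value equals `t` exactly when `n` exceeds the number of eigenvalues above `t` but
  -- not the number of those at least `t`; the length of this range is the multiplicity.
  have himage : ((↑) : ℕ+ → ℕ) '' {n : ℕ+ | minMax T n = t} =
      (Finset.Ioc {i | t < μ i}.ncard {i | t ≤ μ i}.ncard : Finset ℕ) := by
    ext n
    simp only [Set.mem_image, Set.mem_ofPred_eq, Finset.coe_Ioc, Set.mem_Ioc]
    constructor
    · rintro ⟨n, hn, rfl⟩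
      refine ⟨?_, (le_minMax_iff hinf hc hs hb n.pos ht).mp hn.ge⟩
      by_contra h
      exact (((lt_minMax_iff hinf hc hs hb n.pos ht).mpr (not_lt.mp h)).ne') hn
    · rintro ⟨h1, h2⟩
      have hn : 0 < n := by omega
      refine ⟨⟨n, hn⟩, le_antisymm ?_ ((le_minMax_iff hinf hc hs hb hn ht).mpr h2), rfl⟩
      by_contra h
      have := (lt_minMax_iff hinf hc hs hb hn ht).mp (not_le.mp h)
      omega
  rw [← PNat.coe_injective.encard_image, himage, Set.encard_coe_eq_coe_finsetCard, Nat.card_Ioc,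
    hcard]
  simp

end MinMax

end

end HoneycombScatterer

namespace HoneycombScatterer

noncomputable section

open scoped ComplexOrder

/-! ### The band functions -/

theorem not_finiteDimensional_dualL2 : ¬ FiniteDimensional ℂ DualL2 := by
  intro h
  have hli : LinearIndependent ℂ fun m : ℤ × ℤ => (lp.single 2 m (1 : ℂ) : DualL2) := by
    refine Orthonormal.linearIndependent ⟨fun m => ?_, fun m m' h => ?_⟩
    · rw [lp.norm_single (by norm_num)]; simp
    · dsimp only
      rw [lp.inner_single_left, lp.single_apply, Pi.single_eq_of_ne h]; simp
  have := hli.finite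
  exact not_finite (ℤ × ℤ)

theorem re_inner_kreinOp_pos {a κ : ℝ} (ha : 0 < a) (hκ : 0 < κ) {α : ℝ} {k : Plane}
    (hM : (kreinMatrix a α κ k).PosDef) {v : DualL2} (hv : v ≠ 0) :
    0 < RCLike.re (inner ℂ v (kreinOp ha hκ α k v)) :=
  (re_inner_freeOp_pos hκ a k hv).trans_le (re_inner_freeOp_le ha hκ hM v)

/-- The `n`-th band function. -/
def band {a κ : ℝ} (ha : 0 < a) (hκ : 0 < κ) (α : ℝ) (k : Plane) (n : ℕ) : ℝ :=
  1 / minMax (kreinOp ha hκ α k) n - κ ^ 2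

theorem minMax_kreinOp_pos {a κ : ℝ} (ha : 0 < a) (hκ : 0 < κ) {α : ℝ} {k : Plane}
    (hM : (kreinMatrix a α κ k).PosDef) {n : ℕ} (hn : 0 < n) :
    0 < minMax (kreinOp ha hκ α k) n :=
  minMax_pos not_finiteDimensional_dualL2 (isCompactOperator_kreinOp ha hκ α k)
    (isSymmetric_kreinOp ha hκ α k) (fun _ hv => re_inner_kreinOp_pos ha hκ hM hv) hn

theorem continuous_band {a κ : ℝ} (ha : 0 < a) (hκ : 0 < κ) {α : ℝ}
    (hM : ∀ k, (kreinMatrix a α κ k).PosDef) {n : ℕ} (hn : 0 < n) :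
    Continuous fun k => band ha hκ α k n := by
  have h : Continuous fun k => minMax (kreinOp ha hκ α k) n := by
    have hl : LipschitzWith 1 fun T : DualL2 →L[ℂ] DualL2 => minMax T n :=
      LipschitzWith.of_dist_le_mul fun T T' => by
        rw [NNReal.coe_one, one_mul, Real.dist_eq, dist_eq_norm]
        exact abs_minMax_sub_le not_finiteDimensional_dualL2 T T' hn
    exact hl.continuous.comp (continuous_kreinOp ha hκ fun k => (hM k).isUnit)
  exact (continuous_const.div h fun k => (minMax_kreinOp_pos ha hκ (hM k) hn).ne').sub
    continuous_const

theorem band_mono {a κ : ℝ} (ha : 0 < a) (hκ : 0 < κ) {α : ℝ} {k : Plane}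
    (hM : (kreinMatrix a α κ k).PosDef) {m n : ℕ} (hm : 0 < m) (hmn : m ≤ n) :
    band ha hκ α k m ≤ band ha hκ α k n := by
  have h := minMax_anti not_finiteDimensional_dualL2 (kreinOp ha hκ α k) hm hmn
  have h2 := minMax_kreinOp_pos ha hκ hM (hm.trans_le hmn)
  exact sub_le_sub_right (one_div_le_one_div_of_le h2 h) _

/-- `toLinearPMap` returns the given relation only if it is single valued. Here that is injectivity
of `kreinOp`, a consequence of its strict positivity. -/
theorem graph_fiberHamiltonian {a κ : ℝ} (ha : 0 < a) (hκ : 0 < κ) {α : ℝ} {k : Plane}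
    (hM : (kreinMatrix a α κ k).PosDef) :
    (fiberHamiltonian a (fun _ => α) k).graph = fiberGraph a (fun _ => α) k := by
  refine Submodule.toLinearPMap_graph_eq _ ?_
  rintro ⟨u, f⟩ h hu
  dsimp only at hu ⊢
  subst hu
  rw [mem_fiberGraph_iff_kreinOp ha hκ hM.isUnit, smul_zero, add_zero] at h
  by_contra hf
  have hp := re_inner_kreinOp_pos ha hκ hM hf
  rw [← h, inner_zero_right, map_zero] at hp
  exact lt_irrefl _ hp

theorem mem_eigenspace_fiberHamiltonian {a κ : ℝ} (ha : 0 < a) (hκ : 0 < κ) {α : ℝ} {k : Plane}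
    (hM : (kreinMatrix a α κ k).PosDef) (z : ℂ) (u : DualL2) :
    u ∈ eigenspace (fiberHamiltonian a (fun _ => α) k) z ↔
      u = (z + ((κ ^ 2 : ℝ) : ℂ)) • kreinOp ha hκ α k u := by
  change (u, z • u) ∈ (fiberHamiltonian a (fun _ => α) k).graph ↔ _
  rw [graph_fiberHamiltonian ha hκ hM, mem_fiberGraph_iff_kreinOp ha hκ hM.isUnit, ← add_smul,
    map_smul]

theorem eigenspace_fiberHamiltonian {a κ : ℝ} (ha : 0 < a) (hκ : 0 < κ) {α : ℝ} {k : Plane}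
    (hM : (kreinMatrix a α κ k).PosDef) {z : ℂ} (hz : z + ((κ ^ 2 : ℝ) : ℂ) ≠ 0) :
    eigenspace (fiberHamiltonian a (fun _ => α) k) z =
      Module.End.eigenspace (kreinOp ha hκ α k : Module.End ℂ DualL2)
        (z + ((κ ^ 2 : ℝ) : ℂ))⁻¹ := by
  ext u
  rw [mem_eigenspace_fiberHamiltonian ha hκ hM, Module.End.mem_eigenspace_iff, eq_comm,
    ← eq_inv_smul_iff₀ hz]
  rfl

/-- Eigenvalues of a fiber lie above the reference energy. -/
theorem eigenvalue_gt {a κ : ℝ} (ha : 0 < a) (hκ : 0 < κ) {α : ℝ} {k : Plane}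
    (hM : (kreinMatrix a α κ k).PosDef) {z : ℂ} {u : DualL2} (hu : u ≠ 0)
    (h : u ∈ eigenspace (fiberHamiltonian a (fun _ => α) k) z) :
    ∃ E : ℝ, z = E ∧ 0 < E + κ ^ 2 := by
  rw [mem_eigenspace_fiberHamiltonian ha hκ hM] at h
  set T := kreinOp ha hκ α k
  set w := z + ((κ ^ 2 : ℝ) : ℂ) with hw
  have hsym : inner ℂ (T u) u = inner ℂ u (T u) := isSymmetric_kreinOp ha hκ α k u u
  have hre : inner ℂ u (T u) = ((RCLike.re (inner ℂ u (T u)) : ℝ) : ℂ) := by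
    have : (starRingEnd ℂ) (inner ℂ u (T u)) = inner ℂ u (T u) := by
      rw [inner_conj_symm, hsym]
    exact (Complex.conj_eq_iff_re.mp this).symm
  have hpos := re_inner_kreinOp_pos ha hκ hM hu
  set p := RCLike.re (inner ℂ u (T u)) with hp
  have hn : 0 < ‖u‖ ^ 2 := by positivity
  have h2 : ((‖u‖ ^ 2 : ℝ) : ℂ) = w * p := by
    rw [← hre, ← inner_smul_right, ← h, inner_self_eq_norm_sq_to_K]
    simp
  have hwv : w = ((‖u‖ ^ 2 / p : ℝ) : ℂ) := by
    rw [Complex.ofReal_div, h2, mul_div_cancel_right₀ _ (by exact_mod_cast hpos.ne')]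
  refine ⟨‖u‖ ^ 2 / p - κ ^ 2, ?_, ?_⟩
  · rw [Complex.ofReal_sub, ← hwv, hw]; ring
  · rw [sub_add_cancel]; exact div_pos hn hpos

theorem band_eq_iff {a κ : ℝ} (ha : 0 < a) (hκ : 0 < κ) {α : ℝ} {k : Plane}
    (hM : (kreinMatrix a α κ k).PosDef) {n : ℕ} (hn : 0 < n) (E : ℝ) :
    band ha hκ α k n = E ↔ 0 < E + κ ^ 2 ∧ minMax (kreinOp ha hκ α k) n = (E + κ ^ 2)⁻¹ := by
  have h := minMax_kreinOp_pos ha hκ hM hn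
  rw [band]
  constructor
  · rintro rfl
    rw [sub_add_cancel]
    exact ⟨by positivity, by rw [one_div, inv_inv]⟩
  · rintro ⟨_, h2⟩
    rw [h2, one_div, inv_inv]; ring

/-- The map `λ ↦ 1/(λ + κ²)` reverses order and matches eigenspaces, so decreasing min–max values
become increasing eigenvalues. All other complex numbers have trivial eigenspace by `eigenvalue_gt`.
-/
theorem isEigenvalueEnumeration_band {a κ : ℝ} (ha : 0 < a) (hκ : 0 < κ) {α : ℝ} {k : Plane}
    (hM : (kreinMatrix a α κ k).PosDef) :
    IsEigenvalueEnumeration (fiberHamiltonian a (fun _ => α) k)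
      (fun n : ℕ+ => band ha hκ α k n) := by
  refine ⟨fun m n hmn => band_mono ha hκ hM m.pos hmn, fun z => ?_⟩
  by_cases hz : ∃ E : ℝ, z = E ∧ 0 < E + κ ^ 2
  · obtain ⟨E, rfl, hE⟩ := hz
    have e : (E : ℂ) + ((κ ^ 2 : ℝ) : ℂ) = ((E + κ ^ 2 : ℝ) : ℂ) := by push_cast; ring
    have hne : (E : ℂ) + ((κ ^ 2 : ℝ) : ℂ) ≠ 0 := by rw [e]; exact_mod_cast hE.ne'
    rw [eigenspace_fiberHamiltonian ha hκ hM hne, e, ← Complex.ofReal_inv]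
    refine ⟨ContinuousLinearMap.finite_dimensional_eigenspace
      (isCompactOperator_kreinOp ha hκ α k) _ (by exact_mod_cast (inv_pos.mpr hE).ne'), ?_⟩
    rw [← encard_minMax_eq not_finiteDimensional_dualL2 (isCompactOperator_kreinOp ha hκ α k)
      (isSymmetric_kreinOp ha hκ α k) (fun _ hv => re_inner_kreinOp_pos ha hκ hM hv)
      (inv_pos.mpr hE)]
    congr 1
    ext n
    simp only [Set.mem_ofPred_eq, Complex.ofReal_inj]
    rw [band_eq_iff ha hκ hM n.pos]
    exact and_iff_right hE
  · have hbot : eigenspace (fiberHamiltonian a (fun _ => α) k) z = ⊥ := by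
      rw [eq_bot_iff]
      intro u hu
      by_contra hu0
      exact hz (eigenvalue_gt ha hκ hM hu0 hu)
    rw [hbot]
    refine ⟨inferInstance, ?_⟩
    rw [finrank_bot, Nat.cast_zero, Set.encard_eq_zero, Set.eq_empty_iff_forall_notMem]
    intro n hn
    exact hz ⟨_, hn.symm, ((band_eq_iff ha hκ hM n.pos _).mp rfl).1⟩

/-- The eigenvalues of a fiber are the values of the band functions. -/
theorem exists_band_eq_iff {a κ : ℝ} (ha : 0 < a) (hκ : 0 < κ) {α : ℝ} {k : Plane}
    (hM : (kreinMatrix a α κ k).PosDef) (z : ℂ) :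
    (∃ n : ℕ+, (band ha hκ α k n : ℂ) = z) ↔
      ∃ u ≠ 0, (u, z • u) ∈ fiberGraph a (fun _ => α) k := by
  obtain ⟨hf, h⟩ := (isEigenvalueEnumeration_band ha hκ hM).2 z
  have e : (∃ n : ℕ+, (band ha hκ α k n : ℂ) = z) ↔
      {n : ℕ+ | (band ha hκ α k n : ℂ) = z}.encard ≠ 0 := by
    rw [ne_eq, Set.encard_eq_zero, ← ne_eq, ← Set.nonempty_iff_ne_empty]; rfl
  rw [e, h, ne_eq, Nat.cast_eq_zero, Submodule.finrank_eq_zero, Submodule.eq_bot_iff]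
  push Not
  rw [← graph_fiberHamiltonian ha hκ hM]
  exact exists_congr fun u => and_comm

end

end HoneycombScatterer

namespace HoneycombScatterer

noncomputable section

/-! ### The fibers of a function on the dual plane -/

/-- The space `L²(Γ*; ℓ²(Λ*))`. -/
abbrev FiberL2 : Type := Lp DualL2 2 cellMeasure

theorem eLpNorm_two_sq {X E : Type*} [MeasurableSpace X] [NormedAddCommGroup E] (f : X → E)
    (μ : Measure X) : eLpNorm f 2 μ ^ 2 = ∫⁻ x, ‖f x‖ₑ ^ 2 ∂μ := by
  have h := eLpNorm_nnreal_pow_eq_lintegral (f := f) (μ := μ) (p := 2) two_ne_zero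
  simpa using h

theorem memLp_two_iff {X E : Type*} [MeasurableSpace X] [NormedAddCommGroup E] {f : X → E}
    {μ : Measure X} (hf : AEStronglyMeasurable f μ) :
    MemLp f 2 μ ↔ ∫⁻ x, ‖f x‖ₑ ^ 2 ∂μ < ⊤ := by
  rw [MemLp, and_iff_right hf, ← eLpNorm_two_sq]
  simp [lt_top_iff_ne_top]

theorem enorm_sq_eq_tsum (u : DualL2) : ‖u‖ₑ ^ 2 = ∑' m, ‖u m‖ₑ ^ 2 := by
  have h := hasSum_norm_sq u
  have e : ∀ x : ℂ, ‖x‖ₑ ^ 2 = ENNReal.ofReal (‖x‖ ^ 2) := fun x => by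
    rw [ENNReal.ofReal_pow (norm_nonneg _), ofReal_norm]
  simp_rw [e]
  rw [← ENNReal.ofReal_tsum_of_nonneg (fun _ => by positivity) h.summable, h.tsum_eq,
    ENNReal.ofReal_pow (norm_nonneg _), ofReal_norm]

theorem memℓp_two_iff_enorm {u : ℤ × ℤ → ℂ} : Memℓp u 2 ↔ ∑' m, ‖u m‖ₑ ^ 2 ≠ ⊤ := by
  rw [memℓp_two_iff]
  have e : ∀ x : ℂ, ‖x‖ₑ ^ 2 = ((‖x‖₊ ^ 2 : NNReal) : ENNReal) := fun x => by
    rw [ENNReal.coe_pow]; rfl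
  simp_rw [e]
  rw [ENNReal.tsum_coe_ne_top_iff_summable, ← NNReal.summable_coe]
  simp

open Classical in
/-- The fiber over `t` of a function on the dual plane. -/
def cellFiber (a : ℝ) (g : Plane → ℂ) (t : Fin 2 → ℝ) : DualL2 :=
  if h : Memℓp (fun m => g (unfoldMap a (t, m))) 2 then ⟨_, h⟩ else 0

theorem cellFiber_apply {a : ℝ} {g : Plane → ℂ} {t : Fin 2 → ℝ}
    (h : Memℓp (fun m => g (unfoldMap a (t, m))) 2) (m : ℤ × ℤ) :
    cellFiber a g t m = g (unfoldMap a (t, m)) := by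
  rw [cellFiber, dif_pos h]

theorem lintegral_enorm_sq_eq_cell {a : ℝ} (ha : 0 < a) {g : Plane → ℂ}
    (hg : AEStronglyMeasurable g volume) :
    ∫⁻ ν, ‖g ν‖ₑ ^ 2 = ENNReal.ofReal (1 / cellArea a) *
      ∫⁻ t, ∑' m, ‖g (unfoldMap a (t, m))‖ₑ ^ 2 ∂cellMeasure := by
  obtain ⟨g', hg', hgg⟩ := hg
  rw [lintegral_congr_ae (g := fun ν => ‖g' ν‖ₑ ^ 2) (hgg.mono fun ν h => by simp [h]),
    lintegral_eq_cell ha (by fun_prop)]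
  congr 1
  refine lintegral_congr_ae ?_
  filter_upwards [ae_cell_of_ae ha hgg] with t ht
  simp_rw [ht]

theorem aemeasurable_tsum_cell {a : ℝ} (ha : 0 < a) {g : Plane → ℂ}
    (hg : AEStronglyMeasurable g volume) :
    AEMeasurable (fun t => ∑' m, ‖g (unfoldMap a (t, m))‖ₑ ^ 2) cellMeasure := by
  obtain ⟨g', hg', hgg⟩ := hg
  refine ⟨fun t => ∑' m, ‖g' (unfoldMap a (t, m))‖ₑ ^ 2, ?_, ?_⟩
  · refine Measurable.tsum fun m => ?_
    exact ((hg'.measurable.comp (measurable_unfoldMap ha m)).enorm).pow_const 2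
  · filter_upwards [ae_cell_of_ae ha hgg] with t ht
    simp_rw [ht]

theorem ae_memℓp_cell {a : ℝ} (ha : 0 < a) {g : Plane → ℂ} (hg : MemLp g 2 volume) :
    ∀ᵐ t ∂cellMeasure, Memℓp (fun m => g (unfoldMap a (t, m))) 2 := by
  have h := (memLp_two_iff hg.1).mp hg
  rw [lintegral_enorm_sq_eq_cell ha hg.1] at h
  have h2 : ∫⁻ t, ∑' m, ‖g (unfoldMap a (t, m))‖ₑ ^ 2 ∂cellMeasure ≠ ⊤ := by
    intro e
    rw [e, ENNReal.mul_top (ofReal_one_div_cellArea_ne_zero ha)] at h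
    exact lt_irrefl _ h
  filter_upwards [ae_lt_top' (aemeasurable_tsum_cell ha hg.1) h2] with t ht
  exact memℓp_two_iff_enorm.mpr ht.ne

theorem ae_cellFiber_apply {a : ℝ} (ha : 0 < a) {g : Plane → ℂ} (hg : MemLp g 2 volume) :
    ∀ᵐ t ∂cellMeasure, ∀ m, cellFiber a g t m = g (unfoldMap a (t, m)) := by
  filter_upwards [ae_memℓp_cell ha hg] with t ht m
  exact cellFiber_apply ht m

/-- A sequence-valued function is the pointwise limit of its finite truncations, so measurability
can be checked on coordinates. -/
theorem aestronglyMeasurable_dual {f : (Fin 2 → ℝ) → DualL2}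
    (hf : ∀ m, AEStronglyMeasurable (fun t => f t m) cellMeasure) :
    AEStronglyMeasurable f cellMeasure := by
  refine aestronglyMeasurable_of_tendsto_ae (u := atTop)
    (f := fun (s : Finset (ℤ × ℤ)) t => ∑ m ∈ s, (lp.single 2 m (f t m) : DualL2)) ?_ ?_
  · intro s
    refine Finset.aestronglyMeasurable_fun_sum _ fun m _ => ?_
    have : Continuous fun z : ℂ => (lp.single 2 m z : DualL2) :=
      (lp.isometry_single (E := fun _ : ℤ × ℤ => ℂ) (p := 2) m).continuous
    exact this.comp_aestronglyMeasurable (hf m)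
  · exact Eventually.of_forall fun t => lp.hasSum_single (by norm_num) (f t)

theorem lintegral_cellFiber {a : ℝ} (ha : 0 < a) {g : Plane → ℂ} (hg : MemLp g 2 volume) :
    ∫⁻ ν, ‖g ν‖ₑ ^ 2 = ENNReal.ofReal (1 / cellArea a) *
      ∫⁻ t, ‖cellFiber a g t‖ₑ ^ 2 ∂cellMeasure := by
  rw [lintegral_enorm_sq_eq_cell ha hg.1]
  congr 1
  refine lintegral_congr_ae ?_
  filter_upwards [ae_cellFiber_apply ha hg] with t ht
  rw [enorm_sq_eq_tsum]
  simp_rw [ht]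

theorem memLp_cellFiber {a : ℝ} (ha : 0 < a) {g : Plane → ℂ} (hg : MemLp g 2 volume) :
    MemLp (cellFiber a g) 2 cellMeasure := by
  have hm : AEStronglyMeasurable (cellFiber a g) cellMeasure := by
    refine aestronglyMeasurable_dual fun m => ?_
    obtain ⟨g', hg', hgg⟩ := hg.1
    refine ⟨fun t => g' (unfoldMap a (t, m)),
      (hg'.measurable.comp (measurable_unfoldMap ha m)).stronglyMeasurable, ?_⟩
    filter_upwards [ae_cellFiber_apply ha hg, ae_cell_of_ae ha hgg] with t h1 h2
    rw [h1, h2]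
  rw [memLp_two_iff hm]
  have h := (memLp_two_iff hg.1).mp hg
  rw [lintegral_cellFiber ha hg] at h
  exact lt_top_iff_ne_top.mpr fun e => by
    rw [e, ENNReal.mul_top (ofReal_one_div_cellArea_ne_zero ha)] at h
    exact lt_irrefl _ h

/-- The unitary (up to scaling) map `L²(ℝ²) → L²(Γ*; ℓ²(Λ*))`. -/
def toFibers {a : ℝ} (ha : 0 < a) : PlaneL2 →ₗ[ℂ] FiberL2 where
  toFun g := (memLp_cellFiber ha (Lp.memLp g)).toLp _
  map_add' g g' := by
    refine Lp.ext ?_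
    filter_upwards [(memLp_cellFiber ha (Lp.memLp (g + g'))).coeFn_toLp,
      (memLp_cellFiber ha (Lp.memLp g)).coeFn_toLp, (memLp_cellFiber ha (Lp.memLp g')).coeFn_toLp,
      ae_cellFiber_apply ha (Lp.memLp (g + g')), ae_cellFiber_apply ha (Lp.memLp g),
      ae_cellFiber_apply ha (Lp.memLp g'), ae_cell_of_ae ha (Lp.coeFn_add g g'),
      Lp.coeFn_add ((memLp_cellFiber ha (Lp.memLp g)).toLp _)
        ((memLp_cellFiber ha (Lp.memLp g')).toLp _)] with t h1 h2 h3 h4 h5 h6 h7 h8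
    rw [h1, h8, Pi.add_apply, h2, h3]
    ext m
    rw [lp.coeFn_add, Pi.add_apply, h4, h5, h6, h7, Pi.add_apply]
  map_smul' c g := by
    refine Lp.ext ?_
    filter_upwards [(memLp_cellFiber ha (Lp.memLp (c • g))).coeFn_toLp,
      (memLp_cellFiber ha (Lp.memLp g)).coeFn_toLp,
      ae_cellFiber_apply ha (Lp.memLp (c • g)), ae_cellFiber_apply ha (Lp.memLp g),
      ae_cell_of_ae ha (Lp.coeFn_smul c g),
      Lp.coeFn_smul c ((memLp_cellFiber ha (Lp.memLp g)).toLp _)] with t h1 h2 h3 h4 h5 h6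
    rw [h1, RingHom.id_apply, h6, Pi.smul_apply, h2]
    ext m
    rw [lp.coeFn_smul, Pi.smul_apply, h3, h4, h5, Pi.smul_apply]

theorem ae_toFibers {a : ℝ} (ha : 0 < a) (g : PlaneL2) :
    ∀ᵐ t ∂cellMeasure, ∀ m, toFibers ha g t m = g (unfoldMap a (t, m)) := by
  filter_upwards [(memLp_cellFiber ha (Lp.memLp g)).coeFn_toLp,
    ae_cellFiber_apply ha (Lp.memLp g)] with t h1 h2 m
  rw [← h2 m, ← h1]; rfl

theorem norm_toFibers {a : ℝ} (ha : 0 < a) (g : PlaneL2) :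
    ‖g‖ ^ 2 = 1 / cellArea a * ‖toFibers ha g‖ ^ 2 := by
  have h := lintegral_cellFiber ha (Lp.memLp g)
  have e : ∫⁻ t, ‖cellFiber a g t‖ₑ ^ 2 ∂cellMeasure
      = ∫⁻ t, ‖toFibers ha g t‖ₑ ^ 2 ∂cellMeasure :=
    lintegral_congr_ae ((memLp_cellFiber ha (Lp.memLp g)).coeFn_toLp.symm.mono fun t ht => by
      dsimp only
      rw [ht]; rfl)
  rw [e, ← eLpNorm_two_sq, ← eLpNorm_two_sq, ← Lp.enorm_def, ← Lp.enorm_def] at h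
  have h2 := congrArg ENNReal.toReal h
  have hc := cellArea_pos ha
  rwa [ENNReal.toReal_mul, ENNReal.toReal_pow, ENNReal.toReal_pow, toReal_enorm, toReal_enorm,
    ENNReal.toReal_ofReal (by positivity)] at h2

/-- The inverse of `unfoldMap`. -/
def unfoldInv (a : ℝ) (ν : Plane) : (Fin 2 → ℝ) × (ℤ × ℤ) :=
  let s : Fin 2 → ℝ := ![inner ℝ ν (v₁ a), inner ℝ ν (v₂ a)]
  (s - intVec (cellIndex s), cellIndex s)

theorem unfoldInv_unfoldMap {a : ℝ} (ha : 0 < a) {t : Fin 2 → ℝ} (ht : t ∈ unitCell)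
    (m : ℤ × ℤ) : unfoldInv a (unfoldMap a (t, m)) = (t, m) := by
  have h1 := inner_momentum_latticeVec ha (t + intVec m) (1, 0)
  have h2 := inner_momentum_latticeVec ha (t + intVec m) (0, 1)
  have e1 : latticeVec a (1, 0) = v₁ a := by simp [latticeVec]
  have e2 : latticeVec a (0, 1) = v₂ a := by simp [latticeVec]
  rw [e1] at h1
  rw [e2] at h2
  have hpi := Real.pi_pos
  have e : (![inner ℝ (unfoldMap a (t, m)) (v₁ a), inner ℝ (unfoldMap a (t, m)) (v₂ a)] :
      Fin 2 → ℝ) = t + intVec m := by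
    ext i
    fin_cases i
    · change inner ℝ ((2 * Real.pi)⁻¹ • momentum a (t + intVec m)) (v₁ a) = (t + intVec m) 0
      rw [inner_smul_left, h1]; simp; field_simp
    · change inner ℝ ((2 * Real.pi)⁻¹ • momentum a (t + intVec m)) (v₂ a) = (t + intVec m) 1
      rw [inner_smul_left, h2]; simp; field_simp
  simp only [unfoldInv, e, cellIndex_add_intVec ht, add_sub_cancel_right]

theorem measurable_unfoldInv (a : ℝ) : Measurable (unfoldInv a) := by
  have hs : Measurable fun ν : Plane => (![inner ℝ ν (v₁ a), inner ℝ ν (v₂ a)] : Fin 2 → ℝ) := by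
    refine measurable_pi_lambda _ fun i => ?_
    fin_cases i
    · exact (continuous_id.inner continuous_const).measurable
    · exact (continuous_id.inner continuous_const).measurable
  have hi := measurable_cellIndex.comp hs
  have hv : Measurable intVec := measurable_of_countable _
  exact (hs.sub (hv.comp hi)).prodMk hi

theorem measurable_dual_apply (m : ℤ × ℤ) : Continuous fun u : DualL2 => u m :=
  (lp.evalCLM ℂ (fun _ : ℤ × ℤ => ℂ) 2 m).continuous

theorem toFibers_surjective {a : ℝ} (ha : 0 < a) : Function.Surjective (toFibers ha) := by
  intro G
  set g : Plane → ℂ := fun ν => G (unfoldInv a ν).1 (unfoldInv a ν).2 with hg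
  have hG : Measurable fun p : (Fin 2 → ℝ) × (ℤ × ℤ) => G p.1 p.2 :=
    measurable_from_prod_countable_left fun m =>
      ((measurable_dual_apply m).comp_stronglyMeasurable (Lp.stronglyMeasurable G)).measurable
  have hgm : Measurable g := hG.comp (measurable_unfoldInv a)
  have hgu : ∀ t ∈ unitCell, ∀ m, g (unfoldMap a (t, m)) = G t m := by
    intro t ht m
    simp only [hg, unfoldInv_unfoldMap ha ht]
  have hg2 : MemLp g 2 volume := by
    rw [memLp_two_iff hgm.aestronglyMeasurable,
      lintegral_enorm_sq_eq_cell ha hgm.aestronglyMeasurable]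
    refine ENNReal.mul_lt_top ENNReal.ofReal_lt_top ?_
    refine lt_of_eq_of_lt ?_ ((memLp_two_iff (Lp.aestronglyMeasurable G)).mp (Lp.memLp G))
    refine lintegral_congr_ae ?_
    filter_upwards [ae_mem_unitCell] with t ht
    simp_rw [hgu t ht, enorm_sq_eq_tsum]
  refine ⟨hg2.toLp g, Lp.ext ?_⟩
  filter_upwards [ae_toFibers ha (hg2.toLp g), ae_cell_of_ae ha hg2.coeFn_toLp,
    ae_mem_unitCell] with t h1 h2 h3
  ext m
  rw [h1, h2, hgu t h3]

theorem toFibers_bijective {a : ℝ} (ha : 0 < a) : Function.Bijective (toFibers ha) := by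
  refine ⟨(injective_iff_map_eq_zero _).mpr fun g hg => ?_, toFibers_surjective ha⟩
  have h := norm_toFibers ha g
  rw [hg] at h
  simpa using h

/-- `toFibers` as a continuous linear equivalence. -/
def toFibersEquiv {a : ℝ} (ha : 0 < a) : PlaneL2 ≃L[ℂ] FiberL2 :=
  (LinearEquiv.ofBijective (toFibers ha) (toFibers_bijective ha)).toContinuousLinearEquivOfBounds
    (√(cellArea a)) (√(1 / cellArea a))
    (fun g => by
      have h := norm_toFibers ha g
      have hc := cellArea_pos ha
      rw [LinearEquiv.ofBijective_apply]
      refine (pow_le_pow_iff_left₀ (norm_nonneg _) (by positivity) two_ne_zero).mp ?_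
      rw [mul_pow, Real.sq_sqrt hc.le, h]
      field_simp; rfl)
    (fun G => by
      obtain ⟨g, rfl⟩ :=
        (LinearEquiv.ofBijective (toFibers ha) (toFibers_bijective ha)).surjective G
      have h := norm_toFibers ha g
      have hc := cellArea_pos ha
      rw [LinearEquiv.symm_apply_apply, LinearEquiv.ofBijective_apply]
      refine (pow_le_pow_iff_left₀ (norm_nonneg _) (by positivity) two_ne_zero).mp ?_
      rw [mul_pow, Real.sq_sqrt (by positivity), h])

/-- The Floquet transform. -/
def floquet {a : ℝ} (ha : 0 < a) : PlaneL2 ≃L[ℂ] FiberL2 :=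
  (Lp.fourierTransformₗᵢ Plane ℂ).toContinuousLinearEquiv.trans (toFibersEquiv ha)

open FourierTransform in
theorem ae_floquet {a : ℝ} (ha : 0 < a) (ψ : PlaneL2) :
    ∀ᵐ t ∂cellMeasure, ∀ m, floquet ha ψ t m = (𝓕 ψ : PlaneL2) (unfoldMap a (t, m)) :=
  ae_toFibers ha (𝓕 ψ)

end

end HoneycombScatterer

namespace HoneycombScatterer

noncomputable section

/-! ### The Green function as an element of `L²` -/

theorem exists_norm_kreinVec_le {a κ : ℝ} (ha : 0 < a) (hκ : 0 < κ) :
    ∃ C, ∀ t ∈ unitCell, ∀ j, ‖kreinVec ha hκ (momentum a t) j‖ ≤ C := by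
  have h : ∀ j, ∃ C, ∀ k ∈ Metric.closedBall (0 : Plane) (‖k₁ a‖ + ‖k₂ a‖),
      ‖kreinVec ha hκ k j‖ ≤ C := fun j =>
    (isCompact_closedBall _ _).exists_bound_of_continuousOn (continuous_kreinVec ha hκ j).continuousOn
  choose C hC using h
  refine ⟨max (C 0) (C 1), fun t ht j => ?_⟩
  have hk : momentum a t ∈ Metric.closedBall (0 : Plane) (‖k₁ a‖ + ‖k₂ a‖) := by
    simpa using norm_momentum_le ht
  fin_cases j
  · exact (hC 0 _ hk).trans (le_max_left _ _)
  · exact (hC 1 _ hk).trans (le_max_right _ _)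

theorem resolventSymbol_unfoldMap (a κ : ℝ) (t : Fin 2 → ℝ) (m : ℤ × ℤ) :
    1 / (‖(2 * Real.pi) • unfoldMap a (t, m)‖ ^ 2 + κ ^ 2) = freeResolvent a κ (momentum a t) m := by
  rw [two_pi_smul_unfoldMap, freeResolvent]

theorem conj_greenSymbol (κ : ℝ) (x ν : Plane) :
    (starRingEnd ℂ) (greenSymbol κ x ν) = greenSymbol κ (-x) ν := by
  rw [greenSymbol, greenSymbol, map_mul, Complex.conj_ofReal, bloch_neg, ← Complex.inv_eq_conj]
  exact norm_bloch _ _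

theorem greenSymbol_unfoldMap {a κ : ℝ} (ha : 0 < a) (hκ : 0 < κ) (t : Fin 2 → ℝ) (n m : ℤ × ℤ)
    (j : Fin 2) :
    greenSymbol κ (-sitePoint a (n, j)) (unfoldMap a (t, m)) =
      cellChar (-n) t * kreinVec ha hκ (momentum a t) j m := by
  rw [← conj_greenSymbol, greenSymbol, resolventSymbol_unfoldMap, two_pi_smul_unfoldMap,
    ← planeWave_eq_bloch, sitePoint, planeWave_add_latticeVec ha, kreinVec_apply, cellChar_neg,
    map_mul, map_mul, Complex.conj_ofReal]
  ring

/-- Unfolding reduces the norm to that of the Krein vectors, which are bounded over the cell. The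
symbol does not involve the lattice, so any lattice will do; the one with `a = 1` is used. -/
theorem memLp_greenSymbol {κ : ℝ} (hκ : 0 < κ) (x : Plane) :
    MemLp (greenSymbol κ x) 2 volume := by
  have hm := (continuous_greenSymbol hκ x).aestronglyMeasurable (μ := volume)
  rw [memLp_two_iff hm, lintegral_enorm_sq_eq_cell one_pos hm]
  obtain ⟨C, hC⟩ := exists_norm_kreinVec_le one_pos hκ
  refine ENNReal.mul_lt_top ENNReal.ofReal_lt_top ?_
  refine lt_of_le_of_lt (b := ∫⁻ _ : Fin 2 → ℝ, (ENNReal.ofReal C) ^ 2 ∂cellMeasure) ?_ (by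
    rw [lintegral_const]; simp)
  refine lintegral_mono_ae ?_
  filter_upwards [ae_mem_unitCell] with t ht
  have e : ∀ m, ‖greenSymbol κ x (unfoldMap 1 (t, m))‖ₑ
      = ‖kreinVec one_pos hκ (momentum 1 t) 0 m‖ₑ := by
    intro m
    rw [← ofReal_norm, ← ofReal_norm, norm_greenSymbol, kreinVec_apply, norm_mul, RCLike.norm_conj,
      norm_planeWave, one_mul, resolventSymbol_unfoldMap, Complex.norm_real,
      Real.norm_of_nonneg (freeResolvent_pos hκ _ _).le]
  simp_rw [e, ← enorm_sq_eq_tsum]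
  rw [← ofReal_norm]
  gcongr
  exact hC t ht 0

open FourierTransform in
/-- `G(· - x)` as an element of `L²`. -/
def greenL2 {κ : ℝ} (hκ : 0 < κ) (x : Plane) : PlaneL2 :=
  𝓕⁻ ((memLp_greenSymbol hκ (-x)).toLp _)

open FourierTransform in
-- `greenL2` is given by its symbol and `green` by a time integral. `fourier_green` matches the
-- transforms, and uniqueness for an integrable function whose transform is in `L²` identifies the
-- two.
theorem coeFn_greenL2 {κ : ℝ} (hκ : 0 < κ) (x : Plane) :
    greenL2 hκ x =ᵐ[volume] fun x' => (green κ (x' - x) : ℂ) := by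
  refine (ae_eq_fourierInv_of_fourier_ae_eq (g := fun x' => (green κ (x' - x) : ℂ))
    ((integrable_green hκ).comp_sub_right x).ofReal ?_).symm
  filter_upwards [(memLp_greenSymbol hκ (-x)).coeFn_toLp] with ν hν
  rw [hν, fourier_apply_eq, greenSymbol, ← fourier_green hκ, fourier_apply_eq,
    ← integral_const_mul,
    ← integral_add_right_eq_self (fun x' => bloch ((2 * Real.pi) • ν) (-x') * _) x]
  congr 1; funext x'
  rw [add_sub_cancel_right, neg_add, bloch_add_right]
  ring

theorem inner_planeL2_eq {a : ℝ} (ha : 0 < a) (f g : PlaneL2) :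
    inner ℂ f g = ((1 / cellArea a : ℝ) : ℂ) *
      ∫ t, inner ℂ (floquet ha f t) (floquet ha g t) ∂cellMeasure := by
  have hc := cellArea_pos ha
  have hs : √(1 / cellArea a) * √(1 / cellArea a) = 1 / cellArea a :=
    Real.mul_self_sqrt (by positivity)
  let U : PlaneL2 →ₗᵢ[ℂ] FiberL2 :=
    { toLinearMap := (√(1 / cellArea a) : ℂ) • toFibers ha
      norm_map' := fun g => by
        have h := norm_toFibers ha g
        rw [LinearMap.smul_apply, norm_smul, Complex.norm_real,
          Real.norm_of_nonneg (Real.sqrt_nonneg _)]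
        refine (pow_left_inj₀ (by positivity) (norm_nonneg _) two_ne_zero).mp ?_
        rw [mul_pow, Real.sq_sqrt (by positivity), h] }
  have h1 := (Lp.fourierTransformₗᵢ Plane ℂ).inner_map_map f g
  rw [← h1, ← U.inner_map_map]
  change inner ℂ ((√(1 / cellArea a) : ℂ) • floquet ha f) ((√(1 / cellArea a) : ℂ) • floquet ha g)
    = _
  rw [inner_smul_left, inner_smul_right, ← mul_assoc, Complex.conj_ofReal, ← Complex.ofReal_mul, hs,
    L2.inner_def]

theorem integrable_green_mul {κ : ℝ} (hκ : 0 < κ) (w : PlaneL2) (x : Plane) :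
    Integrable (fun x' => (green κ (x - x') : ℂ) * w x') ∧
      ∫ x', (green κ (x - x') : ℂ) * w x' = inner ℂ (greenL2 hκ x) w := by
  have e : (fun x' => inner ℂ (greenL2 hκ x x') (w x')) =ᵐ[volume]
      fun x' => (green κ (x - x') : ℂ) * w x' := by
    filter_upwards [coeFn_greenL2 hκ x] with x' hx'
    rw [hx', RCLike.inner_apply, Complex.conj_ofReal, ← green_neg, neg_sub, mul_comm]
  refine ⟨(L2.integrable_inner _ _).congr e, ?_⟩
  rw [L2.inner_def, integral_congr_ae e]

/-- The potential always exists, since it is a pairing with an `L²` function, and it is determined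
at every point. -/
theorem isGreenPotential_iff {κ : ℝ} (hκ : 0 < κ) (w : PlaneL2) (φ : Plane → ℂ) :
    IsGreenPotential κ w φ ↔ φ = fun x => inner ℂ (greenL2 hκ x) w := by
  rw [funext_iff]
  refine forall_congr' fun x => ?_
  rw [and_iff_right (integrable_green_mul hκ w x).1, (integrable_green_mul hκ w x).2]

open FourierTransform in
theorem inner_greenL2 {κ : ℝ} (hκ : 0 < κ) (w : PlaneL2) (x : Plane) :
    inner ℂ (greenL2 hκ x) w = ∫ ν, greenSymbol κ x ν * (𝓕 w : PlaneL2) ν := by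
  rw [← (Lp.fourierTransformₗᵢ Plane ℂ).inner_map_map]
  have e : Lp.fourierTransformₗᵢ Plane ℂ (greenL2 hκ x) = (memLp_greenSymbol hκ (-x)).toLp _ :=
    (Lp.fourierTransformₗᵢ Plane ℂ).apply_symm_apply _
  rw [e, L2.inner_def]
  refine integral_congr_ae ?_
  filter_upwards [(memLp_greenSymbol hκ (-x)).coeFn_toLp] with ν hν
  rw [hν, RCLike.inner_apply, conj_greenSymbol, neg_neg, mul_comm]
  rfl

open FourierTransform in
-- A Green function centred at a site splits in the fibers into a character, which records the cell,
-- and a Krein vector, which records the sublattice.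
theorem floquet_greenL2 {a κ : ℝ} (ha : 0 < a) (hκ : 0 < κ) (n : ℤ × ℤ) (j : Fin 2) :
    ∀ᵐ t ∂cellMeasure, floquet ha (greenL2 hκ (sitePoint a (n, j))) t =
      cellChar (-n) t • kreinVec ha hκ (momentum a t) j := by
  have e : (𝓕 (greenL2 hκ (sitePoint a (n, j))) : PlaneL2) =
      (memLp_greenSymbol hκ (-sitePoint a (n, j))).toLp _ :=
    (Lp.fourierTransformₗᵢ Plane ℂ).apply_symm_apply _
  filter_upwards [ae_floquet ha (greenL2 hκ (sitePoint a (n, j))),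
    ae_cell_of_ae ha (memLp_greenSymbol hκ (-sitePoint a (n, j))).coeFn_toLp] with t h1 h2
  ext m
  rw [h1, e, h2, greenSymbol_unfoldMap ha hκ]
  rfl

/-- The potential at a site, in terms of the fibers. -/
theorem inner_greenL2_site {a κ : ℝ} (ha : 0 < a) (hκ : 0 < κ) (w : PlaneL2) (n : ℤ × ℤ)
    (j : Fin 2) : inner ℂ (greenL2 hκ (sitePoint a (n, j))) w = ((1 / cellArea a : ℝ) : ℂ) *
      ∫ t, cellChar n t * inner ℂ (kreinVec ha hκ (momentum a t) j) (floquet ha w t)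
        ∂cellMeasure := by
  rw [inner_planeL2_eq ha]
  congr 1
  refine integral_congr_ae ?_
  filter_upwards [floquet_greenL2 ha hκ n j] with t ht
  rw [ht, inner_smul_left, cellChar_neg, Complex.conj_conj]

open FourierTransform in
theorem memLp_resolventSymbol_mul {κ : ℝ} (hκ : 0 < κ) (w : PlaneL2) :
    MemLp (fun ν => ((1 / (‖(2 * Real.pi) • ν‖ ^ 2 + κ ^ 2) : ℝ) : ℂ) * w ν) 2 volume := by
  refine MemLp.of_le_mul (c := 1 / κ ^ 2) (Lp.memLp w)
    ((Complex.continuous_ofReal.comp (continuous_resolventSymbol hκ)).aestronglyMeasurable.mul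
      (Lp.aestronglyMeasurable w)) (Eventually.of_forall fun ν => ?_)
  rw [norm_mul, Complex.norm_real, Real.norm_of_nonneg (by positivity)]
  gcongr
  exact le_add_of_nonneg_left (by positivity)

open FourierTransform in
/-- The free resolvent on `L²(ℝ²)`. -/
def freeL2 {κ : ℝ} (hκ : 0 < κ) (w : PlaneL2) : PlaneL2 :=
  𝓕⁻ ((memLp_resolventSymbol_mul hκ (𝓕 w)).toLp _)

open FourierTransform in
theorem coeFn_freeL2 {κ : ℝ} (hκ : 0 < κ) (w : PlaneL2) :
    freeL2 hκ w =ᵐ[volume] fun x => inner ℂ (greenL2 hκ x) w := by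
  have hi : Integrable fun ν => ((1 / (‖(2 * Real.pi) • ν‖ ^ 2 + κ ^ 2) : ℝ) : ℂ)
      * (𝓕 w : PlaneL2) ν := by
    have h := memLp_greenSymbol hκ 0
    have e : greenSymbol κ 0 = fun ν => ((1 / (‖(2 * Real.pi) • ν‖ ^ 2 + κ ^ 2) : ℝ) : ℂ) := by
      funext ν; rw [greenSymbol, bloch_zero, one_mul]
    rw [e] at h
    exact h.integrable_mul (Lp.memLp _)
  refine (fourierInv_ae_eq hi (memLp_resolventSymbol_mul hκ (𝓕 w)).coeFn_toLp.symm).symm.trans ?_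
  refine Eventually.of_forall fun x => ?_
  dsimp only
  rw [fourierInv_apply_eq, inner_greenL2]
  congr 1; funext ν
  rw [greenSymbol, mul_assoc]

open FourierTransform in
theorem floquet_freeL2 {a κ : ℝ} (ha : 0 < a) (hκ : 0 < κ) (w : PlaneL2) :
    ∀ᵐ t ∂cellMeasure, floquet ha (freeL2 hκ w) t = freeOp hκ a (momentum a t) (floquet ha w t) := by
  have e : (𝓕 (freeL2 hκ w) : PlaneL2) = (memLp_resolventSymbol_mul hκ (𝓕 w)).toLp _ :=
    (Lp.fourierTransformₗᵢ Plane ℂ).apply_symm_apply _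
  filter_upwards [ae_floquet ha (freeL2 hκ w), ae_floquet ha w,
    ae_cell_of_ae ha (memLp_resolventSymbol_mul hκ (𝓕 w)).coeFn_toLp] with t h1 h2 h3
  ext m
  rw [h1, e, h3, freeOp_apply, resolventSymbol_unfoldMap, h2]

end

end HoneycombScatterer

namespace HoneycombScatterer

noncomputable section

/-! ### The Hamiltonian through its fibers -/

theorem continuous_momentum_kreinVec {a κ : ℝ} (ha : 0 < a) (hκ : 0 < κ) (j : Fin 2) :
    Continuous fun t => kreinVec ha hκ (momentum a t) j :=
  (continuous_kreinVec ha hκ j).comp (continuous_momentum a)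

theorem memLp_smul_kreinVec {a κ : ℝ} (ha : 0 < a) (hκ : 0 < κ) (j : Fin 2) (θ : CellL2) :
    MemLp (fun t => θ t • kreinVec ha hκ (momentum a t) j) 2 cellMeasure := by
  obtain ⟨C, hC⟩ := exists_norm_kreinVec_le ha hκ
  refine MemLp.of_le_mul (c := C) (Lp.memLp θ) ((Lp.aestronglyMeasurable θ).smul
    (continuous_momentum_kreinVec ha hκ j).aestronglyMeasurable) ?_
  filter_upwards [ae_mem_unitCell] with t ht
  rw [norm_smul, mul_comm]
  exact mul_le_mul_of_nonneg_right (hC t ht j) (norm_nonneg _)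

/-- The source operator: charges to fibers of the potential. -/
def sourceOp {a κ : ℝ} (ha : 0 < a) (hκ : 0 < κ) (j : Fin 2) : CellL2 →L[ℂ] FiberL2 :=
  LinearMap.mkContinuousOfExistsBound
    { toFun := fun θ => (memLp_smul_kreinVec ha hκ j θ).toLp _
      map_add' := fun θ θ' => by
        rw [← MemLp.toLp_add]
        refine MemLp.toLp_congr _ _ ?_
        filter_upwards [Lp.coeFn_add θ θ'] with t ht
        rw [ht, Pi.add_apply, add_smul, Pi.add_apply]
      map_smul' := fun c θ => by
        rw [RingHom.id_apply, ← MemLp.toLp_const_smul]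
        refine MemLp.toLp_congr _ _ ?_
        filter_upwards [Lp.coeFn_smul c θ] with t ht
        rw [ht, Pi.smul_apply, smul_assoc, Pi.smul_apply] }
    (by
      obtain ⟨C, hC⟩ := exists_norm_kreinVec_le ha hκ
      refine ⟨C, fun θ => ?_⟩
      refine Lp.norm_le_mul_norm_of_ae_le_mul (f := (memLp_smul_kreinVec ha hκ j θ).toLp _)
        (g := θ) ?_
      filter_upwards [ae_mem_unitCell, (memLp_smul_kreinVec ha hκ j θ).coeFn_toLp] with t ht h
      rw [h, norm_smul, mul_comm]
      exact mul_le_mul_of_nonneg_right (hC t ht j) (norm_nonneg _))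

theorem coeFn_sourceOp {a κ : ℝ} (ha : 0 < a) (hκ : 0 < κ) (j : Fin 2) (θ : CellL2) :
    sourceOp ha hκ j θ =ᵐ[cellMeasure] fun t => θ t • kreinVec ha hκ (momentum a t) j :=
  (memLp_smul_kreinVec ha hκ j θ).coeFn_toLp

theorem sourceOp_cellBasis {a κ : ℝ} (ha : 0 < a) (hκ : 0 < κ) (n : ℤ × ℤ) (j : Fin 2) :
    sourceOp ha hκ j (cellBasis (-n)) = floquet ha (greenL2 hκ (sitePoint a (n, j))) := by
  refine Lp.ext ?_
  filter_upwards [coeFn_sourceOp ha hκ j (cellBasis (-n)), coeFn_cellBasis (-n),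
    floquet_greenL2 ha hκ n j] with t h1 h2 h3
  rw [h1, h2, h3]

theorem hasSum_prod_fin {β M : Type*} [AddCommMonoid M] [TopologicalSpace M] [ContinuousAdd M]
    {f : β × Fin 2 → M} {s : Fin 2 → M} (h : ∀ j, HasSum (fun n => f (n, j)) (s j)) :
    HasSum f (∑ j, s j) := by
  have h2 : ∀ j, HasSum (fun p : β × Fin 2 => if p.2 = j then f p else 0) (s j) := by
    intro j
    have hinj : Function.Injective fun n : β => (n, j) := fun n n' h => congrArg Prod.fst h
    refine (hinj.hasSum_iff ?_).mp ?_
    · rintro ⟨n, j'⟩ hn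
      rw [if_neg]
      rintro rfl
      exact hn ⟨n, rfl⟩
    · simpa [Function.comp_def] using h j
  refine (hasSum_sum fun j _ => h2 j).congr_fun ?_
  intro p
  simp

/-- The charge at a site, from its Fourier series. -/
def siteCharge (θ : Fin 2 → CellL2) (p : (ℤ × ℤ) × Fin 2) : ℂ := cellBasis.repr (θ p.2) (-p.1)

/-- Expand `θ` in characters and apply the bounded source operator term by term. The Green function
at cell `n` carries the character of index `-n`, hence the sign in `siteCharge`. -/
theorem hasSum_siteCharge_greenL2 {a κ : ℝ} (ha : 0 < a) (hκ : 0 < κ) (θ : Fin 2 → CellL2) :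
    HasSum (fun p => siteCharge θ p • greenL2 hκ (sitePoint a p))
      ((floquet ha).symm (∑ j, sourceOp ha hκ j (θ j))) := by
  rw [map_sum]
  refine hasSum_prod_fin fun j => ?_
  have h1 := (cellBasis.hasSum_repr (θ j)).mapL (sourceOp ha hκ j)
  have h2 := h1.mapL ((floquet ha).symm : FiberL2 →L[ℂ] PlaneL2)
  have h3 := (Equiv.neg (ℤ × ℤ)).hasSum_iff.mpr h2
  refine h3.congr_fun fun n => ?_
  simp only [Function.comp_apply, Equiv.neg_apply, map_smul, sourceOp_cellBasis,
    ContinuousLinearEquiv.coe_coe, ContinuousLinearEquiv.symm_apply_apply]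
  rfl

/-- `L²` sums and pointwise sums agree. -/
theorem ae_hasSum_of_hasSum {ι : Type*} [Countable ι] {f : ι → PlaneL2} {F : PlaneL2}
    (h : HasSum f F) {g : ι → Plane → ℂ} (hfg : ∀ i, f i =ᵐ[volume] g i)
    (hg : ∀ x, Summable fun i => g i x) : ∀ᵐ x, HasSum (fun i => g i x) (F x) := by
  obtain ⟨s, hs⟩ := exists_seq_tendsto (atTop : Filter (Finset ι))
  -- Convergence in `L²` gives almost everywhere convergence of a subsequence only; the assumed
  -- pointwise summability then identifies the limit with the full sum.
  have h1 := tendstoInMeasure_of_tendsto_Lp (h.comp hs)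
  obtain ⟨ns, hns, hlim⟩ := h1.exists_seq_tendsto_ae
  have hsum : ∀ᵐ x, ∀ N, (∑ i ∈ s N, f i : PlaneL2) x = ∑ i ∈ s N, g i x := by
    rw [ae_all_iff]
    intro N
    filter_upwards [Lp.coeFn_finsetSum (s N) f, ae_all_iff.mpr hfg] with x h2 h3
    rw [h2, Finset.sum_apply]
    exact Finset.sum_congr rfl fun i _ => h3 i
  filter_upwards [hlim, hsum] with x h2 h3
  have h4 : Tendsto (fun i => ∑ j ∈ s (ns i), g j x) atTop (𝓝 (∑' i, g i x)) :=
    ((hg x).hasSum.comp hs).comp hns.tendsto_atTop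
  have h5 : Tendsto (fun i => ∑ j ∈ s (ns i), g j x) atTop (𝓝 (F x)) :=
    h2.congr fun i => h3 (ns i)
  rw [← tendsto_nhds_unique h4 h5]
  exact (hg x).hasSum

theorem summable_siteCharge_green {a κ : ℝ} (ha : 0 < a) (hκ : 0 < κ) (θ : Fin 2 → CellL2)
    (x : Plane) : Summable fun p => siteCharge θ p * (green κ (x - sitePoint a p) : ℂ) := by
  refine Summable.of_norm_bounded ((summable_green_site ha hκ x).mul_left (‖θ 0‖ + ‖θ 1‖)) ?_
  rintro ⟨n, j⟩
  rw [norm_mul, Complex.norm_real, Real.norm_of_nonneg (green_nonneg _ _)]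
  refine mul_le_mul_of_nonneg_right ?_ (green_nonneg _ _)
  refine (lp.norm_apply_le_norm (by norm_num) _ _).trans ?_
  rw [LinearIsometryEquiv.norm_map]
  fin_cases j
  · exact le_add_of_nonneg_right (norm_nonneg _)
  · exact le_add_of_nonneg_left (norm_nonneg _)

theorem ae_hasSum_siteCharge {a κ : ℝ} (ha : 0 < a) (hκ : 0 < κ) (θ : Fin 2 → CellL2) :
    ∀ᵐ x, HasSum (fun p => siteCharge θ p * (green κ (x - sitePoint a p) : ℂ))
      ((floquet ha).symm (∑ j, sourceOp ha hκ j (θ j)) x) := by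
  refine ae_hasSum_of_hasSum (hasSum_siteCharge_greenL2 ha hκ θ) (fun p => ?_)
    (summable_siteCharge_green ha hκ θ)
  filter_upwards [Lp.coeFn_smul (siteCharge θ p) (greenL2 hκ (sitePoint a p)),
    coeFn_greenL2 hκ (sitePoint a p)] with x h1 h2
  rw [h1, Pi.smul_apply, h2, smul_eq_mul]

/-- The wave function decomposes as required iff its fibers do. -/
theorem ae_hasSum_iff_floquet {a κ : ℝ} (ha : 0 < a) (hκ : 0 < κ) (θ : Fin 2 → CellL2)
    (ψ w : PlaneL2) :
    (∀ᵐ x, HasSum (fun p => siteCharge θ p * (green κ (x - sitePoint a p) : ℂ))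
      (ψ x - inner ℂ (greenL2 hκ x) w)) ↔
    ∀ᵐ t ∂cellMeasure, floquet ha ψ t = freeOp hκ a (momentum a t) (floquet ha w t) +
      ∑ j, θ j t • kreinVec ha hκ (momentum a t) j := by
  set P := (floquet ha).symm (∑ j, sourceOp ha hκ j (θ j)) with hP
  have h1 : (∀ᵐ x, HasSum (fun p => siteCharge θ p * (green κ (x - sitePoint a p) : ℂ))
      (ψ x - inner ℂ (greenL2 hκ x) w)) ↔ ψ = freeL2 hκ w + P := by
    constructor
    · intro h
      refine Lp.ext ?_
      filter_upwards [h, ae_hasSum_siteCharge ha hκ θ, coeFn_freeL2 hκ w,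
        Lp.coeFn_add (freeL2 hκ w) P] with x h1 h2 h3 h4
      rw [h4, Pi.add_apply, h3, ← h1.unique h2]; ring
    · intro h
      filter_upwards [ae_hasSum_siteCharge ha hκ θ, coeFn_freeL2 hκ w,
        Lp.coeFn_add (freeL2 hκ w) P] with x h2 h3 h4
      rw [h, h4, Pi.add_apply, h3, add_sub_cancel_left]
      exact h2
  rw [h1, ← (floquet ha).injective.eq_iff, map_add, hP, ContinuousLinearEquiv.apply_symm_apply,
    Lp.ext_iff]
  have h2 : ∀ᵐ t ∂cellMeasure, (floquet ha (freeL2 hκ w) + ∑ j, sourceOp ha hκ j (θ j)) t =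
      freeOp hκ a (momentum a t) (floquet ha w t) +
        ∑ j, θ j t • kreinVec ha hκ (momentum a t) j := by
    filter_upwards [Lp.coeFn_add (floquet ha (freeL2 hκ w)) (∑ j, sourceOp ha hκ j (θ j)),
      floquet_freeL2 ha hκ w, Lp.coeFn_add (sourceOp ha hκ 0 (θ 0)) (sourceOp ha hκ 1 (θ 1)),
      coeFn_sourceOp ha hκ 0 (θ 0), coeFn_sourceOp ha hκ 1 (θ 1)] with t h1 h2 h3 h4 h5
    rw [h1, Pi.add_apply, h2, Fin.sum_univ_two, Fin.sum_univ_two, h3, Pi.add_apply, h4, h5]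
  constructor
  · intro h
    filter_upwards [h, h2] with t h3 h4
    rw [h3, h4]
  · intro h
    filter_upwards [h, h2] with t h3 h4
    rw [h3, h4]

theorem exists_norm_le_unitCell {E : Type*} [NormedAddCommGroup E] {f : (Fin 2 → ℝ) → E}
    (hf : Continuous f) : ∃ C, ∀ t ∈ unitCell, ‖f t‖ ≤ C := by
  obtain ⟨C, hC⟩ := (isCompact_Icc (a := (0 : Fin 2 → ℝ)) (b := 1)).exists_bound_of_continuousOn
    hf.continuousOn
  exact ⟨C, fun t ht => hC t ⟨fun i => (ht i).1.le, fun i => (ht i).2⟩⟩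

theorem memLp_continuous_mul {f : (Fin 2 → ℝ) → ℂ} (hf : Continuous f) {g : (Fin 2 → ℝ) → ℂ}
    (hg : MemLp g 2 cellMeasure) : MemLp (fun t => f t * g t) 2 cellMeasure := by
  obtain ⟨C, hC⟩ := exists_norm_le_unitCell hf
  refine MemLp.of_le_mul (c := C) hg (hf.aestronglyMeasurable.mul hg.1) ?_
  filter_upwards [ae_mem_unitCell] with t ht
  rw [norm_mul]
  exact mul_le_mul_of_nonneg_right (hC t ht) (norm_nonneg _)

/-- The convolution of the scattering matrix with the charges. -/
theorem hasSum_kreinCoef {a κ : ℝ} (ha : 0 < a) (hκ : 0 < κ) (α : ℝ) (θ : Fin 2 → CellL2)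
    (n : ℤ × ℤ) (j : Fin 2) :
    HasSum (fun p : (ℤ × ℤ) × Fin 2 => (kreinCoef a α κ j p.2 (n - p.1) : ℂ) * siteCharge θ p)
      (∫ t, cellChar n t * ∑ l, kreinMatrix a α κ (momentum a t) j l * θ l t ∂cellMeasure) := by
  -- The convolution is read as Parseval's identity for `θ_l` against the conjugate of character
  -- times symbol, hence the conjugation.
  have hcont : ∀ l, Continuous fun t => (starRingEnd ℂ)
      (cellChar n t * kreinMatrix a α κ (momentum a t) j l) := fun l =>
    Complex.continuous_conj.comp
      ((continuous_cellChar n).mul (continuous_kreinMatrix_momentum ha hκ α j l))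
  have hX : ∀ l, MemLp (fun t => (starRingEnd ℂ)
      (cellChar n t * kreinMatrix a α κ (momentum a t) j l)) 2 cellMeasure := fun l => by
    have h := memLp_continuous_mul (hcont l) (memLp_const (μ := cellMeasure) (p := 2) (1 : ℂ))
    simpa using h
  have hK : ∀ l, HasSum (fun n' : ℤ × ℤ => (kreinCoef a α κ j l (n - n') : ℂ) *
      siteCharge θ (n', l)) (∫ t, cellChar n t * kreinMatrix a α κ (momentum a t) j l * θ l t
        ∂cellMeasure) := by
    intro l
    have h := (Equiv.neg (ℤ × ℤ)).hasSum_iff.mpr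
      (cellBasis.hasSum_inner_mul_inner ((hX l).toLp _) (θ l))
    have e : inner ℂ ((hX l).toLp _) (θ l) =
        ∫ t, cellChar n t * kreinMatrix a α κ (momentum a t) j l * θ l t ∂cellMeasure := by
      rw [L2.inner_def]
      refine integral_congr_ae ?_
      filter_upwards [(hX l).coeFn_toLp] with t ht
      rw [ht, RCLike.inner_apply, Complex.conj_conj, mul_comm]
    rw [e] at h
    refine h.congr_fun fun n' => ?_
    simp only [Function.comp_apply, Equiv.neg_apply]
    rw [← HilbertBasis.repr_apply_apply]
    congr 1
    rw [L2.inner_def, ← integral_kreinMatrix ha hκ]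
    refine integral_congr_ae ?_
    filter_upwards [(hX l).coeFn_toLp, coeFn_cellBasis (-n')] with t h1 h2
    rw [h1, h2, RCLike.inner_apply, Complex.conj_conj, sub_eq_add_neg, cellChar_add]
    ring
  have h := hasSum_prod_fin (f := fun p : (ℤ × ℤ) × Fin 2 =>
    (kreinCoef a α κ j p.2 (n - p.1) : ℂ) * siteCharge θ p) hK
  convert h using 1
  rw [← integral_finsetSum]
  · congr 1; funext t
    rw [Finset.mul_sum]
    exact Finset.sum_congr rfl fun l _ => by ring
  · intro l _
    refine (memLp_continuous_mul ((continuous_cellChar n).mul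
      (continuous_kreinMatrix_momentum ha hκ α j l)) (Lp.memLp (θ l))).integrable (by norm_num)

theorem memLp_inner_kreinVec {a κ : ℝ} (ha : 0 < a) (hκ : 0 < κ) (j : Fin 2) (W : FiberL2) :
    MemLp (fun t => inner ℂ (kreinVec ha hκ (momentum a t) j) (W t)) 2 cellMeasure := by
  obtain ⟨C, hC⟩ := exists_norm_kreinVec_le ha hκ
  refine MemLp.of_le_mul (c := C) (Lp.memLp W)
    ((continuous_momentum_kreinVec ha hκ j).aestronglyMeasurable.inner
      (Lp.aestronglyMeasurable W)) ?_
  filter_upwards [ae_mem_unitCell] with t ht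
  exact (norm_inner_le_norm _ _).trans (mul_le_mul_of_nonneg_right (hC t ht j) (norm_nonneg _))

/-- The boundary condition at the sites, in the fibers. -/
theorem forall_hasSum_iff_floquet {a κ : ℝ} (ha : 0 < a) (hκ : 0 < κ) (α : ℝ)
    (θ : Fin 2 → CellL2) (w : PlaneL2) :
    (∀ p : (ℤ × ℤ) × Fin 2, HasSum (fun p' : (ℤ × ℤ) × Fin 2 =>
      (kreinCoef a α κ p.2 p'.2 (p.1 - p'.1) : ℂ) * siteCharge θ p')
        (inner ℂ (greenL2 hκ (sitePoint a p)) w)) ↔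
    ∀ᵐ t ∂cellMeasure, ∀ j, ((1 / cellArea a : ℝ) : ℂ) *
        inner ℂ (kreinVec ha hκ (momentum a t) j) (floquet ha w t) =
      ∑ l, kreinMatrix a α κ (momentum a t) j l * θ l t := by
  have hm : ∀ j, MemLp (fun t => ((1 / cellArea a : ℝ) : ℂ) *
      inner ℂ (kreinVec ha hκ (momentum a t) j) (floquet ha w t)) 2 cellMeasure := fun j =>
    (memLp_inner_kreinVec ha hκ j _).const_mul _
  have hm' : ∀ j, MemLp (fun t => ∑ l, kreinMatrix a α κ (momentum a t) j l * θ l t) 2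
      cellMeasure := fun j => memLp_finsetSum _ fun l _ =>
    memLp_continuous_mul (continuous_kreinMatrix_momentum ha hκ α j l) (Lp.memLp _)
  rw [ae_all_iff]
  constructor
  · intro h j
    refine ae_eq_of_fourier_eq (hm j) (hm' j) fun n => ?_
    rw [← (h (n, j)).unique (hasSum_kreinCoef ha hκ α θ n j), inner_greenL2_site ha hκ,
      ← integral_const_mul]
    congr 1; funext t; ring
  · rintro h ⟨n, j⟩
    have e : inner ℂ (greenL2 hκ (sitePoint a (n, j))) w =
        ∫ t, cellChar n t * ∑ l, kreinMatrix a α κ (momentum a t) j l * θ l t ∂cellMeasure := by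
      rw [inner_greenL2_site ha hκ, ← integral_const_mul]
      refine integral_congr_ae ?_
      filter_upwards [h j] with t ht
      rw [← ht]; ring
    rw [e]
    exact hasSum_kreinCoef ha hκ α θ n j

/-- Riesz–Fischer on each sublattice: square summable charges are the Fourier coefficients of two
`L²` functions on the cell. -/
theorem exists_siteCharge {a : ℝ} (ha : 0 < a) (P : (honeycomb a → ℂ) → Prop) :
    (∃ q : lp (fun _ : honeycomb a => ℂ) 2, P q) ↔
      ∃ θ : Fin 2 → CellL2, P fun y => siteCharge θ ((siteEquiv ha).symm y) := by
  constructor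
  · rintro ⟨q, hq⟩
    have hs : Summable fun y => ‖q y‖ ^ 2 := by
      have := (memℓp_gen_iff (by norm_num)).mp (lp.memℓp q)
      simpa using this
    have hmem : ∀ j, Memℓp (fun n : ℤ × ℤ => q (siteEquiv ha (-n, j))) 2 := by
      intro j
      rw [memℓp_two_iff]
      refine hs.comp_injective (i := fun n : ℤ × ℤ => siteEquiv ha (-n, j)) ?_
      intro n n' h
      have := (siteEquiv ha).injective h
      simpa using this
    refine ⟨fun j => cellBasis.repr.symm ⟨_, hmem j⟩, ?_⟩
    convert hq using 1
    funext y
    obtain ⟨⟨n, j⟩, rfl⟩ := (siteEquiv ha).surjective y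
    rw [Equiv.symm_apply_apply, siteCharge, LinearIsometryEquiv.apply_symm_apply]
    change q (siteEquiv ha (- -n, j)) = _
    rw [neg_neg]
  · rintro ⟨θ, hθ⟩
    have hs : Summable fun p => ‖siteCharge θ p‖ ^ 2 := by
      have h : ∀ j, HasSum (fun n : ℤ × ℤ => ‖siteCharge θ (n, j)‖ ^ 2)
          (‖cellBasis.repr (θ j)‖ ^ 2) := fun j =>
        (Equiv.neg (ℤ × ℤ)).hasSum_iff.mpr (hasSum_norm_sq (cellBasis.repr (θ j)))
      exact (hasSum_prod_fin h).summable
    have hmem : Memℓp (fun y => siteCharge θ ((siteEquiv ha).symm y)) 2 := by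
      rw [memℓp_gen_iff (by norm_num)]
      have := (siteEquiv ha).symm.summable_iff.mpr hs
      simpa [Function.comp_def] using this
    exact ⟨⟨_, hmem⟩, hθ⟩

/-- The fibers of an element of the graph, and conversely, with the charges. -/
theorem mem_scattererGraph_iff_exists {a κ : ℝ} (ha : 0 < a) (hκ : 0 < κ) (α : ℝ)
    (ψ η : PlaneL2) :
    (ψ, η) ∈ scattererGraph κ (honeycomb a) (fun _ => α) ↔ ∃ θ : Fin 2 → CellL2,
      ∀ᵐ t ∂cellMeasure, FiberRel a α (momentum a t)
        (fun j => (cellArea a : ℂ) * θ j t) (floquet ha ψ t) (floquet ha η t) := by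
  have hc := cellArea_pos ha
  set w : PlaneL2 := η + ((κ ^ 2 : ℝ) : ℂ) • ψ with hw
  have h0 : (ψ, η) ∈ scattererGraph κ (honeycomb a) (fun _ => α) ↔
      ∃ q : lp (fun _ : honeycomb a => ℂ) 2,
        (∀ y : honeycomb a, HasSum (fun y' : honeycomb a =>
          (scatteringMatrix κ (honeycomb a) (fun _ => α) y y' : ℂ) * q y')
            (inner ℂ (greenL2 hκ (y : Plane)) w)) ∧
        ∀ᵐ x : Plane, HasSum (fun y : honeycomb a => q y * (green κ (x - y) : ℂ))
          (ψ x - inner ℂ (greenL2 hκ x) w) := by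
    change (∃ (φ : Plane → ℂ) (q : lp (fun _ : honeycomb a => ℂ) 2), IsGreenPotential κ w φ ∧ _) ↔ _
    simp_rw [isGreenPotential_iff hκ]
    constructor
    · rintro ⟨φ, q, rfl, h⟩
      exact ⟨q, h⟩
    · rintro ⟨q, h⟩
      exact ⟨_, q, rfl, h⟩
  rw [h0, exists_siteCharge ha (fun q => (∀ y : honeycomb a, HasSum (fun y' : honeycomb a =>
          (scatteringMatrix κ (honeycomb a) (fun _ => α) y y' : ℂ) * q y')
            (inner ℂ (greenL2 hκ (y : Plane)) w)) ∧
        ∀ᵐ x : Plane, HasSum (fun y : honeycomb a => q y * (green κ (x - y) : ℂ))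
          (ψ x - inner ℂ (greenL2 hκ x) w))]
  refine exists_congr fun θ => ?_
  have e1 : (∀ y : honeycomb a, HasSum (fun y' : honeycomb a =>
      (scatteringMatrix κ (honeycomb a) (fun _ => α) y y' : ℂ) *
        siteCharge θ ((siteEquiv ha).symm y')) (inner ℂ (greenL2 hκ (y : Plane)) w)) ↔
      ∀ p : (ℤ × ℤ) × Fin 2, HasSum (fun p' : (ℤ × ℤ) × Fin 2 =>
        (kreinCoef a α κ p.2 p'.2 (p.1 - p'.1) : ℂ) * siteCharge θ p')
          (inner ℂ (greenL2 hκ (sitePoint a p)) w) := by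
    rw [← (siteEquiv ha).forall_congr_right]
    refine forall_congr' fun p => ?_
    rw [← (siteEquiv ha).hasSum_iff]
    simp only [Function.comp_def, Equiv.symm_apply_apply, scatteringMatrix_site, coe_siteEquiv]
  have e2 : (∀ᵐ x : Plane, HasSum (fun y : honeycomb a =>
      siteCharge θ ((siteEquiv ha).symm y) * (green κ (x - y) : ℂ))
        (ψ x - inner ℂ (greenL2 hκ x) w)) ↔
      ∀ᵐ x, HasSum (fun p => siteCharge θ p * (green κ (x - sitePoint a p) : ℂ))
        (ψ x - inner ℂ (greenL2 hκ x) w) := by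
    have : ∀ x : Plane, HasSum (fun y : honeycomb a =>
        siteCharge θ ((siteEquiv ha).symm y) * (green κ (x - y) : ℂ))
          (ψ x - inner ℂ (greenL2 hκ x) w) ↔
        HasSum (fun p => siteCharge θ p * (green κ (x - sitePoint a p) : ℂ))
          (ψ x - inner ℂ (greenL2 hκ x) w) := by
      intro x
      rw [← (siteEquiv ha).hasSum_iff]
      simp only [Function.comp_def, Equiv.symm_apply_apply, coe_siteEquiv]
    simp_rw [this]
  rw [e1, e2, forall_hasSum_iff_floquet ha hκ, ae_hasSum_iff_floquet ha hκ, ← eventually_and]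
  have hwt : ∀ᵐ t ∂cellMeasure, floquet ha w t =
      floquet ha η t + ((κ ^ 2 : ℝ) : ℂ) • floquet ha ψ t := by
    rw [hw, map_add, map_smul]
    filter_upwards [Lp.coeFn_add (floquet ha η) (((κ ^ 2 : ℝ) : ℂ) • floquet ha ψ),
      Lp.coeFn_smul ((κ ^ 2 : ℝ) : ℂ) (floquet ha ψ)] with t h1 h2
    rw [h1, Pi.add_apply, h2, Pi.smul_apply]
  refine eventually_congr ?_
  filter_upwards [hwt] with t ht
  rw [fiberRel_iff ha hκ, ← ht, and_comm]
  -- The fiber relation carries `1/|Γ|` in front of the charges and the full operator does not; this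
  -- is the factor `|Γ|` between `θ` and the fiber charge.
  have hcc : ((1 / cellArea a : ℝ) : ℂ) * (cellArea a : ℂ) = 1 := by
    rw [← Complex.ofReal_mul, one_div_mul_cancel hc.ne', Complex.ofReal_one]
  refine and_congr ?_ (forall_congr' fun j => ?_)
  · rw [Finset.smul_sum]
    simp_rw [smul_smul, ← mul_assoc, hcc, one_mul]
  · have hne : (cellArea a : ℂ) ≠ 0 := by exact_mod_cast hc.ne'
    rw [← mul_right_inj' hne, ← mul_assoc, mul_comm (cellArea a : ℂ), hcc, one_mul, Finset.mul_sum]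
    simp_rw [mul_left_comm (cellArea a : ℂ)]

open ComplexOrder in
/-- The Hamiltonian is the direct integral of the fibers. -/
theorem mem_scattererGraph_iff {a κ : ℝ} (ha : 0 < a) (hκ : 0 < κ) {α κ₀ : ℝ} (hκ₀ : 0 < κ₀)
    (hM : ∀ k, (kreinMatrix a α κ₀ k).PosDef) (ψ η : PlaneL2) :
    (ψ, η) ∈ scattererGraph κ (honeycomb a) (fun _ => α) ↔
      ∀ᵐ t ∂cellMeasure,
        (floquet ha ψ t, floquet ha η t) ∈ fiberGraph a (fun _ => α) (momentum a t) := by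
  rw [mem_scattererGraph_iff_exists ha hκ]
  constructor
  · rintro ⟨θ, hθ⟩
    filter_upwards [hθ] with t ht
    exact ⟨_, ht⟩
  · intro h
    have hc := cellArea_pos ha
    -- The hypothesis provides a charge for each `t` separately, with no measurability. At the
    -- reference energy `κ₀` the Krein matrix is invertible, so the charge is an explicit expression
    -- in the data, with coefficients continuous in `t`, and lies in `L²`. At the given `κ` the
    -- matrix might be singular.
    set W : FiberL2 := floquet ha η + ((κ₀ ^ 2 : ℝ) : ℂ) • floquet ha ψ with hW
    have hcont : ∀ j l, Continuous fun t => (kreinMatrix a α κ₀ (momentum a t))⁻¹ j l :=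
      fun j l => (continuous_kreinMatrix_inv ha hκ₀ (fun k => (hM k).isUnit) j l).comp
        (continuous_momentum a)
    have hmem : ∀ j, MemLp (fun t => ((1 / cellArea a : ℝ) : ℂ) *
        ∑ l, (kreinMatrix a α κ₀ (momentum a t))⁻¹ j l *
        inner ℂ (kreinVec ha hκ₀ (momentum a t) l) (W t)) 2 cellMeasure := fun j =>
      (memLp_finsetSum _ fun l _ => memLp_continuous_mul (hcont j l)
        (memLp_inner_kreinVec ha hκ₀ l W)).const_mul _
    refine ⟨fun j => (hmem j).toLp _, ?_⟩
    filter_upwards [h, (hmem 0).coeFn_toLp, (hmem 1).coeFn_toLp,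
      Lp.coeFn_add (floquet ha η) (((κ₀ ^ 2 : ℝ) : ℂ) • floquet ha ψ),
      Lp.coeFn_smul ((κ₀ ^ 2 : ℝ) : ℂ) (floquet ha ψ)] with t ht h0 h1 h2 h3
    obtain ⟨q, hq⟩ := ht
    have hq2 := fiberRel_charge ha hκ₀ (hM (momentum a t)).isUnit hq
    have hWt : W t = floquet ha η t + ((κ₀ ^ 2 : ℝ) : ℂ) • floquet ha ψ t := by
      rw [hW, h2, Pi.add_apply, h3, Pi.smul_apply]
    have e : (fun j => (cellArea a : ℂ) * ((hmem j).toLp _ : CellL2) t) = q := by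
      rw [hq2]
      have hcc : (cellArea a : ℂ) * ((1 / cellArea a : ℝ) : ℂ) = 1 := by
        rw [← Complex.ofReal_mul, mul_one_div_cancel hc.ne', Complex.ofReal_one]
      funext j
      have hj : ((hmem j).toLp _ : CellL2) t = ((1 / cellArea a : ℝ) : ℂ) *
          ∑ l, (kreinMatrix a α κ₀ (momentum a t))⁻¹ j l *
            inner ℂ (kreinVec ha hκ₀ (momentum a t) l) (W t) := by
        fin_cases j
        · exact h0
        · exact h1
      rw [hj, ← mul_assoc, hcc, one_mul, hWt]
      rfl
    rw [e]
    exact hq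

end

end HoneycombScatterer

namespace HoneycombScatterer

noncomputable section

open scoped ComplexOrder

/-! ### The spectrum as the union of the fiber spectra -/

theorem memLp_clm_apply {A : (Fin 2 → ℝ) → DualL2 →L[ℂ] DualL2} (hA : Continuous A) (F : FiberL2) :
    MemLp (fun t => A t (F t)) 2 cellMeasure := by
  obtain ⟨C, hC⟩ := exists_norm_le_unitCell hA
  refine MemLp.of_le_mul (c := C) (Lp.memLp F) ?_ ?_
  · have hc : Continuous fun p : (Fin 2 → ℝ) × DualL2 => A p.1 p.2 :=
      (hA.comp continuous_fst).clm_apply continuous_snd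
    exact hc.comp_aestronglyMeasurable
      (aestronglyMeasurable_id.prodMk (Lp.aestronglyMeasurable F))
  · filter_upwards [ae_mem_unitCell] with t ht
    exact (A t).le_of_opNorm_le (hC t ht) _

/-- Multiplication by a continuous family of operators in the fibers. -/
def fiberwiseOp {A : (Fin 2 → ℝ) → DualL2 →L[ℂ] DualL2} (hA : Continuous A) :
    FiberL2 →L[ℂ] FiberL2 :=
  LinearMap.mkContinuousOfExistsBound
    { toFun := fun F => (memLp_clm_apply hA F).toLp _
      map_add' := fun F F' => by
        rw [← MemLp.toLp_add]
        refine MemLp.toLp_congr _ _ ?_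
        filter_upwards [Lp.coeFn_add F F'] with t ht
        rw [ht, Pi.add_apply, map_add, Pi.add_apply]
      map_smul' := fun c F => by
        rw [RingHom.id_apply, ← MemLp.toLp_const_smul]
        refine MemLp.toLp_congr _ _ ?_
        filter_upwards [Lp.coeFn_smul c F] with t ht
        rw [ht, Pi.smul_apply, map_smul, Pi.smul_apply] }
    (by
      obtain ⟨C, hC⟩ := exists_norm_le_unitCell hA
      refine ⟨C, fun F => ?_⟩
      refine Lp.norm_le_mul_norm_of_ae_le_mul (f := (memLp_clm_apply hA F).toLp _) (g := F) ?_
      filter_upwards [ae_mem_unitCell, (memLp_clm_apply hA F).coeFn_toLp] with t ht h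
      rw [h]
      exact (A t).le_of_opNorm_le (hC t ht) _)

theorem coeFn_fiberwiseOp {A : (Fin 2 → ℝ) → DualL2 →L[ℂ] DualL2} (hA : Continuous A)
    (F : FiberL2) : fiberwiseOp hA F =ᵐ[cellMeasure] fun t => A t (F t) :=
  (memLp_clm_apply hA F).coeFn_toLp

theorem graph_pointScatterer {a κ : ℝ} (ha : 0 < a) (hκ : 0 < κ) {α κ₀ : ℝ} (hκ₀ : 0 < κ₀)
    (hM : ∀ k, (kreinMatrix a α κ₀ k).PosDef) :
    (pointScatterer κ (honeycomb a) (fun _ => α)).graph =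
      scattererGraph κ (honeycomb a) (fun _ => α) := by
  refine Submodule.toLinearPMap_graph_eq _ ?_
  rintro ⟨ψ, η⟩ h hψ
  dsimp only at hψ ⊢
  subst hψ
  rw [mem_scattererGraph_iff ha hκ hκ₀ hM, map_zero] at h
  rw [← (floquet ha).map_eq_zero_iff]
  refine Lp.ext ?_
  filter_upwards [h, Lp.coeFn_zero DualL2 2 cellMeasure] with t ht h0
  rw [h0, Pi.zero_apply] at ht ⊢
  rw [← graph_fiberHamiltonian ha hκ₀ (hM _)] at ht
  exact LinearPMap.graph_fst_eq_zero_snd _ ht rfl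

/-- The fiber graph at `f + z u`, through the operator at the reference energy. -/
theorem mem_fiberGraph_add_iff {a κ : ℝ} (ha : 0 < a) (hκ : 0 < κ) {α : ℝ} {k : Plane}
    (hM : (kreinMatrix a α κ k).PosDef) (z : ℂ) (u f : DualL2) :
    (u, f + z • u) ∈ fiberGraph a (fun _ => α) k ↔
      (1 - (z + ((κ ^ 2 : ℝ) : ℂ)) • kreinOp ha hκ α k) u = kreinOp ha hκ α k f := by
  rw [mem_fiberGraph_iff_kreinOp ha hκ hM.isUnit, add_assoc, ← add_smul, map_add, map_smul,
    _root_.sub_apply, _root_.smul_apply, sub_eq_iff_eq_add]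
  rfl

/-- Fredholm alternative for the compact operator `kreinOp`: without an eigenvector there is a
bounded inverse. -/
theorem isUnit_one_sub_smul_kreinOp {a κ : ℝ} (ha : 0 < a) (hκ : 0 < κ) {α : ℝ} {k : Plane}
    (hM : (kreinMatrix a α κ k).PosDef) {z : ℂ}
    (hz : ∀ u, (u, z • u) ∈ fiberGraph a (fun _ => α) k → u = 0) :
    IsUnit (1 - (z + ((κ ^ 2 : ℝ) : ℂ)) • kreinOp ha hκ α k) := by
  set w := z + ((κ ^ 2 : ℝ) : ℂ) with hw
  set T := kreinOp ha hκ α k with hT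
  rcases eq_or_ne w 0 with h0 | h0
  · rw [h0, zero_smul, sub_zero]; exact isUnit_one
  have hne : ¬ Module.End.HasEigenvalue (T : Module.End ℂ DualL2) w⁻¹ := by
    intro h
    obtain ⟨u, hu, hu0⟩ := h.exists_hasEigenvector
    refine hu0 (hz u ?_)
    have h1 : T u = w⁻¹ • u := Module.End.mem_eigenspace_iff.mp hu
    have h2 := (mem_fiberGraph_add_iff ha hκ hM z u 0).mpr (by
      rw [map_zero, ← hw, ← hT, _root_.sub_apply, _root_.smul_apply, h1, smul_smul,
        mul_inv_cancel₀ h0, one_smul]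
      exact sub_self _)
    rwa [zero_add] at h2
  have hres : w⁻¹ ∈ resolventSet ℂ T :=
    ((isCompactOperator_kreinOp ha hκ α k).hasEigenvalue_or_mem_resolventSet
      (inv_ne_zero h0)).resolve_left hne
  rw [spectrum.mem_resolventSet_iff] at hres
  have e : 1 - w • T = w • (algebraMap ℂ (DualL2 →L[ℂ] DualL2) w⁻¹ - T) := by
    rw [smul_sub, Algebra.algebraMap_eq_smul_one, smul_smul, mul_inv_cancel₀ h0, one_smul]
  rw [e]
  rw [Algebra.smul_def]
  exact ((IsUnit.mk0 w h0).map (algebraMap ℂ (DualL2 →L[ℂ] DualL2))).mul hres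

/-- The fiber resolvents are `(1 - wT)⁻¹T` with `w = z + κ₀²`. They exist for every `k` and vary
continuously, so they are bounded on the closed cell and act together as one bounded operator. -/
theorem mem_opResolventSet {a κ : ℝ} (ha : 0 < a) (hκ : 0 < κ) {α κ₀ : ℝ} (hκ₀ : 0 < κ₀)
    (hM : ∀ k, (kreinMatrix a α κ₀ k).PosDef) {z : ℂ}
    (hz : ∀ k u, (u, z • u) ∈ fiberGraph a (fun _ => α) k → u = 0) :
    z ∈ opResolventSet (pointScatterer κ (honeycomb a) (fun _ => α)) := by
  set w := z + ((κ₀ ^ 2 : ℝ) : ℂ) with hw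
  set T : (Fin 2 → ℝ) → DualL2 →L[ℂ] DualL2 := fun t => kreinOp ha hκ₀ α (momentum a t) with hT
  have hTc : Continuous T :=
    (continuous_kreinOp ha hκ₀ fun k => (hM k).isUnit).comp (continuous_momentum a)
  have hu : ∀ t, IsUnit (1 - w • T t) := fun t =>
    isUnit_one_sub_smul_kreinOp ha hκ₀ (hM _) (hz _)
  have hA : Continuous fun t => Ring.inverse (1 - w • T t) * T t := by
    refine Continuous.mul ?_ hTc
    rw [continuous_iff_continuousAt]
    intro t
    have h1 : ContinuousAt (fun t => 1 - w • T t) t :=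
      (continuous_const.sub (hTc.fun_const_smul w)).continuousAt
    obtain ⟨v, hv⟩ := hu t
    have h2 := NormedRing.inverse_continuousAt v
    rw [hv] at h2
    exact ContinuousAt.comp (f := fun t => 1 - w • T t) h2 h1
  refine ⟨((floquet ha).symm : FiberL2 →L[ℂ] PlaneL2) ∘L fiberwiseOp hA ∘L
    (floquet ha : PlaneL2 →L[ℂ] FiberL2), fun f u => ?_⟩
  rw [graph_pointScatterer ha hκ hκ₀ hM, mem_scattererGraph_iff ha hκ hκ₀ hM,
    ContinuousLinearMap.comp_apply, ContinuousLinearMap.comp_apply, ContinuousLinearEquiv.coe_coe,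
    ContinuousLinearEquiv.coe_coe, ContinuousLinearEquiv.eq_symm_apply, Lp.ext_iff]
  refine eventually_congr ?_
  have hadd : ∀ᵐ t ∂cellMeasure, floquet ha (f + z • u) t = floquet ha f t + z • floquet ha u t := by
    rw [map_add, map_smul]
    filter_upwards [Lp.coeFn_add (floquet ha f) (z • floquet ha u),
      Lp.coeFn_smul z (floquet ha u)] with t h1 h2
    rw [h1, Pi.add_apply, h2, Pi.smul_apply]
  filter_upwards [hadd, coeFn_fiberwiseOp hA (floquet ha f)] with t h1 h2
  rw [h1, h2, mem_fiberGraph_add_iff ha hκ₀ (hM _)]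
  constructor
  · intro h
    have h3 : (Ring.inverse (1 - w • T t) * (1 - w • T t)) (floquet ha u t) =
        (Ring.inverse (1 - w • T t) * T t) (floquet ha f t) :=
      congrArg (fun v => Ring.inverse (1 - w • T t) v) h
    rwa [Ring.inverse_mul_cancel _ (hu t)] at h3
  · intro h
    have h3 : ((1 - w • T t) * Ring.inverse (1 - w • T t)) (T t (floquet ha f t)) =
        T t (floquet ha f t) := by
      rw [Ring.mul_inverse_cancel _ (hu t)]; rfl
    rw [h]
    exact h3

/-- A point of the cell may lie on its upper boundary, so positive mass is sought in a small box
with `t` as its upper corner. -/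
theorem cellMeasure_ball_pos {t : Fin 2 → ℝ} (ht : t ∈ unitCell) {ε : ℝ} (hε : 0 < ε) :
    0 < cellMeasure (Metric.ball t ε) := by
  rw [cellMeasure, Measure.restrict_apply Metric.isOpen_ball.measurableSet]
  have hsub : Set.pi Set.univ (fun i => Set.Ioc (max 0 (t i - ε / 2)) (t i)) ⊆
      Metric.ball t ε ∩ unitCell := by
    intro s hs
    have hs' : ∀ i, max 0 (t i - ε / 2) < s i ∧ s i ≤ t i := fun i => hs i (Set.mem_univ i)
    refine ⟨?_, fun i => ⟨(le_max_left _ _).trans_lt (hs' i).1, (hs' i).2.trans (ht i).2⟩⟩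
    rw [Metric.mem_ball]
    refine lt_of_le_of_lt ((dist_pi_le_iff (half_pos hε).le).mpr fun i => ?_) (half_lt_self hε)
    rw [Real.dist_eq, abs_sub_comm, abs_of_nonneg (by linarith [(hs' i).2])]
    linarith [(le_max_right 0 (t i - ε / 2)).trans_lt (hs' i).1]
  refine lt_of_lt_of_le ?_ (measure_mono hsub)
  rw [Real.volume_pi_Ioc]
  refine pos_iff_ne_zero.mpr (Finset.prod_ne_zero_iff.mpr fun i _ => ?_)
  have : max 0 (t i - ε / 2) < t i := max_lt (ht i).1 (by linarith)
  simpa using this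

/-- A Weyl argument. The eigenvector `u₀` is spread over nearby fibers as `w T_t u₀`, which lies in
the domain of every fiber and equals `u₀` at `t₀`. Applying the operator minus `z` gives `w (u₀ - w
T_t u₀)`, small near `t₀`, and no bounded inverse is compatible with that. -/
theorem notMem_opResolventSet {a κ : ℝ} (ha : 0 < a) (hκ : 0 < κ) {α κ₀ : ℝ} (hκ₀ : 0 < κ₀)
    (hM : ∀ k, (kreinMatrix a α κ₀ k).PosDef) {z : ℂ} {t₀ : Fin 2 → ℝ} (ht₀ : t₀ ∈ unitCell)
    {u₀ : DualL2} (hu₀ : u₀ ≠ 0)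
    (hz : (u₀, z • u₀) ∈ fiberGraph a (fun _ => α) (momentum a t₀)) :
    z ∉ opResolventSet (pointScatterer κ (honeycomb a) (fun _ => α)) := by
  rintro ⟨R, hR⟩
  set w := z + ((κ₀ ^ 2 : ℝ) : ℂ) with hw
  set T : (Fin 2 → ℝ) → DualL2 →L[ℂ] DualL2 := fun t => kreinOp ha hκ₀ α (momentum a t) with hT
  have hTc : Continuous T :=
    (continuous_kreinOp ha hκ₀ fun k => (hM k).isUnit).comp (continuous_momentum a)
  have hTu : Continuous fun t => w • T t u₀ := (hTc.clm_apply continuous_const).fun_const_smul w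
  have h0 : w • T t₀ u₀ = u₀ := by
    have h := (mem_fiberGraph_add_iff ha hκ₀ (hM (momentum a t₀)) z u₀ 0).mp (by rwa [zero_add])
    rw [map_zero, _root_.sub_apply, sub_eq_zero] at h
    exact h.symm
  set M : FiberL2 →L[ℂ] FiberL2 := (floquet ha : PlaneL2 →L[ℂ] FiberL2) ∘L R ∘L
    ((floquet ha).symm : FiberL2 →L[ℂ] PlaneL2) with hMdef
  have hn : 0 < ‖u₀‖ := norm_pos_iff.mpr hu₀
  -- Makes `‖M‖ ‖w‖ δ ≤ ‖u₀‖/4`, short of the lower bound `‖u₀‖/2` for the spread vector. The `+ 1`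
  -- covers a vanishing product.
  set δ := ‖u₀‖ / (4 * (‖M‖ * ‖w‖ + 1)) with hδ
  have hδ0 : 0 < δ := by positivity
  obtain ⟨ε, hε, hball⟩ := Metric.continuousAt_iff.mp hTu.continuousAt δ hδ0
  rw [h0] at hball
  set S := Metric.ball t₀ ε with hS
  have hSm : MeasurableSet S := Metric.isOpen_ball.measurableSet
  set g : CellL2 := indicatorConstLp 2 hSm (measure_ne_top _ _) (1 : ℂ) with hg
  have hg0 : 0 < ‖g‖ := by
    rw [hg, norm_indicatorConstLp (by norm_num) (by norm_num), norm_one, one_mul]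
    exact Real.rpow_pos_of_pos (ENNReal.toReal_pos (cellMeasure_ball_pos ht₀ hε).ne' (measure_ne_top _ _)) _
  have hv : MemLp (S.indicator fun t => w • T t u₀) 2 cellMeasure := by
    refine MemLp.of_bound ((hTu.aestronglyMeasurable).indicator hSm) (‖u₀‖ + δ)
      (Eventually.of_forall fun t => ?_)
    by_cases ht : t ∈ S
    · rw [Set.indicator_of_mem ht]
      have h := hball ht
      rw [dist_eq_norm] at h
      linarith [norm_le_norm_add_norm_sub u₀ (w • T t u₀),
        norm_sub_rev u₀ (w • T t u₀)]
    · rw [Set.indicator_of_notMem ht, norm_zero]; positivity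
  have hf : MemLp (S.indicator fun t => w • (u₀ - w • T t u₀)) 2 cellMeasure := by
    refine MemLp.of_bound ((((continuous_const.sub hTu).fun_const_smul w).aestronglyMeasurable).indicator
      hSm) (‖w‖ * δ) (Eventually.of_forall fun t => ?_)
    by_cases ht : t ∈ S
    · rw [Set.indicator_of_mem ht, norm_smul, norm_sub_rev, ← dist_eq_norm]
      exact mul_le_mul_of_nonneg_left (hball ht).le (norm_nonneg _)
    · rw [Set.indicator_of_notMem ht, norm_zero]; positivity
  have hgS : ∀ᵐ t ∂cellMeasure, (t ∈ S → g t = 1) ∧ (t ∉ S → g t = 0) := by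
    filter_upwards [indicatorConstLp_coeFn (p := 2) (hs := hSm)
      (hμs := measure_ne_top cellMeasure S) (c := (1 : ℂ))] with t ht
    rw [hg, ht]
    exact ⟨fun h => Set.indicator_of_mem h _, fun h => Set.indicator_of_notMem h _⟩
  have hvg : ‖u₀‖ / 2 * ‖g‖ ≤ ‖hv.toLp _‖ := by
    have hle : ‖g‖ ≤ 2 / ‖u₀‖ * ‖hv.toLp _‖ := by
      refine Lp.norm_le_mul_norm_of_ae_le_mul ?_
      filter_upwards [hgS, hv.coeFn_toLp] with t h1 h2
      rw [h2]
      by_cases ht : t ∈ S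
      · rw [h1.1 ht, norm_one, Set.indicator_of_mem ht]
        have h := hball ht
        rw [dist_eq_norm] at h
        have hδ2 : δ ≤ ‖u₀‖ / 4 := by
          refine div_le_div_of_nonneg_left hn.le (by norm_num) ?_
          have : 0 ≤ ‖M‖ * ‖w‖ := by positivity
          linarith
        have h3 : ‖u₀‖ / 2 ≤ ‖w • T t u₀‖ := by
          have := norm_sub_norm_le u₀ (w • T t u₀)
          rw [norm_sub_rev] at this
          linarith
        calc (1 : ℝ) = 2 / ‖u₀‖ * (‖u₀‖ / 2) := by field_simp
          _ ≤ _ := by gcongr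
      · rw [h1.2 ht, norm_zero]; positivity
    calc _ ≤ ‖u₀‖ / 2 * (2 / ‖u₀‖ * ‖hv.toLp _‖) := by gcongr
      _ = _ := by field_simp
  have hfg : ‖hf.toLp _‖ ≤ ‖w‖ * δ * ‖g‖ := by
    refine Lp.norm_le_mul_norm_of_ae_le_mul ?_
    filter_upwards [hgS, hf.coeFn_toLp] with t h1 h2
    rw [h2]
    by_cases ht : t ∈ S
    · rw [h1.1 ht, norm_one, mul_one, Set.indicator_of_mem ht, norm_smul, norm_sub_rev,
        ← dist_eq_norm]
      exact mul_le_mul_of_nonneg_left (hball ht).le (norm_nonneg _)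
    · rw [Set.indicator_of_notMem ht, norm_zero]; positivity
  have hrel : hv.toLp _ = M (hf.toLp _) := by
    have h := (hR ((floquet ha).symm (hf.toLp _)) ((floquet ha).symm (hv.toLp _))).mp (by
      rw [graph_pointScatterer ha hκ hκ₀ hM, mem_scattererGraph_iff ha hκ hκ₀ hM, map_add, map_smul,
        ContinuousLinearEquiv.apply_symm_apply, ContinuousLinearEquiv.apply_symm_apply]
      filter_upwards [Lp.coeFn_add (hf.toLp _) (z • hv.toLp _), Lp.coeFn_smul z (hv.toLp _),
        hv.coeFn_toLp, hf.coeFn_toLp] with t h1 h2 h3 h4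
      rw [h1, Pi.add_apply, h2, Pi.smul_apply, mem_fiberGraph_add_iff ha hκ₀ (hM _), h3, h4]
      by_cases ht : t ∈ S
      · rw [Set.indicator_of_mem ht, Set.indicator_of_mem ht, ← hw]
        change (1 - w • T t) (w • T t u₀) = T t (w • (u₀ - w • T t u₀))
        simp only [_root_.sub_apply, _root_.smul_apply, map_smul, map_sub,
          one_apply_eq_self, smul_sub]
      · rw [Set.indicator_of_notMem ht, Set.indicator_of_notMem ht, map_zero, map_zero])
    rw [hMdef, ContinuousLinearMap.comp_apply, ContinuousLinearMap.comp_apply,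
      ContinuousLinearEquiv.coe_coe, ContinuousLinearEquiv.coe_coe, ← h,
      ContinuousLinearEquiv.apply_symm_apply]
  have h1 : ‖u₀‖ / 2 * ‖g‖ ≤ ‖M‖ * (‖w‖ * δ * ‖g‖) :=
    hvg.trans ((hrel ▸ M.le_opNorm _).trans (by gcongr))
  have h2 : ‖M‖ * ‖w‖ * δ ≤ ‖u₀‖ / 4 := by
    have : (‖M‖ * ‖w‖ + 1) * δ = ‖u₀‖ / 4 := by rw [hδ]; field_simp
    nlinarith
  nlinarith

/-! ### Periodicity of the fibers -/

theorem fiberGraph_add_dualVec {a α : ℝ} (ha : 0 < a) (k : Plane) (n : ℤ × ℤ) {u f : DualL2}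
    (h : (u, f) ∈ fiberGraph a (fun _ => α) (k + dualVec a n)) {u' f' : DualL2}
    (hu : ∀ m, u' m = u (m - n)) (hf : ∀ m, f' m = f (m - n)) :
    (u', f') ∈ fiberGraph a (fun _ => α) k := by
  have hk : ∀ m, dualVec a (m - n) + (k + dualVec a n) = dualVec a m + k := by
    intro m
    simp only [dualVec, Prod.fst_sub, Prod.snd_sub]
    push_cast
    module
  have hw : ∀ y m, planeWave a (k + dualVec a n) y (m - n) = planeWave a k y m := by
    intro y m
    rw [planeWave, hk, planeWave]
  obtain ⟨q, h1, h2⟩ := h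
  refine ⟨q, fun m => ?_, fun j => ?_⟩
  · have := h1 (m - n)
    rw [hk] at this
    simp only [hw] at this
    dsimp only at this ⊢
    rw [hf, hu, this]
  · obtain ⟨S, hS1, hS2⟩ := h2 j
    refine ⟨S, fun r => ?_, hS2⟩
    have := hS1 r
    rw [isCutoffValue_iff ha] at this ⊢
    rw [this, ← (Equiv.subRight n).tsum_eq]
    refine tsum_congr fun m => ?_
    rw [Equiv.subRight_apply, hk, hw]
    dsimp only
    rw [hu]

/-- Eigenvalues are periodic in the quasi-momentum. -/
theorem exists_eigenvector_of_add_dualVec {a α : ℝ} (ha : 0 < a) (k : Plane) (n : ℤ × ℤ) {z : ℂ}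
    (h : ∃ u ≠ 0, (u, z • u) ∈ fiberGraph a (fun _ => α) (k + dualVec a n)) :
    ∃ u ≠ 0, (u, z • u) ∈ fiberGraph a (fun _ => α) k := by
  obtain ⟨u, hu0, hu⟩ := h
  have hmem : Memℓp (fun m => u (m - n)) 2 :=
    memℓp_two_iff.mpr ((Equiv.subRight n).summable_iff.mpr (summable_norm_sq u))
  refine ⟨⟨_, hmem⟩, fun h0 => hu0 ?_, fiberGraph_add_dualVec ha k n hu (fun _ => rfl) fun _ => rfl⟩
  ext m
  have := congrFun (congrArg (fun v : DualL2 => (v : ℤ × ℤ → ℂ)) h0) (m + n)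
  simpa using this

theorem exists_mem_unitCell {a α : ℝ} (ha : 0 < a) {k : Plane} {z : ℂ}
    (h : ∃ u ≠ 0, (u, z • u) ∈ fiberGraph a (fun _ => α) k) :
    ∃ t ∈ unitCell, ∃ u ≠ 0, (u, z • u) ∈ fiberGraph a (fun _ => α) (momentum a t) := by
  obtain ⟨t, rfl⟩ := exists_momentum_eq ha k
  refine ⟨_, sub_cellIndex_mem t,
    exists_eigenvector_of_add_dualVec ha _ (cellIndex t) ?_⟩
  rwa [← momentum_intVec, ← momentum_add, sub_add_cancel]

/-- The spectrum of the Hamiltonian is the set of all eigenvalues of the fibers. -/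
theorem mem_opSpectrum_iff {a κ : ℝ} (ha : 0 < a) (hκ : 0 < κ) {α κ₀ : ℝ} (hκ₀ : 0 < κ₀)
    (hM : ∀ k, (kreinMatrix a α κ₀ k).PosDef) (z : ℂ) :
    z ∈ opSpectrum (pointScatterer κ (honeycomb a) (fun _ => α)) ↔
      ∃ k, ∃ u ≠ 0, (u, z • u) ∈ fiberGraph a (fun _ => α) k := by
  rw [opSpectrum, Set.mem_compl_iff]
  constructor
  · intro h
    by_contra! h2
    exact h (mem_opResolventSet ha hκ hκ₀ hM fun k u hu => by
      by_contra h0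
      exact h2 k u h0 hu)
  · rintro ⟨k, h⟩
    obtain ⟨t, ht, u, hu0, hu⟩ := exists_mem_unitCell ha h
    exact notMem_opResolventSet ha hκ hκ₀ hM ht hu0 hu

end

end HoneycombScatterer

namespace HoneycombScatterer

noncomputable section

open scoped ComplexOrder

/-! ### The lowest band -/

theorem le_minMax_one {H : Type*} [NormedAddCommGroup H] [InnerProductSpace ℂ H] (T : H →L[ℂ] H)
    {v : H} (hv : ‖v‖ = 1) : RCLike.re (inner ℂ v (T v)) ≤ minMax T 1 := by
  have hv0 : v ≠ 0 := by
    rintro rfl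
    rw [norm_zero] at hv
    exact zero_ne_one hv
  refine le_minMax one_pos (Submodule.span ℂ {v}) (finrank_span_singleton hv0) fun x hx => ?_
  obtain ⟨c, rfl⟩ := Submodule.mem_span_singleton.mp hx
  rw [map_smul, inner_smul_left, inner_smul_right, norm_smul, hv, mul_one, ← mul_assoc,
    ← Complex.normSq_eq_conj_mul_self, Complex.normSq_eq_norm_sq]
  have : RCLike.re (((‖c‖ ^ 2 : ℝ) : ℂ) * inner ℂ v (T v)) =
      ‖c‖ ^ 2 * RCLike.re (inner ℂ v (T v)) := Complex.re_ofReal_mul _ _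
  rw [this, mul_comm]

/-- A single plane wave is the trial vector. It does not vanish at the scatterer `0`, so the Krein
correction raises its form strictly. Consequently the first band lies strictly below every free
energy. -/
theorem freeResolvent_lt_minMax {a κ : ℝ} (ha : 0 < a) (hκ : 0 < κ) {α : ℝ} {k : Plane}
    (hM : (kreinMatrix a α κ k).PosDef) (m : ℤ × ℤ) :
    freeResolvent a κ k m < minMax (kreinOp ha hκ α k) 1 := by
  set v : DualL2 := lp.single 2 m (1 : ℂ) with hv
  have hn : ‖v‖ = 1 := by rw [hv, lp.norm_single (by norm_num)]; simp
  have hd := freeResolvent_pos (a := a) hκ k m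
  have h1 : inner ℂ v (freeOp hκ a k v) = (freeResolvent a κ k m : ℂ) := by
    rw [hv, lp.inner_single_left, freeOp_apply, lp.single_apply_self]
    simp
  have h2 : inner ℂ (kreinVec ha hκ k 0) v ≠ (0 : ℂ) := by
    rw [← inner_conj_symm, hv, lp.inner_single_left, kreinVec_apply]
    simp [cellPoint, planeWave_zero, hd.ne']
  have h3 := re_inner_freeOp_lt ha hκ hM h2
  rw [h1] at h3
  exact lt_of_lt_of_le h3 (le_minMax_one _ hn)

theorem band_one_lt {a κ : ℝ} (ha : 0 < a) (hκ : 0 < κ) {α : ℝ} {k : Plane}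
    (hM : (kreinMatrix a α κ k).PosDef) (m : ℤ × ℤ) :
    band ha hκ α k 1 < ‖dualVec a m + k‖ ^ 2 := by
  have h := freeResolvent_lt_minMax ha hκ hM m
  have h2 := freeResolvent_pos (a := a) hκ k m
  have h3 := one_div_lt_one_div_of_lt h2 h
  rw [freeResolvent, one_div_one_div] at h3
  rw [band]; linarith

theorem band_one_zero_neg {a κ : ℝ} (ha : 0 < a) (hκ : 0 < κ) {α : ℝ}
    (hM : (kreinMatrix a α κ 0).PosDef) : band ha hκ α 0 1 < 0 := by
  have h := band_one_lt ha hκ hM 0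
  rwa [dualVec_zero, add_zero, norm_zero, zero_pow two_ne_zero] at h

/-- At a negative eigenvalue the Krein matrix is singular. -/
theorem det_kreinMatrix_eq_zero_of_eigenvector {a κ : ℝ} (ha : 0 < a) (hκ : 0 < κ) {α : ℝ} {k : Plane} :
    (∃ u ≠ 0, (u, ((-κ ^ 2 : ℝ) : ℂ) • u) ∈ fiberGraph a (fun _ => α) k) →
      (kreinMatrix a α κ k).det = 0 := by
  rintro ⟨u, hu0, q, hq⟩
  rw [← FiberRel.eq_def, fiberRel_iff ha hκ] at hq
  have h0 : ((-κ ^ 2 : ℝ) : ℂ) • u + ((κ ^ 2 : ℝ) : ℂ) • u = 0 := by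
    rw [← add_smul]; push_cast; simp
  simp only [h0, map_zero, zero_add, inner_zero_right] at hq
  rw [← Matrix.exists_mulVec_eq_zero_iff]
  refine ⟨q, ?_, ?_⟩
  · rintro rfl
    refine hu0 (hq.1.trans ?_)
    simp
  · funext j
    exact (hq.2 j).symm

theorem kreinMatrix_zero_symm {a κ : ℝ} (ha : 0 < a) (hκ : 0 < κ) (α : ℝ) :
    kreinMatrix a α κ 0 1 1 = kreinMatrix a α κ 0 0 0 ∧
      kreinMatrix a α κ 0 1 0 = kreinMatrix a α κ 0 0 1 := by
  refine ⟨?_, ?_⟩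
  · rw [kreinMatrix_zero ha hκ, kreinMatrix_zero ha hκ]
    simp [greenSum]
  · rw [← (isHermitian_kreinMatrix ha hκ α 0).apply 1 0, kreinMatrix_zero ha hκ]
    exact Complex.conj_ofReal _

/-- The symmetric combination of charges at zero quasi-momentum. -/
def evenKrein (a α κ : ℝ) : ℝ :=
  α + 1 / (2 * Real.pi) * Real.log (κ / 2) - greenSum a κ 0 0 - greenSum a κ 0 1

theorem evenKrein_eq {a κ : ℝ} (ha : 0 < a) (hκ : 0 < κ) (α : ℝ) :
    (evenKrein a α κ : ℂ) = kreinMatrix a α κ 0 0 0 + kreinMatrix a α κ 0 0 1 := by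
  rw [kreinMatrix_zero ha hκ, kreinMatrix_zero ha hκ, evenKrein]
  simp; ring

/-- If the even charge combination is critical, `-κ²` is an eigenvalue at zero quasi-momentum. -/
theorem exists_eigenvector_of_evenKrein {a κ : ℝ} (ha : 0 < a) (hκ : 0 < κ) {α : ℝ}
    (h : evenKrein a α κ = 0) :
    ∃ u ≠ 0, (u, ((-κ ^ 2 : ℝ) : ℂ) • u) ∈ fiberGraph a (fun _ => α) 0 := by
  have hc := cellArea_pos ha
  have hsum := evenKrein_eq ha hκ α
  rw [h, Complex.ofReal_zero] at hsum
  have h0 : ∀ u : DualL2, ((-κ ^ 2 : ℝ) : ℂ) • u + ((κ ^ 2 : ℝ) : ℂ) • u = 0 := fun u => by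
    rw [← add_smul]; push_cast; simp
  refine ⟨((1 / cellArea a : ℝ) : ℂ) • ∑ j : Fin 2, (1 : ℂ) • kreinVec ha hκ 0 j, ?_,
    fun _ => 1, ?_⟩
  · intro hu
    have hd := freeResolvent_pos (a := a) hκ 0 0
    have h1 := congrFun (congrArg (fun v : DualL2 => (v : ℤ × ℤ → ℂ)) hu) 0
    rw [Fin.sum_univ_two] at h1
    simp only [one_smul, lp.coeFn_smul, lp.coeFn_add, Pi.smul_apply, Pi.add_apply, kreinVec_apply,
      lp.coeFn_zero, Pi.zero_apply, smul_eq_mul, mul_eq_zero, Complex.ofReal_eq_zero,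
      planeWave, dualVec_zero, add_zero, inner_zero_left, Complex.ofReal_zero, mul_zero,
      Complex.exp_zero, map_one, one_mul] at h1
    rcases h1 with h1 | h1
    · exact (one_div_pos.mpr hc).ne' h1
    · rw [← Complex.ofReal_add] at h1
      have : freeResolvent a κ 0 0 + freeResolvent a κ 0 0 = 0 := by exact_mod_cast h1
      linarith
  · rw [← FiberRel.eq_def, fiberRel_iff ha hκ]
    simp only [h0, map_zero, zero_add, inner_zero_right]
    refine ⟨trivial, fun j => ?_⟩
    obtain ⟨h1, h2⟩ := kreinMatrix_zero_symm ha hκ α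
    rw [Fin.sum_univ_two, mul_one, mul_one]
    fin_cases j
    · exact hsum
    · change 0 = kreinMatrix a α κ 0 1 0 + kreinMatrix a α κ 0 1 1
      rw [h1, h2, add_comm, ← hsum]

/-- Strict diagonal dominance: at every `k` the diagonal entries have modulus at least `L - greenSum
a κ 0 0` and the others at most `greenSum a κ 0 1`. Positivity at `k = 0` of the even combination is
the strict inequality between these bounds. -/
theorem det_kreinMatrix_ne_zero {a κ : ℝ} (ha : 0 < a) (hκ : 0 < κ) {α : ℝ}
    (h : 0 < evenKrein a α κ) (k : Plane) : (kreinMatrix a α κ k).det ≠ 0 := by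
  set L := α + 1 / (2 * Real.pi) * Real.log (κ / 2) with hL
  have h00 := norm_kreinMatrix_sub_le ha hκ α k 0 0
  have h11 := norm_kreinMatrix_sub_le ha hκ α k 1 1
  have h01 := norm_kreinMatrix_sub_le ha hκ α k 0 1
  have h10 : ‖kreinMatrix a α κ k 1 0‖ = ‖kreinMatrix a α κ k 0 1‖ := by
    rw [← (isHermitian_kreinMatrix ha hκ α k).apply 1 0]; exact norm_star _
  have e11 : greenSum a κ 1 1 = greenSum a κ 0 0 := by simp [greenSum]
  rw [if_pos rfl, ← hL] at h00 h11
  rw [if_neg (by decide), sub_zero] at h01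
  rw [e11] at h11
  have hpos : greenSum a κ 0 1 < L - greenSum a κ 0 0 := by
    rw [evenKrein, ← hL] at h; linarith
  have hB := greenSum_nonneg a κ 0 1
  have hlow : ∀ z : ℂ, ‖z - (L : ℂ)‖ ≤ greenSum a κ 0 0 → L - greenSum a κ 0 0 ≤ ‖z‖ := by
    intro z hz
    have h1 := norm_sub_norm_le (L : ℂ) z
    rw [norm_sub_rev, Complex.norm_real, Real.norm_eq_abs] at h1
    linarith [le_abs_self L]
  have l0 := hlow _ h00
  have l1 := hlow _ h11
  intro hdet
  rw [Matrix.det_fin_two, sub_eq_zero] at hdet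
  have hn := congrArg norm hdet
  rw [norm_mul, norm_mul, h10] at hn
  have h2 : greenSum a κ 0 1 * greenSum a κ 0 1 <
      (L - greenSum a κ 0 0) * (L - greenSum a κ 0 0) :=
    mul_self_lt_mul_self hB hpos
  have h3 : (L - greenSum a κ 0 0) * (L - greenSum a κ 0 0) ≤
      ‖kreinMatrix a α κ k 0 0‖ * ‖kreinMatrix a α κ k 1 1‖ :=
    mul_le_mul l0 l1 (hB.trans hpos.le) (norm_nonneg _)
  have h4 : ‖kreinMatrix a α κ k 0 1‖ * ‖kreinMatrix a α κ k 0 1‖ ≤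
      greenSum a κ 0 1 * greenSum a κ 0 1 := mul_self_le_mul_self (norm_nonneg _) h01
  linarith

theorem freeResolvent_anti {a κ κ' : ℝ} (hκ : 0 < κ) (h : κ ≤ κ') (k : Plane) (m : ℤ × ℤ) :
    freeResolvent a κ' k m ≤ freeResolvent a κ k m := by
  unfold freeResolvent
  gcongr

theorem norm_kreinMatrix_sub_kappa_le {a μ κ κ' : ℝ} (ha : 0 < a) (hμ : 0 < μ) (hκ : μ ≤ κ)
    (hκ' : μ ≤ κ') (α : ℝ) (k : Plane) (j l : Fin 2) :
    ‖kreinMatrix a α κ k j l - kreinMatrix a α κ' k j l‖ ≤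
      1 / cellArea a * (∑' m, freeResolvent a μ k m * freeResolvent a μ k m) *
        |κ ^ 2 - κ' ^ 2| := by
  have hc := cellArea_pos ha
  rw [kreinMatrix_sub_kappa ha (hμ.trans_le hκ) (hμ.trans_le hκ'), norm_mul, Complex.norm_real,
    Real.norm_eq_abs, abs_mul, abs_of_pos (one_div_pos.mpr hc), mul_right_comm]
  refine mul_le_mul_of_nonneg_right ?_ (abs_nonneg _)
  refine mul_le_mul_of_nonneg_left ?_ (by positivity)
  refine tsum_of_norm_bounded (summable_freeResolvent_mul ha hμ hμ k).hasSum fun m => ?_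
  have h1 := freeResolvent_pos (a := a) (hμ.trans_le hκ) k m
  have h2 := freeResolvent_pos (a := a) (hμ.trans_le hκ') k m
  rw [norm_mul, norm_planeWave, one_mul, Complex.norm_real, Real.norm_of_nonneg (by positivity)]
  exact mul_le_mul (freeResolvent_anti hμ hκ k m) (freeResolvent_anti hμ hκ' k m) h2.le
    (freeResolvent_pos hμ k m).le

theorem continuousOn_evenKrein {a μ : ℝ} (ha : 0 < a) (hμ : 0 < μ) (α : ℝ) :
    ContinuousOn (evenKrein a α) (Set.Ici μ) := by
  set D := 1 / cellArea a * (∑' m, freeResolvent a μ 0 m * freeResolvent a μ 0 m) with hD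
  intro κ hκ
  rw [ContinuousWithinAt, tendsto_iff_norm_sub_tendsto_zero]
  have hlim : Tendsto (fun κ' : ℝ => D * |κ' ^ 2 - κ ^ 2| + D * |κ' ^ 2 - κ ^ 2|)
      (𝓝[Set.Ici μ] κ) (𝓝 0) := by
    have hcont : Continuous fun κ' : ℝ => D * |κ' ^ 2 - κ ^ 2| + D * |κ' ^ 2 - κ ^ 2| := by
      fun_prop
    have := hcont.tendsto κ
    simp only [sub_self, abs_zero, mul_zero, add_zero] at this
    exact this.mono_left nhdsWithin_le_nhds
  refine squeeze_zero' (Eventually.of_forall fun _ => norm_nonneg _) ?_ hlim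
  filter_upwards [self_mem_nhdsWithin] with κ' hκ'
  have h1 := norm_kreinMatrix_sub_kappa_le ha hμ hκ' hκ α 0 0 0
  have h2 := norm_kreinMatrix_sub_kappa_le ha hμ hκ' hκ α 0 0 1
  have e : ‖evenKrein a α κ' - evenKrein a α κ‖ =
      ‖(kreinMatrix a α κ' 0 0 0 - kreinMatrix a α κ 0 0 0) +
        (kreinMatrix a α κ' 0 0 1 - kreinMatrix a α κ 0 0 1)‖ := by
    rw [← Complex.norm_real, Complex.ofReal_sub, evenKrein_eq ha (hμ.trans_le hκ'),
      evenKrein_eq ha (hμ.trans_le hκ)]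
    congr 1; ring
  rw [e]
  exact (norm_add_le _ _).trans (add_le_add h1 h2)

/-- The quadratic form is tested on equal charges `(1, 1)`. -/
theorem evenKrein_pos {a κ : ℝ} (ha : 0 < a) (hκ : 0 < κ) {α : ℝ}
    (hM : (kreinMatrix a α κ 0).PosDef) : 0 < evenKrein a α κ := by
  have h := (Matrix.posDef_iff_dotProduct_mulVec.mp hM).2 (x := fun _ => (1 : ℂ))
    (fun h => one_ne_zero (congrFun h 0))
  obtain ⟨h1, h2⟩ := kreinMatrix_zero_symm ha hκ α
  have e : star (fun _ : Fin 2 => (1 : ℂ)) ⬝ᵥ (kreinMatrix a α κ 0).mulVec (fun _ => 1) =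
      ((2 * evenKrein a α κ : ℝ) : ℂ) := by
    simp only [dotProduct, Matrix.mulVec, Fin.sum_univ_two, Pi.star_apply, star_one, one_mul,
      mul_one, h1, h2]
    push_cast
    rw [evenKrein_eq ha hκ]; ring
  rw [e] at h
  have := Complex.zero_lt_real.mp h
  linarith

/-- The bottom of the spectrum is the lowest eigenvalue at zero quasi-momentum. -/
theorem band_one_zero_le {a κ : ℝ} (ha : 0 < a) (hκ : 0 < κ) {α : ℝ}
    (hM : ∀ k, (kreinMatrix a α κ k).PosDef) (k : Plane) :
    band ha hκ α 0 1 ≤ band ha hκ α k 1 := by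
  by_contra! hlt
  set E := band ha hκ α k 1 with hE
  have hneg := hlt.trans (band_one_zero_neg ha hκ (hM 0))
  set κ' := √(-E) with hκ'
  have hκ'0 : 0 < κ' := Real.sqrt_pos.mpr (by linarith)
  have hEκ : E = -κ' ^ 2 := by rw [hκ', Real.sq_sqrt (by linarith)]; ring
  have hgt := ((band_eq_iff ha hκ (hM k) one_pos E).mp hE.symm).1
  have hκκ : κ' ≤ κ := by
    refine (pow_le_pow_iff_left₀ hκ'0.le hκ.le two_ne_zero).mp ?_
    rw [hEκ] at hgt; linarith
  -- Otherwise the even combination, positive at `κ`, vanishes at some `μ ≥ κ'`. Then `-μ² ≤ E` is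
  -- an eigenvalue at `k = 0`, below the assumed lowest one.
  have hpos : 0 < evenKrein a α κ' := by
    by_contra! hle
    obtain ⟨μ, hμ, hμ0⟩ := intermediate_value_Icc hκκ
      ((continuousOn_evenKrein ha hκ'0 α).mono Set.Icc_subset_Ici_self)
      ⟨hle, (evenKrein_pos ha hκ (hM 0)).le⟩
    have hμp : 0 < μ := hκ'0.trans_le hμ.1
    obtain ⟨n, hn⟩ := (exists_band_eq_iff ha hκ (hM 0) _).mpr
      (exists_eigenvector_of_evenKrein ha hμp hμ0)
    have hn' : band ha hκ α 0 n = -μ ^ 2 := by exact_mod_cast hn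
    have h1 := band_mono ha hκ (hM 0) one_pos (Nat.one_le_iff_ne_zero.mpr n.ne_zero)
    have h2 : κ' ^ 2 ≤ μ ^ 2 := by gcongr; exact hμ.1
    exact absurd ((hlt.trans_le h1).trans_eq hn') (by rw [hEκ, not_lt]; exact neg_le_neg h2)
  -- Dominance at `κ'` makes the Krein matrix at `k` nonsingular, while `E = -κ'²` being an
  -- eigenvalue makes it singular.
  refine det_kreinMatrix_ne_zero ha hκ'0 hpos k (det_kreinMatrix_eq_zero_of_eigenvector ha hκ'0 ?_)
  rw [← hEκ]
  exact (exists_band_eq_iff ha hκ (hM k) _).mp ⟨1, rfl⟩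

/-! ### The fourth band at zero quasi-momentum -/

/-- Three conditions are imposed: orthogonality to the zero mode and to both Krein vectors. On what
remains `kreinOp` is the free resolvent, and every surviving mode has `|ξ_m| ≥ |k₁|`. -/
theorem dualLength_sq_le_band_four {a κ : ℝ} (ha : 0 < a) (hκ : 0 < κ) {α : ℝ}
    (hM : (kreinMatrix a α κ 0).PosDef) : dualLength a ^ 2 ≤ band ha hκ α 0 4 := by
  set W : Submodule ℂ DualL2 := Submodule.span ℂ (Set.range
    ![lp.single 2 (0 : ℤ × ℤ) (1 : ℂ), kreinVec ha hκ 0 0, kreinVec ha hκ 0 1]) with hW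
  have hfin : FiniteDimensional ℂ W := FiniteDimensional.span_of_finite ℂ (Set.finite_range _)
  have hrank : Module.finrank ℂ W < 4 := by
    refine lt_of_le_of_lt (finrank_range_le_card (R := ℂ) _) ?_
    simp
  have hL := dualLength_pos ha
  have h := minMax_le not_finiteDimensional_dualL2 (T := kreinOp ha hκ α 0) (n := 4)
    (t := 1 / (dualLength a ^ 2 + κ ^ 2)) W hrank (by
      intro v hv
      have hm : ∀ i, inner ℂ ((![lp.single 2 (0 : ℤ × ℤ) (1 : ℂ), kreinVec ha hκ 0 0,
          kreinVec ha hκ 0 1] : Fin 3 → DualL2) i) v = (0 : ℂ) := fun i =>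
        Submodule.inner_right_of_mem_orthogonal (Submodule.subset_span (Set.mem_range_self i)) hv
      have h0 : v 0 = 0 := by
        have := hm 0
        simp only [Matrix.cons_val_zero, lp.inner_single_left] at this
        simpa using this
      have hg : (fun l => inner ℂ (kreinVec ha hκ 0 l) v) = (0 : Fin 2 → ℂ) := by
        funext l
        fin_cases l
        · exact hm 1
        · exact hm 2
      have hT : kreinOp ha hκ α 0 v = freeOp hκ a 0 v := by
        rw [kreinOp_apply, hg, Matrix.mulVec_zero]
        simp
      rw [hT]
      refine hasSum_le (fun m => ?_) (hasSum_inner_freeOp hκ a 0 v)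
        ((hasSum_norm_sq v).mul_left _)
      by_cases hm0 : m = 0
      · rw [hm0, h0]; simp
      · refine mul_le_mul_of_nonneg_right ?_ (by positivity)
        rw [freeResolvent, add_zero]
        have hle := dualLength_le_norm_sub (a := a) hm0
        rw [dualVec_zero, sub_zero] at hle
        gcongr)
  have hp := minMax_kreinOp_pos ha hκ hM (n := 4) (by norm_num)
  have h2 := one_div_le_one_div_of_le hp h
  rw [one_div_one_div] at h2
  rw [band]; linarith

/-! ### Energies carried by two degenerate plane waves -/

/-- The modes `0` and `(1, -1)` agree at all sites, because `ξ_m · x₀ = (4π/3)(m₁ + m₂)` vanishes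
for the second. If `k` gives them equal energy, their difference vanishes on every scatterer and is
an eigenvector with zero charge. -/
theorem exists_eigenvector_of_ge {a : ℝ} (ha : 0 < a) (α : ℝ) {E : ℝ}
    (hE : dualLength a ^ 2 ≤ E) :
    ∃ k, ∃ u ≠ 0, (u, (E : ℂ) • u) ∈ fiberGraph a (fun _ => α) k := by
  have hL := dualLength_pos ha
  -- On the line of equal energy, `k = (s - 1/2) k₁ + (s + 1/2) k₂`, the energy in units of `|k₁|²`
  -- is `s² + 3/4`. So this construction reaches every `E ≥ |k₁|²`.
  set s := √(E / dualLength a ^ 2 - 3 / 4) with hs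
  have hs2 : s ^ 2 = E / dualLength a ^ 2 - 3 / 4 := by
    refine Real.sq_sqrt ?_
    have : 1 ≤ E / dualLength a ^ 2 := (one_le_div (by positivity)).mpr hE
    linarith
  set t : Fin 2 → ℝ := ![s - 1 / 2, s + 1 / 2] with ht
  have hk : ‖momentum a t‖ ^ 2 = E := by
    rw [norm_sq_momentum]
    simp only [ht, Matrix.cons_val_zero, Matrix.cons_val_one]
    have : (s - 1 / 2) ^ 2 + (s + 1 / 2) ^ 2 - (s - 1 / 2) * (s + 1 / 2) = E / dualLength a ^ 2 := by
      linear_combination hs2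
    rw [this]; field_simp
  have hk' : ‖dualVec a (1, -1) + momentum a t‖ ^ 2 = E := by
    rw [dualVec_eq_momentum, ← momentum_add, norm_sq_momentum]
    simp only [ht, Pi.add_apply, Matrix.cons_val_zero, Matrix.cons_val_one]
    have : ((((1 : ℤ) : ℝ) + (s - 1 / 2)) ^ 2 + (((-1 : ℤ) : ℝ) + (s + 1 / 2)) ^ 2 -
        (((1 : ℤ) : ℝ) + (s - 1 / 2)) * (((-1 : ℤ) : ℝ) + (s + 1 / 2))) = E / dualLength a ^ 2 := by
      push_cast
      linear_combination hs2
    rw [this]; field_simp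
  set k := momentum a t
  have hne : ((1, -1) : ℤ × ℤ) ≠ 0 := by decide
  set u : DualL2 := lp.single 2 (0 : ℤ × ℤ) (1 : ℂ) - lp.single 2 ((1, -1) : ℤ × ℤ) (1 : ℂ) with hu
  have hu0 : u 0 = 1 := by
    rw [hu, lp.coeFn_sub, Pi.sub_apply, lp.single_apply_self, lp.single_apply,
      Pi.single_eq_of_ne hne.symm, sub_zero]
  have hum : ∀ m, m ≠ 0 → m ≠ (1, -1) → u m = 0 := fun m h1 h2 => by
    rw [hu, lp.coeFn_sub, Pi.sub_apply, lp.single_apply, lp.single_apply, Pi.single_eq_of_ne h1,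
      Pi.single_eq_of_ne h2, sub_zero]
  have hen : ∀ m, ((‖dualVec a m + k‖ ^ 2 : ℝ) : ℂ) * u m = (E : ℂ) * u m := by
    intro m
    by_cases h1 : m = 0
    · rw [h1, dualVec_zero, zero_add, hk]
    · by_cases h2 : m = (1, -1)
      · rw [h2, hk']
      · rw [hum m h1 h2, mul_zero, mul_zero]
  refine ⟨k, u, ?_, ?_⟩
  · intro h
    rw [h] at hu0
    exact zero_ne_one hu0
  rw [mem_fiberGraph_iff]
  refine ⟨0, (fiberRel_iff ha one_pos α k 0 u _).mpr ⟨?_, fun j => ?_⟩⟩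
  · ext m
    simp only [Pi.zero_apply, zero_smul, Finset.sum_const_zero, smul_zero, add_zero]
    rw [freeOp_apply, ← add_smul, lp.coeFn_smul, Pi.smul_apply, smul_eq_mul, add_mul, ← hen m,
      ← add_mul, ← mul_assoc, ← Complex.ofReal_add, ← Complex.ofReal_mul, freeResolvent,
      one_div_mul_cancel (by positivity), Complex.ofReal_one, one_mul]
  · simp only [Pi.zero_apply, mul_zero, Finset.sum_const_zero]
    rw [← add_smul, inner_smul_right, hu, inner_sub_right, ← inner_conj_symm _ (lp.single 2 0 1),
      ← inner_conj_symm _ (lp.single 2 (1, -1) 1), lp.inner_single_left, lp.inner_single_left,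
      kreinVec_apply, kreinVec_apply, freeResolvent, freeResolvent, hk', dualVec_zero, zero_add, hk]
    have hp : planeWave a k (cellPoint a j) (1, -1) = planeWave a k (cellPoint a j) 0 := by
      rw [planeWave_eq_mul, planeWave_eq_mul, dualVec_zero]
      congr 1
      fin_cases j
      · simp [cellPoint, bloch]
      · simp only [cellPoint, bloch]
        simp [inner_dualVec_x₀ ha]
    rw [hp, sub_self, mul_zero]

end

end HoneycombScatterer

namespace HoneycombScatterer

noncomputable section

open scoped ComplexOrder

/-! ### The Brillouin zone -/

theorem isClosed_brillouinZone (a : ℝ) : IsClosed (brillouinZone a) := by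
  rw [show brillouinZone a = ⋂ m : ℤ × ℤ, {k | ‖k‖ ≤ ‖k - dualVec a m‖} by
    ext k; simp [brillouinZone]]
  exact isClosed_iInter fun m => isClosed_le continuous_norm (continuous_id.sub continuous_const).norm

/-- Pick a shortest representative modulo the dual lattice; only the finitely many no longer than
`k` compete. -/
theorem exists_add_dualVec_mem {a : ℝ} (ha : 0 < a) (k : Plane) :
    ∃ n, k + dualVec a n ∈ brillouinZone a := by
  have hne : {m : ℤ × ℤ | ‖dualVec a m + k‖ ≤ ‖k‖}.Nonempty :=
    ⟨0, by simp [dualVec_zero]⟩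
  obtain ⟨n, hn, hmin⟩ := Set.exists_min_image _ (fun m => ‖dualVec a m + k‖)
    (finite_norm_dualVec_add_le ha k ‖k‖) hne
  refine ⟨n, fun m => ?_⟩
  rw [add_sub_assoc, ← dualVec_sub, add_comm k, add_comm k]
  by_cases h : ‖dualVec a (n - m) + k‖ ≤ ‖k‖
  · exact hmin _ h
  · exact hn.trans (not_le.mp h).le

theorem dualVec_neg (a : ℝ) (m : ℤ × ℤ) : dualVec a (-m) = -dualVec a m := by
  rw [← zero_sub, dualVec_sub, dualVec_zero, zero_sub]

theorem norm_le_of_mem_brillouinZone {a : ℝ} (ha : 0 < a) {k : Plane} (hk : k ∈ brillouinZone a) :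
    ‖k‖ ≤ ‖k₁ a‖ + ‖k₂ a‖ := by
  obtain ⟨t, rfl⟩ := exists_momentum_eq ha k
  refine (hk (cellIndex t)).trans ?_
  rw [← momentum_intVec, ← momentum_sub]
  exact norm_momentum_le (sub_cellIndex_mem t)

theorem isCompact_brillouinZone {a : ℝ} (ha : 0 < a) : IsCompact (brillouinZone a) :=
  Metric.isCompact_of_isClosed_isBounded (isClosed_brillouinZone a)
    (isBounded_iff_forall_norm_le.mpr ⟨_, fun _ hk => norm_le_of_mem_brillouinZone ha hk⟩)

theorem zero_mem_brillouinZone (a : ℝ) : (0 : Plane) ∈ brillouinZone a := fun m => by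
  rw [norm_zero]; exact norm_nonneg _

theorem isPreconnected_brillouinZone (a : ℝ) : IsPreconnected (brillouinZone a) := by
  refine (StarConvex.isPathConnected (a := (0 : Plane)) ?_
    (zero_mem_brillouinZone a)).isConnected.isPreconnected
  -- The zone is an intersection of half-planes containing the origin, hence star-shaped about it.
  intro k hk s t hs ht hst m
  rw [smul_zero, zero_add]
  have h : ‖k‖ ^ 2 ≤ ‖k - dualVec a m‖ ^ 2 := by gcongr; exact hk m
  rw [norm_sub_sq_real] at h
  refine (pow_le_pow_iff_left₀ (norm_nonneg _) (norm_nonneg _) two_ne_zero).mp ?_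
  rw [norm_sub_sq_real, real_inner_smul_left]
  nlinarith [norm_nonneg (dualVec a m), sq_nonneg ‖dualVec a m‖]

/-! ### The corner of the Brillouin zone -/

/-- The Dirac point `(k₁ - k₂)/3`, a corner of the Brillouin zone. -/
def diracPoint (a : ℝ) : Plane := momentum a ![1 / 3, -(1 / 3)]

theorem norm_sq_dualVec_add_diracPoint (a : ℝ) (m : ℤ × ℤ) :
    ‖dualVec a m + diracPoint a‖ ^ 2 = dualLength a ^ 2 *
      (((m.1 ^ 2 + m.2 ^ 2 - m.1 * m.2 + m.1 - m.2 : ℤ) : ℝ) + 1 / 3) := by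
  rw [dualVec_eq_momentum, diracPoint, ← momentum_add, norm_sq_momentum]
  simp only [Pi.add_apply, Matrix.cons_val_zero, Matrix.cons_val_one]
  push_cast; ring

/-- With `d = m₁ - m₂`, four times the integer part of the norm form is `(m₁ + m₂)² + 3d² + 4d`,
which is at least `-1` for integral `d`. As a multiple of four it is nonnegative. -/
theorem norm_diracPoint_le (a : ℝ) (m : ℤ × ℤ) :
    ‖diracPoint a‖ ≤ ‖dualVec a m + diracPoint a‖ := by
  refine (pow_le_pow_iff_left₀ (norm_nonneg _) (norm_nonneg _) two_ne_zero).mp ?_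
  have h0 := norm_sq_dualVec_add_diracPoint a 0
  rw [dualVec_zero, zero_add] at h0
  rw [h0, norm_sq_dualVec_add_diracPoint]
  gcongr ?_ * (Int.cast ?_ + _)
  simp only [Prod.fst_zero, Prod.snd_zero]
  rcases le_or_gt (m.1 - m.2) (-1) with h | h
  · nlinarith [sq_nonneg (m.1 + m.2), mul_nonneg_of_nonpos_of_nonpos (by omega : m.1 - m.2 + 1 ≤ 0)
      (by omega : m.1 - m.2 ≤ 0), sq_nonneg (m.1 - m.2 + 2), sq_nonneg (m.1 - m.2 + 1)]
  · nlinarith [sq_nonneg (m.1 + m.2), sq_nonneg (m.1 - m.2)]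

theorem diracPoint_mem (a : ℝ) : diracPoint a ∈ brillouinZone a := fun m => by
  have h := norm_diracPoint_le a (-m)
  rwa [dualVec_neg, neg_add_eq_sub] at h

/-- The action on the dual lattice of the rotation by `2π/3` about `-diracPoint`. -/
def dualRotation : ℤ × ℤ ≃ ℤ × ℤ where
  toFun m := (-m.2, m.1 - m.2 + 1)
  invFun m := (m.2 - m.1 - 1, -m.1)
  left_inv m := by ext <;> dsimp <;> ring
  right_inv m := by ext <;> dsimp <;> ring

theorem norm_dualRotation (a : ℝ) (m : ℤ × ℤ) :
    ‖dualVec a (dualRotation m) + diracPoint a‖ = ‖dualVec a m + diracPoint a‖ := by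
  refine (pow_left_inj₀ (norm_nonneg _) (norm_nonneg _) two_ne_zero).mp ?_
  rw [norm_sq_dualVec_add_diracPoint, norm_sq_dualVec_add_diracPoint]
  simp only [dualRotation, Equiv.coe_fn_mk]
  push_cast; ring

theorem planeWave_diracPoint_dualRotation {a : ℝ} (ha : 0 < a) (m : ℤ × ℤ) :
    planeWave a (diracPoint a) (x₀ a) (dualRotation m) =
      bloch (k₁ a) (x₀ a) * planeWave a (diracPoint a) (x₀ a) m := by
  rw [bloch_k₁_x₀ ha, planeWave_eq_mul, planeWave_eq_mul, mul_left_comm]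
  congr 1
  rw [bloch, bloch, inner_dualVec_x₀ ha, inner_dualVec_x₀ ha, ← Complex.exp_add]
  rw [Complex.exp_eq_exp_iff_exists_int]
  refine ⟨-(2 * m.2), ?_⟩
  simp only [dualRotation, Equiv.coe_fn_mk]
  push_cast; ring

theorem exists_planeWave_dualRotation {a : ℝ} (ha : 0 < a) {j l : Fin 2} (h : j ≠ l) :
    ∃ c : ℂ, c ≠ 1 ∧ ∀ m,
      planeWave a (diracPoint a) (cellPoint a j - cellPoint a l) (dualRotation m) =
        c * planeWave a (diracPoint a) (cellPoint a j - cellPoint a l) m := by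
  have h1 := bloch_k₁_x₀_ne ha
  fin_cases j <;> fin_cases l
  · exact absurd rfl h
  · refine ⟨(starRingEnd ℂ) (bloch (k₁ a) (x₀ a)), fun e => h1 ?_, fun m => ?_⟩
    · rw [← Complex.conj_conj (bloch (k₁ a) (x₀ a)), e, map_one]
    · simp [cellPoint, ← conj_planeWave, planeWave_diracPoint_dualRotation ha]
  · exact ⟨_, h1, fun m => by simp [cellPoint, planeWave_diracPoint_dualRotation ha]⟩
  · exact absurd rfl h

/-- Reindexing by the rotation multiplies the sum by a number different from `1`, so the sum is
zero. -/
theorem tsum_planeWave_diracPoint_mul {a : ℝ} (ha : 0 < a) {j l : Fin 2} (h : j ≠ l)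
    {f : ℤ × ℤ → ℂ} (hf : ∀ m, f (dualRotation m) = f m) :
    ∑' m, planeWave a (diracPoint a) (cellPoint a j - cellPoint a l) m * f m = 0 := by
  obtain ⟨c, hc, hr⟩ := exists_planeWave_dualRotation ha h
  have e := dualRotation.tsum_eq
    fun m => planeWave a (diracPoint a) (cellPoint a j - cellPoint a l) m * f m
  simp only [hr, hf, mul_assoc, tsum_mul_left] at e
  have e2 : (c - 1) * ∑' m, planeWave a (diracPoint a) (cellPoint a j - cellPoint a l) m * f m = 0 := by
    rw [sub_mul, one_mul, e, sub_self]
  exact (mul_eq_zero.mp e2).resolve_left (sub_ne_zero.mpr hc)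

/-- The diagonal entries agree for any `k`, and the rotation kills the off-diagonal lattice sums,
whose weights depend on `|ξ_m + k|` only. -/
theorem kreinMatrix_diracPoint {a κ : ℝ} (ha : 0 < a) (hκ : 0 < κ) (α : ℝ) :
    ∃ s : ℂ, ∀ j l, kreinMatrix a α κ (diracPoint a) j l = if j = l then s else 0 := by
  refine ⟨kreinMatrix a α κ (diracPoint a) 0 0, fun j l => ?_⟩
  by_cases h : j = l
  · subst h
    rw [if_pos rfl, kreinMatrix, Matrix.of_apply, Matrix.of_apply]
    congr 1; funext r
    rw [kreinCut_self, kreinCut_self]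
  · rw [if_neg h]
    refine tendsto_nhds_unique (tendsto_kreinCut ha hκ α _ j l)
      (tendsto_const_nhds.congr fun r => ?_)
    rw [kreinCut, if_neg h, waveSum, cutSum, tsum_planeWave_diracPoint_mul ha h, mul_zero, sub_zero]
    intro m
    simp only [cutResolvent, freeResolvent, norm_dualRotation]

end

end HoneycombScatterer

namespace HoneycombScatterer

noncomputable section

open scoped ComplexOrder

/-! ### Degeneracy of the two lowest bands at the Dirac point -/

/-- Below all free energies of the fiber the multiplier `(|ξ_m + k|² + κ²)/(|ξ_m + k|² - E)` is
bounded; it carries the Krein vectors to the Green functions at energy `E`. -/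
theorem exists_greenVec {a κ E : ℝ} (ha : 0 < a) (hκ : 0 < κ) (hE : E < ‖diracPoint a‖ ^ 2)
    (hEκ : 0 < E + κ ^ 2) :
    ∃ h : Fin 2 → DualL2, ∀ l m, h l m =
      (starRingEnd ℂ) (planeWave a (diracPoint a) (cellPoint a l) m) *
        (((‖dualVec a m + diracPoint a‖ ^ 2 - E)⁻¹ : ℝ) : ℂ) := by
  set k := diracPoint a with hk
  have hle : ∀ m, ‖k‖ ^ 2 ≤ ‖dualVec a m + k‖ ^ 2 := fun m => by
    gcongr; exact norm_diracPoint_le a m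
  have hb : ∀ m, |(‖dualVec a m + k‖ ^ 2 + κ ^ 2) / (‖dualVec a m + k‖ ^ 2 - E)| ≤
      1 + (E + κ ^ 2) / (‖k‖ ^ 2 - E) := fun m => by
    have h1 : 0 < ‖k‖ ^ 2 - E := sub_pos.mpr hE
    have h2 : 0 < ‖dualVec a m + k‖ ^ 2 - E := by linarith [hle m]
    rw [abs_of_nonneg (by positivity), show (‖dualVec a m + k‖ ^ 2 + κ ^ 2) /
      (‖dualVec a m + k‖ ^ 2 - E) = 1 + (E + κ ^ 2) / (‖dualVec a m + k‖ ^ 2 - E) by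
        field_simp; ring]
    gcongr
    exact norm_diracPoint_le a m
  refine ⟨fun l => diagOp _ hb (kreinVec ha hκ k l), fun l m => ?_⟩
  have h2 : 0 < ‖dualVec a m + k‖ ^ 2 - E := by linarith [hle m]
  rw [diagOp_apply, kreinVec_apply, mul_left_comm, ← Complex.ofReal_mul, freeResolvent]
  congr 2
  field_simp

/-- At the Dirac point both the Krein matrix and the inner products of Krein vectors with Green
functions are scalar. The condition on the charges is then one scalar equation, the same for each
component, so if it holds for some nonzero charge it holds for all. -/
theorem mem_fiberGraph_diracPoint {a κ E : ℝ} (ha : 0 < a) (hκ : 0 < κ) {α : ℝ}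
    (hE : E < ‖diracPoint a‖ ^ 2) {h : Fin 2 → DualL2}
    (hh : ∀ l m, h l m = (starRingEnd ℂ) (planeWave a (diracPoint a) (cellPoint a l) m) *
        (((‖dualVec a m + diracPoint a‖ ^ 2 - E)⁻¹ : ℝ) : ℂ))
    (hex : ∃ u ≠ 0, (u, (E : ℂ) • u) ∈ fiberGraph a (fun _ => α) (diracPoint a)) (l : Fin 2) :
    (h l, (E : ℂ) • h l) ∈ fiberGraph a (fun _ => α) (diracPoint a) := by
  set k := diracPoint a with hk
  have hc := (cellArea_pos ha).ne'
  have hpos : ∀ m, 0 < ‖dualVec a m + k‖ ^ 2 - E := fun m => by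
    have : ‖k‖ ^ 2 ≤ ‖dualVec a m + k‖ ^ 2 := by gcongr; exact norm_diracPoint_le a m
    linarith
  obtain ⟨s, hs⟩ := kreinMatrix_diracPoint ha hκ α
  rw [← hk] at hs
  have hin : ∃ σ : ℂ, ∀ j l, inner ℂ (kreinVec ha hκ k j) (h l) = if j = l then σ else 0 := by
    have hi : ∀ j l, inner ℂ (kreinVec ha hκ k j) (h l) =
        ∑' m, planeWave a k (cellPoint a j - cellPoint a l) m *
          ((freeResolvent a κ k m * (‖dualVec a m + k‖ ^ 2 - E)⁻¹ : ℝ) : ℂ) := fun j l => by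
      rw [← (inner_kreinVec ha hκ k j (h l)).tsum_eq]
      congr 1; funext m
      rw [hh, ← planeWave_mul_conj]
      push_cast; ring
    refine ⟨inner ℂ (kreinVec ha hκ k 0) (h 0), fun j l => ?_⟩
    by_cases hjl : j = l
    · rw [if_pos hjl, hi, hi, hjl, sub_self, sub_self]
    · rw [if_neg hjl, hi, tsum_planeWave_diracPoint_mul ha hjl]
      intro m
      simp only [freeResolvent, hk, norm_dualRotation]
  obtain ⟨σ, hσ⟩ := hin
  have hfirst : ∀ (q : Fin 2 → ℂ) (u : DualL2), (∀ m, ((E : ℂ) • u) m =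
      ((‖dualVec a m + k‖ ^ 2 : ℝ) : ℂ) * u m - ((1 / cellArea a : ℝ) : ℂ) *
        ∑ j, q j * (starRingEnd ℂ) (planeWave a k (cellPoint a j) m)) ↔
      u = ((1 / cellArea a : ℝ) : ℂ) • ∑ j, q j • h j := fun q u => by
    rw [lp.ext_iff, funext_iff]
    refine forall_congr' fun m => ?_
    have hne : ((‖dualVec a m + k‖ ^ 2 - E : ℝ) : ℂ) ≠ 0 := by exact_mod_cast (hpos m).ne'
    simp only [Fin.sum_univ_two, lp.coeFn_smul, lp.coeFn_add, Pi.smul_apply, Pi.add_apply, hh,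
      smul_eq_mul, Complex.ofReal_inv]
    generalize (starRingEnd ℂ) (planeWave a k (cellPoint a 0) m) = p₀
    generalize (starRingEnd ℂ) (planeWave a k (cellPoint a 1) m) = p₁
    generalize ((1 / cellArea a : ℝ) : ℂ) = c
    rw [show c * (q 0 * (p₀ * ((‖dualVec a m + k‖ ^ 2 - E : ℝ) : ℂ)⁻¹) +
      q 1 * (p₁ * ((‖dualVec a m + k‖ ^ 2 - E : ℝ) : ℂ)⁻¹)) =
      (c * (q 0 * p₀ + q 1 * p₁)) / ((‖dualVec a m + k‖ ^ 2 - E : ℝ) : ℂ) by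
        rw [div_eq_mul_inv]; ring, eq_div_iff hne]
    push_cast
    constructor <;> intro h <;> linear_combination -h
  have hsecond : ∀ (q : Fin 2 → ℂ) (u : DualL2),
      u = ((1 / cellArea a : ℝ) : ℂ) • ∑ j, q j • h j →
      (FiberRel a α k q u ((E : ℂ) • u) ↔ ∀ j,
        ((E + κ ^ 2 : ℝ) : ℂ) * (((1 / cellArea a : ℝ) : ℂ) * (q j * σ)) = s * q j) :=
      fun q u hu => by
    have h1 := (fiber_eq_iff ha hκ k q u ((E : ℂ) • u)).mp ((hfirst q u).mpr hu)
    rw [fiberRel_iff ha hκ, and_iff_right h1]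
    refine forall_congr' fun j => ?_
    rw [← add_smul, ← Complex.ofReal_add, inner_smul_right, hu, inner_smul_right, inner_sum]
    simp only [inner_smul_right, hσ, hs, mul_ite, ite_mul, mul_zero, zero_mul, Finset.sum_ite_eq,
      Finset.mem_univ, if_true]
  obtain ⟨u, hu0, q, hq⟩ := hex
  rw [← FiberRel.eq_def] at hq
  have hu := (hfirst q u).mp hq.1
  have hrel := (hsecond q u hu).mp hq
  -- The given eigenvector has a nonzero charge, since with zero charge it would vanish at an energy
  -- below all free ones. A nonzero component can be cancelled.
  have hval : ((E + κ ^ 2 : ℝ) : ℂ) * (((1 / cellArea a : ℝ) : ℂ) * σ) = s := by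
    by_contra hne
    refine hu0 (hu.trans ?_)
    have hq0 : ∀ j, q j = 0 := fun j => by
      by_contra hj
      exact hne (mul_right_cancel₀ hj (by linear_combination hrel j))
    simp [hq0]
  have hmem : (((1 / cellArea a : ℝ) : ℂ) • h l, (E : ℂ) • ((1 / cellArea a : ℝ) : ℂ) • h l) ∈
      fiberGraph a (fun _ => α) k := by
    rw [mem_fiberGraph_iff]
    refine ⟨Pi.single l 1, (hsecond _ _ ?_).mpr fun j => ?_⟩
    · congr 1
      simp [Pi.single_apply, ite_smul]
    · rw [← hval]; ring
  have hcc : (((1 / cellArea a : ℝ) : ℂ)) ≠ 0 := by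
    exact_mod_cast (one_div_ne_zero hc)
  have := (fiberGraph a (fun _ => α) k).smul_mem (((1 / cellArea a : ℝ) : ℂ))⁻¹ hmem
  rwa [Prod.smul_mk, smul_comm _ (E : ℂ), inv_smul_smul₀ hcc] at this

/-- Comparing the coefficients at `0` and at its image under the rotation suffices: the ratio of the
two phases changes by a nontrivial cube root of unity. -/
theorem linearIndependent_greenVec {a E : ℝ} (ha : 0 < a) (hE : E < ‖diracPoint a‖ ^ 2)
    {h : Fin 2 → DualL2}
    (hh : ∀ l m, h l m = (starRingEnd ℂ) (planeWave a (diracPoint a) (cellPoint a l) m) *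
        (((‖dualVec a m + diracPoint a‖ ^ 2 - E)⁻¹ : ℝ) : ℂ)) : LinearIndependent ℂ h := by
  rw [Fintype.linearIndependent_iff]
  intro g hg
  have hm : ∀ m, g 0 + g 1 * (starRingEnd ℂ) (planeWave a (diracPoint a) (x₀ a) m) = 0 := by
    intro m
    have hpos : 0 < ‖dualVec a m + diracPoint a‖ ^ 2 - E := by
      have : ‖diracPoint a‖ ^ 2 ≤ ‖dualVec a m + diracPoint a‖ ^ 2 := by
        gcongr; exact norm_diracPoint_le a m
      linarith
    have h1 := congrFun (congrArg (fun v : DualL2 => (v : ℤ × ℤ → ℂ)) hg) m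
    simp only [Fin.sum_univ_two, lp.coeFn_smul, lp.coeFn_add, Pi.smul_apply, Pi.add_apply, hh,
      smul_eq_mul, lp.coeFn_zero, Pi.zero_apply, ← mul_assoc, ← add_mul, mul_eq_zero,
      Complex.ofReal_eq_zero, inv_eq_zero, hpos.ne', or_false] at h1
    simpa [cellPoint, planeWave_zero] using h1
  have h1 := hm 0
  have h2 := hm (dualRotation 0)
  rw [planeWave_diracPoint_dualRotation ha, map_mul] at h2
  have hp : (starRingEnd ℂ) (planeWave a (diracPoint a) (x₀ a) 0) ≠ 0 :=
    (map_ne_zero _).mpr (Complex.exp_ne_zero _)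
  have hb : (starRingEnd ℂ) (bloch (k₁ a) (x₀ a)) - 1 ≠ 0 := fun e => bloch_k₁_x₀_ne ha (by
    rw [← Complex.conj_conj (bloch (k₁ a) (x₀ a)), sub_eq_zero.mp e, map_one])
  have hg1 : g 1 = 0 := by
    have : g 1 * ((starRingEnd ℂ) (planeWave a (diracPoint a) (x₀ a) 0) *
        ((starRingEnd ℂ) (bloch (k₁ a) (x₀ a)) - 1)) = 0 := by linear_combination h2 - h1
    exact (mul_eq_zero.mp this).resolve_right (mul_ne_zero hp hb)
  rw [hg1, zero_mul, add_zero] at h1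
  intro i
  fin_cases i
  · exact h1
  · exact hg1

/-- Two independent eigenvectors at the lowest energy occupy two indices of the enumeration. -/
theorem band_two_diracPoint_le {a κ : ℝ} (ha : 0 < a) (hκ : 0 < κ) {α : ℝ}
    (hM : (kreinMatrix a α κ (diracPoint a)).PosDef) :
    band ha hκ α (diracPoint a) 2 ≤ band ha hκ α (diracPoint a) 1 := by
  set E := band ha hκ α (diracPoint a) 1 with hEdef
  have hE : E < ‖diracPoint a‖ ^ 2 := by
    have := band_one_lt ha hκ hM 0
    rwa [dualVec_zero, zero_add] at this
  have hEκ := ((band_eq_iff ha hκ hM one_pos E).mp hEdef.symm).1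
  obtain ⟨h, hh⟩ := exists_greenVec ha hκ hE hEκ
  have hmem := mem_fiberGraph_diracPoint ha hκ hE hh
    ((exists_band_eq_iff ha hκ hM _).mp ⟨1, rfl⟩)
  obtain ⟨hfin, henc⟩ := (isEigenvalueEnumeration_band ha hκ hM).2 (E : ℂ)
  have hrank : 2 ≤ Module.finrank ℂ (eigenspace (fiberHamiltonian a (fun _ => α) (diracPoint a)) E) := by
    have hli : LinearIndependent ℂ fun l =>
        (⟨h l, by
          change (h l, (E : ℂ) • h l) ∈ (fiberHamiltonian a (fun _ => α) (diracPoint a)).graph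
          rw [graph_fiberHamiltonian ha hκ hM]; exact hmem l⟩ :
          eigenspace (fiberHamiltonian a (fun _ => α) (diracPoint a)) (E : ℂ)) :=
      LinearIndependent.of_comp (Submodule.subtype _) (linearIndependent_greenVec ha hE hh)
    simpa using hli.fintype_card_le_finrank
  have htwo : 1 < {n : ℕ+ | (band ha hκ α (diracPoint a) n : ℂ) = E}.encard := by
    rw [henc]
    exact_mod_cast hrank
  obtain ⟨n, hn, hn1⟩ := Set.exists_ne_of_one_lt_encard htwo 1
  have hn' : band ha hκ α (diracPoint a) n = E := by exact_mod_cast hn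
  rw [← hn']
  refine band_mono ha hκ hM two_pos ?_
  have : (n : ℕ) ≠ 1 := fun e => hn1 (PNat.coe_injective e)
  have := n.pos
  omega

end

end HoneycombScatterer

namespace HoneycombScatterer

noncomputable section

open scoped ComplexOrder

/-! ### The band structure -/

/-- Each piece lies in a single component, so three pieces meet at most three components; an empty
piece does no harm. -/
theorem encard_components_union_le {X : Type*} [TopologicalSpace X] {A B C : Set X}
    (hA : IsPreconnected A) (hB : IsPreconnected B) (hC : IsPreconnected C) :
    {D : Set X | ∃ z ∈ A ∪ B ∪ C, D = connectedComponentIn (A ∪ B ∪ C) z}.encard ≤ 3 := by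
  have key : ∀ P : Set X, IsPreconnected P → P ⊆ A ∪ B ∪ C →
      ∃ D₀, ∀ z ∈ P, connectedComponentIn (A ∪ B ∪ C) z = D₀ := by
    intro P hP hPS
    rcases P.eq_empty_or_nonempty with rfl | ⟨x, hx⟩
    · exact ⟨∅, fun z hz => hz.elim⟩
    · exact ⟨connectedComponentIn (A ∪ B ∪ C) x, fun z hz =>
        (connectedComponentIn_eq (hP.subset_connectedComponentIn hx hPS hz)).symm⟩
  obtain ⟨D₁, h1⟩ := key A hA fun x hx => Or.inl (Or.inl hx)
  obtain ⟨D₂, h2⟩ := key B hB fun x hx => Or.inl (Or.inr hx)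
  obtain ⟨D₃, h3⟩ := key C hC fun x hx => Or.inr hx
  refine (Set.encard_le_encard (t := {D₁, D₂, D₃}) ?_).trans ?_
  · rintro D ⟨z, (hz | hz) | hz, rfl⟩
    · exact Or.inl (h1 z hz)
    · exact Or.inr (Or.inl (h2 z hz))
    · exact Or.inr (Or.inr (h3 z hz))
  · refine (Set.encard_insert_le _ _).trans ?_
    refine (add_le_add_left ((Set.encard_insert_le _ _).trans
      (add_le_add_left (Set.encard_singleton _).le 1)) 1).trans ?_
    norm_num

theorem opSpectrum_eq_image_band {a κ : ℝ} (ha : 0 < a) (hκ : 0 < κ) {α κ₀ : ℝ} (hκ₀ : 0 < κ₀)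
    (hM : ∀ k, (kreinMatrix a α κ₀ k).PosDef) :
    opSpectrum (pointScatterer κ (honeycomb a) (fun _ => α)) =
      Complex.ofReal '' {E | ∃ k ∈ brillouinZone a, ∃ n : ℕ+, band ha hκ₀ α k n = E} := by
  ext z
  rw [mem_opSpectrum_iff ha hκ hκ₀ hM]
  constructor
  · rintro ⟨k, hk⟩
    obtain ⟨n, hn⟩ := exists_add_dualVec_mem ha k
    have h := exists_eigenvector_of_add_dualVec ha (k + dualVec a n) (-n) (z := z) (α := α) (by
      rwa [dualVec_neg, add_neg_cancel_right])
    obtain ⟨i, hi⟩ := (exists_band_eq_iff ha hκ₀ (hM _) z).mpr h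
    exact ⟨_, ⟨_, hn, i, rfl⟩, hi⟩
  · rintro ⟨E, ⟨k, -, n, rfl⟩, rfl⟩
    exact ⟨k, (exists_band_eq_iff ha hκ₀ (hM _) _).mp ⟨n, rfl⟩⟩

theorem exists_bandEdges {a κ : ℝ} (ha : 0 < a) (hκ : 0 < κ) {α : ℝ}
    (hM : ∀ k, (kreinMatrix a α κ k).PosDef) :
    ∃ M₂ m₃ M₃ m₄ : ℝ,
      IsGreatest ((fun k => band ha hκ α k 2) '' brillouinZone a) M₂ ∧
      IsLeast ((fun k => band ha hκ α k 3) '' brillouinZone a) m₃ ∧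
      IsGreatest ((fun k => band ha hκ α k 3) '' brillouinZone a) M₃ ∧
      IsLeast ((fun k => band ha hκ α k 4) '' brillouinZone a) m₄ ∧
      {E | ∃ k ∈ brillouinZone a, ∃ n : ℕ+, band ha hκ α k n = E} =
        Set.Icc (band ha hκ α 0 1) M₂ ∪ Set.Icc m₃ M₃ ∪ Set.Ici m₄ := by
  have hne : (brillouinZone a).Nonempty := ⟨0, zero_mem_brillouinZone a⟩
  have hcont : ∀ n, 0 < n → ContinuousOn (fun k => band ha hκ α k n) (brillouinZone a) :=
    fun n hn => (continuous_band ha hκ hM hn).continuousOn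
  have hmax : ∀ n, 0 < n → ∃ k ∈ brillouinZone a,
      ∀ k' ∈ brillouinZone a, band ha hκ α k' n ≤ band ha hκ α k n := fun n hn =>
    (isCompact_brillouinZone ha).exists_isMaxOn hne (hcont n hn)
  have hmin : ∀ n, 0 < n → ∃ k ∈ brillouinZone a,
      ∀ k' ∈ brillouinZone a, band ha hκ α k n ≤ band ha hκ α k' n := fun n hn =>
    (isCompact_brillouinZone ha).exists_isMinOn hne (hcont n hn)
  have hivt : ∀ n, 0 < n → ∀ k ∈ brillouinZone a, ∀ k' ∈ brillouinZone a, ∀ E,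
      band ha hκ α k n ≤ E → E ≤ band ha hκ α k' n →
      ∃ p ∈ brillouinZone a, band ha hκ α p n = E := fun n hn k hk k' hk' E h1 h2 =>
    (isPreconnected_brillouinZone a).intermediate_value hk hk' (hcont n hn) ⟨h1, h2⟩
  have h0 := zero_mem_brillouinZone a
  have hK := diracPoint_mem a
  obtain ⟨p₂, hp₂, hM₂⟩ := hmax 2 (by norm_num)
  obtain ⟨q₃, hq₃, hm₃⟩ := hmin 3 (by norm_num)
  obtain ⟨p₃, hp₃, hM₃⟩ := hmax 3 (by norm_num)
  obtain ⟨q₄, hq₄, hm₄⟩ := hmin 4 (by norm_num)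
  refine ⟨_, _, _, _, ⟨⟨p₂, hp₂, rfl⟩, ?_⟩, ⟨⟨q₃, hq₃, rfl⟩, ?_⟩, ⟨⟨p₃, hp₃, rfl⟩, ?_⟩,
    ⟨⟨q₄, hq₄, rfl⟩, ?_⟩, ?_⟩
  · rintro _ ⟨k, hk, rfl⟩; exact hM₂ k hk
  · rintro _ ⟨k, hk, rfl⟩; exact hm₃ k hk
  · rintro _ ⟨k, hk, rfl⟩; exact hM₃ k hk
  · rintro _ ⟨k, hk, rfl⟩; exact hm₄ k hk
  refine Set.Subset.antisymm ?_ ?_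
  · rintro _ ⟨k, hk, n, rfl⟩
    have hlow : band ha hκ α 0 1 ≤ band ha hκ α k n :=
      (band_one_zero_le ha hκ hM k).trans (band_mono ha hκ (hM k) one_pos n.pos)
    rcases le_or_gt (n : ℕ) 2 with h | h
    · exact Or.inl (Or.inl ⟨hlow, (band_mono ha hκ (hM k) n.pos h).trans (hM₂ k hk)⟩)
    · rcases Nat.lt_or_ge (n : ℕ) 4 with h' | h'
      · obtain h3 : (n : ℕ) = 3 := by omega
        rw [h3]
        exact Or.inl (Or.inr ⟨hm₃ k hk, hM₃ k hk⟩)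
      · exact Or.inr ((hm₄ k hk).trans (band_mono ha hκ (hM k) (by norm_num) h'))
  · rintro E ((⟨hE1, hE2⟩ | ⟨hE1, hE2⟩) | hE)
    -- The degeneracy closes the first interval: up to the Dirac energy the first band takes every
    -- value, and from there the second band does, starting at or below that energy.
    · rcases le_or_gt E (band ha hκ α (diracPoint a) 1) with h | h
      · obtain ⟨p, hp, e⟩ := hivt 1 one_pos 0 h0 _ hK E hE1 h
        exact ⟨p, hp, 1, e⟩
      · obtain ⟨p, hp, e⟩ := hivt 2 two_pos _ hK p₂ hp₂ E
          ((band_two_diracPoint_le ha hκ (hM _)).trans h.le) hE2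
        exact ⟨p, hp, 2, e⟩
    · obtain ⟨p, hp, e⟩ := hivt 3 (by norm_num) q₃ hq₃ p₃ hp₃ E hE1 hE2
      exact ⟨p, hp, 3, e⟩
    -- The fourth band reaches from its minimum to its value at `k = 0`, which is at least `|k₁|²`.
    -- Higher energies come from the pairs of plane waves invisible to the scatterers.
    · rcases le_or_gt E (band ha hκ α 0 4) with h | h
      · obtain ⟨p, hp, e⟩ := hivt 4 (by norm_num) q₄ hq₄ 0 h0 E hE h
        exact ⟨p, hp, 4, e⟩
      · have hd := (dualLength_sq_le_band_four ha hκ (hM 0)).trans h.le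
        obtain ⟨k, hk⟩ := exists_eigenvector_of_ge ha α hd
        obtain ⟨n, hn⟩ := exists_add_dualVec_mem ha k
        have h := exists_eigenvector_of_add_dualVec ha (k + dualVec a n) (-n) (z := (E : ℂ))
          (α := α) (by rwa [dualVec_neg, add_neg_cancel_right])
        obtain ⟨i, hi⟩ := (exists_band_eq_iff ha hκ (hM _) _).mpr h
        exact ⟨_, hn, i, by exact_mod_cast hi⟩

end

end HoneycombScatterer

/-! ### The band structure theorem. -/

open HoneycombScatterer in
theorem theorem3 (a : ℝ) (ha : 0 < a) (κ : ℝ) (hκ : 0 < κ) (α : ℝ) :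
    ∃ lam : Plane → ℕ+ → ℝ,
      (∀ k ∈ brillouinZone a,
        IsEigenvalueEnumeration (fiberHamiltonian a (fun _ => α) k) (lam k)) ∧
      ∃ M₂ m₃ M₃ m₄ : ℝ,
        IsGreatest ((fun k => lam k 2) '' brillouinZone a) M₂ ∧
        IsLeast ((fun k => lam k 3) '' brillouinZone a) m₃ ∧
        IsGreatest ((fun k => lam k 3) '' brillouinZone a) M₃ ∧
        IsLeast ((fun k => lam k 4) '' brillouinZone a) m₄ ∧
        opSpectrum (pointScatterer κ (honeycomb a) (fun _ => α)) =
          Complex.ofReal '' (Set.Icc (lam 0 1) M₂ ∪ Set.Icc m₃ M₃ ∪ Set.Ici m₄) ∧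
        {C : Set ℂ | ∃ z ∈ opSpectrum (pointScatterer κ (honeycomb a) (fun _ => α)),
          C = connectedComponentIn
            (opSpectrum (pointScatterer κ (honeycomb a) (fun _ => α))) z}.encard ≤ 3 := by
  -- The given `κ` only presents the operator. The bands are built at a separate `κ₀`, where all
  -- Krein matrices are positive definite.
  obtain ⟨κ₀, hκ₀, hM⟩ := exists_forall_posDef ha α
  obtain ⟨M₂, m₃, M₃, m₄, h2, h3, h3', h4, hS⟩ := exists_bandEdges ha hκ₀ hM
  have hspec : opSpectrum (pointScatterer κ (honeycomb a) (fun _ => α)) =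
      Complex.ofReal '' (Set.Icc (band ha hκ₀ α 0 1) M₂ ∪ Set.Icc m₃ M₃ ∪ Set.Ici m₄) := by
    rw [← hS]
    exact opSpectrum_eq_image_band ha hκ hκ₀ hM
  refine ⟨fun k n => band ha hκ₀ α k n, fun k _ => isEigenvalueEnumeration_band ha hκ₀ (hM k),
    M₂, m₃, M₃, m₄, h2, h3, h3', h4, hspec, ?_⟩
  rw [hspec, Set.image_union, Set.image_union]
  exact encard_components_union_le
    (isPreconnected_Icc.image _ Complex.continuous_ofReal.continuousOn)
    (isPreconnected_Icc.image _ Complex.continuous_ofReal.continuousOn)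
    (isPreconnected_Ici.image _ Complex.continuous_ofReal.continuousOn)
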